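/- Let $F$ be a field of characteristic $0$ and let $q\in F$ be a primitive $d$-th root of unity, with $d>1$ odd. Let $U_q=U_q(sl(2|1))$ be the unital associative $F$-algebra with generators $k_1^{\pm1},k_2^{\pm1},e_1,e_2,f_1,f_2$ and relations \[k_ik_i^{-1}=k_i^{-1}k_i=1,\quad k_2k_1=k_1k_2,\] \[e_1k_1=q^{-2}k_1e_1,\ e_2k_1=qk_1e_2,\ e_1k_2=qk_2e_1,\ e_2k_2=k_2e_2,\] \[k_1f_1=q^{-2}f_1k_1,\ k_1f_2=qf_2k_1,\ k_2f_1=qf_1k_2,\ k_2f_2=f_2k_2,\] \[e_1f_1=f_1e_1+\tfrac{k_1-k_1^{-1}}{q-q^{-1}},\ e_2f_2=-f_2e_2+\tfrac{k_2-k_2^{-1}}{q-q^{-1}},\ e_1f_2=f_2e_1,\ e_2f_1=f_1e_2,\ e_2^2=f_2^2=0,\] \[e_1^2e_2-(q+q^{-1})e_1e_2e_1+e_2e_1^2=0,\quad f_1^2f_2-(q+q^{-1})f_1f_2f_1+f_2f_1^2=0,\] and let $\bar U_q=U_q/(f_1^d,\,k_1^d-1,\,k_2^d-1,\,e_1^d)$.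 Put $e_3=e_1e_2-q^{-1}e_2e_1$ and $f_3=f_2f_1-qf_1f_2$. Tensor products of superspaces carry the sign rule $\tau(a\otimes b)=(-1)^{|a||b|}b\otimes a$; in particular $(a\otimes b)(c\otimes d)=(-1)^{|b||c|}ac\otimes bd$, and $\Delta^{op}=\tau\circ\Delta$. A Hopf superalgebra $H$ with invertible antipode is called braided, with universal $R$-matrix $R$, if $R\in H\otimes H$ is even and invertible, $\Delta^{op}(x)=R\Delta(x)R^{-1}$ for all $x\in H$, $(\Delta\otimes\mathrm{id})(R)=R_{13}R_{23}$ and $(\mathrm{id}\otimes\Delta)(R)=R_{13}R_{12}$. For a finite-dimensional Hopf superalgebra $H$ with antipode $S$, let $X=(H^{op})^*$: with $\lambda(f\otimes g)(a\otimes b)=(-1)^{|g||a|}f(a)g(b)$, it is $H^*$ with product $\Delta_H^*\circ\lambda$, unit $\epsilon_H$, coproduct $\lambda^{-1}\circ(\mu_H\circ\tau)^*$, counit $f\mapsto f(1)$ and antipode $S_X=(S^{-1})^*$. The quantum double $D(H)$ is the supercoalgebra $X\otimes H$ with unit $\epsilon_H\otimes1$, product \[(f\otimes a)(g\otimes b)=\sum(-1)^{|g||a|+|a'''|(|a'|+|a''|)+|?||a'|}\,f\cdot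 g\big(S^{-1}(a''')\,?\,a'\big)\otimes a''b,\] where $\sum a'\otimes a''\otimes a'''$ is the iterated coproduct of $a$ and $?$ is the argument of the functional, and antipode $f\otimes a\mapsto(-1)^{|f||a|}(\epsilon_H\otimes S(a))(S_X(f)\otimes1)$. Its $R$-matrix is $R_{D(H)}=\sum_i(\epsilon_H\otimes e_i)\otimes(e^i\otimes1)$, for a basis $(e_i)$ of $H$ and the dual basis $(e^i)$. Then: (1) $\bar U_q$ is finite-dimensional, and it has exactly one structure of a Hopf superalgebra with invertible antipode in which $k_i^{\pm1},e_1,f_1$ are even, $e_2,f_2$ are odd, and for $i=1,2$ \[\Delta(k_i^{\pm1})=k_i^{\pm1}\otimes k_i^{\pm1},\quad \Delta(e_i)=e_i\otimes1+k_i\otimes e_i,\quad \Delta(f_i)=f_i\otimes k_i^{-1}+1\otimes f_i,\] \[\epsilon(k_i^{\pm1})=1,\ \epsilon(e_i)=\epsilon(f_i)=0,\quad S(k_i^{\pm1})=k_i^{\mp1},\ S(e_i)=-k_i^{-1}e_i,\ S(f_i)=-f_ik_i.\] (2) The elements $k_1^ik_2^je_1^re_3^he_2^t$ ($0\le i,j,r<d$,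 $h,t\in\{0,1\}$) form a basis of a Hopf subsuperalgebra $B_q^+$ of $\bar U_q$. Write $(\cdot)^*$ for the dual basis and define, in $X=((B_q^+)^{op})^*$, with $v,p$ running over $0,\dots,d-1$, \[\alpha_{k_1}=\sum_{v,p} q^{-2v+p}(k_1^vk_2^p)^*,\quad \alpha_{k_2}=\sum_{v,p} q^{v}(k_1^vk_2^p)^*,\] \[\alpha_{e_1}=-(q-q^{-1})^{-1}\sum_{v,p} q^{2v-p}(k_1^vk_2^pe_1)^*,\quad \alpha_{e_2}=(q-q^{-1})^{-1}\sum_{v,p} q^{-v}(k_1^vk_2^pe_2)^*,\] \[\alpha_{e_3}=(q-q^{-1})^{-1}\sum_{v,p} q^{v-p}\big((k_1^vk_2^pe_1e_2)^*+(k_1^vk_2^pe_3)^*\big).\] (3) There is exactly one linear map $\chi:D(B_q^+)\to\bar U_q$ with \[\chi\big(\alpha_{e_1}^w\alpha_{e_3}^s\alpha_{e_2}^l\alpha_{k_1}^{i_1}\alpha_{k_2}^{j_1}\otimes k_1^{i_2}k_2^{j_2}e_1^re_3^he_2^t\big)=f_1^wf_3^sf_2^lk_1^{i_1+i_2}k_2^{j_1+j_2}e_1^re_3^he_2^t\]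 for $0\le w,i_1,i_2,j_1,j_2,r<d$ and $s,l,h,t\in\{0,1\}$. It is surjective, even, and compatible with the products, units, coproducts, counits and antipodes. (4) The Hopf superalgebra $\bar U_q$ is braided with universal $R$-matrix $\bar R=(\chi\otimes\chi)(R_{D(B_q^+)})$. -/

import Mathlib

open scoped TensorProduct

noncomputable section

/-- The Koszul sign `(-1)^i` attached to a parity `i`. -/
def koszulSign (F : Type*) [Field F] (i : ZMod 2) : F := if i = 0 then 1 else -1

section Superspaces

variable {F : Type*} [Field F]
variable {V V' W W' : Type*} [AddCommGroup V] [Module F V] [AddCommGroup V'] [Module F V']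
  [AddCommGroup W] [Module F W] [AddCommGroup W'] [Module F W']

/-- `p i : V → V` (`i ∈ ℤ/2`) are the projections of a `ℤ/2`-grading `V = V₀ ⊕ V₁`, where `V_i` is
the range of `p i`; a vector `v` is homogeneous of degree `i` when `p i v = v`. -/
structure IsGrading (p : ZMod 2 → V →ₗ[F] V) : Prop where
  proj : ∀ i j, p i ∘ₗ p j = if i = j then p i else 0
  total : p 0 + p 1 = LinearMap.id

/-- `f (V_i) ⊆ W_i` for the gradings with projections `p` and `r`: a superspace morphism. -/
def IsEvenMap (p : ZMod 2 → V →ₗ[F] V) (r : ZMod 2 → W →ₗ[F] W) (f : V →ₗ[F] W) : Prop :=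
  ∀ i, f ∘ₗ p i = r i ∘ₗ f

/-- The grading of a tensor product. -/
def tensorPart (p : ZMod 2 → V →ₗ[F] V) (r : ZMod 2 → W →ₗ[F] W) (k : ZMod 2) :
    V ⊗[F] W →ₗ[F] V ⊗[F] W :=
  ∑ i : ZMod 2, TensorProduct.map (p i) (r (k - i))

/-- The super flip `τ (v ⊗ w) = (-1)^{|v||w|} w ⊗ v`. -/
def superFlip (p : ZMod 2 → V →ₗ[F] V) (r : ZMod 2 → W →ₗ[F] W) :
    V ⊗[F] W →ₗ[F] W ⊗[F] V :=
  ∑ i : ZMod 2, ∑ j : ZMod 2, koszulSign F (i * j) •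
    ((TensorProduct.comm F V W).toLinearMap ∘ₗ TensorProduct.map (p i) (r j))

/-- The map `id ⊗ τ ⊗ id`, that is `(v ⊗ v') ⊗ (w ⊗ w') ↦ (-1)^{|v'||w|} (v ⊗ w) ⊗ (v' ⊗ w')`. -/
def superInterchange (p : ZMod 2 → V' →ₗ[F] V') (r : ZMod 2 → W →ₗ[F] W) :
    (V ⊗[F] V') ⊗[F] (W ⊗[F] W') →ₗ[F] (V ⊗[F] W) ⊗[F] (V' ⊗[F] W') :=
  ∑ i : ZMod 2, ∑ j : ZMod 2, koszulSign F (i * j) •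
    ((TensorProduct.tensorTensorTensorComm F V V' W W').toLinearMap ∘ₗ
      TensorProduct.map (TensorProduct.map LinearMap.id (p i))
        (TensorProduct.map (r j) LinearMap.id))

/-- The involution `v ⊗ w ↦ (-1)^{|v||w|} v ⊗ w`. -/
def superSign (p : ZMod 2 → V →ₗ[F] V) (r : ZMod 2 → W →ₗ[F] W) :
    V ⊗[F] W →ₗ[F] V ⊗[F] W :=
  ∑ i : ZMod 2, ∑ j : ZMod 2, koszulSign F (i * j) • TensorProduct.map (p i) (r j)

end Superspaces

/-- The structure maps `(μ, η, Δ, ε, S, S⁻¹)` of a Hopf superalgebra on a superspace `V`, the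
`ℤ/2`-grading being given by its projections `part i`. The axioms are in `IsHopf`. -/
@[ext]
structure SuperHopfData (F V : Type*) [Field F] [AddCommGroup V] [Module F V] where
  part : ZMod 2 → V →ₗ[F] V
  mul : V ⊗[F] V →ₗ[F] V
  one : V
  comul : V →ₗ[F] V ⊗[F] V
  counit : V →ₗ[F] F
  antipode : V →ₗ[F] V
  antipodeInv : V →ₗ[F] V

namespace SuperHopfData

variable {F : Type*} [Field F]
variable {V W : Type*} [AddCommGroup V] [Module F V] [AddCommGroup W] [Module F W]

/-- The product of two elements. -/
def m (H : SuperHopfData F V) (x y : V) : V := H.mul (x ⊗ₜ[F] y)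

/-- Powers of an element. -/
def npow (H : SuperHopfData F V) (x : V) : ℕ → V
  | 0 => H.one
  | n + 1 => H.m (H.npow x n) x

/-- The tensor product of two Hopf superalgebras; in particular
`(a ⊗ b)(c ⊗ d) = (-1)^{|b||c|} ac ⊗ bd`. -/
def tensor (A : SuperHopfData F V) (B : SuperHopfData F W) : SuperHopfData F (V ⊗[F] W) where
  part := tensorPart A.part B.part
  mul := TensorProduct.map A.mul B.mul ∘ₗ superInterchange B.part A.part
  one := A.one ⊗ₜ[F] B.one
  comul := superInterchange A.part B.part ∘ₗ TensorProduct.map A.comul B.comul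
  counit := (TensorProduct.lid F F).toLinearMap ∘ₗ TensorProduct.map A.counit B.counit
  antipode := TensorProduct.map A.antipode B.antipode
  antipodeInv := TensorProduct.map A.antipodeInv B.antipodeInv

/-- The axioms of a Hopf superalgebra with invertible antipode: all structure maps are even,
`(V, μ, η)` is an associative unital superalgebra, `(V, Δ, ε)` is a coassociative counital
supercoalgebra, `Δ` and `ε` are superalgebra morphisms, `S` is an antipode with inverse `S⁻¹`. -/
structure IsHopf (H : SuperHopfData F V) : Prop where
  grading : IsGrading H.part
  mul_even : IsEvenMap (tensorPart H.part H.part) H.part H.mul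
  one_even : H.part 0 H.one = H.one
  mul_assoc : ∀ x y z, H.m (H.m x y) z = H.m x (H.m y z)
  one_mul : ∀ x, H.m H.one x = x
  mul_one : ∀ x, H.m x H.one = x
  comul_even : IsEvenMap H.part (tensorPart H.part H.part) H.comul
  counit_even : H.counit ∘ₗ H.part 1 = 0
  coassoc : (TensorProduct.assoc F V V V).toLinearMap ∘ₗ
    TensorProduct.map H.comul LinearMap.id ∘ₗ H.comul =
      TensorProduct.map LinearMap.id H.comul ∘ₗ H.comul
  counit_left : (TensorProduct.lid F V).toLinearMap ∘ₗ
    TensorProduct.map H.counit LinearMap.id ∘ₗ H.comul = LinearMap.id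
  counit_right : (TensorProduct.rid F V).toLinearMap ∘ₗ
    TensorProduct.map LinearMap.id H.counit ∘ₗ H.comul = LinearMap.id
  comul_one : H.comul H.one = H.one ⊗ₜ[F] H.one
  comul_mul : ∀ x y, H.comul (H.m x y) = (H.tensor H).m (H.comul x) (H.comul y)
  counit_one : H.counit H.one = 1
  counit_mul : ∀ x y, H.counit (H.m x y) = H.counit x * H.counit y
  antipode_even : IsEvenMap H.part H.part H.antipode
  antipode_left : ∀ x, H.mul (TensorProduct.map H.antipode LinearMap.id (H.comul x)) =
    H.counit x • H.one
  antipode_right : ∀ x, H.mul (TensorProduct.map LinearMap.id H.antipode (H.comul x)) =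
    H.counit x • H.one
  antipode_antipodeInv : ∀ x, H.antipode (H.antipodeInv x) = x
  antipodeInv_antipode : ∀ x, H.antipodeInv (H.antipode x) = x

/-- `f` is a morphism of Hopf superalgebras. -/
structure IsHopfHom (A : SuperHopfData F V) (B : SuperHopfData F W) (f : V →ₗ[F] W) : Prop where
  even : IsEvenMap A.part B.part f
  map_mul : ∀ x y, f (A.m x y) = B.m (f x) (f y)
  map_one : f A.one = B.one
  map_comul : ∀ x, B.comul (f x) = TensorProduct.map f f (A.comul x)
  map_counit : ∀ x, B.counit (f x) = A.counit x
  map_antipode : ∀ x, B.antipode (f x) = f (A.antipode x)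

/-- `R₁₂ = R ⊗ 1`. -/
def leg12 (H : SuperHopfData F V) (R : V ⊗[F] V) : (V ⊗[F] V) ⊗[F] V := R ⊗ₜ[F] H.one

/-- `R₂₃ = 1 ⊗ R`. -/
def leg23 (H : SuperHopfData F V) (R : V ⊗[F] V) : (V ⊗[F] V) ⊗[F] V :=
  (TensorProduct.assoc F V V V).symm (H.one ⊗ₜ[F] R)

/-- `R₁₃ = ∑ sᵢ ⊗ 1 ⊗ tᵢ` for `R = ∑ sᵢ ⊗ tᵢ`. -/
def leg13 (H : SuperHopfData F V) (R : V ⊗[F] V) : (V ⊗[F] V) ⊗[F] V :=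
  TensorProduct.map ((TensorProduct.mk F V V).flip H.one) LinearMap.id R

/-- `H` is braided (quasitriangular) with universal `R`-matrix `R`: the element `R` of the
superalgebra `H ⊗ H` is even and invertible, `Δᵒᵖ(x) = R Δ(x) R⁻¹`,
`(Δ ⊗ id)(R) = R₁₃ R₂₃` and `(id ⊗ Δ)(R) = R₁₃ R₁₂`. -/
structure IsBraided (H : SuperHopfData F V) (R : V ⊗[F] V) : Prop where
  even : (H.tensor H).part 0 R = R
  quasicocomm : ∃ R' : V ⊗[F] V,
    (H.tensor H).m R R' = (H.tensor H).one ∧ (H.tensor H).m R' R = (H.tensor H).one ∧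
    ∀ x, superFlip H.part H.part (H.comul x) = (H.tensor H).m ((H.tensor H).m R (H.comul x)) R'
  hexagon_left : TensorProduct.map H.comul LinearMap.id R =
    ((H.tensor H).tensor H).m (H.leg13 R) (H.leg23 R)
  hexagon_right : (TensorProduct.assoc F V V V).symm (TensorProduct.map LinearMap.id H.comul R) =
    ((H.tensor H).tensor H).m (H.leg13 R) (H.leg12 R)

/-- The Hopf superalgebra `X = (Hᵒᵖ)*`. With `λ (f ⊗ g) (a ⊗ b) = (-1)^{|g||a|} f(a) g(b)`, its
product is `Δ* ∘ λ` and its coproduct is `λ⁻¹ ∘ (μ ∘ τ)*`. Here `λ` is `dualDistrib` followed by the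
transpose of the involution `superSign`, since `f(a) g(b) ≠ 0` forces `|g| = |b|`. -/
def dualOp (H : SuperHopfData F V) [FiniteDimensional F V] :
    SuperHopfData F (Module.Dual F V) where
  part i := (H.part i).dualMap
  mul := H.comul.dualMap ∘ₗ (superSign H.part H.part).dualMap ∘ₗ TensorProduct.dualDistrib F V V
  one := H.counit
  comul := (TensorProduct.dualDistribEquiv F V V).symm.toLinearMap ∘ₗ
    (superSign H.part H.part).dualMap ∘ₗ (H.mul ∘ₗ superFlip H.part H.part).dualMap
  counit := Module.Dual.eval F V H.one
  antipode := H.antipodeInv.dualMap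
  antipodeInv := H.antipode.dualMap

/-- `a ⊗ c ↦ (x ↦ S⁻¹(c) x_l a)`, where `x_l` is the component of degree `l` of `x`. -/
def sandwich (H : SuperHopfData F V) (l : ZMod 2) : V ⊗[F] V →ₗ[F] (V →ₗ[F] V) :=
  TensorProduct.lift (LinearMap.mk₂ F
    (fun a c => (TensorProduct.curry H.mul (H.antipodeInv c)) ∘ₗ
      ((TensorProduct.curry H.mul).flip a) ∘ₗ H.part l)
    (fun a a' c => by ext x; simp [TensorProduct.tmul_add])
    (fun s a c => by ext x; simp)
    (fun a c c' => by ext x; simp)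
    (fun s a c => by ext x; simp))

/-- The cross relation of the quantum double: writing `∑ a' ⊗ a'' ⊗ a'''` for the iterated
coproduct of `a`,
`a ⊗ g ↦ ∑ (-1)^{|g||a| + |a'''|(|a'| + |a''|) + |?||a'|} g(S⁻¹(a''') ? a') ⊗ a''`. -/
def doubleCross (H : SuperHopfData F V) :
    V ⊗[F] Module.Dual F V →ₗ[F] Module.Dual F V ⊗[F] V :=
  ∑ i₁ : ZMod 2, ∑ i₂ : ZMod 2, ∑ i₃ : ZMod 2, ∑ j : ZMod 2, ∑ l : ZMod 2,
    koszulSign F (j * (i₁ + i₂ + i₃) + i₃ * (i₁ + i₂) + l * i₁) •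
      (TensorProduct.map
          (TensorProduct.lift (Module.Dual.transpose ∘ₗ H.sandwich l)) LinearMap.id ∘ₗ
        (TensorProduct.rightComm F (V ⊗[F] V) V (Module.Dual F V)).toLinearMap ∘ₗ
        TensorProduct.map
          ((TensorProduct.rightComm F V V V).toLinearMap ∘ₗ
            TensorProduct.map (TensorProduct.map (H.part i₁) (H.part i₂)) (H.part i₃) ∘ₗ
            TensorProduct.map H.comul LinearMap.id ∘ₗ H.comul)
          (H.part j).dualMap)

/-- The product of the quantum double on `X ⊗ H`:
`(f ⊗ a)(g ⊗ b) = ∑ (-1)^{|g||a| + |a'''|(|a'| + |a''|) + |?||a'|} f g(S⁻¹(a''') ? a') ⊗ a'' b`. -/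
def doubleMul (H : SuperHopfData F V) [FiniteDimensional F V] :
    (Module.Dual F V ⊗[F] V) ⊗[F] (Module.Dual F V ⊗[F] V) →ₗ[F] Module.Dual F V ⊗[F] V :=
  TensorProduct.map H.dualOp.mul H.mul ∘ₗ
    (TensorProduct.assoc F (Module.Dual F V) (Module.Dual F V) (V ⊗[F] V)).symm.toLinearMap ∘ₗ
    TensorProduct.map LinearMap.id
      ((TensorProduct.assoc F (Module.Dual F V) V V).toLinearMap ∘ₗ
        TensorProduct.map H.doubleCross LinearMap.id ∘ₗ
        (TensorProduct.assoc F V (Module.Dual F V) V).symm.toLinearMap) ∘ₗ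
    (TensorProduct.assoc F (Module.Dual F V) V (Module.Dual F V ⊗[F] V)).toLinearMap

/-- The quantum double `D(H) = (Hᵒᵖ)* ⋈ H`. As a supercoalgebra it is the tensor product
`(Hᵒᵖ)* ⊗ H`. Its antipode is `f ⊗ a ↦ (-1)^{|f||a|} (1 ⊗ S a)(S_X f ⊗ 1)`. -/
def double (H : SuperHopfData F V) [FiniteDimensional F V] :
    SuperHopfData F (Module.Dual F V ⊗[F] V) where
  part := (H.dualOp.tensor H).part
  mul := H.doubleMul
  one := (H.dualOp.tensor H).one
  comul := (H.dualOp.tensor H).comul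
  counit := (H.dualOp.tensor H).counit
  antipode := H.doubleMul ∘ₗ
    TensorProduct.map (TensorProduct.mk F (Module.Dual F V) V H.dualOp.one ∘ₗ H.antipode)
      ((TensorProduct.mk F (Module.Dual F V) V).flip H.one ∘ₗ H.dualOp.antipode) ∘ₗ
    superFlip H.dualOp.part H.part
  antipodeInv := H.doubleMul ∘ₗ
    TensorProduct.map (TensorProduct.mk F (Module.Dual F V) V H.dualOp.one ∘ₗ H.antipodeInv)
      ((TensorProduct.mk F (Module.Dual F V) V).flip H.one ∘ₗ H.dualOp.antipodeInv) ∘ₗ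
    superFlip H.dualOp.part H.part

/-- The universal `R`-matrix `∑ᵢ (1 ⊗ eᵢ) ⊗ (eⁱ ⊗ 1)` of the quantum double, where `eᵢ` is a basis
of `H` and `eⁱ` the dual basis. -/
def doubleR {ι : Type*} [Fintype ι] (H : SuperHopfData F V) [FiniteDimensional F V]
    (b : Module.Basis ι F V) :
    (Module.Dual F V ⊗[F] V) ⊗[F] (Module.Dual F V ⊗[F] V) :=
  ∑ i, (H.dualOp.one ⊗ₜ[F] b i) ⊗ₜ[F] (b.coord i ⊗ₜ[F] H.one)

end SuperHopfData

/-- Generators of `U_q(sl(2|1))`; `K1`, `K2` stand for `k₁⁻¹`, `k₂⁻¹`. -/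
inductive UqGen
  | k1 | k2 | K1 | K2 | e1 | e2 | f1 | f2

namespace UqGen

/-- The degrees of the generators. -/
def deg : UqGen → ZMod 2
  | e2 => 1
  | f2 => 1
  | _ => 0

end UqGen

section Uq

variable (F : Type*) [Field F] (q : F) (d : ℕ)

/-- A generator as an element of the free algebra. -/
abbrev freeGen (g : UqGen) : FreeAlgebra F UqGen := FreeAlgebra.ι F g

open UqGen in
/-- The defining relations of `U_q(sl(2|1))`. -/
inductive UqRel : FreeAlgebra F UqGen → FreeAlgebra F UqGen → Prop
  | k1K1 : UqRel (freeGen F k1 * freeGen F K1) 1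
  | K1k1 : UqRel (freeGen F K1 * freeGen F k1) 1
  | k2K2 : UqRel (freeGen F k2 * freeGen F K2) 1
  | K2k2 : UqRel (freeGen F K2 * freeGen F k2) 1
  | k2k1 : UqRel (freeGen F k2 * freeGen F k1) (freeGen F k1 * freeGen F k2)
  | e1k1 : UqRel (freeGen F e1 * freeGen F k1) (q ^ (-2 : ℤ) • (freeGen F k1 * freeGen F e1))
  | e2k1 : UqRel (freeGen F e2 * freeGen F k1) (q • (freeGen F k1 * freeGen F e2))
  | e1k2 : UqRel (freeGen F e1 * freeGen F k2) (q • (freeGen F k2 * freeGen F e1))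
  | e2k2 : UqRel (freeGen F e2 * freeGen F k2) (freeGen F k2 * freeGen F e2)
  | k1f1 : UqRel (freeGen F k1 * freeGen F f1) (q ^ (-2 : ℤ) • (freeGen F f1 * freeGen F k1))
  | k1f2 : UqRel (freeGen F k1 * freeGen F f2) (q • (freeGen F f2 * freeGen F k1))
  | k2f1 : UqRel (freeGen F k2 * freeGen F f1) (q • (freeGen F f1 * freeGen F k2))
  | k2f2 : UqRel (freeGen F k2 * freeGen F f2) (freeGen F f2 * freeGen F k2)
  | e1f1 : UqRel (freeGen F e1 * freeGen F f1)
      (freeGen F f1 * freeGen F e1 + (q - q⁻¹)⁻¹ • (freeGen F k1 - freeGen F K1))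
  | e2f2 : UqRel (freeGen F e2 * freeGen F f2)
      (-(freeGen F f2 * freeGen F e2) + (q - q⁻¹)⁻¹ • (freeGen F k2 - freeGen F K2))
  | e1f2 : UqRel (freeGen F e1 * freeGen F f2) (freeGen F f2 * freeGen F e1)
  | e2f1 : UqRel (freeGen F e2 * freeGen F f1) (freeGen F f1 * freeGen F e2)
  | e2e2 : UqRel (freeGen F e2 ^ 2) 0
  | f2f2 : UqRel (freeGen F f2 ^ 2) 0
  | serre_e : UqRel (freeGen F e1 ^ 2 * freeGen F e2
      - (q + q⁻¹) • (freeGen F e1 * freeGen F e2 * freeGen F e1)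
      + freeGen F e2 * freeGen F e1 ^ 2) 0
  | serre_f : UqRel (freeGen F f1 ^ 2 * freeGen F f2
      - (q + q⁻¹) • (freeGen F f1 * freeGen F f2 * freeGen F f1)
      + freeGen F f2 * freeGen F f1 ^ 2) 0

/-- The algebra `U_q = U_q(sl(2|1))` over `F`. -/
def Uq : Type _ := RingQuot (UqRel F q)

instance : Ring (Uq F q) := inferInstanceAs (Ring (RingQuot (UqRel F q)))

instance : Algebra F (Uq F q) := inferInstanceAs (Algebra F (RingQuot (UqRel F q)))

/-- The canonical surjection of the free algebra onto `U_q`. -/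
def uqProj : FreeAlgebra F UqGen →ₐ[F] Uq F q := RingQuot.mkAlgHom F (UqRel F q)

/-- The generators of `U_q`. -/
def uqGen (g : UqGen) : Uq F q := uqProj F q (freeGen F g)

/-- The generators of the two-sided ideal `(f₁^d, k₁^d - 1, k₂^d - 1, e₁^d)` of `U_q`. -/
inductive UbarRel : Uq F q → Uq F q → Prop
  | f1 : UbarRel (uqGen F q .f1 ^ d) 0
  | k1 : UbarRel (uqGen F q .k1 ^ d - 1) 0
  | k2 : UbarRel (uqGen F q .k2 ^ d - 1) 0
  | e1 : UbarRel (uqGen F q .e1 ^ d) 0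

/-- The algebra `Ū_q`, the quotient of `U_q` by the ideal `(f₁^d, k₁^d - 1, k₂^d - 1, e₁^d)`. -/
def Ubar : Type _ := RingQuot (UbarRel F q d)

instance : Ring (Ubar F q d) := inferInstanceAs (Ring (RingQuot (UbarRel F q d)))

instance : Algebra F (Ubar F q d) := inferInstanceAs (Algebra F (RingQuot (UbarRel F q d)))

/-- The canonical projection of `U_q` onto `Ū_q`. -/
def ubarProj : Uq F q →ₐ[F] Ubar F q d := RingQuot.mkAlgHom F (UbarRel F q d)

/-- The generators of `Ū_q`. -/
def ubarGen (g : UqGen) : Ubar F q d := ubarProj F q d (uqGen F q g)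

/-- `e₃ = e₁ e₂ - q⁻¹ e₂ e₁`. -/
def ubarE3 : Ubar F q d :=
  ubarGen F q d .e1 * ubarGen F q d .e2 - q⁻¹ • (ubarGen F q d .e2 * ubarGen F q d .e1)

/-- `f₃ = f₂ f₁ - q f₁ f₂`. -/
def ubarF3 : Ubar F q d :=
  ubarGen F q d .f2 * ubarGen F q d .f1 - q • (ubarGen F q d .f1 * ubarGen F q d .f2)

open UqGen in
/-- `H` is the Hopf superalgebra structure of `Ū_q`: it extends the algebra structure, it satisfies
the axioms of a Hopf superalgebra with invertible antipode, and the degrees, coproducts, counits and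
antipodes of the generators are the prescribed ones. -/
structure IsUbarStructure (H : SuperHopfData F (Ubar F q d)) : Prop where
  mul_eq : H.mul = LinearMap.mul' F (Ubar F q d)
  one_eq : H.one = 1
  isHopf : H.IsHopf
  deg : ∀ g, H.part g.deg (ubarGen F q d g) = ubarGen F q d g
  comul_k1 : H.comul (ubarGen F q d k1) = ubarGen F q d k1 ⊗ₜ[F] ubarGen F q d k1
  comul_k2 : H.comul (ubarGen F q d k2) = ubarGen F q d k2 ⊗ₜ[F] ubarGen F q d k2
  comul_K1 : H.comul (ubarGen F q d K1) = ubarGen F q d K1 ⊗ₜ[F] ubarGen F q d K1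
  comul_K2 : H.comul (ubarGen F q d K2) = ubarGen F q d K2 ⊗ₜ[F] ubarGen F q d K2
  comul_e1 : H.comul (ubarGen F q d e1) =
    ubarGen F q d e1 ⊗ₜ[F] 1 + ubarGen F q d k1 ⊗ₜ[F] ubarGen F q d e1
  comul_e2 : H.comul (ubarGen F q d e2) =
    ubarGen F q d e2 ⊗ₜ[F] 1 + ubarGen F q d k2 ⊗ₜ[F] ubarGen F q d e2
  comul_f1 : H.comul (ubarGen F q d f1) =
    ubarGen F q d f1 ⊗ₜ[F] ubarGen F q d K1 + 1 ⊗ₜ[F] ubarGen F q d f1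
  comul_f2 : H.comul (ubarGen F q d f2) =
    ubarGen F q d f2 ⊗ₜ[F] ubarGen F q d K2 + 1 ⊗ₜ[F] ubarGen F q d f2
  counit_k1 : H.counit (ubarGen F q d k1) = 1
  counit_k2 : H.counit (ubarGen F q d k2) = 1
  counit_K1 : H.counit (ubarGen F q d K1) = 1
  counit_K2 : H.counit (ubarGen F q d K2) = 1
  counit_e1 : H.counit (ubarGen F q d e1) = 0
  counit_e2 : H.counit (ubarGen F q d e2) = 0
  counit_f1 : H.counit (ubarGen F q d f1) = 0
  counit_f2 : H.counit (ubarGen F q d f2) = 0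
  antipode_k1 : H.antipode (ubarGen F q d k1) = ubarGen F q d K1
  antipode_k2 : H.antipode (ubarGen F q d k2) = ubarGen F q d K2
  antipode_K1 : H.antipode (ubarGen F q d K1) = ubarGen F q d k1
  antipode_K2 : H.antipode (ubarGen F q d K2) = ubarGen F q d k2
  antipode_e1 : H.antipode (ubarGen F q d e1) = -(ubarGen F q d K1 * ubarGen F q d e1)
  antipode_e2 : H.antipode (ubarGen F q d e2) = -(ubarGen F q d K2 * ubarGen F q d e2)
  antipode_f1 : H.antipode (ubarGen F q d f1) = -(ubarGen F q d f1 * ubarGen F q d k1)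
  antipode_f2 : H.antipode (ubarGen F q d f2) = -(ubarGen F q d f2 * ubarGen F q d k2)

/-- Exponents `(i, j, r, h, t)` of the monomials `k₁^i k₂^j e₁^r e₃^h e₂^t`; also exponents
`(i, j, w, s, l)` of the monomials `α_{e₁}^w α_{e₃}^s α_{e₂}^l α_{k₁}^i α_{k₂}^j`. -/
structure BIdx (d : ℕ) where
  i : Fin d
  j : Fin d
  r : Fin d
  h : Fin 2
  t : Fin 2

/-- Exponents as a plain product. -/
def bIdxEquiv (d : ℕ) : BIdx d ≃ Fin d × Fin d × Fin d × Fin 2 × Fin 2 where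
  toFun x := (x.i, x.j, x.r, x.h, x.t)
  invFun y := ⟨y.1, y.2.1, y.2.2.1, y.2.2.2.1, y.2.2.2.2⟩
  left_inv _ := rfl
  right_inv _ := rfl

instance (d : ℕ) : Fintype (BIdx d) := Fintype.ofEquiv _ (bIdxEquiv d).symm

/-- The monomial `k₁^i k₂^j e₁^r e₃^h e₂^t` in `Ū_q`. -/
def bMonomial (x : BIdx d) : Ubar F q d :=
  ubarGen F q d .k1 ^ (x.i : ℕ) * ubarGen F q d .k2 ^ (x.j : ℕ) * ubarGen F q d .e1 ^ (x.r : ℕ) *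
    ubarE3 F q d ^ (x.h : ℕ) * ubarGen F q d .e2 ^ (x.t : ℕ)

/-- The positive Borel part `B_q⁺` of `Ū_q`: the linear span of `k₁^i k₂^j e₁^r e₃^h e₂^t`,
`0 ≤ i, j, r < d`, `h, t ∈ {0, 1}`. -/
def Bplus : Submodule F (Ubar F q d) := Submodule.span F (Set.range (bMonomial F q d))

instance : FiniteDimensional F (Bplus F q d) :=
  FiniteDimensional.span_of_finite F (Set.finite_range _)

end Uq

section Alpha

variable {F : Type*} [Field F] {d : ℕ} {V : Type*} [AddCommGroup V] [Module F V]

/-- `α_{k₁} = ∑ q^{-2v+p} (k₁^v k₂^p)*`, with respect to the basis `k₁^i k₂^j e₁^r e₃^h e₂^t`. -/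
def alphaK1 (q : F) (b : Module.Basis (BIdx d) F V) : Module.Dual F V :=
  ∑ x : BIdx d, (if (x.r : ℕ) = 0 ∧ x.h = 0 ∧ x.t = 0
    then q ^ (-2 * ((x.i : ℕ) : ℤ) + ((x.j : ℕ) : ℤ)) else 0) • b.coord x

/-- `α_{k₂} = ∑ q^v (k₁^v k₂^p)*`. -/
def alphaK2 (q : F) (b : Module.Basis (BIdx d) F V) : Module.Dual F V :=
  ∑ x : BIdx d, (if (x.r : ℕ) = 0 ∧ x.h = 0 ∧ x.t = 0 then q ^ (x.i : ℕ) else 0) • b.coord x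

/-- `α_{e₁} = -(q - q⁻¹)⁻¹ ∑ q^{2v-p} (k₁^v k₂^p e₁)*`. -/
def alphaE1 (q : F) (b : Module.Basis (BIdx d) F V) : Module.Dual F V :=
  -(q - q⁻¹)⁻¹ • ∑ x : BIdx d, (if (x.r : ℕ) = 1 ∧ x.h = 0 ∧ x.t = 0
    then q ^ (2 * ((x.i : ℕ) : ℤ) - ((x.j : ℕ) : ℤ)) else 0) • b.coord x

/-- `α_{e₂} = (q - q⁻¹)⁻¹ ∑ q^{-v} (k₁^v k₂^p e₂)*`. -/
def alphaE2 (q : F) (b : Module.Basis (BIdx d) F V) : Module.Dual F V :=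
  (q - q⁻¹)⁻¹ • ∑ x : BIdx d, (if (x.r : ℕ) = 0 ∧ x.h = 0 ∧ x.t = 1
    then q ^ (-((x.i : ℕ) : ℤ)) else 0) • b.coord x

/-- `α_{e₃} = (q - q⁻¹)⁻¹ ∑ q^{v-p} ((k₁^v k₂^p e₁ e₂)* + (k₁^v k₂^p e₃)*)`. -/
def alphaE3 (q : F) (b : Module.Basis (BIdx d) F V) : Module.Dual F V :=
  (q - q⁻¹)⁻¹ • ∑ x : BIdx d,
    (if ((x.r : ℕ) = 1 ∧ x.h = 0 ∧ x.t = 1) ∨ ((x.r : ℕ) = 0 ∧ x.h = 1 ∧ x.t = 0)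
      then q ^ (((x.i : ℕ) : ℤ) - ((x.j : ℕ) : ℤ)) else 0) • b.coord x

/-- The monomial `α_{e₁}^w α_{e₃}^s α_{e₂}^l α_{k₁}^i α_{k₂}^j`, with the product of `X`, for
`(w, s, l, i, j) = (y.r, y.h, y.t, y.i, y.j)`. -/
def alphaMonomial (q : F) (X : SuperHopfData F (Module.Dual F V)) (b : Module.Basis (BIdx d) F V)
    (y : BIdx d) : Module.Dual F V :=
  X.m (X.m (X.m (X.m (X.npow (alphaE1 q b) y.r) (X.npow (alphaE3 q b) y.h))
    (X.npow (alphaE2 q b) y.t)) (X.npow (alphaK1 q b) y.i)) (X.npow (alphaK2 q b) y.j)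

/-- The defining property of the linear map `χ : D(B_q⁺) → Ū_q`:
`χ (α_{e₁}^w α_{e₃}^s α_{e₂}^l α_{k₁}^{i₁} α_{k₂}^{j₁} ⊗ k₁^{i₂} k₂^{j₂} e₁^r e₃^h e₂^t)
  = f₁^w f₃^s f₂^l k₁^{i₁+i₂} k₂^{j₁+j₂} e₁^r e₃^h e₂^t`. -/
def IsChi (q : F) (HB : SuperHopfData F (Bplus F q d)) (b : Module.Basis (BIdx d) F (Bplus F q d))
    (χ : Module.Dual F (Bplus F q d) ⊗[F] Bplus F q d →ₗ[F] Ubar F q d) : Prop :=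
  ∀ y x : BIdx d, χ (alphaMonomial q HB.dualOp b y ⊗ₜ[F] b x) =
    ubarGen F q d .f1 ^ (y.r : ℕ) * ubarF3 F q d ^ (y.h : ℕ) * ubarGen F q d .f2 ^ (y.t : ℕ) *
      ubarGen F q d .k1 ^ ((y.i : ℕ) + (x.i : ℕ)) * ubarGen F q d .k2 ^ ((y.j : ℕ) + (x.j : ℕ)) *
      ubarGen F q d .e1 ^ (x.r : ℕ) * ubarE3 F q d ^ (x.h : ℕ) * ubarGen F q d .e2 ^ (x.t : ℕ)

end Alpha

end

noncomputable section

section KoszulSign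

variable {F : Type*} [Field F]

theorem zmod_two_cases (i : ZMod 2) : i = 0 ∨ i = 1 := by
  revert i; decide

@[simp] theorem koszulSign_zero : koszulSign F 0 = 1 := by simp [koszulSign]

@[simp] theorem koszulSign_one : koszulSign F 1 = -1 := by simp [koszulSign]

theorem koszulSign_add (i j : ZMod 2) :
    koszulSign F (i + j) = koszulSign F i * koszulSign F j := by
  rcases zmod_two_cases i with rfl | rfl <;> rcases zmod_two_cases j with rfl | rfl <;>
    simp [show (1 + 1 : ZMod 2) = 0 by decide]

@[simp] theorem koszulSign_mul_self (i : ZMod 2) : koszulSign F i * koszulSign F i = 1 := by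
  rcases zmod_two_cases i with rfl | rfl <;> simp

end KoszulSign

section Superspaces

variable {F : Type*} [Field F]
variable {V V' W W' : Type*} [AddCommGroup V] [Module F V] [AddCommGroup V'] [Module F V']
  [AddCommGroup W] [Module F W] [AddCommGroup W'] [Module F W']

namespace IsGrading

variable {p : ZMod 2 → V →ₗ[F] V} {r : ZMod 2 → W →ₗ[F] W}

theorem apply_apply (hp : IsGrading p) (i j : ZMod 2) (v : V) :
    p i (p j v) = if i = j then p i v else 0 := by
  have := LinearMap.congr_fun (hp.proj i j) v
  rw [LinearMap.comp_apply] at this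
  rw [this]
  split_ifs <;> rfl

theorem apply_self (hp : IsGrading p) (i : ZMod 2) (v : V) : p i (p i v) = p i v := by
  rw [hp.apply_apply, if_pos rfl]

theorem add_apply (hp : IsGrading p) (v : V) : p 0 v + p 1 v = v :=
  LinearMap.congr_fun hp.total v

theorem apply_of_hom (hp : IsGrading p) {i : ZMod 2} {v : V} (hv : p i v = v) (j : ZMod 2) :
    p j v = if j = i then v else 0 := by
  rw [← hv, hp.apply_apply]
  split_ifs with h
  · rw [h]
  · rfl

theorem induction (hp : IsGrading p) {P : V → Prop} (add : ∀ v w, P v → P w → P (v + w))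
    (hom : ∀ i v, p i v = v → P v) (v : V) : P v := by
  rw [← hp.add_apply v]
  exact add _ _ (hom 0 _ (hp.apply_self _ _)) (hom 1 _ (hp.apply_self _ _))

theorem tensor_induction (hp : IsGrading p) (hr : IsGrading r) {P : V ⊗[F] W → Prop}
    (add : ∀ v w, P v → P w → P (v + w))
    (hom : ∀ i j v w, p i v = v → r j w = w → P (v ⊗ₜ w)) (t : V ⊗[F] W) : P t := by
  induction t with
  | zero => simpa using hom 0 0 0 0 (map_zero _) (map_zero _)
  | add a b ha hb => exact add a b ha hb
  | tmul v w =>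
    rw [← hp.add_apply v, ← hr.add_apply w]
    simp only [TensorProduct.add_tmul, TensorProduct.tmul_add]
    have h (i j) : P (p i v ⊗ₜ r j w) := hom i j _ _ (hp.apply_self _ _) (hr.apply_self _ _)
    exact add _ _ (add _ _ (h 0 0) (h 1 0)) (add _ _ (h 0 1) (h 1 1))

theorem tensor_ext (hp : IsGrading p) (hr : IsGrading r) {f g : V ⊗[F] W →ₗ[F] W'}
    (h : ∀ i j v w, p i v = v → r j w = w → f (v ⊗ₜ w) = g (v ⊗ₜ w)) : f = g := by
  ext1
  ext v w
  refine hp.tensor_induction hr (P := fun t => f t = g t) (fun a b ha hb => ?_) h (v ⊗ₜ w)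
  rw [map_add, map_add, ha, hb]

end IsGrading

theorem sum_zmod_two {M : Type*} [AddCommMonoid M] (f : ZMod 2 → M) : ∑ i, f i = f 0 + f 1 :=
  Fin.sum_univ_two f

section Homogeneous

variable {p : ZMod 2 → V →ₗ[F] V} {p' : ZMod 2 → V' →ₗ[F] V'} {r : ZMod 2 → W →ₗ[F] W}

theorem tensorPart_tmul (hp : IsGrading p) (hr : IsGrading r) {i j : ZMod 2} {v : V} {w : W}
    (hv : p i v = v) (hw : r j w = w) (k : ZMod 2) :
    tensorPart p r k (v ⊗ₜ[F] w) = if k = i + j then v ⊗ₜ[F] w else 0 := by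
  simp only [tensorPart, LinearMap.sum_apply, TensorProduct.map_tmul, hp.apply_of_hom hv,
    hr.apply_of_hom hw]
  rw [Finset.sum_eq_single i]
  · rw [if_pos rfl, ite_cond_congr (c := k = i + j)]
    · split_ifs <;> simp
    · rw [sub_eq_iff_eq_add, add_comm j i]
  · intro b _ hb
    rw [if_neg hb, TensorProduct.zero_tmul]
  · simp

theorem superFlip_tmul (hp : IsGrading p) (hr : IsGrading r) {i j : ZMod 2} {v : V} {w : W}
    (hv : p i v = v) (hw : r j w = w) :
    superFlip p r (v ⊗ₜ[F] w) = koszulSign F (i * j) • (w ⊗ₜ[F] v) := by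
  simp only [superFlip, LinearMap.sum_apply, LinearMap.smul_apply, LinearMap.comp_apply,
    TensorProduct.map_tmul, hp.apply_of_hom hv, hr.apply_of_hom hw, LinearEquiv.coe_coe,
    TensorProduct.comm_tmul]
  rw [Finset.sum_eq_single i, Finset.sum_eq_single j] <;> simp +contextual

theorem superSign_tmul (hp : IsGrading p) (hr : IsGrading r) {i j : ZMod 2} {v : V} {w : W}
    (hv : p i v = v) (hw : r j w = w) :
    superSign p r (v ⊗ₜ[F] w) = koszulSign F (i * j) • (v ⊗ₜ[F] w) := by
  simp only [superSign, LinearMap.sum_apply, LinearMap.smul_apply,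
    TensorProduct.map_tmul, hp.apply_of_hom hv, hr.apply_of_hom hw]
  rw [Finset.sum_eq_single i, Finset.sum_eq_single j] <;> simp +contextual

theorem superInterchange_tmul (hp : IsGrading p') (hr : IsGrading r) {i j : ZMod 2} (v : V)
    {v' : V'} {w : W} (w' : W') (hv : p' i v' = v') (hw : r j w = w) :
    superInterchange p' r ((v ⊗ₜ[F] v') ⊗ₜ[F] (w ⊗ₜ[F] w')) =
      koszulSign F (i * j) • ((v ⊗ₜ[F] w) ⊗ₜ[F] (v' ⊗ₜ[F] w')) := by
  simp only [superInterchange, LinearMap.sum_apply, LinearMap.smul_apply, LinearMap.comp_apply,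
    TensorProduct.map_tmul, hp.apply_of_hom hv, hr.apply_of_hom hw, LinearEquiv.coe_coe,
    LinearMap.id_apply, TensorProduct.tensorTensorTensorComm_tmul]
  rw [Finset.sum_eq_single i, Finset.sum_eq_single j] <;> simp +contextual

theorem IsGrading.tensor (hp : IsGrading p) (hr : IsGrading r) : IsGrading (tensorPart p r) where
  proj i j := by
    refine hp.tensor_ext hr fun a b v w hv hw => ?_
    rw [LinearMap.comp_apply, tensorPart_tmul hp hr hv hw]
    by_cases hj : j = a + b
    · rw [if_pos hj, tensorPart_tmul hp hr hv hw]
      by_cases hi : i = j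
      · rw [if_pos hi, if_pos (hi.trans hj), tensorPart_tmul hp hr hv hw, if_pos (hi.trans hj)]
      · rw [if_neg hi, if_neg (fun h => hi (h.trans hj.symm))]; rfl
    · rw [if_neg hj, map_zero]
      by_cases hi : i = j
      · rw [if_pos hi, tensorPart_tmul hp hr hv hw, if_neg (hi ▸ hj)]
      · rw [if_neg hi]; rfl
  total := by
    refine hp.tensor_ext hr fun a b v w hv hw => ?_
    rw [LinearMap.add_apply, tensorPart_tmul hp hr hv hw, tensorPart_tmul hp hr hv hw,
      LinearMap.id_apply]
    generalize a + b = c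
    rcases zmod_two_cases c with rfl | rfl <;> simp

theorem IsEvenMap.apply {f : V →ₗ[F] W} (hf : IsEvenMap p r f) (i : ZMod 2) (v : V) :
    f (p i v) = r i (f v) := LinearMap.congr_fun (hf i) v

theorem IsEvenMap.hom {f : V →ₗ[F] W} (hf : IsEvenMap p r f) {i : ZMod 2} {v : V}
    (hv : p i v = v) : r i (f v) = f v := by rw [← hf.apply, hv]

theorem IsEvenMap.of_hom (hp : IsGrading p) (hr : IsGrading r) {f : V →ₗ[F] W}
    (h : ∀ i v, p i v = v → r i (f v) = f v) : IsEvenMap p r f := by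
  intro i
  ext v
  refine hp.induction (P := fun v => f (p i v) = r i (f v)) (fun a b ha hb => ?_) (fun j v hv => ?_) v
  · rw [map_add, map_add, map_add, map_add, ha, hb]
  · rw [hp.apply_of_hom hv, hr.apply_of_hom (h j v hv)]
    split_ifs <;> simp

theorem tensor_hom (hp : IsGrading p) (hr : IsGrading r) {i j : ZMod 2} {v : V} {w : W}
    (hv : p i v = v) (hw : r j w = w) : tensorPart p r (i + j) (v ⊗ₜ[F] w) = v ⊗ₜ[F] w := by
  rw [tensorPart_tmul hp hr hv hw, if_pos rfl]

end Homogeneous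

end Superspaces

namespace SuperHopfData

variable {F : Type*} [Field F]
variable {V W V' W' : Type*} [AddCommGroup V] [Module F V] [AddCommGroup W] [Module F W]
  [AddCommGroup V'] [Module F V'] [AddCommGroup W'] [Module F W']

/-- The axioms of an associative unital superalgebra. -/
structure IsSuperAlg (A : SuperHopfData F V) : Prop where
  grading : IsGrading A.part
  mul_even : IsEvenMap (tensorPart A.part A.part) A.part A.mul
  one_even : A.part 0 A.one = A.one
  mul_assoc : ∀ x y z, A.m (A.m x y) z = A.m x (A.m y z)
  one_mul : ∀ x, A.m A.one x = x
  mul_one : ∀ x, A.m x A.one = x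

theorem IsHopf.isSuperAlg {A : SuperHopfData F V} (h : A.IsHopf) : A.IsSuperAlg :=
  ⟨h.grading, h.mul_even, h.one_even, h.mul_assoc, h.one_mul, h.mul_one⟩

section m

variable (A : SuperHopfData F V) (x y z : V) (c : F)

theorem m_add : A.m x (y + z) = A.m x y + A.m x z := by simp [m, TensorProduct.tmul_add]
theorem add_m : A.m (x + y) z = A.m x z + A.m y z := by simp [m, TensorProduct.add_tmul]
@[simp] theorem m_smul : A.m x (c • y) = c • A.m x y := by simp [m]
@[simp] theorem smul_m : A.m (c • x) y = c • A.m x y := by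
  rw [m, ← TensorProduct.smul_tmul', map_smul]; rfl
@[simp] theorem m_zero : A.m x 0 = 0 := by simp [m]
@[simp] theorem zero_m : A.m 0 x = 0 := by simp [m]

end m

namespace IsSuperAlg

variable {A : SuperHopfData F V} {B : SuperHopfData F W}

theorem hom_m (hA : A.IsSuperAlg) {i j : ZMod 2} {x y : V} (hx : A.part i x = x)
    (hy : A.part j y = y) : A.part (i + j) (A.m x y) = A.m x y :=
  hA.mul_even.hom (tensor_hom hA.grading hA.grading hx hy)

theorem part_hom_m (hA : A.IsSuperAlg) {i : ZMod 2} {x : V} (hx : A.part i x = x) (j : ZMod 2)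
    (y : V) : A.part (i + j) (A.m x y) = A.m x (A.part j y) := by
  refine hA.grading.induction (P := fun y => A.part (i + j) (A.m x y) = A.m x (A.part j y))
    (fun a b ha hb => ?_) (fun k y hy => ?_) y
  · rw [m_add, map_add, map_add, m_add, ha, hb]
  · rw [hA.grading.apply_of_hom (hA.hom_m hx hy), hA.grading.apply_of_hom hy]
    by_cases h : j = k <;> simp [h]

theorem tensor_m (hA : IsGrading A.part) (hB : IsGrading B.part) {i j : ZMod 2} (a : V)
    {b : W} {c : V} (d : W) (hb : B.part i b = b) (hc : A.part j c = c) :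
    (A.tensor B).m (a ⊗ₜ b) (c ⊗ₜ d) = koszulSign F (i * j) • (A.m a c ⊗ₜ[F] B.m b d) := by
  simp only [m, tensor, LinearMap.comp_apply, superInterchange_tmul hB hA a d hb hc, map_smul,
    TensorProduct.map_tmul]

theorem tensor_m_even_left (hA : IsGrading A.part) (hB : IsGrading B.part) (a : V)
    {b : W} (c : V) (d : W) (hb : B.part 0 b = b) :
    (A.tensor B).m (a ⊗ₜ b) (c ⊗ₜ d) = A.m a c ⊗ₜ[F] B.m b d := by
  refine hA.induction (P := fun c => (A.tensor B).m (a ⊗ₜ b) (c ⊗ₜ d) = A.m a c ⊗ₜ[F] B.m b d)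
    (fun x y hx hy => ?_) (fun k y hy => ?_) c
  · rw [TensorProduct.add_tmul, m_add, m_add, TensorProduct.add_tmul, hx, hy]
  · rw [tensor_m hA hB a d hb hy]; simp

theorem tensor_m_even_right (hA : IsGrading A.part) (hB : IsGrading B.part) (a : V)
    (b : W) {c : V} (d : W) (hc : A.part 0 c = c) :
    (A.tensor B).m (a ⊗ₜ b) (c ⊗ₜ d) = A.m a c ⊗ₜ[F] B.m b d := by
  refine hB.induction (P := fun b => (A.tensor B).m (a ⊗ₜ b) (c ⊗ₜ d) = A.m a c ⊗ₜ[F] B.m b d)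
    (fun x y hx hy => ?_) (fun k y hy => ?_) b
  · rw [TensorProduct.tmul_add, add_m, add_m, TensorProduct.tmul_add, hx, hy]
  · rw [tensor_m hA hB a d hy hc]; simp

theorem tensor_mul_even (hA : A.IsSuperAlg) (hB : B.IsSuperAlg) :
    IsEvenMap (tensorPart (A.tensor B).part (A.tensor B).part) (A.tensor B).part
      (A.tensor B).mul := by
  have hT : IsGrading (A.tensor B).part := hA.grading.tensor hB.grading
  intro i
  refine TensorProduct.ext' fun s t => ?_
  change (A.tensor B).mul (tensorPart (A.tensor B).part (A.tensor B).part i (s ⊗ₜ t)) =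
    (A.tensor B).part i ((A.tensor B).mul (s ⊗ₜ t))
  refine hA.grading.tensor_induction hB.grading
    (P := fun s => (A.tensor B).mul (tensorPart (A.tensor B).part (A.tensor B).part i (s ⊗ₜ t)) =
      (A.tensor B).part i ((A.tensor B).mul (s ⊗ₜ t)))
    (fun a b ha hb => by simp only [TensorProduct.add_tmul, map_add, ha, hb])
    (fun j k a b ha hb => ?_) s
  refine hA.grading.tensor_induction hB.grading
    (P := fun t => (A.tensor B).mul (tensorPart (A.tensor B).part (A.tensor B).part i (_ ⊗ₜ t)) =
      (A.tensor B).part i ((A.tensor B).mul (_ ⊗ₜ t)))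
    (fun a b ha hb => by simp only [TensorProduct.tmul_add, map_add, ha, hb])
    (fun j' k' c d hc hd => ?_) t
  have e1 : (A.tensor B).part (j + k) (a ⊗ₜ b) = a ⊗ₜ b := tensor_hom hA.grading hB.grading ha hb
  have e2 : (A.tensor B).part (j' + k') (c ⊗ₜ d) = c ⊗ₜ d :=
    tensor_hom hA.grading hB.grading hc hd
  have e3 : (A.tensor B).mul ((a ⊗ₜ b) ⊗ₜ (c ⊗ₜ d)) =
    koszulSign F (k * j') • (A.m a c ⊗ₜ[F] B.m b d) := tensor_m hA.grading hB.grading a d hb hc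
  have e4 : (A.tensor B).part i (A.m a c ⊗ₜ[F] B.m b d) =
      if i = j + j' + (k + k') then A.m a c ⊗ₜ[F] B.m b d else 0 :=
    tensorPart_tmul hA.grading hB.grading (hA.hom_m ha hc) (hB.hom_m hb hd) i
  rw [tensorPart_tmul hT hT e1 e2, e3, map_smul, e4, show j + k + (j' + k') = j + j' + (k + k') by ring]
  split_ifs
  · rw [e3]
  · simp

theorem tensor (hA : A.IsSuperAlg) (hB : B.IsSuperAlg) : (A.tensor B).IsSuperAlg where
  grading := hA.grading.tensor hB.grading
  mul_even := tensor_mul_even hA hB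
  one_even := by
    have := tensor_hom hA.grading hB.grading hA.one_even hB.one_even
    rwa [add_zero] at this
  mul_assoc x y z := by
    refine hA.grading.tensor_induction hB.grading (P := fun x => (A.tensor B).m
      ((A.tensor B).m x y) z = (A.tensor B).m x ((A.tensor B).m y z))
      (fun a b ha hb => by simp only [add_m, ha, hb]) (fun i i' a a' ha ha' => ?_) x
    refine hA.grading.tensor_induction hB.grading (P := fun y => (A.tensor B).m
      ((A.tensor B).m _ y) z = (A.tensor B).m _ ((A.tensor B).m y z))
      (fun a b ha hb => by simp only [add_m, m_add, ha, hb]) (fun j j' b b' hb hb' => ?_) y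
    refine hA.grading.tensor_induction hB.grading (P := fun z => (A.tensor B).m
      ((A.tensor B).m _ _) z = (A.tensor B).m _ ((A.tensor B).m _ z))
      (fun a b ha hb => by simp only [m_add, ha, hb]) (fun k k' c c' hc hc' => ?_) z
    rw [tensor_m hA.grading hB.grading a b' ha' hb, tensor_m hA.grading hB.grading b c' hb' hc,
      smul_m, m_smul, tensor_m hA.grading hB.grading _ _ (hB.hom_m ha' hb') hc,
      tensor_m hA.grading hB.grading _ _ ha' (hA.hom_m hb hc), hA.mul_assoc, hB.mul_assoc,
      smul_smul, smul_smul, ← koszulSign_add, ← koszulSign_add]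
    congr 2
    ring
  one_mul x := by
    refine hA.grading.tensor_induction hB.grading (P := fun x => (A.tensor B).m
      (A.one ⊗ₜ B.one) x = x)
      (fun a b ha hb => by rw [m_add, ha, hb]) (fun i i' a a' ha ha' => ?_) x
    rw [tensor_m hA.grading hB.grading _ _ hB.one_even ha, hA.one_mul, hB.one_mul]
    simp
  mul_one x := by
    refine hA.grading.tensor_induction hB.grading (P := fun x => (A.tensor B).m
      x (A.one ⊗ₜ B.one) = x)
      (fun a b ha hb => by rw [add_m, ha, hb]) (fun i i' a a' ha ha' => ?_) x
    rw [tensor_m hA.grading hB.grading _ _ ha' hA.one_even, hA.mul_one, hB.mul_one]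
    simp

end IsSuperAlg

/-- The superspace underlying a superalgebra, as a type with an `Algebra` instance. -/
@[nolint unusedArguments]
def SAlg (A : SuperHopfData F V) (_ : A.IsSuperAlg) : Type _ := V

namespace SAlg

variable {A : SuperHopfData F V} {h : A.IsSuperAlg}

instance : AddCommGroup (SAlg A h) := inferInstanceAs (AddCommGroup V)
instance : Module F (SAlg A h) := inferInstanceAs (Module F V)

instance : Ring (SAlg A h) where
  __ : AddCommGroup (SAlg A h) := inferInstance
  mul := A.m
  one := A.one
  mul_assoc := h.mul_assoc
  one_mul := h.one_mul
  mul_one := h.mul_one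
  left_distrib := A.m_add
  right_distrib := A.add_m
  zero_mul := A.zero_m
  mul_zero := A.m_zero

instance : Algebra F (SAlg A h) :=
  Algebra.ofModule (fun c x y => A.smul_m x y c) (fun c x y => A.m_smul x y c)

end SAlg

end SuperHopfData

namespace SuperHopfData

variable {F : Type*} [Field F]
variable {V W V' W' Z : Type*} [AddCommGroup V] [Module F V] [AddCommGroup W] [Module F W]
  [AddCommGroup V'] [Module F V'] [AddCommGroup W'] [Module F W'] [AddCommGroup Z] [Module F Z]

theorem _root_.IsEvenMap.of_tmul {p : ZMod 2 → V →ₗ[F] V} {r : ZMod 2 → W →ₗ[F] W}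
    {s : ZMod 2 → Z →ₗ[F] Z} (hp : IsGrading p) (hr : IsGrading r) (hs : IsGrading s)
    {f : V ⊗[F] W →ₗ[F] Z}
    (h : ∀ i j v w, p i v = v → r j w = w → s (i + j) (f (v ⊗ₜ w)) = f (v ⊗ₜ w)) :
    IsEvenMap (tensorPart p r) s f := by
  intro k
  refine hp.tensor_ext hr fun i j v w hv hw => ?_
  rw [LinearMap.comp_apply, LinearMap.comp_apply, tensorPart_tmul hp hr hv hw,
    hs.apply_of_hom (h i j v w hv hw)]
  split_ifs <;> simp

/-- A morphism of unital superalgebras. -/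
structure IsSuperAlgHom (A : SuperHopfData F V) (B : SuperHopfData F W) (f : V →ₗ[F] W) :
    Prop where
  even : IsEvenMap A.part B.part f
  map_m : ∀ x y, f (A.m x y) = B.m (f x) (f y)
  map_one : f A.one = B.one

namespace IsSuperAlgHom

variable {A : SuperHopfData F V} {B : SuperHopfData F W} {A' : SuperHopfData F V'}
  {B' : SuperHopfData F W'} {C : SuperHopfData F Z}

protected theorem id : IsSuperAlgHom A A LinearMap.id := ⟨fun _ => rfl, fun _ _ => rfl, rfl⟩

theorem comp {g : W →ₗ[F] Z} {f : V →ₗ[F] W} (hg : IsSuperAlgHom B C g)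
    (hf : IsSuperAlgHom A B f) : IsSuperAlgHom A C (g ∘ₗ f) where
  even i := by rw [LinearMap.comp_assoc, hf.even i, ← LinearMap.comp_assoc, hg.even i]; rfl
  map_m x y := by simp only [LinearMap.comp_apply, hf.map_m, hg.map_m]
  map_one := by rw [LinearMap.comp_apply, hf.map_one, hg.map_one]

theorem map_m_of_hom (hA : IsGrading A.part) {f : V →ₗ[F] W}
    (h : ∀ i j x y, A.part i x = x → A.part j y = y → f (A.m x y) = B.m (f x) (f y)) (x y : V) :
    f (A.m x y) = B.m (f x) (f y) := by
  refine hA.induction (P := fun x => f (A.m x y) = B.m (f x) (f y))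
    (fun a b ha hb => by simp only [add_m, map_add, ha, hb]) (fun i x hx => ?_) x
  exact hA.induction (P := fun y => f (A.m x y) = B.m (f x) (f y))
    (fun a b ha hb => by simp only [m_add, map_add, ha, hb]) (fun j y hy => h i j x y hx hy) y

theorem map_m_of_tmul_hom (hA : IsGrading A.part) (hB : IsGrading B.part) {f : V ⊗[F] W →ₗ[F] Z}
    (h : ∀ i i' j j' a b c d, A.part i a = a → B.part i' b = b → A.part j c = c → B.part j' d = d →
      f ((A.tensor B).m (a ⊗ₜ b) (c ⊗ₜ d)) = C.m (f (a ⊗ₜ b)) (f (c ⊗ₜ d))) (x y : V ⊗[F] W) :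
    f ((A.tensor B).m x y) = C.m (f x) (f y) := by
  refine hA.tensor_induction hB (P := fun x => f ((A.tensor B).m x y) = C.m (f x) (f y))
    (fun a b ha hb => by simp only [add_m, map_add, ha, hb]) (fun i i' a b ha hb => ?_) x
  exact hA.tensor_induction hB (P := fun y => f ((A.tensor B).m _ y) = C.m (f _) (f y))
    (fun a b ha hb => by simp only [m_add, map_add, ha, hb])
    (fun j j' c d hc hd => h i i' j j' a b c d ha hb hc hd) y

theorem tensor (hA : IsGrading A.part) (hB : IsGrading B.part) (hA' : IsGrading A'.part)
    (hB' : IsGrading B'.part) {f : V →ₗ[F] V'} {g : W →ₗ[F] W'} (hf : IsSuperAlgHom A A' f)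
    (hg : IsSuperAlgHom B B' g) :
    IsSuperAlgHom (A.tensor B) (A'.tensor B') (TensorProduct.map f g) where
  even := IsEvenMap.of_tmul hA hB (hA'.tensor hB') fun i j v w hv hw => by
    rw [TensorProduct.map_tmul]; exact tensor_hom hA' hB' (hf.even.hom hv) (hg.even.hom hw)
  map_m := map_m_of_tmul_hom hA hB fun i i' j j' a b c d ha hb hc hd => by
    rw [IsSuperAlg.tensor_m hA hB a d hb hc, map_smul, TensorProduct.map_tmul,
      TensorProduct.map_tmul, TensorProduct.map_tmul,
      IsSuperAlg.tensor_m hA' hB' _ _ (hg.even.hom hb) (hf.even.hom hc), hf.map_m, hg.map_m]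
  map_one := by
    change TensorProduct.map f g (A.one ⊗ₜ B.one) = A'.one ⊗ₜ B'.one
    rw [TensorProduct.map_tmul, hf.map_one, hg.map_one]

end IsSuperAlgHom

variable {A : SuperHopfData F V} {B : SuperHopfData F W} {C : SuperHopfData F Z}

theorem IsSuperAlg.flip_hom (hA : A.IsSuperAlg) (hB : B.IsSuperAlg) :
    IsSuperAlgHom (A.tensor B) (B.tensor A) (superFlip A.part B.part) where
  even := IsEvenMap.of_tmul hA.grading hB.grading (hB.grading.tensor hA.grading)
    fun i j v w hv hw => by
      rw [superFlip_tmul hA.grading hB.grading hv hw, map_smul, add_comm]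
      congr 1
      exact tensor_hom hB.grading hA.grading hw hv
  map_m := IsSuperAlgHom.map_m_of_tmul_hom hA.grading hB.grading
    fun i i' j j' a b c d ha hb hc hd => by
      rw [IsSuperAlg.tensor_m hA.grading hB.grading a d hb hc, map_smul,
        superFlip_tmul hA.grading hB.grading ha hb, superFlip_tmul hA.grading hB.grading hc hd,
        superFlip_tmul hA.grading hB.grading (hA.hom_m ha hc) (hB.hom_m hb hd), smul_m, m_smul,
        IsSuperAlg.tensor_m hB.grading hA.grading b c ha hd]
      simp only [smul_smul, ← koszulSign_add]
      congr 2
      clear ha hb hc hd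
      revert i i' j j'; decide
  map_one := by
    have := superFlip_tmul hA.grading hB.grading hA.one_even hB.one_even
    rwa [mul_zero, koszulSign_zero, one_smul] at this

theorem IsSuperAlg.tensor3_m (hA : A.IsSuperAlg) (hB : B.IsSuperAlg) (hC : C.IsSuperAlg)
    {j k i' j' : ZMod 2} (a : V) {b : W} {c : Z} {a' : V} {b' : W} (c' : Z)
    (hb : B.part j b = b) (hc : C.part k c = c)
    (ha' : A.part i' a' = a') (hb' : B.part j' b' = b') :
    ((A.tensor B).tensor C).m ((a ⊗ₜ b) ⊗ₜ c) ((a' ⊗ₜ b') ⊗ₜ c') =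
      koszulSign F (k * (i' + j') + j * i') • ((A.m a a' ⊗ₜ B.m b b') ⊗ₜ C.m c c') := by
  rw [IsSuperAlg.tensor_m (hA.tensor hB).grading hC.grading _ _ hc
    (tensor_hom hA.grading hB.grading ha' hb'),
    IsSuperAlg.tensor_m hA.grading hB.grading _ _ hb ha', ← TensorProduct.smul_tmul', smul_smul,
    ← koszulSign_add]

theorem IsSuperAlg.assoc_hom (hA : A.IsSuperAlg) (hB : B.IsSuperAlg) (hC : C.IsSuperAlg) :
    IsSuperAlgHom ((A.tensor B).tensor C) (A.tensor (B.tensor C))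
      (TensorProduct.assoc F V W Z).toLinearMap where
  even := by
    have hAB := (hA.tensor hB).grading
    have hBC := (hB.tensor hC).grading
    refine IsEvenMap.of_tmul hAB hC.grading (hA.tensor (hB.tensor hC)).grading
      fun i j v w hv hw => ?_
    rw [← hv]
    refine hA.grading.tensor_induction hB.grading (P := fun v => (A.tensor (B.tensor C)).part (i + j)
        ((TensorProduct.assoc F V W Z).toLinearMap ((A.tensor B).part i v ⊗ₜ w)) =
        (TensorProduct.assoc F V W Z).toLinearMap ((A.tensor B).part i v ⊗ₜ w))
      (fun a b ha hb => by simp only [TensorProduct.add_tmul, map_add, ha, hb])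
      (fun k l a b ha hb => ?_) v
    rw [show (A.tensor B).part i (a ⊗ₜ b) = _ from tensorPart_tmul hA.grading hB.grading ha hb i]
    split_ifs with h
    · have := tensor_hom hA.grading hBC ha (tensor_hom hB.grading hC.grading hb hw)
      rw [← add_assoc, ← h] at this
      exact this
    · simp
  map_m x y := by
    have key : ∀ (x y : (V ⊗[F] W) ⊗[F] Z),
        (TensorProduct.assoc F V W Z).toLinearMap (((A.tensor B).tensor C).m x y) =
        (A.tensor (B.tensor C)).m ((TensorProduct.assoc F V W Z).toLinearMap x)
          ((TensorProduct.assoc F V W Z).toLinearMap y) := by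
      refine IsSuperAlgHom.map_m_of_tmul_hom (hA.tensor hB).grading hC.grading
        fun i k i' k' s c s' c' _ hc _ hc' => ?_
      refine hA.grading.tensor_induction hB.grading (P := fun s =>
        (TensorProduct.assoc F V W Z).toLinearMap
          (((A.tensor B).tensor C).m (s ⊗ₜ c) (s' ⊗ₜ c')) = (A.tensor (B.tensor C)).m
          ((TensorProduct.assoc F V W Z).toLinearMap (s ⊗ₜ c))
          ((TensorProduct.assoc F V W Z).toLinearMap (s' ⊗ₜ c')))
        (fun a b ha hb => by simp only [TensorProduct.add_tmul, map_add, add_m, ha, hb])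
        (fun l n a b ha hb => ?_) s
      refine hA.grading.tensor_induction hB.grading (P := fun s' =>
        (TensorProduct.assoc F V W Z).toLinearMap
          (((A.tensor B).tensor C).m (_ ⊗ₜ c) (s' ⊗ₜ c')) = (A.tensor (B.tensor C)).m
          ((TensorProduct.assoc F V W Z).toLinearMap (_ ⊗ₜ c))
          ((TensorProduct.assoc F V W Z).toLinearMap (s' ⊗ₜ c')))
        (fun a b ha hb => by simp only [TensorProduct.add_tmul, map_add, m_add, ha, hb])
        (fun l' n' a' b' ha' hb' => ?_) s'
      rw [IsSuperAlg.tensor3_m hA hB hC _ _ hb hc ha' hb']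
      simp only [LinearEquiv.coe_coe, map_smul, TensorProduct.assoc_tmul]
      rw [IsSuperAlg.tensor_m hA.grading (hB.tensor hC).grading _ _
        (tensor_hom hB.grading hC.grading hb hc) ha', IsSuperAlg.tensor_m hB.grading hC.grading _ _
        hc hb', TensorProduct.tmul_smul, smul_smul, ← koszulSign_add]
      congr 2
      ring
    exact key x y
  map_one := rfl

/-- The ground field as a superalgebra. -/
def scalars (F : Type*) [Field F] : SuperHopfData F F where
  part i := if i = 0 then LinearMap.id else 0
  mul := LinearMap.mul' F F
  one := 1
  comul := 0
  counit := 0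
  antipode := 0
  antipodeInv := 0

theorem scalars_grading : IsGrading (scalars F).part where
  proj i j := by
    ext
    rcases zmod_two_cases i with rfl | rfl <;> rcases zmod_two_cases j with rfl | rfl <;>
      simp [scalars]
  total := by ext; simp [scalars]

theorem IsSuperAlg.lid_hom (hA : A.IsSuperAlg) :
    IsSuperAlgHom ((scalars F).tensor A) A (TensorProduct.lid F V).toLinearMap where
  even := IsEvenMap.of_tmul scalars_grading hA.grading hA.grading fun i j c v hc hv => by
    rcases zmod_two_cases i with rfl | rfl
    · simp [hv]
    · have : c = 0 := by simpa [scalars] using hc.symm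
      simp [this]
  map_m := IsSuperAlgHom.map_m_of_tmul_hom scalars_grading hA.grading
    fun i i' j j' c v c' v' hc hv hc' hv' => by
      rw [IsSuperAlg.tensor_m scalars_grading hA.grading _ _ hv hc']
      rcases zmod_two_cases j with rfl | rfl
      · have : (scalars F).m c c' = c * c' := rfl
        simp [this, smul_smul, mul_comm]
      · have : c' = 0 := by simpa [scalars] using hc'.symm
        simp [this, m, scalars]
  map_one := by simp [SuperHopfData.tensor, scalars]

theorem IsSuperAlg.rid_hom (hA : A.IsSuperAlg) :
    IsSuperAlgHom (A.tensor (scalars F)) A (TensorProduct.rid F V).toLinearMap where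
  even := IsEvenMap.of_tmul hA.grading scalars_grading hA.grading fun j i v c hv hc => by
    rcases zmod_two_cases i with rfl | rfl
    · simp [hv]
    · have : c = 0 := by simpa [scalars] using hc.symm
      simp [this]
  map_m := IsSuperAlgHom.map_m_of_tmul_hom hA.grading scalars_grading
    fun i i' j j' v c v' c' hv hc hv' hc' => by
      rw [IsSuperAlg.tensor_m hA.grading scalars_grading _ _ hc hv']
      rcases zmod_two_cases i' with rfl | rfl
      · have : (scalars F).m c c' = c * c' := rfl
        simp [this, smul_smul, mul_comm]
      · have : c = 0 := by simpa [scalars] using hc.symm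
        simp [this, m, scalars]
  map_one := by simp [SuperHopfData.tensor, scalars]

/-- The opposite superalgebra, `x · y = (-1)^{|x||y|} y x`. -/
def superOp (A : SuperHopfData F V) : SuperHopfData F V :=
  { A with mul := A.mul ∘ₗ superFlip A.part A.part }

theorem superOp_m (hA : IsGrading A.part) {i j : ZMod 2} {x y : V} (hx : A.part i x = x)
    (hy : A.part j y = y) : A.superOp.m x y = koszulSign F (i * j) • A.m y x := by
  simp only [m, superOp, LinearMap.comp_apply, superFlip_tmul hA hA hx hy, map_smul]

theorem IsSuperAlg.superOp (hA : A.IsSuperAlg) : A.superOp.IsSuperAlg where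
  grading := hA.grading
  mul_even := IsEvenMap.of_tmul hA.grading hA.grading hA.grading fun i j x y hx hy => by
    have := superOp_m hA.grading hx hy
    simp only [m] at this
    rw [this, map_smul]
    exact congrArg _ (by rw [add_comm]; exact hA.hom_m hy hx)
  one_even := hA.one_even
  mul_assoc x y z := by
    refine hA.grading.induction (P := fun x => A.superOp.m (A.superOp.m x y) z =
      A.superOp.m x (A.superOp.m y z))
      (fun a b ha hb => by simp only [add_m, ha, hb]) (fun i x hx => ?_) x
    refine hA.grading.induction (P := fun y => A.superOp.m (A.superOp.m x y) z =
      A.superOp.m x (A.superOp.m y z))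
      (fun a b ha hb => by simp only [add_m, m_add, ha, hb]) (fun j y hy => ?_) y
    refine hA.grading.induction (P := fun z => A.superOp.m (A.superOp.m x y) z =
      A.superOp.m x (A.superOp.m y z))
      (fun a b ha hb => by simp only [m_add, ha, hb]) (fun k z hz => ?_) z
    rw [superOp_m hA.grading hx hy, superOp_m hA.grading hy hz, smul_m, m_smul,
      superOp_m hA.grading (hA.hom_m hy hx) hz, superOp_m hA.grading hx (hA.hom_m hz hy),
      hA.mul_assoc, smul_smul, smul_smul, ← koszulSign_add, ← koszulSign_add]
    congr 2
    ring
  one_mul x := by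
    refine hA.grading.induction (P := fun x => A.superOp.m A.one x = x)
      (fun a b ha hb => by rw [m_add, ha, hb]) (fun i x hx => ?_) x
    rw [superOp_m hA.grading hA.one_even hx, zero_mul, koszulSign_zero, one_smul, hA.mul_one]
  mul_one x := by
    refine hA.grading.induction (P := fun x => A.superOp.m x A.one = x)
      (fun a b ha hb => by rw [add_m, ha, hb]) (fun i x hx => ?_) x
    rw [superOp_m hA.grading hx hA.one_even, mul_zero, koszulSign_zero, one_smul, hA.one_mul]

end SuperHopfData

section QCommutation

variable {F : Type*} [Field F] {R : Type*} [Ring R] [Algebra F R]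

theorem qcomm_assoc {a b : R} {c : F} (h : a * b = c • (b * a)) (x : R) :
    a * (b * x) = c • (b * (a * x)) := by
  rw [← mul_assoc, h, smul_mul_assoc, mul_assoc]

theorem qcomm_mul_left {a b k : R} {c c' : F} (h : a * k = c • (k * a)) (h' : b * k = c' • (k * b)) :
    (a * b) * k = (c * c') • (k * (a * b)) := by
  rw [mul_assoc, h', mul_smul_comm, ← mul_assoc, h, smul_mul_assoc, smul_smul, mul_assoc, mul_comm]

theorem qcomm_mul_right {a k l : R} {c c' : F} (h : a * k = c • (k * a))
    (h' : a * l = c' • (l * a)) : a * (k * l) = (c * c') • ((k * l) * a) := by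
  rw [← mul_assoc, h, smul_mul_assoc, mul_assoc, h', mul_smul_comm, smul_smul, mul_assoc]

theorem qcomm_pow_left {a k : R} {c : F} (h : a * k = c • (k * a)) (n : ℕ) :
    a ^ n * k = c ^ n • (k * a ^ n) := by
  induction n with
  | zero => simp
  | succ n ih => rw [pow_succ, pow_succ, qcomm_mul_left ih h]

theorem qcomm_pow_right {a k : R} {c : F} (h : a * k = c • (k * a)) (n : ℕ) :
    a * k ^ n = c ^ n • (k ^ n * a) := by
  induction n with
  | zero => simp
  | succ n ih => rw [pow_succ, pow_succ, qcomm_mul_right ih h]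

theorem qcomm_symm {a k : R} {c : F} (hc : c ≠ 0) (h : a * k = c • (k * a)) :
    k * a = c⁻¹ • (a * k) := by
  rw [h, smul_smul, inv_mul_cancel₀ hc, one_smul]

/-- Gauss binomial coefficients. -/
def gaussBinom (z : F) : ℕ → ℕ → F
  | _, 0 => 1
  | 0, _ + 1 => 0
  | n + 1, k + 1 => gaussBinom z n k + z ^ (k + 1) * gaussBinom z n (k + 1)

theorem gaussBinom_eq_zero (z : F) {n k : ℕ} (h : n < k) : gaussBinom z n k = 0 := by
  induction n generalizing k with
  | zero => obtain ⟨k, rfl⟩ := Nat.exists_eq_succ_of_ne_zero h.ne'; rfl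
  | succ n ih =>
    obtain ⟨k, rfl⟩ := Nat.exists_eq_succ_of_ne_zero (Nat.zero_lt_of_lt h).ne'
    rw [Nat.succ_eq_add_one] at *
    rw [gaussBinom, ih (by omega), ih (by omega), mul_zero, add_zero]

theorem gaussBinom_self (z : F) (n : ℕ) : gaussBinom z n n = 1 := by
  induction n with
  | zero => rfl
  | succ n ih => rw [gaussBinom, ih, gaussBinom_eq_zero z n.lt_succ_self, mul_zero, add_zero]

theorem gaussBinom_succ_mul (z : F) (n k : ℕ) :
    (z ^ (k + 1) - 1) * gaussBinom z (n + 1) (k + 1) = (z ^ (n + 1) - 1) * gaussBinom z n k := by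
  induction n generalizing k with
  | zero =>
    rw [gaussBinom]
    cases k with
    | zero => simp [gaussBinom]
    | succ k => simp [gaussBinom]
  | succ n ih =>
    rw [gaussBinom]
    cases k with
    | zero =>
      have h0 := ih 0
      have e1 : gaussBinom z (n + 1) 0 = 1 := by cases n <;> rfl
      have e2 : gaussBinom z n 0 = 1 := by cases n <;> rfl
      rw [e2] at h0
      rw [e1]
      linear_combination z * h0
    | succ k =>
      have h0 := ih (k + 1)
      have h1 := ih k
      have h2 : gaussBinom z (n + 1) (k + 1) =
        gaussBinom z n k + z ^ (k + 1) * gaussBinom z n (k + 1) := rfl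
      linear_combination z ^ (k + 2) * h0 + z * h1 - z * (z ^ (n + 1) - 1) * h2

theorem gaussBinom_eq_zero_of_isPrimitiveRoot {z : F} {d k : ℕ} (hz : IsPrimitiveRoot z d)
    (hk : 0 < k) (hkd : k < d) : gaussBinom z d k = 0 := by
  obtain ⟨d, rfl⟩ := Nat.exists_eq_succ_of_ne_zero (hk.trans hkd).ne'
  obtain ⟨k, rfl⟩ := Nat.exists_eq_succ_of_ne_zero hk.ne'
  have h := gaussBinom_succ_mul z d k
  rw [hz.pow_eq_one, sub_self, zero_mul] at h
  exact (mul_eq_zero.mp h).resolve_left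
    (sub_ne_zero.mpr (hz.pow_ne_one_of_pos_of_lt hk.ne' hkd))

theorem add_pow_of_qcomm {z : F} {a b : R} (h : b * a = z • (a * b)) (n : ℕ) :
    (a + b) ^ n = ∑ k ∈ Finset.range (n + 1), gaussBinom z n k • (a ^ k * b ^ (n - k)) := by
  induction n with
  | zero => simp [gaussBinom]
  | succ n ih =>
    rw [pow_succ', ih, add_mul, Finset.mul_sum, Finset.mul_sum]
    have e1 : ∀ k, a * gaussBinom z n k • (a ^ k * b ^ (n - k)) =
        gaussBinom z n k • (a ^ (k + 1) * b ^ (n + 1 - (k + 1))) := fun k => by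
      rw [mul_smul_comm, ← mul_assoc, ← pow_succ', Nat.add_sub_add_right]
    have e2 : ∀ k ∈ Finset.range (n + 1), b * gaussBinom z n k • (a ^ k * b ^ (n - k)) =
        (z ^ k * gaussBinom z n k) • (a ^ k * b ^ (n + 1 - k)) := fun k hk => by
      rw [mul_smul_comm, ← mul_assoc, qcomm_pow_right h, smul_mul_assoc, mul_assoc, ← pow_succ',
        smul_smul, mul_comm, Nat.sub_add_comm (Nat.lt_succ_iff.mp (Finset.mem_range.mp hk))]
    have e3 : ∀ k, gaussBinom z (n + 1) (k + 1) • (a ^ (k + 1) * b ^ (n + 1 - (k + 1))) =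
        gaussBinom z n k • (a ^ (k + 1) * b ^ (n + 1 - (k + 1))) +
        (z ^ (k + 1) * gaussBinom z n (k + 1)) • (a ^ (k + 1) * b ^ (n + 1 - (k + 1))) :=
      fun k => by rw [gaussBinom, add_smul]
    have e4 : gaussBinom z (n + 1) 0 • (a ^ 0 * b ^ (n + 1 - 0)) =
        (z ^ 0 * gaussBinom z n 0) • (a ^ 0 * b ^ (n + 1 - 0)) := by
      cases n <;> simp [gaussBinom]
    rw [Finset.sum_congr rfl fun k _ => e1 k, Finset.sum_congr rfl e2, Finset.sum_range_succ' _ (n + 1),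
      Finset.sum_congr rfl fun k _ => e3 k, Finset.sum_add_distrib, add_assoc, e4,
      ← Finset.sum_range_succ' (fun k => (z ^ k * gaussBinom z n k) • (a ^ k * b ^ (n + 1 - k))),
      Finset.sum_range_succ _ (n + 1),
      gaussBinom_eq_zero z n.lt_succ_self, mul_zero, zero_smul, add_zero]

theorem add_pow_of_qcomm_of_isPrimitiveRoot {z : F} {d : ℕ} (hz : IsPrimitiveRoot z d) (hd : 0 < d)
    {a b : R} (h : b * a = z • (a * b)) : (a + b) ^ d = a ^ d + b ^ d := by
  rw [add_pow_of_qcomm h, Finset.sum_range_succ, gaussBinom_self, Nat.sub_self, pow_zero, mul_one,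
    one_smul, Finset.sum_eq_single 0]
  · obtain ⟨d, rfl⟩ := Nat.exists_eq_succ_of_ne_zero hd.ne'
    simp [gaussBinom, add_comm]
  · intro k hk hk0
    rw [gaussBinom_eq_zero_of_isPrimitiveRoot hz (Nat.pos_of_ne_zero hk0) (Finset.mem_range.mp hk),
      zero_smul]
  · simp [hd.ne']

end QCommutation

section RootsOfUnity

variable {F : Type*} [Field F] {q : F} {d : ℕ}

theorem IsPrimitiveRoot.zpow_neg_two (hq : IsPrimitiveRoot q d) (hd : Odd d) :
    IsPrimitiveRoot (q ^ (-2 : ℤ)) d := by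
  rw [zpow_neg, IsPrimitiveRoot.inv_iff]
  exact_mod_cast hq.pow_of_coprime 2 (Nat.coprime_two_left.mpr hd)

theorem IsPrimitiveRoot.sq_ne_one (hq : IsPrimitiveRoot q d) (hd : Odd d) (hd1 : 1 < d) :
    q ^ 2 ≠ 1 := fun h => by
  have := hq.dvd_of_pow_eq_one 2 h
  have := Nat.Coprime.eq_one_of_dvd (Nat.coprime_two_right.mpr hd) this
  omega

theorem IsPrimitiveRoot.sq_ne_neg_one (hq : IsPrimitiveRoot q d) (hd : Odd d) (hd1 : 1 < d) :
    q ^ 2 ≠ -1 := fun h => by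
  have h4 : q ^ 4 = 1 := by rw [show 4 = 2 * 2 from rfl, pow_mul, h]; ring
  have := hq.dvd_of_pow_eq_one 4 h4
  have := Nat.Coprime.eq_one_of_dvd (Nat.Coprime.pow_right 2 (Nat.coprime_two_right.mpr hd)) this
  omega

/-- The standing conditions on the parameter `q`. -/
structure IsOddRoot (q : F) (d : ℕ) : Prop where
  root : IsPrimitiveRoot q d
  odd : Odd d
  one_lt : 1 < d

namespace IsOddRoot

variable (h : IsOddRoot q d)
include h

theorem pos : 0 < d := Nat.zero_lt_of_lt h.one_lt

theorem ne_zero : q ≠ 0 := h.root.ne_zero h.pos.ne'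

theorem sub_inv_ne : q - q⁻¹ ≠ 0 := fun h0 => h.root.sq_ne_one h.odd h.one_lt <| by
  have := congrArg (· * q) h0
  simp only [sub_mul, inv_mul_cancel₀ h.ne_zero, zero_mul] at this
  linear_combination this

theorem add_inv_ne : q + q⁻¹ ≠ 0 := fun h0 => h.root.sq_ne_neg_one h.odd h.one_lt <| by
  have := congrArg (· * q) h0
  simp only [add_mul, inv_mul_cancel₀ h.ne_zero, zero_mul] at this
  linear_combination this

end IsOddRoot

end RootsOfUnity

section Borel

variable {F : Type*} [Field F] {R : Type*} [Ring R] [Algebra F R] {S : Type*} [Ring S] [Algebra F S]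

/-- The quantum Serre element. -/
def serreElt (q : F) (a b : R) : R := a ^ 2 * b - (q + q⁻¹) • (a * b * a) + b * a ^ 2

/-- The defining relations of the Borel part of `Ū_q`. -/
structure BorelRel (q : F) (d : ℕ) (k1 k2 e1 e2 : R) : Prop where
  k1_pow : k1 ^ d = 1
  k2_pow : k2 ^ d = 1
  k2k1 : k2 * k1 = k1 * k2
  e1k1 : e1 * k1 = q ^ (-2 : ℤ) • (k1 * e1)
  e2k1 : e2 * k1 = q • (k1 * e2)
  e1k2 : e1 * k2 = q • (k2 * e1)
  e2k2 : e2 * k2 = k2 * e2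
  e2e2 : e2 * e2 = 0
  serre : serreElt q e1 e2 = 0
  e1_pow : e1 ^ d = 0

theorem serreElt_map (φ : R →ₐ[F] S) (q : F) (a b : R) :
    φ (serreElt q a b) = serreElt q (φ a) (φ b) := by
  simp [serreElt]

theorem serreElt_add {q : F} (hq : q ≠ 0) {a1 a2 b1 b2 : R} (h11 : a1 * b1 = q ^ (-2 : ℤ) • (b1 * a1))
    (h12 : a1 * b2 = q • (b2 * a1)) (h21 : a2 * b1 = q • (b1 * a2)) :
    serreElt q (a1 + b1) (a2 + b2) = serreElt q a1 a2 + serreElt q b1 b2 := by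
  simp only [serreElt, pow_two, mul_add, add_mul, mul_assoc, h11, h12, h21, qcomm_assoc h11,
    qcomm_assoc h12, qcomm_assoc h21, smul_mul_assoc, mul_smul_comm, smul_smul]
  match_scalars <;> field_simp <;> ring

namespace BorelRel

variable {q : F} {d : ℕ} {k1 k2 e1 e2 : R}

theorem map (h : BorelRel q d k1 k2 e1 e2) (φ : R →ₐ[F] S) :
    BorelRel q d (φ k1) (φ k2) (φ e1) (φ e2) where
  k1_pow := by rw [← map_pow, h.k1_pow, map_one]
  k2_pow := by rw [← map_pow, h.k2_pow, map_one]
  k2k1 := by rw [← map_mul, h.k2k1, map_mul]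
  e1k1 := by rw [← map_mul, h.e1k1, map_smul, map_mul]
  e2k1 := by rw [← map_mul, h.e2k1, map_smul, map_mul]
  e1k2 := by rw [← map_mul, h.e1k2, map_smul, map_mul]
  e2k2 := by rw [← map_mul, h.e2k2, map_mul]
  e2e2 := by rw [← map_mul, h.e2e2, map_zero]
  serre := by rw [← serreElt_map, h.serre, map_zero]
  e1_pow := by rw [← map_pow, h.e1_pow, map_zero]

theorem sum (hq : IsOddRoot q d) {a1 a2 b1 b2 : R} (ha : BorelRel q d k1 k2 a1 a2)
    (hb : BorelRel q d k1 k2 b1 b2) (h11 : a1 * b1 = q ^ (-2 : ℤ) • (b1 * a1))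
    (h12 : a1 * b2 = q • (b2 * a1)) (h21 : a2 * b1 = q • (b1 * a2)) (h22 : a2 * b2 = -(b2 * a2)) :
    BorelRel q d k1 k2 (a1 + b1) (a2 + b2) where
  k1_pow := ha.k1_pow
  k2_pow := ha.k2_pow
  k2k1 := ha.k2k1
  e1k1 := by rw [add_mul, mul_add, smul_add, ha.e1k1, hb.e1k1]
  e2k1 := by rw [add_mul, mul_add, smul_add, ha.e2k1, hb.e2k1]
  e1k2 := by rw [add_mul, mul_add, smul_add, ha.e1k2, hb.e1k2]
  e2k2 := by rw [add_mul, mul_add, ha.e2k2, hb.e2k2]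
  e2e2 := by
    rw [add_mul, mul_add, mul_add, ha.e2e2, hb.e2e2, h22]
    abel
  serre := by rw [serreElt_add hq.ne_zero h11 h12 h21, ha.serre, hb.serre, add_zero]
  e1_pow := by
    rw [add_comm, add_pow_of_qcomm_of_isPrimitiveRoot (hq.root.zpow_neg_two hq.odd) hq.pos h11,
      ha.e1_pow, hb.e1_pow, add_zero]

theorem e2_mul_e1 (hq : q ≠ 0) (e1 e2 : R) :
    e2 * e1 = q • (e1 * e2) + (-q) • (e1 * e2 - q⁻¹ • (e2 * e1)) := by
  rw [smul_sub, smul_smul, neg_mul, mul_inv_cancel₀ hq]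
  module

theorem e3_mul_e1 (h : BorelRel q d k1 k2 e1 e2) (hq : q ≠ 0) :
    (e1 * e2 - q⁻¹ • (e2 * e1)) * e1 = q⁻¹ • (e1 * (e1 * e2 - q⁻¹ • (e2 * e1))) := by
  have := h.serre
  have key : q⁻¹ • (e1 * (e1 * e2 - q⁻¹ • (e2 * e1))) - (e1 * e2 - q⁻¹ • (e2 * e1)) * e1 =
      q⁻¹ • serreElt q e1 e2 := by
    simp only [serreElt, pow_two, mul_sub, sub_mul, smul_mul_assoc, mul_smul_comm, mul_assoc]
    match_scalars <;> field_simp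
    ring
  rw [this, smul_zero, sub_eq_zero] at key
  exact key.symm

theorem e2_mul_e3 (h : BorelRel q d k1 k2 e1 e2) (hq : q ≠ 0) :
    e2 * (e1 * e2 - q⁻¹ • (e2 * e1)) = (-q) • ((e1 * e2 - q⁻¹ • (e2 * e1)) * e2) := by
  simp only [mul_sub, sub_mul, mul_smul_comm, smul_mul_assoc, mul_assoc, h.e2e2, mul_zero]
  rw [← mul_assoc e2 e2 e1, h.e2e2, zero_mul]
  match_scalars
  field_simp

theorem e3_mul_e3 (h : BorelRel q d k1 k2 e1 e2) (hq : IsOddRoot q d) :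
    (e1 * e2 - q⁻¹ • (e2 * e1)) * (e1 * e2 - q⁻¹ • (e2 * e1)) = 0 := by
  have s1 : e2 * serreElt q e1 e2 = 0 := by rw [h.serre, mul_zero]
  have s2 : serreElt q e1 e2 * e2 = 0 := by rw [h.serre, zero_mul]
  have z : ∀ x, e2 * (e2 * x) = 0 := fun x => by rw [← mul_assoc, h.e2e2, zero_mul]
  simp only [serreElt, pow_two, mul_add, add_mul, mul_sub, sub_mul, mul_smul_comm, smul_mul_assoc,
    mul_assoc, h.e2e2, z, mul_zero, add_zero, zero_sub] at s1 s2
  have t1 : e2 * (e1 * (e1 * e2)) = (q + q⁻¹) • (e2 * (e1 * (e2 * e1))) := by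
    rw [← sub_eq_zero, s1]
  have t2 : e1 * (e2 * (e1 * e2)) = e2 * (e1 * (e2 * e1)) := by
    have h0 := hq.add_inv_ne
    have : (q + q⁻¹) • (e1 * (e2 * (e1 * e2))) = (q + q⁻¹) • (e2 * (e1 * (e2 * e1))) := by
      rw [← t1, eq_comm, ← sub_eq_zero, ← s2]
      abel
    exact smul_right_injective R h0 this
  simp only [mul_sub, sub_mul, mul_smul_comm, smul_mul_assoc, mul_assoc, z, mul_zero, t1, t2]
  have := hq.ne_zero
  match_scalars
  field_simp
  ring

end BorelRel

end Borel

section Generation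

variable {F : Type*} [Field F] {R : Type*} [Ring R] [Algebra F R] {s : Set R}

theorem induction_of_adjoin_left (hs : Algebra.adjoin F s = ⊤) {P : R → Prop}
    (add : ∀ x y, P x → P y → P (x + y)) (smul : ∀ (c : F) x, P x → P (c • x)) (one : P 1)
    (mul : ∀ g ∈ s, ∀ x, P x → P (g * x)) (x : R) : P x := by
  have key : ∀ a ∈ Algebra.adjoin F s, ∀ x, P x → P (a * x) := by
    intro a ha
    induction ha using Algebra.adjoin_induction with
    | mem a ha => exact mul a ha
    | algebraMap c => intro x hx; rw [← Algebra.smul_def]; exact smul c x hx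
    | add a b _ _ iha ihb => intro x hx; rw [add_mul]; exact add _ _ (iha x hx) (ihb x hx)
    | mul a b _ _ iha ihb => intro x hx; rw [mul_assoc]; exact iha _ (ihb x hx)
  simpa using key x (hs ▸ Algebra.mem_top) 1 one

theorem induction_of_adjoin_right (hs : Algebra.adjoin F s = ⊤) {P : R → Prop}
    (add : ∀ x y, P x → P y → P (x + y)) (smul : ∀ (c : F) x, P x → P (c • x)) (one : P 1)
    (mul : ∀ g ∈ s, ∀ x, P x → P (x * g)) (x : R) : P x := by
  have key : ∀ a ∈ Algebra.adjoin F s, ∀ x, P x → P (x * a) := by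
    intro a ha
    induction ha using Algebra.adjoin_induction with
    | mem a ha => exact mul a ha
    | algebraMap c => intro x hx; rw [← Algebra.commutes, ← Algebra.smul_def]; exact smul c x hx
    | add a b _ _ iha ihb => intro x hx; rw [mul_add]; exact add _ _ (iha x hx) (ihb x hx)
    | mul a b _ _ iha ihb => intro x hx; rw [← mul_assoc]; exact ihb _ (iha x hx)
  simpa using key x (hs ▸ Algebra.mem_top) 1 one

end Generation

section Span

variable {F : Type*} [Field F] {R : Type*} [Ring R] [Algebra F R]

/-- Straightening relations for the ordered monomials `k₁^i k₂^j e₁^r e₃^h e₂^t`. -/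
structure Straightening (F : Type*) [Field F] {R : Type*} [Ring R] [Algebra F R] (d : ℕ)
    (k1 k2 e1 e3 e2 : R) : Prop where
  k1_pow : k1 ^ d = 1
  k2_pow : k2 ^ d = 1
  k2k1 : k2 * k1 = k1 * k2
  e1k1 : ∃ c : F, c ≠ 0 ∧ e1 * k1 = c • (k1 * e1)
  e2k1 : ∃ c : F, c ≠ 0 ∧ e2 * k1 = c • (k1 * e2)
  e3k1 : ∃ c : F, c ≠ 0 ∧ e3 * k1 = c • (k1 * e3)
  e1k2 : ∃ c : F, c ≠ 0 ∧ e1 * k2 = c • (k2 * e1)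
  e2k2 : ∃ c : F, c ≠ 0 ∧ e2 * k2 = c • (k2 * e2)
  e3k2 : ∃ c : F, c ≠ 0 ∧ e3 * k2 = c • (k2 * e3)
  e1_pow : e1 ^ d = 0
  e2e2 : e2 * e2 = 0
  e3e3 : e3 * e3 = 0
  e2e1 : ∃ a b : F, e2 * e1 = a • (e1 * e2) + b • e3
  e3e1 : ∃ c : F, e3 * e1 = c • (e1 * e3)
  e2e3 : ∃ c : F, e2 * e3 = c • (e3 * e2)

namespace Straightening

variable {d : ℕ} {k1 k2 e1 e3 e2 : R}

theorem nilp_comm (h : Straightening F d k1 k2 e1 e3 e2) (r s t i j : ℕ) : ∃ c : F, c ≠ 0 ∧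
    (e1 ^ r * e3 ^ s * e2 ^ t) * (k1 ^ i * k2 ^ j) =
      c • ((k1 ^ i * k2 ^ j) * (e1 ^ r * e3 ^ s * e2 ^ t)) := by
  obtain ⟨c1, h1, H1⟩ := h.e1k1
  obtain ⟨c2, h2, H2⟩ := h.e2k1
  obtain ⟨c3, h3, H3⟩ := h.e3k1
  obtain ⟨d1, h1', H1'⟩ := h.e1k2
  obtain ⟨d2, h2', H2'⟩ := h.e2k2
  obtain ⟨d3, h3', H3'⟩ := h.e3k2
  refine ⟨_, ?_, qcomm_mul_right (qcomm_pow_right (qcomm_mul_left (qcomm_mul_left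
    (qcomm_pow_left H1 r) (qcomm_pow_left H3 s)) (qcomm_pow_left H2 t)) i)
    (qcomm_pow_right (qcomm_mul_left (qcomm_mul_left
    (qcomm_pow_left H1' r) (qcomm_pow_left H3' s)) (qcomm_pow_left H2' t)) j)⟩
  simp [h1, h2, h3, h1', h2', h3']

theorem span_torus_first (h : Straightening F d k1 k2 e1 e3 e2) (hd : 0 < d)
    (hgen : Algebra.adjoin F {k1, k2, e1, e2} = ⊤) :
    Submodule.span F (Set.range fun x : BIdx d => k1 ^ (x.i : ℕ) * k2 ^ (x.j : ℕ) *
      e1 ^ (x.r : ℕ) * e3 ^ (x.h : ℕ) * e2 ^ (x.t : ℕ)) = ⊤ := by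
  set S := Submodule.span F (Set.range fun x : BIdx d => k1 ^ (x.i : ℕ) * k2 ^ (x.j : ℕ) *
      e1 ^ (x.r : ℕ) * e3 ^ (x.h : ℕ) * e2 ^ (x.t : ℕ)) with hS
  have mem : ∀ i j r s t : ℕ, k1 ^ i * k2 ^ j * e1 ^ r * e3 ^ s * e2 ^ t ∈ S := by
    intro i j r s t
    by_cases hr : r < d
    swap
    · rw [← Nat.add_sub_of_le (not_lt.mp hr), pow_add, h.e1_pow]; simp
    by_cases hs : s < 2
    swap
    · rw [← Nat.add_sub_of_le (not_lt.mp hs), pow_add, pow_two, h.e3e3]; simp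
    by_cases ht : t < 2
    swap
    · rw [← Nat.add_sub_of_le (not_lt.mp ht), pow_add, pow_two, h.e2e2]; simp
    have e (k : R) (hk : k ^ d = 1) (i : ℕ) : k ^ i = k ^ (i % d) := by
      conv_lhs => rw [← Nat.div_add_mod i d, pow_add, pow_mul, hk, one_pow, one_mul]
    rw [e k1 h.k1_pow i, e k2 h.k2_pow j]
    exact Submodule.subset_span
      ⟨⟨⟨i % d, Nat.mod_lt _ hd⟩, ⟨j % d, Nat.mod_lt _ hd⟩, ⟨r, hr⟩, ⟨s, hs⟩, ⟨t, ht⟩⟩, rfl⟩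
  have closed : ∀ g : R, (∀ i j r s t : ℕ, s < 2 → t < 2 →
      k1 ^ i * k2 ^ j * e1 ^ r * e3 ^ s * e2 ^ t * g ∈ S) → ∀ x ∈ S, x * g ∈ S := by
    intro g hg x hx
    induction hx using Submodule.span_induction with
    | mem x hx => obtain ⟨y, rfl⟩ := hx; exact hg _ _ _ _ _ y.h.isLt y.t.isLt
    | zero => simp
    | add x y _ _ hx hy => rw [add_mul]; exact S.add_mem hx hy
    | smul c x _ hx => rw [smul_mul_assoc]; exact S.smul_mem c hx
  rw [eq_top_iff]
  rintro x -
  refine induction_of_adjoin_right hgen (P := (· ∈ S)) (fun _ _ => S.add_mem)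
    (fun c _ => S.smul_mem c) (by simpa using mem 0 0 0 0 0) ?_ x
  simp only [Set.mem_insert_iff, Set.mem_singleton_iff]
  rintro g (rfl | rfl | rfl | rfl)
  · refine closed _ fun i j r s t _ _ => ?_
    obtain ⟨c, -, hc⟩ := h.nilp_comm r s t 1 0
    have := S.smul_mem c (mem (i + 1) j r s t)
    convert this using 1
    simp only [pow_one, pow_zero, mul_one] at hc
    have hcomm : k2 ^ j * g = g * k2 ^ j := ((show Commute k2 g from h.k2k1).pow_left j).eq
    calc _ = g ^ i * k2 ^ j * (e1 ^ r * e3 ^ s * e2 ^ t * g) := by simp only [mul_assoc]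
      _ = c • (g ^ i * (k2 ^ j * g) * (e1 ^ r * e3 ^ s * e2 ^ t)) := by
        rw [hc, mul_smul_comm]; simp only [mul_assoc]
      _ = _ := by rw [hcomm, pow_succ]; simp only [mul_assoc]
  · refine closed _ fun i j r s t _ _ => ?_
    obtain ⟨c, -, hc⟩ := h.nilp_comm r s t 0 1
    have := S.smul_mem c (mem i (j + 1) r s t)
    convert this using 1
    simp only [pow_one, pow_zero, one_mul] at hc
    calc _ = k1 ^ i * g ^ j * (e1 ^ r * e3 ^ s * e2 ^ t * g) := by simp only [mul_assoc]
      _ = _ := by rw [hc, mul_smul_comm, pow_succ]; simp only [mul_assoc]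
  · refine closed _ fun i j r s t _ ht => ?_
    obtain ⟨c, hc⟩ := h.e3e1
    have hc' := qcomm_pow_left hc s
    have h0 : k1 ^ i * k2 ^ j * g ^ r * e3 ^ s * g ∈ S := by
      have := S.smul_mem (c ^ s) (mem i j (r + 1) s 0)
      convert this using 1
      rw [mul_assoc, hc', mul_smul_comm, pow_zero, mul_one, pow_succ]
      simp only [mul_assoc]
    rcases (by omega : t = 0 ∨ t = 1) with rfl | rfl
    · simpa using h0
    · obtain ⟨a, b, hab⟩ := h.e2e1
      have := S.add_mem (S.smul_mem (a * c ^ s) (mem i j (r + 1) s 1))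
        (S.smul_mem b (mem i j r (s + 1) 0))
      convert this using 1
      rw [pow_one, pow_zero, mul_one, mul_assoc, hab, mul_add, mul_smul_comm, mul_smul_comm,
        ← mul_assoc, mul_assoc _ (e3 ^ s) g, hc', mul_smul_comm, smul_mul_assoc, smul_smul,
        pow_succ e3, pow_succ g]
      simp only [mul_assoc]
  · refine closed _ fun i j r s t _ ht => ?_
    rw [mul_assoc, ← pow_succ]
    exact mem i j r s (t + 1)

theorem span_torus_last (h : Straightening F d k1 k2 e1 e3 e2) (hd : 0 < d)
    (hgen : Algebra.adjoin F {k1, k2, e1, e2} = ⊤) :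
    Submodule.span F (Set.range fun x : BIdx d => e1 ^ (x.r : ℕ) * e3 ^ (x.h : ℕ) *
      e2 ^ (x.t : ℕ) * k1 ^ (x.i : ℕ) * k2 ^ (x.j : ℕ)) = ⊤ := by
  rw [eq_top_iff, ← h.span_torus_first hd hgen, Submodule.span_le]
  rintro _ ⟨x, rfl⟩
  obtain ⟨c, hc, hc'⟩ := h.nilp_comm x.r x.h x.t x.i x.j
  have := Submodule.smul_mem _ c⁻¹ (Submodule.subset_span (R := F) (Set.mem_range_self
    (f := fun x : BIdx d => e1 ^ (x.r : ℕ) * e3 ^ (x.h : ℕ) *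
      e2 ^ (x.t : ℕ) * k1 ^ (x.i : ℕ) * k2 ^ (x.j : ℕ)) x))
  have e : k1 ^ (x.i : ℕ) * k2 ^ (x.j : ℕ) * e1 ^ (x.r : ℕ) * e3 ^ (x.h : ℕ) * e2 ^ (x.t : ℕ) =
      c⁻¹ • (e1 ^ (x.r : ℕ) * e3 ^ (x.h : ℕ) * e2 ^ (x.t : ℕ) * k1 ^ (x.i : ℕ) * k2 ^ (x.j : ℕ)) := by
    simp only [mul_assoc] at hc' ⊢
    rw [hc', smul_smul, inv_mul_cancel₀ hc, one_smul]
  rw [SetLike.mem_coe]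
  dsimp only
  rw [e]
  exact this

end Straightening

theorem BorelRel.straightening {q : F} {d : ℕ} (hq : IsOddRoot q d) {k1 k2 e1 e2 : R}
    (h : BorelRel q d k1 k2 e1 e2) :
    Straightening F d k1 k2 e1 (e1 * e2 - q⁻¹ • (e2 * e1)) e2 where
  k1_pow := h.k1_pow
  k2_pow := h.k2_pow
  k2k1 := h.k2k1
  e1k1 := ⟨_, zpow_ne_zero _ hq.ne_zero, h.e1k1⟩
  e2k1 := ⟨_, hq.ne_zero, h.e2k1⟩
  e3k1 := ⟨_, mul_ne_zero (zpow_ne_zero (-2) hq.ne_zero) hq.ne_zero, by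
    rw [sub_mul, smul_mul_assoc, qcomm_mul_left h.e1k1 h.e2k1, qcomm_mul_left h.e2k1 h.e1k1,
      mul_comm q, mul_sub, smul_sub, mul_smul_comm, smul_comm q⁻¹]⟩
  e1k2 := ⟨_, hq.ne_zero, h.e1k2⟩
  e2k2 := ⟨1, one_ne_zero, by rw [h.e2k2, one_smul]⟩
  e3k2 := ⟨_, mul_ne_zero hq.ne_zero one_ne_zero, by
    have h22 : e2 * k2 = (1 : F) • (k2 * e2) := by rw [h.e2k2, one_smul]
    rw [sub_mul, smul_mul_assoc, qcomm_mul_left h.e1k2 h22, qcomm_mul_left h22 h.e1k2,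
      mul_comm 1 q, mul_sub, smul_sub, mul_smul_comm, smul_comm q⁻¹]⟩
  e1_pow := h.e1_pow
  e2e2 := h.e2e2
  e3e3 := h.e3_mul_e3 hq
  e2e1 := ⟨_, _, BorelRel.e2_mul_e1 hq.ne_zero e1 e2⟩
  e3e1 := ⟨_, h.e3_mul_e1 hq.ne_zero⟩
  e2e3 := ⟨_, h.e2_mul_e3 hq.ne_zero⟩

end Span

/-- Generators of the Borel part. -/
inductive BorelGen
  | k1 | k2 | e1 | e2

section BorelAlg

variable (F : Type*) [Field F] (q : F) (d : ℕ)

open BorelGen FreeAlgebra in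
/-- Defining relations of the Borel part. -/
inductive BorelPres : FreeAlgebra F BorelGen → FreeAlgebra F BorelGen → Prop
  | k1_pow : BorelPres (ι F k1 ^ d) 1
  | k2_pow : BorelPres (ι F k2 ^ d) 1
  | k2k1 : BorelPres (ι F k2 * ι F k1) (ι F k1 * ι F k2)
  | e1k1 : BorelPres (ι F e1 * ι F k1) (q ^ (-2 : ℤ) • (ι F k1 * ι F e1))
  | e2k1 : BorelPres (ι F e2 * ι F k1) (q • (ι F k1 * ι F e2))
  | e1k2 : BorelPres (ι F e1 * ι F k2) (q • (ι F k2 * ι F e1))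
  | e2k2 : BorelPres (ι F e2 * ι F k2) (ι F k2 * ι F e2)
  | e2e2 : BorelPres (ι F e2 * ι F e2) 0
  | serre : BorelPres (serreElt q (ι F e1) (ι F e2)) 0
  | e1_pow : BorelPres (ι F e1 ^ d) 0

/-- The algebra with generators `k₁, k₂, e₁, e₂` and the relations `BorelRel`. -/
def BorelAlg : Type _ := RingQuot (BorelPres F q d)

instance : Ring (BorelAlg F q d) := inferInstanceAs (Ring (RingQuot (BorelPres F q d)))

instance : Algebra F (BorelAlg F q d) := inferInstanceAs (Algebra F (RingQuot (BorelPres F q d)))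

namespace BorelAlg

/-- The projection of the free algebra. -/
def proj : FreeAlgebra F BorelGen →ₐ[F] BorelAlg F q d := RingQuot.mkAlgHom F (BorelPres F q d)

/-- The generators. -/
def gen (g : BorelGen) : BorelAlg F q d := proj F q d (FreeAlgebra.ι F g)

theorem proj_surjective : Function.Surjective (proj F q d) :=
  RingQuot.mkAlgHom_surjective F (BorelPres F q d)

variable {F q d} in
theorem proj_rel {x y : FreeAlgebra F BorelGen} (h : BorelPres F q d x y) :
    proj F q d x = proj F q d y := RingQuot.mkAlgHom_rel F h

theorem borelRel : BorelRel q d (gen F q d .k1) (gen F q d .k2) (gen F q d .e1) (gen F q d .e2) where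
  k1_pow := by simpa [gen] using proj_rel (BorelPres.k1_pow (F := F) (q := q) (d := d))
  k2_pow := by simpa [gen] using proj_rel (BorelPres.k2_pow (F := F) (q := q) (d := d))
  k2k1 := by simpa [gen] using proj_rel (BorelPres.k2k1 (F := F) (q := q) (d := d))
  e1k1 := by
    simpa only [gen, map_mul, map_smul] using proj_rel (BorelPres.e1k1 (F := F) (q := q) (d := d))
  e2k1 := by simpa [gen] using proj_rel (BorelPres.e2k1 (F := F) (q := q) (d := d))
  e1k2 := by simpa [gen] using proj_rel (BorelPres.e1k2 (F := F) (q := q) (d := d))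
  e2k2 := by simpa [gen] using proj_rel (BorelPres.e2k2 (F := F) (q := q) (d := d))
  e2e2 := by simpa [gen] using proj_rel (BorelPres.e2e2 (F := F) (q := q) (d := d))
  serre := by
    simpa only [gen, serreElt_map, map_zero] using
      proj_rel (BorelPres.serre (F := F) (q := q) (d := d))
  e1_pow := by simpa [gen] using proj_rel (BorelPres.e1_pow (F := F) (q := q) (d := d))

theorem adjoin_gen : Algebra.adjoin F
    {gen F q d .k1, gen F q d .k2, gen F q d .e1, gen F q d .e2} = ⊤ := by
  have h : Algebra.adjoin F (Set.range (gen F q d)) = ⊤ := by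
    have := congrArg (Subalgebra.map (proj F q d)) (FreeAlgebra.adjoin_range_ι F BorelGen)
    rw [AlgHom.map_adjoin, Algebra.map_top, (AlgHom.range_eq_top _).mpr (proj_surjective F q d),
      ← Set.range_comp] at this
    exact this
  rw [eq_top_iff, ← h]
  refine Algebra.adjoin_mono ?_
  rintro _ ⟨g, rfl⟩
  cases g <;> simp

variable {F q d}
variable {R : Type*} [Ring R] [Algebra F R] {k1 k2 e1 e2 : R}

/-- The universal property. -/
def lift (h : BorelRel q d k1 k2 e1 e2) : BorelAlg F q d →ₐ[F] R :=
  RingQuot.liftAlgHom F ⟨FreeAlgebra.lift F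
    (fun g => match g with | .k1 => k1 | .k2 => k2 | .e1 => e1 | .e2 => e2), by
    intro x y r
    cases r <;> simp only [serreElt_map, map_mul, map_pow, map_smul, map_one, map_zero,
      FreeAlgebra.lift_ι_apply]
    exacts [h.k1_pow, h.k2_pow, h.k2k1, h.e1k1, h.e2k1, h.e1k2, h.e2k2, h.e2e2, h.serre, h.e1_pow]⟩

theorem lift_proj (h : BorelRel q d k1 k2 e1 e2) (x : FreeAlgebra F BorelGen) :
    lift h (proj F q d x) = FreeAlgebra.lift F
      (fun g => match g with | .k1 => k1 | .k2 => k2 | .e1 => e1 | .e2 => e2) x :=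
  RingQuot.liftAlgHom_mkAlgHom_apply _ _ _ _

@[simp] theorem lift_k1 (h : BorelRel q d k1 k2 e1 e2) : lift h (gen F q d .k1) = k1 := by
  rw [gen, lift_proj, FreeAlgebra.lift_ι_apply]

@[simp] theorem lift_k2 (h : BorelRel q d k1 k2 e1 e2) : lift h (gen F q d .k2) = k2 := by
  rw [gen, lift_proj, FreeAlgebra.lift_ι_apply]

@[simp] theorem lift_e1 (h : BorelRel q d k1 k2 e1 e2) : lift h (gen F q d .e1) = e1 := by
  rw [gen, lift_proj, FreeAlgebra.lift_ι_apply]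

@[simp] theorem lift_e2 (h : BorelRel q d k1 k2 e1 e2) : lift h (gen F q d .e2) = e2 := by
  rw [gen, lift_proj, FreeAlgebra.lift_ι_apply]

end BorelAlg

end BorelAlg

section UbarPresentation

open UqGen

/-- The relations of `Ū_q` for a family of elements of an algebra. -/
structure UbarSat {F : Type*} [Field F] {R : Type*} [Ring R] [Algebra F R] (q : F) (d : ℕ)
    (g : UqGen → R) : Prop where
  k1K1 : g k1 * g K1 = 1
  K1k1 : g K1 * g k1 = 1
  k2K2 : g k2 * g K2 = 1
  K2k2 : g K2 * g k2 = 1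
  pos : BorelRel q d (g k1) (g k2) (g e1) (g e2)
  neg : BorelRel q d (g K1) (g K2) (g f1) (g f2)
  e1f1 : g e1 * g f1 = g f1 * g e1 + (q - q⁻¹)⁻¹ • (g k1 - g K1)
  e2f2 : g e2 * g f2 = -(g f2 * g e2) + (q - q⁻¹)⁻¹ • (g k2 - g K2)
  e1f2 : g e1 * g f2 = g f2 * g e1
  e2f1 : g e2 * g f1 = g f1 * g e2

variable {F : Type*} [Field F] {q : F} {d : ℕ}

theorem qcomm_inv {R : Type*} [Ring R] [Algebra F R] {k K f : R} {c : F} (h1 : k * K = 1)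
    (h2 : K * k = 1) (h : k * f = c • (f * k)) : f * K = c • (K * f) := by
  calc f * K = K * (k * f) * K := by rw [← mul_assoc, h2, one_mul]
    _ = c • (K * f * (k * K)) := by
      rw [h, mul_smul_comm, smul_mul_assoc]; simp only [mul_assoc]
    _ = c • (K * f) := by rw [h1, mul_one]

theorem qcomm_inv' {R : Type*} [Ring R] [Algebra F R] {k K f : R} {c : F} (h1 : k * K = 1)
    (h2 : K * k = 1) (h : f * K = c • (K * f)) : k * f = c • (f * k) := by
  calc k * f = k * (f * K) * k := by rw [mul_assoc, mul_assoc, h2, mul_one]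
    _ = c • (k * K * (f * k)) := by
      rw [h, mul_smul_comm, smul_mul_assoc]; simp only [mul_assoc]
    _ = c • (f * k) := by rw [h1, one_mul]

theorem ubarProj_rel {x y : FreeAlgebra F UqGen} (h : UqRel F q x y) :
    ubarProj F q d (uqProj F q x) = ubarProj F q d (uqProj F q y) :=
  congrArg _ (RingQuot.mkAlgHom_rel F h)

theorem ubarProj_rel' {x y : Uq F q} (h : UbarRel F q d x y) :
    ubarProj F q d x = ubarProj F q d y := RingQuot.mkAlgHom_rel F h

theorem ubarSat : UbarSat q d (ubarGen F q d) := by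
  have k1K1 : ubarGen F q d k1 * ubarGen F q d K1 = 1 := by
    simpa [ubarGen, uqGen] using ubarProj_rel (UqRel.k1K1 (q := q)) (d := d)
  have K1k1 : ubarGen F q d K1 * ubarGen F q d k1 = 1 := by
    simpa [ubarGen, uqGen] using ubarProj_rel (UqRel.K1k1 (q := q)) (d := d)
  have k2K2 : ubarGen F q d k2 * ubarGen F q d K2 = 1 := by
    simpa [ubarGen, uqGen] using ubarProj_rel (UqRel.k2K2 (q := q)) (d := d)
  have K2k2 : ubarGen F q d K2 * ubarGen F q d k2 = 1 := by
    simpa [ubarGen, uqGen] using ubarProj_rel (UqRel.K2k2 (q := q)) (d := d)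
  have k2k1 : ubarGen F q d k2 * ubarGen F q d k1 = ubarGen F q d k1 * ubarGen F q d k2 := by
    simpa [ubarGen, uqGen] using ubarProj_rel (UqRel.k2k1 (q := q)) (d := d)
  have k1p : ubarGen F q d k1 ^ d = 1 := by
    rw [← sub_eq_zero]
    simpa only [ubarGen, map_pow, map_sub, map_one, map_zero] using
      ubarProj_rel' (UbarRel.k1 (q := q)) (d := d)
  have k2p : ubarGen F q d k2 ^ d = 1 := by
    rw [← sub_eq_zero]
    simpa only [ubarGen, map_pow, map_sub, map_one, map_zero] using
      ubarProj_rel' (UbarRel.k2 (q := q)) (d := d)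
  have inv_pow {k K : Ubar F q d} (h : k * K = 1) (h' : K * k = 1) (hk : k ^ d = 1) :
      K ^ d = 1 := by
    have := (show Commute K k from h'.trans h.symm).mul_pow d
    rwa [h', one_pow, hk, mul_one, eq_comm] at this
  refine ⟨k1K1, K1k1, k2K2, K2k2, ⟨k1p, k2p, k2k1, ?_, ?_, ?_, ?_, ?_, ?_, ?_⟩,
    ⟨inv_pow k1K1 K1k1 k1p, inv_pow k2K2 K2k2 k2p, ?_, ?_, ?_, ?_, ?_, ?_, ?_, ?_⟩, ?_, ?_, ?_, ?_⟩
  · simpa only [ubarGen, uqGen, map_mul, map_smul] using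
      ubarProj_rel (UqRel.e1k1 (q := q)) (d := d)
  · simpa [ubarGen, uqGen] using ubarProj_rel (UqRel.e2k1 (q := q)) (d := d)
  · simpa [ubarGen, uqGen] using ubarProj_rel (UqRel.e1k2 (q := q)) (d := d)
  · simpa [ubarGen, uqGen] using ubarProj_rel (UqRel.e2k2 (q := q)) (d := d)
  · simpa [ubarGen, uqGen, pow_two] using ubarProj_rel (UqRel.e2e2 (q := q)) (d := d)
  · simpa [ubarGen, uqGen, serreElt] using ubarProj_rel (UqRel.serre_e (q := q)) (d := d)
  · simpa [ubarGen] using ubarProj_rel' (UbarRel.e1 (q := q)) (d := d)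
  · have h : ubarGen F q d k1 * ubarGen F q d k2 = (1 : F) • (ubarGen F q d k2 * ubarGen F q d k1) := by
      rw [one_smul, k2k1]
    have h1 := qcomm_inv k1K1 K1k1 h
    rw [qcomm_inv k2K2 K2k2 h1, one_smul]
  · refine qcomm_inv k1K1 K1k1 ?_
    simpa only [ubarGen, uqGen, map_mul, map_smul] using
      ubarProj_rel (UqRel.k1f1 (q := q)) (d := d)
  · refine qcomm_inv k1K1 K1k1 ?_
    simpa [ubarGen, uqGen] using ubarProj_rel (UqRel.k1f2 (q := q)) (d := d)
  · refine qcomm_inv k2K2 K2k2 ?_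
    simpa [ubarGen, uqGen] using ubarProj_rel (UqRel.k2f1 (q := q)) (d := d)
  · have h : ubarGen F q d k2 * ubarGen F q d f2 = (1 : F) • (ubarGen F q d f2 * ubarGen F q d k2) := by
      simpa [ubarGen, uqGen] using ubarProj_rel (UqRel.k2f2 (q := q)) (d := d)
    rw [qcomm_inv k2K2 K2k2 h, one_smul]
  · simpa [ubarGen, uqGen, pow_two] using ubarProj_rel (UqRel.f2f2 (q := q)) (d := d)
  · simpa [ubarGen, uqGen, serreElt] using ubarProj_rel (UqRel.serre_f (q := q)) (d := d)
  · simpa [ubarGen] using ubarProj_rel' (UbarRel.f1 (q := q)) (d := d)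
  · simpa only [ubarGen, uqGen, map_mul, map_smul, map_add, map_sub] using
      ubarProj_rel (UqRel.e1f1 (q := q)) (d := d)
  · simpa only [ubarGen, uqGen, map_mul, map_smul, map_add, map_sub, map_neg] using
      ubarProj_rel (UqRel.e2f2 (q := q)) (d := d)
  · simpa [ubarGen, uqGen] using ubarProj_rel (UqRel.e1f2 (q := q)) (d := d)
  · simpa [ubarGen, uqGen] using ubarProj_rel (UqRel.e2f1 (q := q)) (d := d)

variable {R : Type*} [Ring R] [Algebra F R] {g : UqGen → R}

/-- The map out of `U_q` given by elements satisfying the relations of `Ū_q`. -/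
def uqLift (h : UbarSat q d g) : Uq F q →ₐ[F] R :=
  RingQuot.liftAlgHom F ⟨FreeAlgebra.lift F g, by
    intro x y r
    cases r <;> simp only [freeGen, map_mul, map_pow, map_smul, map_one, map_zero, map_add,
      map_sub, map_neg, FreeAlgebra.lift_ι_apply]
    · exact h.k1K1
    · exact h.K1k1
    · exact h.k2K2
    · exact h.K2k2
    · exact h.pos.k2k1
    · exact h.pos.e1k1
    · exact h.pos.e2k1
    · exact h.pos.e1k2
    · exact h.pos.e2k2
    · exact qcomm_inv' h.k1K1 h.K1k1 h.neg.e1k1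
    · exact qcomm_inv' h.k1K1 h.K1k1 h.neg.e2k1
    · exact qcomm_inv' h.k2K2 h.K2k2 h.neg.e1k2
    · have := qcomm_inv' h.k2K2 h.K2k2 (f := g f2) (c := (1 : F)) (by rw [one_smul, h.neg.e2k2])
      rwa [one_smul] at this
    · exact h.e1f1
    · exact h.e2f2
    · exact h.e1f2
    · exact h.e2f1
    · rw [pow_two]; exact h.pos.e2e2
    · rw [pow_two]; exact h.neg.e2e2
    · exact h.pos.serre
    · exact h.neg.serre⟩

theorem uqLift_gen (h : UbarSat q d g) (i : UqGen) : uqLift h (uqGen F q i) = g i := by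
  have : uqLift h (uqProj F q (freeGen F i)) = FreeAlgebra.lift F g (freeGen F i) :=
    RingQuot.liftAlgHom_mkAlgHom_apply _ _ _ _
  rw [uqGen, this, FreeAlgebra.lift_ι_apply]

/-- The universal property of `Ū_q`. -/
def ubarLift (h : UbarSat q d g) : Ubar F q d →ₐ[F] R :=
  RingQuot.liftAlgHom F ⟨uqLift h, by
    intro x y r
    cases r <;> simp only [map_pow, map_sub, map_one, map_zero, uqLift_gen]
    · exact h.neg.e1_pow
    · rw [h.pos.k1_pow, sub_self]
    · rw [h.pos.k2_pow, sub_self]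
    · exact h.pos.e1_pow⟩

@[simp] theorem ubarLift_gen (h : UbarSat q d g) (i : UqGen) :
    ubarLift h (ubarGen F q d i) = g i := by
  have : ubarLift h (ubarProj F q d (uqGen F q i)) = uqLift h (uqGen F q i) :=
    RingQuot.liftAlgHom_mkAlgHom_apply _ _ _ _
  rw [ubarGen, this, uqLift_gen]

theorem adjoin_ubarGen : Algebra.adjoin F (Set.range (ubarGen F q d)) = ⊤ := by
  have hs : Function.Surjective ((ubarProj F q d).comp (uqProj F q)) :=
    (RingQuot.mkAlgHom_surjective F (UbarRel F q d)).comp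
      (RingQuot.mkAlgHom_surjective F (UqRel F q))
  have := congrArg (Subalgebra.map ((ubarProj F q d).comp (uqProj F q)))
    (FreeAlgebra.adjoin_range_ι F UqGen)
  rw [AlgHom.map_adjoin, Algebra.map_top, (AlgHom.range_eq_top _).mpr hs, ← Set.range_comp] at this
  exact this

theorem ubar_induction {P : Ubar F q d → Prop} (add : ∀ x y, P x → P y → P (x + y))
    (smul : ∀ (c : F) x, P x → P (c • x)) (one : P 1)
    (mul : ∀ i x, P x → P (ubarGen F q d i * x)) (x : Ubar F q d) : P x :=
  induction_of_adjoin_left adjoin_ubarGen add smul one (by rintro _ ⟨i, rfl⟩; exact mul i) x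

end UbarPresentation

section BorelTwist

variable {F : Type*} [Field F] {R : Type*} [Ring R] [Algebra F R] {q : F} {d : ℕ}
  {k1 k2 e1 e2 l1 l2 : R}

theorem serreElt_smul (q a b : F) (x y : R) :
    serreElt q (a • x) (b • y) = (a ^ 2 * b) • serreElt q x y := by
  simp only [serreElt, pow_two, smul_mul_assoc, mul_smul_comm, smul_smul]
  match_scalars <;> ring

theorem serreElt_inv (q : F) (x y : R) : serreElt q⁻¹ x y = serreElt q x y := by
  rw [serreElt, serreElt, inv_inv, add_comm q⁻¹]

namespace BorelRel

theorem smul (h : BorelRel q d k1 k2 e1 e2) (a b : F) : BorelRel q d k1 k2 (a • e1) (b • e2) where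
  k1_pow := h.k1_pow
  k2_pow := h.k2_pow
  k2k1 := h.k2k1
  e1k1 := by rw [smul_mul_assoc, mul_smul_comm, h.e1k1, smul_comm]
  e2k1 := by rw [smul_mul_assoc, mul_smul_comm, h.e2k1, smul_comm]
  e1k2 := by rw [smul_mul_assoc, mul_smul_comm, h.e1k2, smul_comm]
  e2k2 := by rw [smul_mul_assoc, mul_smul_comm, h.e2k2]
  e2e2 := by rw [smul_mul_assoc, mul_smul_comm, h.e2e2, smul_zero, smul_zero]
  serre := by rw [serreElt_smul, h.serre, smul_zero]
  e1_pow := by rw [smul_pow, h.e1_pow, smul_zero]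

theorem twist_torus (h : BorelRel q d k1 k2 e1 e2) (hl : l2 * l1 = l1 * l2) (h1 : l1 ^ d = 1)
    (h2 : l2 ^ d = 1) (c1 : ∀ y ∈ ({k1, k2, e1, e2} : Set R), Commute l1 y)
    (c2 : ∀ y ∈ ({k1, k2, e1, e2} : Set R), Commute l2 y) :
    BorelRel q d (l1 * k1) (l2 * k2) e1 e2 where
  k1_pow := by rw [(c1 k1 (by simp)).mul_pow, h1, h.k1_pow, one_mul]
  k2_pow := by rw [(c2 k2 (by simp)).mul_pow, h2, h.k2_pow, one_mul]
  k2k1 := by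
    rw [mul_assoc, ← mul_assoc k2, ← (c1 k2 (by simp)).eq, mul_assoc, ← mul_assoc, hl, h.k2k1,
      mul_assoc, ← mul_assoc l2, (c2 k1 (by simp)).eq]
    simp only [mul_assoc]
  e1k1 := by
    rw [← mul_assoc, ← (c1 e1 (by simp)).eq, mul_assoc, h.e1k1, mul_smul_comm, mul_assoc]
  e2k1 := by
    rw [← mul_assoc, ← (c1 e2 (by simp)).eq, mul_assoc, h.e2k1, mul_smul_comm, mul_assoc]
  e1k2 := by
    rw [← mul_assoc, ← (c2 e1 (by simp)).eq, mul_assoc, h.e1k2, mul_smul_comm, mul_assoc]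
  e2k2 := by rw [← mul_assoc, ← (c2 e2 (by simp)).eq, mul_assoc, h.e2k2, mul_assoc]
  e2e2 := h.e2e2
  serre := h.serre
  e1_pow := h.e1_pow

theorem twist_nilp (h : BorelRel q d k1 k2 e1 e2) (hl : l2 * l1 = l1 * l2)
    (c1 : ∀ y ∈ ({k1, k2, e1, e2} : Set R), Commute l1 y)
    (c2 : ∀ y ∈ ({k1, k2, e1, e2} : Set R), Commute l2 y) :
    BorelRel q d k1 k2 (l1 * e1) (l2 * e2) where
  k1_pow := h.k1_pow
  k2_pow := h.k2_pow
  k2k1 := h.k2k1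
  e1k1 := by rw [mul_assoc, h.e1k1, mul_smul_comm, ← mul_assoc, (c1 k1 (by simp)).eq, mul_assoc]
  e2k1 := by rw [mul_assoc, h.e2k1, mul_smul_comm, ← mul_assoc, (c2 k1 (by simp)).eq, mul_assoc]
  e1k2 := by rw [mul_assoc, h.e1k2, mul_smul_comm, ← mul_assoc, (c1 k2 (by simp)).eq, mul_assoc]
  e2k2 := by rw [mul_assoc, h.e2k2, ← mul_assoc, (c2 k2 (by simp)).eq, mul_assoc]
  e2e2 := by
    rw [mul_assoc, ← mul_assoc e2, ← (c2 e2 (by simp)).eq, mul_assoc l2 e2 e2, h.e2e2, mul_zero,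
      mul_zero]
  serre := by
    have h1 : ∀ x, e1 * (l1 * x) = l1 * (e1 * x) := fun x => by
      rw [← mul_assoc, ← (c1 e1 (by simp)).eq, mul_assoc]
    have h2 : ∀ x, e1 * (l2 * x) = l2 * (e1 * x) := fun x => by
      rw [← mul_assoc, ← (c2 e1 (by simp)).eq, mul_assoc]
    have h3 : ∀ x, e2 * (l1 * x) = l1 * (e2 * x) := fun x => by
      rw [← mul_assoc, ← (c1 e2 (by simp)).eq, mul_assoc]
    have h4 : ∀ x, l2 * (l1 * x) = l1 * (l2 * x) := fun x => by
      rw [← mul_assoc, hl, mul_assoc]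
    have : serreElt q (l1 * e1) (l2 * e2) = l1 * (l1 * (l2 * serreElt q e1 e2)) := by
      simp only [serreElt, pow_two, mul_assoc, mul_add, mul_sub, mul_smul_comm, h1, h2, h3, h4]
    rw [this, h.serre, mul_zero, mul_zero, mul_zero]
  e1_pow := by rw [(c1 e1 (by simp)).mul_pow, h.e1_pow, mul_zero]

theorem mul_torus (hq : q ≠ 0) (h : BorelRel q d k1 k2 e1 e2) :
    BorelRel q d k1 k2 (k1 * e1) (k2 * e2) where
  k1_pow := h.k1_pow
  k2_pow := h.k2_pow
  k2k1 := h.k2k1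
  e1k1 := by rw [mul_assoc, h.e1k1, mul_smul_comm]
  e2k1 := by rw [mul_assoc, h.e2k1, mul_smul_comm, ← mul_assoc, h.k2k1, mul_assoc]
  e1k2 := by rw [mul_assoc, h.e1k2, mul_smul_comm, ← mul_assoc, ← h.k2k1, mul_assoc]
  e2k2 := by rw [mul_assoc, h.e2k2]
  e2e2 := by
    rw [mul_assoc, ← mul_assoc e2, h.e2k2, mul_assoc k2 e2 e2, h.e2e2, mul_zero, mul_zero]
  serre := by
    have h4 : ∀ x, k2 * (k1 * x) = k1 * (k2 * x) := fun x => by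
      rw [← mul_assoc, h.k2k1, mul_assoc]
    have : serreElt q (k1 * e1) (k2 * e2) = k1 * (k1 * (k2 * serreElt q e1 e2)) := by
      simp only [serreElt, pow_two, mul_assoc, mul_add, mul_sub, mul_smul_comm,
        qcomm_assoc h.e1k1, qcomm_assoc h.e1k2, qcomm_assoc h.e2k1, h4, smul_smul, smul_mul_assoc]
      match_scalars <;> field_simp
    rw [this, h.serre, mul_zero, mul_zero, mul_zero]
  e1_pow := by
    have : ∀ n, (k1 * e1) ^ n = (∏ i ∈ Finset.range n, (q ^ (-2 : ℤ)) ^ i) • (k1 ^ n * e1 ^ n) := by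
      intro n
      induction n with
      | zero => simp
      | succ n ih =>
        rw [pow_succ, ih, smul_mul_assoc, mul_assoc, ← mul_assoc (e1 ^ n), qcomm_pow_left h.e1k1,
          smul_mul_assoc, mul_smul_comm, smul_smul, Finset.prod_range_succ, pow_succ, pow_succ]
        simp only [mul_assoc]
    rw [this, h.e1_pow, mul_zero, smul_zero]

theorem qcomm_of_inv {k K e : R} {c : F} (hc : c ≠ 0) (h1 : k * K = 1) (h2 : K * k = 1)
    (h : e * k = c • (k * e)) : e * K = c⁻¹ • (K * e) := by
  calc e * K = c⁻¹ • (K * (c • (k * e)) * K) := by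
        rw [mul_smul_comm, smul_mul_assoc, smul_smul, inv_mul_cancel₀ hc, one_smul, ← mul_assoc,
          h2, one_mul]
    _ = c⁻¹ • (K * e) := by
      rw [← h, mul_assoc, mul_assoc e, h1, mul_one]

theorem inv (hq : q ≠ 0) (h : BorelRel q d k1 k2 e1 e2) (h11 : k1 * l1 = 1) (h11' : l1 * k1 = 1)
    (h22 : k2 * l2 = 1) (h22' : l2 * k2 = 1) : BorelRel q⁻¹ d l1 l2 e1 e2 where
  k1_pow := by
    have := (show Commute k1 l1 from h11.trans h11'.symm).mul_pow d
    rwa [h11, one_pow, h.k1_pow, one_mul, eq_comm] at this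
  k2_pow := by
    have := (show Commute k2 l2 from h22.trans h22'.symm).mul_pow d
    rwa [h22, one_pow, h.k2_pow, one_mul, eq_comm] at this
  k2k1 := by
    have h0 : k2 * k1 = (1 : F) • (k1 * k2) := by rw [h.k2k1, one_smul]
    have h1 := qcomm_symm (inv_ne_zero one_ne_zero) (qcomm_of_inv one_ne_zero h11 h11' h0)
    have h2 := qcomm_of_inv (by simp) h22 h22' h1
    simp only [inv_one, one_smul] at h2
    exact h2.symm
  e1k1 := by
    rw [qcomm_of_inv (zpow_ne_zero _ hq) h11 h11' h.e1k1, inv_zpow]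
  e2k1 := qcomm_of_inv hq h11 h11' h.e2k1
  e1k2 := qcomm_of_inv hq h22 h22' h.e1k2
  e2k2 := by
    have h0 : e2 * k2 = (1 : F) • (k2 * e2) := by rw [h.e2k2, one_smul]
    simpa using qcomm_of_inv one_ne_zero h22 h22' h0
  e2e2 := h.e2e2
  serre := by rw [serreElt_inv, h.serre]
  e1_pow := h.e1_pow

end BorelRel

end BorelTwist

section UbarHopf

open UqGen SuperHopfData

variable {F : Type*} [Field F] {q : F} {d : ℕ}

theorem ubarSat_parity : UbarSat q d
    (fun g => koszulSign F g.deg • ubarGen F q d g) := by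
  have h := ubarSat (F := F) (q := q) (d := d)
  have hp := h.pos.smul 1 (-1)
  have hn := h.neg.smul 1 (-1)
  simp only [one_smul] at hp hn
  refine ⟨?_, ?_, ?_, ?_, ?_, ?_, ?_, ?_, ?_, ?_⟩ <;> simp only [UqGen.deg, koszulSign_zero,
    koszulSign_one, one_smul]
  · exact h.k1K1
  · exact h.K1k1
  · exact h.k2K2
  · exact h.K2k2
  · exact hp
  · exact hn
  · exact h.e1f1
  · simpa using h.e2f2
  · simpa using h.e1f2
  · simpa using h.e2f1

variable (F q d) in
/-- The parity automorphism of `Ū_q`. -/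
def ubarParity : Ubar F q d →ₐ[F] Ubar F q d := ubarLift ubarSat_parity

@[simp] theorem ubarParity_gen (g : UqGen) :
    ubarParity F q d (ubarGen F q d g) = koszulSign F g.deg • ubarGen F q d g :=
  ubarLift_gen _ _

@[simp] theorem ubarParity_ubarParity (x : Ubar F q d) :
    ubarParity F q d (ubarParity F q d x) = x := by
  induction x using ubar_induction with
  | add x y hx hy => simp [hx, hy]
  | smul c x hx => simp [hx]
  | one => simp
  | mul g x hx => simp [hx, smul_smul]

variable (F q d) in
/-- `Ū_q` as a superalgebra. -/
def ubarAlg : SuperHopfData F (Ubar F q d) where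
  part i := (2 : F)⁻¹ • (LinearMap.id + koszulSign F i • (ubarParity F q d).toLinearMap)
  mul := LinearMap.mul' F (Ubar F q d)
  one := 1
  comul := 0
  counit := 0
  antipode := 0
  antipodeInv := 0

theorem ubarAlg_part (i : ZMod 2) (x : Ubar F q d) :
    (ubarAlg F q d).part i x = (2 : F)⁻¹ • (x + koszulSign F i • ubarParity F q d x) := rfl

@[simp] theorem ubarAlg_m (x y : Ubar F q d) : (ubarAlg F q d).m x y = x * y := rfl

variable [CharZero F]

theorem ubarAlg_hom_iff {i : ZMod 2} {x : Ubar F q d} :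
    (ubarAlg F q d).part i x = x ↔ ubarParity F q d x = koszulSign F i • x := by
  rw [ubarAlg_part]
  constructor
  · intro h
    have h2 : x + koszulSign F i • ubarParity F q d x = (2 : F) • x := by
      conv_rhs => rw [← h]
      rw [smul_smul, mul_inv_cancel₀ two_ne_zero, one_smul]
    have h3 : koszulSign F i • ubarParity F q d x = x := by
      rw [two_smul] at h2; exact add_left_cancel h2
    calc _ = (koszulSign F i * koszulSign F i) • ubarParity F q d x := by simp
      _ = _ := by rw [mul_smul, h3]
  · intro h
    rw [h, smul_smul, koszulSign_mul_self, one_smul, ← two_smul F x, smul_smul,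
      inv_mul_cancel₀ two_ne_zero, one_smul]

theorem ubarAlg_grading : IsGrading (ubarAlg F q d).part where
  proj i j := by
    ext x
    simp only [LinearMap.comp_apply, ubarAlg_part, map_smul, map_add, ubarParity_ubarParity]
    rcases zmod_two_cases i with rfl | rfl <;> rcases zmod_two_cases j with rfl | rfl <;>
      simp [ubarAlg_part] <;> module
  total := by
    ext x
    simp only [LinearMap.add_apply, ubarAlg_part, koszulSign_zero, koszulSign_one,
      LinearMap.id_apply]
    module

theorem ubarAlg_isSuperAlg : (ubarAlg F q d).IsSuperAlg where
  grading := ubarAlg_grading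
  mul_even := IsEvenMap.of_tmul ubarAlg_grading ubarAlg_grading ubarAlg_grading
    fun i j x y hx hy => by
      change (ubarAlg F q d).part (i + j) (x * y) = x * y
      rw [ubarAlg_hom_iff] at *
      rw [map_mul, hx, hy, smul_mul_smul_comm, koszulSign_add]
  one_even := by
    change (ubarAlg F q d).part 0 1 = 1
    rw [ubarAlg_hom_iff]; simp
  mul_assoc := mul_assoc
  one_mul := one_mul
  mul_one := mul_one

theorem ubarGen_hom (g : UqGen) : (ubarAlg F q d).part g.deg (ubarGen F q d g) = ubarGen F q d g :=
  ubarAlg_hom_iff.mpr (ubarParity_gen g)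

section Comul

variable (F q d) in
/-- The super tensor square of `Ū_q`. -/
abbrev UbarSq : Type _ := SAlg ((ubarAlg F q d).tensor (ubarAlg F q d))
  (ubarAlg_isSuperAlg.tensor ubarAlg_isSuperAlg)

/-- Pure tensors as elements of the super tensor square. -/
def sqTmul (a b : Ubar F q d) : UbarSq F q d := a ⊗ₜ[F] b

theorem sqTmul_mul_left {a b c e : Ubar F q d} (hb : (ubarAlg F q d).part 0 b = b) :
    sqTmul a b * sqTmul c e = sqTmul (a * c) (b * e) :=
  IsSuperAlg.tensor_m_even_left ubarAlg_grading ubarAlg_grading a c e hb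

theorem sqTmul_mul_right {a b c e : Ubar F q d} (hc : (ubarAlg F q d).part 0 c = c) :
    sqTmul a b * sqTmul c e = sqTmul (a * c) (b * e) :=
  IsSuperAlg.tensor_m_even_right ubarAlg_grading ubarAlg_grading a b e hc

theorem sqTmul_mul_odd {a b c e : Ubar F q d} (hb : (ubarAlg F q d).part 1 b = b)
    (hc : (ubarAlg F q d).part 1 c = c) :
    sqTmul a b * sqTmul c e = -sqTmul (a * c) (b * e) := by
  have := IsSuperAlg.tensor_m ubarAlg_grading ubarAlg_grading a e hb hc
  rw [mul_one, koszulSign_one] at this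
  exact this.trans (neg_one_smul F (sqTmul (a * c) (b * e)))

theorem sqTmul_smul_left (c : F) (a b : Ubar F q d) : sqTmul (c • a) b = c • sqTmul a b := rfl

theorem sqTmul_smul_right (c : F) (a b : Ubar F q d) : sqTmul a (c • b) = c • sqTmul a b :=
  TensorProduct.tmul_smul c a b

theorem sqTmul_add_left (a a' b : Ubar F q d) : sqTmul (a + a') b = sqTmul a b + sqTmul a' b :=
  TensorProduct.add_tmul a a' b

theorem sqTmul_add_right (a b b' : Ubar F q d) : sqTmul a (b + b') = sqTmul a b + sqTmul a b' :=
  TensorProduct.tmul_add a b b'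

theorem sqTmul_sub_left (a a' b : Ubar F q d) : sqTmul (a - a') b = sqTmul a b - sqTmul a' b :=
  TensorProduct.sub_tmul a a' b

theorem sqTmul_sub_right (a b b' : Ubar F q d) : sqTmul a (b - b') = sqTmul a b - sqTmul a b' :=
  TensorProduct.tmul_sub a b b'

theorem sqTmul_neg_left (a b : Ubar F q d) : sqTmul (-a) b = -sqTmul a b :=
  TensorProduct.neg_tmul a b

theorem sqTmul_neg_right (a b : Ubar F q d) : sqTmul a (-b) = -sqTmul a b :=
  TensorProduct.tmul_neg a b

theorem sqTmul_one_one : sqTmul (1 : Ubar F q d) 1 = 1 := rfl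

theorem ubar_one_even : (ubarAlg F q d).part 0 1 = 1 := ubarAlg_isSuperAlg.one_even

/-- The embedding of the first factor. -/
def sqInl : Ubar F q d →ₐ[F] UbarSq F q d where
  toFun a := sqTmul a 1
  map_one' := rfl
  map_mul' a b := by rw [sqTmul_mul_left ubar_one_even, one_mul]
  map_zero' := TensorProduct.zero_tmul _ _
  map_add' a b := sqTmul_add_left a b 1
  commutes' c := by
    rw [Algebra.algebraMap_eq_smul_one, Algebra.algebraMap_eq_smul_one, sqTmul_smul_left]; rfl

/-- The embedding of the second factor. -/
def sqInr : Ubar F q d →ₐ[F] UbarSq F q d where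
  toFun a := sqTmul 1 a
  map_one' := rfl
  map_mul' a b := by rw [sqTmul_mul_right ubar_one_even, one_mul]
  map_zero' := TensorProduct.tmul_zero _ _
  map_add' a b := sqTmul_add_right 1 a b
  commutes' c := by
    rw [Algebra.algebraMap_eq_smul_one, Algebra.algebraMap_eq_smul_one, sqTmul_smul_right]; rfl

theorem sqInl_apply (a : Ubar F q d) : sqInl a = sqTmul a 1 := rfl
theorem sqInr_apply (a : Ubar F q d) : sqInr a = sqTmul 1 a := rfl

theorem commute_sqInr_sqInl {k : Ubar F q d} (hk : (ubarAlg F q d).part 0 k = k)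
    (x : Ubar F q d) : Commute (sqInr k) (sqInl x) := by
  rw [Commute, SemiconjBy, sqInl_apply, sqInr_apply, sqTmul_mul_left hk,
    sqTmul_mul_left ubar_one_even]
  simp

theorem commute_sqInl_sqInr {k : Ubar F q d} (hk : (ubarAlg F q d).part 0 k = k)
    (x : Ubar F q d) : Commute (sqInl k) (sqInr x) := by
  rw [Commute, SemiconjBy, sqInl_apply, sqInr_apply, sqTmul_mul_left ubar_one_even,
    sqTmul_mul_right hk]
  simp

/-- The coproducts of the generators. -/
def comulGen : UqGen → UbarSq F q d
  | k1 => sqTmul (ubarGen F q d k1) (ubarGen F q d k1)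
  | k2 => sqTmul (ubarGen F q d k2) (ubarGen F q d k2)
  | K1 => sqTmul (ubarGen F q d K1) (ubarGen F q d K1)
  | K2 => sqTmul (ubarGen F q d K2) (ubarGen F q d K2)
  | e1 => sqTmul (ubarGen F q d e1) 1 + sqTmul (ubarGen F q d k1) (ubarGen F q d e1)
  | e2 => sqTmul (ubarGen F q d e2) 1 + sqTmul (ubarGen F q d k2) (ubarGen F q d e2)
  | f1 => sqTmul (ubarGen F q d f1) (ubarGen F q d K1) + sqTmul 1 (ubarGen F q d f1)
  | f2 => sqTmul (ubarGen F q d f2) (ubarGen F q d K2) + sqTmul 1 (ubarGen F q d f2)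

theorem ubar_comul_pos (hq : IsOddRoot q d) : BorelRel q d (comulGen (F := F) (q := q) (d := d) k1)
    (comulGen k2) (comulGen e1) (comulGen e2) := by
  have h := ubarSat (F := F) (q := q) (d := d)
  have hk1 := ubarGen_hom (F := F) (q := q) (d := d) k1
  have hk2 := ubarGen_hom (F := F) (q := q) (d := d) k2
  have he1 := ubarGen_hom (F := F) (q := q) (d := d) e1
  have he2 := ubarGen_hom (F := F) (q := q) (d := d) e2
  simp only [UqGen.deg] at hk1 hk2 he1 he2
  have hl := h.pos.map (sqInl (F := F) (q := q) (d := d))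
  have hr := h.pos.map (sqInr (F := F) (q := q) (d := d))
  have e1 : comulGen k1 = sqInl (ubarGen F q d k1) * sqInr (ubarGen F q d k1) := by
    rw [sqInl_apply, sqInr_apply, sqTmul_mul_left ubar_one_even]; simp [comulGen]
  have e2 : comulGen k2 = sqInl (ubarGen F q d k2) * sqInr (ubarGen F q d k2) := by
    rw [sqInl_apply, sqInr_apply, sqTmul_mul_left ubar_one_even]; simp [comulGen]
  have H1 : BorelRel q d (comulGen (F := F) (q := q) (d := d) k1) (comulGen k2)
      (sqTmul (ubarGen F q d UqGen.e1) 1) (sqTmul (ubarGen F q d UqGen.e2) 1) := by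
    have := hl.twist_torus hr.k2k1 hr.k1_pow hr.k2_pow
      (by simp [commute_sqInr_sqInl hk1]) (by simp [commute_sqInr_sqInl hk2])
    rwa [(commute_sqInr_sqInl hk1 _).eq, (commute_sqInr_sqInl hk2 _).eq, ← e1, ← e2] at this
  have H2 : BorelRel q d (comulGen (F := F) (q := q) (d := d) k1) (comulGen k2)
      (sqTmul (ubarGen F q d k1) (ubarGen F q d UqGen.e1))
      (sqTmul (ubarGen F q d k2) (ubarGen F q d UqGen.e2)) := by
    have h0 := hr.twist_nilp hl.k2k1
      (by simp [commute_sqInl_sqInr hk1]) (by simp [commute_sqInl_sqInr hk2])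
    have hc : Commute (sqInl (ubarGen F q d k2)) (sqInl (ubarGen F q d k1)) := hl.k2k1
    have := h0.twist_torus hl.k2k1 hl.k1_pow hl.k2_pow
      (by
        simp only [Set.mem_insert_iff, Set.mem_singleton_iff, forall_eq_or_imp, forall_eq]
        exact ⟨commute_sqInl_sqInr hk1 _, commute_sqInl_sqInr hk1 _,
          (Commute.refl _).mul_right (commute_sqInl_sqInr hk1 _),
          hc.symm.mul_right (commute_sqInl_sqInr hk1 _)⟩)
      (by
        simp only [Set.mem_insert_iff, Set.mem_singleton_iff, forall_eq_or_imp, forall_eq]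
        exact ⟨commute_sqInl_sqInr hk2 _, commute_sqInl_sqInr hk2 _,
          hc.mul_right (commute_sqInl_sqInr hk2 _),
          (Commute.refl _).mul_right (commute_sqInl_sqInr hk2 _)⟩)
    rw [← e1, ← e2] at this
    convert this using 1 <;>
    · rw [sqInl_apply, sqInr_apply, sqTmul_mul_left ubar_one_even]; simp
  refine H1.sum hq H2 ?_ ?_ ?_ ?_
  · rw [sqTmul_mul_left ubar_one_even, sqTmul_mul_left he1, h.pos.e1k1, one_mul, mul_one,
      sqTmul_smul_left]
  · rw [sqTmul_mul_left ubar_one_even, sqTmul_mul_right he1, h.pos.e1k2, one_mul, mul_one,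
      sqTmul_smul_left]
  · rw [sqTmul_mul_left ubar_one_even, sqTmul_mul_left he1, h.pos.e2k1, one_mul, mul_one,
      sqTmul_smul_left]
  · rw [sqTmul_mul_left ubar_one_even, sqTmul_mul_odd he2 he2, h.pos.e2k2, one_mul, mul_one,
      neg_neg]

theorem ubar_comul_neg (hq : IsOddRoot q d) : BorelRel q d (comulGen (F := F) (q := q) (d := d) K1)
    (comulGen K2) (comulGen f1) (comulGen f2) := by
  have h := ubarSat (F := F) (q := q) (d := d)
  have hk1 := ubarGen_hom (F := F) (q := q) (d := d) K1
  have hk2 := ubarGen_hom (F := F) (q := q) (d := d) K2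
  have he1 := ubarGen_hom (F := F) (q := q) (d := d) f1
  have he2 := ubarGen_hom (F := F) (q := q) (d := d) f2
  simp only [UqGen.deg] at hk1 hk2 he1 he2
  have hl := h.neg.map (sqInl (F := F) (q := q) (d := d))
  have hr := h.neg.map (sqInr (F := F) (q := q) (d := d))
  have e1 : comulGen K1 = sqInl (ubarGen F q d K1) * sqInr (ubarGen F q d K1) := by
    rw [sqInl_apply, sqInr_apply, sqTmul_mul_left ubar_one_even]; simp [comulGen]
  have e2 : comulGen K2 = sqInl (ubarGen F q d K2) * sqInr (ubarGen F q d K2) := by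
    rw [sqInl_apply, sqInr_apply, sqTmul_mul_left ubar_one_even]; simp [comulGen]
  have H1 : BorelRel q d (comulGen (F := F) (q := q) (d := d) K1) (comulGen K2)
      (sqTmul 1 (ubarGen F q d f1)) (sqTmul 1 (ubarGen F q d f2)) := by
    have := hr.twist_torus hl.k2k1 hl.k1_pow hl.k2_pow
      (by simp [commute_sqInl_sqInr hk1]) (by simp [commute_sqInl_sqInr hk2])
    rwa [← e1, ← e2] at this
  have H2 : BorelRel q d (comulGen (F := F) (q := q) (d := d) K1) (comulGen K2)
      (sqTmul (ubarGen F q d f1) (ubarGen F q d K1))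
      (sqTmul (ubarGen F q d f2) (ubarGen F q d K2)) := by
    have h0 := hl.twist_nilp hr.k2k1
      (by simp [commute_sqInr_sqInl hk1]) (by simp [commute_sqInr_sqInl hk2])
    have hc : Commute (sqInr (ubarGen F q d K2)) (sqInr (ubarGen F q d K1)) := hr.k2k1
    have := h0.twist_torus hr.k2k1 hr.k1_pow hr.k2_pow
      (by
        simp only [Set.mem_insert_iff, Set.mem_singleton_iff, forall_eq_or_imp, forall_eq]
        exact ⟨commute_sqInr_sqInl hk1 _, commute_sqInr_sqInl hk1 _,
          (Commute.refl _).mul_right (commute_sqInr_sqInl hk1 _),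
          hc.symm.mul_right (commute_sqInr_sqInl hk1 _)⟩)
      (by
        simp only [Set.mem_insert_iff, Set.mem_singleton_iff, forall_eq_or_imp, forall_eq]
        exact ⟨commute_sqInr_sqInl hk2 _, commute_sqInr_sqInl hk2 _,
          hc.mul_right (commute_sqInr_sqInl hk2 _),
          (Commute.refl _).mul_right (commute_sqInr_sqInl hk2 _)⟩)
    rw [(commute_sqInr_sqInl hk1 _).eq, (commute_sqInr_sqInl hk2 _).eq, ← e1, ← e2] at this
    convert this using 1 <;>
    · first
        | rw [(commute_sqInr_sqInl hk1 _).eq, sqInl_apply, sqInr_apply,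
            sqTmul_mul_left ubar_one_even]; simp
        | rw [(commute_sqInr_sqInl hk2 _).eq, sqInl_apply, sqInr_apply,
            sqTmul_mul_left ubar_one_even]; simp
  rw [show comulGen (F := F) (q := q) (d := d) f1 = _ from add_comm _ _,
    show comulGen (F := F) (q := q) (d := d) f2 = _ from add_comm _ _]
  refine H1.sum hq H2 ?_ ?_ ?_ ?_
  · rw [sqTmul_mul_left he1, sqTmul_mul_left hk1, h.neg.e1k1, one_mul, mul_one,
      sqTmul_smul_right]
  · rw [sqTmul_mul_left he1, sqTmul_mul_left hk2, h.neg.e1k2, one_mul, mul_one,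
      sqTmul_smul_right]
  · rw [sqTmul_mul_right he1, sqTmul_mul_left hk1, h.neg.e2k1, one_mul, mul_one,
      sqTmul_smul_right]
  · rw [sqTmul_mul_odd he2 he2, sqTmul_mul_left hk2, h.neg.e2k2, one_mul, mul_one]

end Comul

end UbarHopf

section UbarHopf

open UqGen SuperHopfData

variable {F : Type*} [Field F] {q : F} {d : ℕ}

theorem UbarSat.k_f_comm {R : Type*} [Ring R] [Algebra F R] {g : UqGen → R} (h : UbarSat q d g) :
    g k1 * g f1 = q ^ (-2 : ℤ) • (g f1 * g k1) ∧ g k1 * g f2 = q • (g f2 * g k1) ∧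
    g k2 * g f1 = q • (g f1 * g k2) ∧ g k2 * g f2 = g f2 * g k2 := by
  refine ⟨qcomm_inv' h.k1K1 h.K1k1 h.neg.e1k1, qcomm_inv' h.k1K1 h.K1k1 h.neg.e2k1,
    qcomm_inv' h.k2K2 h.K2k2 h.neg.e1k2, ?_⟩
  have := qcomm_inv' h.k2K2 h.K2k2 (f := g f2) (c := (1 : F)) (by rw [one_smul, h.neg.e2k2])
  rwa [one_smul] at this

theorem UbarSat.pos_inv {R : Type*} [Ring R] [Algebra F R] {g : UqGen → R} (h : UbarSat q d g)
    (hq : q ≠ 0) : BorelRel q⁻¹ d (g K1) (g K2) (g e1) (g e2) :=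
  h.pos.inv hq h.k1K1 h.K1k1 h.k2K2 h.K2k2

theorem UbarSat.neg_inv {R : Type*} [Ring R] [Algebra F R] {g : UqGen → R} (h : UbarSat q d g)
    (hq : q ≠ 0) : BorelRel q⁻¹ d (g k1) (g k2) (g f1) (g f2) :=
  h.neg.inv hq h.K1k1 h.k1K1 h.K2k2 h.k2K2

/-- The counit on the generators. -/
def counitGen : UqGen → F
  | e1 => 0
  | e2 => 0
  | f1 => 0
  | f2 => 0
  | _ => 1

theorem ubarSat_counit (hd : 0 < d) : UbarSat q d (counitGen (F := F)) := by
  refine ⟨?_, ?_, ?_, ?_, ⟨?_, ?_, ?_, ?_, ?_, ?_, ?_, ?_, ?_, ?_⟩,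
    ⟨?_, ?_, ?_, ?_, ?_, ?_, ?_, ?_, ?_, ?_⟩, ?_, ?_, ?_, ?_⟩ <;>
    simp [counitGen, serreElt, hd.ne']

/-- The counit of `Ū_q`. -/
def ubarCounit (hd : 0 < d) : Ubar F q d →ₐ[F] F := ubarLift (ubarSat_counit hd)

@[simp] theorem ubarCounit_gen (hd : 0 < d) (g : UqGen) :
    ubarCounit (F := F) (q := q) hd (ubarGen F q d g) = counitGen g := ubarLift_gen _ _

variable [CharZero F]

section Comul

theorem sqTmul_smul_smul {c : F} (hc : c ≠ 0) (a b : Ubar F q d) :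
    sqTmul (c • a) (c⁻¹ • b) = sqTmul a b := by
  rw [sqTmul_smul_left, sqTmul_smul_right, smul_smul, mul_inv_cancel₀ hc, one_smul]

theorem ubarSat_comul (hq : IsOddRoot q d) : UbarSat q d (comulGen (F := F) (q := q) (d := d)) := by
  have h := ubarSat (F := F) (q := q) (d := d)
  have q0 := hq.ne_zero
  have hk1 := ubarGen_hom (F := F) (q := q) (d := d) k1
  have hk2 := ubarGen_hom (F := F) (q := q) (d := d) k2
  have hK1 := ubarGen_hom (F := F) (q := q) (d := d) K1
  have hK2 := ubarGen_hom (F := F) (q := q) (d := d) K2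
  have he1 := ubarGen_hom (F := F) (q := q) (d := d) e1
  have he2 := ubarGen_hom (F := F) (q := q) (d := d) e2
  have hf1 := ubarGen_hom (F := F) (q := q) (d := d) f1
  have hf2 := ubarGen_hom (F := F) (q := q) (d := d) f2
  simp only [UqGen.deg] at hk1 hk2 hK1 hK2 he1 he2 hf1 hf2
  obtain ⟨c11, c12, c21, c22⟩ := h.k_f_comm
  have hi := h.pos_inv q0
  refine ⟨?_, ?_, ?_, ?_, ubar_comul_pos hq, ubar_comul_neg hq, ?_, ?_, ?_, ?_⟩ <;>
    simp only [comulGen, add_mul, mul_add]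
  · rw [sqTmul_mul_left hk1, h.k1K1, sqTmul_one_one]
  · rw [sqTmul_mul_left hK1, h.K1k1, sqTmul_one_one]
  · rw [sqTmul_mul_left hk2, h.k2K2, sqTmul_one_one]
  · rw [sqTmul_mul_left hK2, h.K2k2, sqTmul_one_one]
  · rw [sqTmul_mul_left ubar_one_even, sqTmul_mul_left ubar_one_even, sqTmul_mul_left he1,
      sqTmul_mul_left he1, sqTmul_mul_left hK1, sqTmul_mul_left hK1, sqTmul_mul_left hf1,
      sqTmul_mul_left hf1, c11, hi.e1k1, show (q⁻¹ ^ (-2 : ℤ)) = (q ^ (-2 : ℤ))⁻¹ by rw [inv_zpow],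
      sqTmul_smul_smul (zpow_ne_zero _ q0), h.e1f1]
    simp only [sqTmul_add_left, sqTmul_add_right, sqTmul_smul_left, sqTmul_smul_right,
      sqTmul_sub_left, sqTmul_sub_right, one_mul, mul_one]
    module
  · rw [sqTmul_mul_left ubar_one_even, sqTmul_mul_left ubar_one_even, sqTmul_mul_odd he2 hf2,
      sqTmul_mul_right ubar_one_even, sqTmul_mul_left hK2, sqTmul_mul_left hK2,
      sqTmul_mul_odd hf2 he2, sqTmul_mul_right hk2, c22, hi.e2k2, h.e2f2]
    simp only [sqTmul_add_left, sqTmul_add_right, sqTmul_smul_left, sqTmul_smul_right,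
      sqTmul_sub_left, sqTmul_sub_right, sqTmul_neg_left, sqTmul_neg_right, one_mul, mul_one]
    module
  · rw [sqTmul_mul_left ubar_one_even, sqTmul_mul_left ubar_one_even, sqTmul_mul_left he1,
      sqTmul_mul_right ubar_one_even, sqTmul_mul_left hK2, sqTmul_mul_left hK2,
      sqTmul_mul_right he1, sqTmul_mul_right hk1, c12, hi.e1k2, sqTmul_smul_smul q0, h.e1f2]
    simp only [one_mul, mul_one]
    abel
  · rw [sqTmul_mul_left ubar_one_even, sqTmul_mul_left ubar_one_even, sqTmul_mul_right hf1,
      sqTmul_mul_right ubar_one_even, sqTmul_mul_left hK1, sqTmul_mul_left hK1,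
      sqTmul_mul_left hf1, sqTmul_mul_left hf1, c21, hi.e2k1, sqTmul_smul_smul q0, h.e2f1]
    simp only [one_mul, mul_one]
    abel

/-- The coproduct of `Ū_q`. -/
def ubarComul (hq : IsOddRoot q d) : Ubar F q d →ₐ[F] UbarSq F q d := ubarLift (ubarSat_comul hq)

@[simp] theorem ubarComul_gen (hq : IsOddRoot q d) (g : UqGen) :
    ubarComul (F := F) hq (ubarGen F q d g) = comulGen g := ubarLift_gen _ _

end Comul

section Antipode

variable (F q d) in
/-- The opposite superalgebra of `Ū_q`. -/
abbrev UbarOp : Type _ := SAlg (ubarAlg F q d).superOp ubarAlg_isSuperAlg.superOp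

/-- An element of `Ū_q` as an element of the opposite superalgebra. -/
def toOp : Ubar F q d →ₗ[F] UbarOp F q d := LinearMap.id (M := Ubar F q d)

theorem toOp_mul {i j : ZMod 2} {x y : Ubar F q d} (hx : (ubarAlg F q d).part i x = x)
    (hy : (ubarAlg F q d).part j y = y) :
    toOp x * toOp y = koszulSign F (i * j) • toOp (y * x) :=
  superOp_m ubarAlg_grading hx hy

theorem toOp_mul_left {x : Ubar F q d} (hx : (ubarAlg F q d).part 0 x = x) (y : Ubar F q d) :
    toOp x * toOp y = toOp (y * x) := by
  refine ubarAlg_grading.induction (P := fun y => toOp x * toOp y = toOp (y * x))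
    (fun a b ha hb => ?_) (fun j y hy => ?_) y
  · rw [map_add, mul_add, add_mul, map_add, ha, hb]
  · rw [toOp_mul hx hy, zero_mul, koszulSign_zero, one_smul]

theorem toOp_mul_right (x : Ubar F q d) {y : Ubar F q d} (hy : (ubarAlg F q d).part 0 y = y) :
    toOp x * toOp y = toOp (y * x) := by
  refine ubarAlg_grading.induction (P := fun x => toOp x * toOp y = toOp (y * x))
    (fun a b ha hb => ?_) (fun j x hx => ?_) x
  · rw [map_add, add_mul, mul_add, map_add, ha, hb]
  · rw [toOp_mul hx hy, mul_zero, koszulSign_zero, one_smul]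

theorem toOp_mul_odd {x y : Ubar F q d} (hx : (ubarAlg F q d).part 1 x = x)
    (hy : (ubarAlg F q d).part 1 y = y) : toOp x * toOp y = -toOp (y * x) := by
  rw [toOp_mul hx hy, mul_one, koszulSign_one, neg_one_smul]

theorem toOp_one : toOp (1 : Ubar F q d) = 1 := rfl

theorem ubar_hom_mul {i j : ZMod 2} {x y : Ubar F q d} (hx : (ubarAlg F q d).part i x = x)
    (hy : (ubarAlg F q d).part j y = y) : (ubarAlg F q d).part (i + j) (x * y) = x * y :=
  ubarAlg_isSuperAlg.hom_m hx hy

theorem ubar_even_pow {x : Ubar F q d} (hx : (ubarAlg F q d).part 0 x = x) (n : ℕ) :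
    (ubarAlg F q d).part 0 (x ^ n) = x ^ n := by
  induction n with
  | zero => rw [pow_zero]; exact ubar_one_even
  | succ n ih => rw [pow_succ]; simpa using ubar_hom_mul ih hx

theorem toOp_pow {x : Ubar F q d} (hx : (ubarAlg F q d).part 0 x = x) (n : ℕ) :
    toOp x ^ n = toOp (x ^ n) := by
  induction n with
  | zero => rw [pow_zero, pow_zero, toOp_one]
  | succ n ih => rw [pow_succ, ih, toOp_mul_right _ hx, pow_succ']

theorem borelRel_toOp (hq : q ≠ 0) {x1 x2 y1 y2 : Ubar F q d} (h : BorelRel q⁻¹ d x1 x2 y1 y2)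
    (hx1 : (ubarAlg F q d).part 0 x1 = x1) (hx2 : (ubarAlg F q d).part 0 x2 = x2)
    (hy1 : (ubarAlg F q d).part 0 y1 = y1) (hy2 : (ubarAlg F q d).part 1 y2 = y2) :
    BorelRel q d (toOp x1) (toOp x2) (toOp y1) (toOp y2) where
  k1_pow := by rw [toOp_pow hx1, h.k1_pow, toOp_one]
  k2_pow := by rw [toOp_pow hx2, h.k2_pow, toOp_one]
  k2k1 := by rw [toOp_mul_left hx2, toOp_mul_left hx1, h.k2k1]
  e1k1 := by
    rw [toOp_mul_left hy1, toOp_mul_left hx1, h.e1k1, map_smul, smul_smul, inv_zpow,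
      mul_inv_cancel₀ (zpow_ne_zero _ hq), one_smul]
  e2k1 := by
    rw [toOp_mul_right _ hx1, toOp_mul_left hx1, h.e2k1, map_smul, smul_smul,
      mul_inv_cancel₀ hq, one_smul]
  e1k2 := by
    rw [toOp_mul_left hy1, toOp_mul_left hx2, h.e1k2, map_smul, smul_smul,
      mul_inv_cancel₀ hq, one_smul]
  e2k2 := by rw [toOp_mul_right _ hx2, toOp_mul_left hx2, h.e2k2]
  e2e2 := by rw [toOp_mul_odd hy2 hy2, h.e2e2, map_zero, neg_zero]
  serre := by
    have := congrArg toOp h.serre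
    rw [map_zero] at this
    rw [← this, serreElt, serreElt, toOp_pow hy1, toOp_mul_left (ubar_even_pow hy1 2),
      toOp_mul_left hy1, toOp_mul_right _ hy1, toOp_mul_right _ (ubar_even_pow hy1 2), inv_inv,
      add_comm q⁻¹, map_add, map_sub, map_smul, mul_assoc y1]
    abel
  e1_pow := by rw [toOp_pow hy1, h.e1_pow, map_zero]

/-- The antipodes of the generators. -/
def antipodeGen : UqGen → Ubar F q d
  | k1 => ubarGen F q d K1
  | k2 => ubarGen F q d K2
  | K1 => ubarGen F q d k1
  | K2 => ubarGen F q d k2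
  | e1 => -(ubarGen F q d K1 * ubarGen F q d e1)
  | e2 => -(ubarGen F q d K2 * ubarGen F q d e2)
  | f1 => -(ubarGen F q d f1 * ubarGen F q d k1)
  | f2 => -(ubarGen F q d f2 * ubarGen F q d k2)

theorem antipodeGen_hom (g : UqGen) :
    (ubarAlg F q d).part g.deg (antipodeGen g) = antipodeGen g := by
  have hk1 := ubarGen_hom (F := F) (q := q) (d := d) k1
  have hk2 := ubarGen_hom (F := F) (q := q) (d := d) k2
  have hK1 := ubarGen_hom (F := F) (q := q) (d := d) K1
  have hK2 := ubarGen_hom (F := F) (q := q) (d := d) K2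
  have he1 := ubarGen_hom (F := F) (q := q) (d := d) e1
  have he2 := ubarGen_hom (F := F) (q := q) (d := d) e2
  have hf1 := ubarGen_hom (F := F) (q := q) (d := d) f1
  have hf2 := ubarGen_hom (F := F) (q := q) (d := d) f2
  simp only [UqGen.deg] at hk1 hk2 hK1 hK2 he1 he2 hf1 hf2
  cases g <;> simp only [antipodeGen, UqGen.deg, map_neg, neg_inj]
  · exact hK1
  · exact hK2
  · exact hk1
  · exact hk2
  · simpa using ubar_hom_mul hK1 he1
  · simpa using ubar_hom_mul hK2 he2
  · simpa using ubar_hom_mul hf1 hk1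
  · simpa using ubar_hom_mul hf2 hk2

theorem ubarSat_antipode (hq : q ≠ 0) :
    UbarSat q d (fun g => toOp (antipodeGen (F := F) (q := q) (d := d) g)) := by
  have h := ubarSat (F := F) (q := q) (d := d)
  have hA := antipodeGen_hom (F := F) (q := q) (d := d)
  have hK1 : (ubarAlg F q d).part 0 (ubarGen F q d K1) = _ := hA k1
  have hK2 : (ubarAlg F q d).part 0 (ubarGen F q d K2) = _ := hA k2
  have hk1 : (ubarAlg F q d).part 0 (ubarGen F q d k1) = _ := hA K1
  have hk2 : (ubarAlg F q d).part 0 (ubarGen F q d k2) = _ := hA K2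
  have he1 : (ubarAlg F q d).part 0 (antipodeGen e1) = _ := hA e1
  have he2 : (ubarAlg F q d).part 1 (antipodeGen e2) = _ := hA e2
  have hf1 : (ubarAlg F q d).part 0 (antipodeGen f1) = _ := hA f1
  have hf2 : (ubarAlg F q d).part 1 (antipodeGen f2) = _ := hA f2
  obtain ⟨c11, c12, c21, c22⟩ := h.k_f_comm
  have q0 := hq
  have hi := h.pos_inv q0
  have hj := h.neg_inv q0
  have hs : q ^ (-2 : ℤ) ≠ 0 := zpow_ne_zero _ q0
  have K1 (x : Ubar F q d) : ubarGen F q d k1 * (ubarGen F q d UqGen.K1 * x) = x := by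
    rw [← mul_assoc, h.k1K1, one_mul]
  have K1' (x : Ubar F q d) : ubarGen F q d UqGen.K1 * (ubarGen F q d k1 * x) = x := by
    rw [← mul_assoc, h.K1k1, one_mul]
  have K2 (x : Ubar F q d) : ubarGen F q d k2 * (ubarGen F q d UqGen.K2 * x) = x := by
    rw [← mul_assoc, h.k2K2, one_mul]
  have K2' (x : Ubar F q d) : ubarGen F q d UqGen.K2 * (ubarGen F q d k2 * x) = x := by
    rw [← mul_assoc, h.K2k2, one_mul]
  refine ⟨?_, ?_, ?_, ?_, ?_, ?_, ?_, ?_, ?_, ?_⟩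
  · change toOp (ubarGen F q d UqGen.K1) * toOp (ubarGen F q d k1) = 1
    rw [toOp_mul_left hK1, h.k1K1, toOp_one]
  · change toOp (ubarGen F q d k1) * toOp (ubarGen F q d UqGen.K1) = 1
    rw [toOp_mul_left hk1, h.K1k1, toOp_one]
  · change toOp (ubarGen F q d UqGen.K2) * toOp (ubarGen F q d k2) = 1
    rw [toOp_mul_left hK2, h.k2K2, toOp_one]
  · change toOp (ubarGen F q d k2) * toOp (ubarGen F q d UqGen.K2) = 1
    rw [toOp_mul_left hk2, h.K2k2, toOp_one]
  · refine borelRel_toOp q0 ?_ hK1 hK2 he1 he2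
    have := (hi.mul_torus (inv_ne_zero q0)).smul (-1) (-1)
    rwa [neg_one_smul, neg_one_smul] at this
  · refine borelRel_toOp q0 ?_ hk1 hk2 hf1 hf2
    have := (hj.mul_torus (inv_ne_zero q0)).smul (-(q ^ (-2 : ℤ))⁻¹) (-1)
    rw [neg_one_smul, c11, c22, neg_smul, smul_smul, inv_mul_cancel₀ hs, one_smul] at this
    exact this
  · rw [toOp_mul_left he1, toOp_mul_left hf1, ← map_sub, ← map_smul, ← map_add]
    congr 1
    simp only [antipodeGen, neg_mul_neg]
    have E1 : ubarGen F q d f1 * ubarGen F q d k1 * (ubarGen F q d UqGen.K1 * ubarGen F q d e1) =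
        ubarGen F q d f1 * ubarGen F q d e1 := by rw [mul_assoc, K1]
    have E2 : ubarGen F q d UqGen.K1 * ubarGen F q d e1 * (ubarGen F q d f1 * ubarGen F q d k1) =
        ubarGen F q d e1 * ubarGen F q d f1 := by
      have t := qcomm_symm hs c11
      have t' := h.pos.e1k1
      rw [t, mul_smul_comm, mul_assoc, ← mul_assoc (ubarGen F q d e1), t', smul_mul_assoc,
        mul_smul_comm, smul_smul, inv_mul_cancel₀ hs, one_smul, mul_assoc, K1']
    rw [E1, E2, h.e1f1]
    module
  · rw [toOp_mul_odd he2 hf2, toOp_mul_odd hf2 he2, ← map_sub, ← map_smul, ← map_neg, ← map_neg,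
      ← map_neg, ← map_add]
    congr 1
    simp only [antipodeGen, neg_mul_neg]
    have E1 : ubarGen F q d f2 * ubarGen F q d k2 * (ubarGen F q d UqGen.K2 * ubarGen F q d e2) =
        ubarGen F q d f2 * ubarGen F q d e2 := by rw [mul_assoc, K2]
    have E2 : ubarGen F q d UqGen.K2 * ubarGen F q d e2 * (ubarGen F q d f2 * ubarGen F q d k2) =
        ubarGen F q d e2 * ubarGen F q d f2 := by
      rw [← c22, mul_assoc, ← mul_assoc (ubarGen F q d e2), h.pos.e2k2, mul_assoc, K2']
    rw [E1, E2, h.e2f2]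
    module
  · rw [toOp_mul_left he1, toOp_mul_right _ he1]
    congr 1
    simp only [antipodeGen, neg_mul_neg]
    have t1 : ubarGen F q d k2 * (ubarGen F q d UqGen.K1 * ubarGen F q d e1) =
      q⁻¹ • (ubarGen F q d UqGen.K1 * ubarGen F q d e1 * ubarGen F q d k2) := by
      have t2 : ubarGen F q d k2 * ubarGen F q d UqGen.K1 =
          ubarGen F q d UqGen.K1 * ubarGen F q d k2 := by
        have := BorelRel.qcomm_of_inv one_ne_zero h.k1K1 h.K1k1 (e := ubarGen F q d k2) (c := (1 : F))
          (by rw [one_smul, h.pos.k2k1])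
        simpa using this
      rw [← mul_assoc, t2, mul_assoc, qcomm_symm q0 h.pos.e1k2, mul_smul_comm, mul_assoc]
    rw [mul_assoc, t1, mul_smul_comm, ← mul_assoc, ← mul_assoc, h.neg.e2k1, smul_mul_assoc,
      smul_mul_assoc, smul_smul, inv_mul_cancel₀ q0, one_smul]
    simp only [mul_assoc]
    rw [← mul_assoc (ubarGen F q d f2), ← h.e1f2]
    simp only [mul_assoc]
  · rw [toOp_mul_left hf1, toOp_mul_right _ hf1]
    congr 1
    simp only [antipodeGen, neg_mul_neg]
    have t1 : ubarGen F q d k1 * (ubarGen F q d UqGen.K2 * ubarGen F q d e2) =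
      q⁻¹ • (ubarGen F q d UqGen.K2 * ubarGen F q d e2 * ubarGen F q d k1) := by
      have t2 : ubarGen F q d k1 * ubarGen F q d UqGen.K2 =
          ubarGen F q d UqGen.K2 * ubarGen F q d k1 := by
        have := BorelRel.qcomm_of_inv one_ne_zero h.k2K2 h.K2k2 (e := ubarGen F q d k1) (c := (1 : F))
          (by rw [one_smul, h.pos.k2k1])
        simpa using this
      rw [← mul_assoc, t2, mul_assoc, qcomm_symm q0 h.pos.e2k1, mul_smul_comm, mul_assoc]
    rw [mul_assoc, t1, mul_smul_comm, ← mul_assoc, ← mul_assoc, h.neg.e1k2, smul_mul_assoc,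
      smul_mul_assoc, smul_smul, inv_mul_cancel₀ q0, one_smul]
    simp only [mul_assoc]
    rw [← mul_assoc (ubarGen F q d f1), ← h.e2f1]
    simp only [mul_assoc]

/-- The antipode of `Ū_q`. -/
def ubarAntipode (hq : q ≠ 0) : Ubar F q d →ₐ[F] UbarOp F q d := ubarLift (ubarSat_antipode hq)

@[simp] theorem ubarAntipode_gen (hq : q ≠ 0) (g : UqGen) :
    ubarAntipode (F := F) (d := d) hq (ubarGen F q d g) = antipodeGen (q := q) g :=
  ubarLift_gen _ _

end Antipode

end UbarHopf

section UbarHopf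

open UqGen SuperHopfData

variable {F : Type*} [Field F] {q : F} {d : ℕ}

theorem ubar_induction_right {P : Ubar F q d → Prop} (add : ∀ x y, P x → P y → P (x + y))
    (smul : ∀ (c : F) x, P x → P (c • x)) (one : P 1)
    (mul : ∀ i x, P x → P (x * ubarGen F q d i)) (x : Ubar F q d) : P x :=
  induction_of_adjoin_right adjoin_ubarGen add smul one (by rintro _ ⟨i, rfl⟩; exact mul i) x

theorem IsSuperAlgHom.ext_ubar {V : Type*} [AddCommGroup V] [Module F V] {B : SuperHopfData F V}
    {f g : Ubar F q d →ₗ[F] V} (hf : IsSuperAlgHom (ubarAlg F q d) B f)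
    (hg : IsSuperAlgHom (ubarAlg F q d) B g)
    (h : ∀ i, f (ubarGen F q d i) = g (ubarGen F q d i)) : f = g := by
  ext x
  induction x using ubar_induction with
  | add x y hx hy => rw [map_add, map_add, hx, hy]
  | smul c x hx => rw [map_smul, map_smul, hx]
  | one => exact hf.map_one.trans hg.map_one.symm
  | mul i x hx =>
    rw [← ubarAlg_m, hf.map_m, hg.map_m, hx, h]

theorem scalars_isSuperAlg : (scalars F).IsSuperAlg where
  grading := scalars_grading
  mul_even := IsEvenMap.of_tmul scalars_grading scalars_grading scalars_grading
    fun i j x y hx hy => by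
      rcases zmod_two_cases i with rfl | rfl
      · rcases zmod_two_cases j with rfl | rfl
        · simp [scalars]
        · have : y = 0 := by simpa [scalars] using hy.symm
          simp [this]
      · have : x = 0 := by simpa [scalars] using hx.symm
        simp [this]
  one_even := by simp [scalars]
  mul_assoc := mul_assoc
  one_mul := one_mul
  mul_one := mul_one

theorem counitGen_of_odd {g : UqGen} {j : ZMod 2} (T : Ubar F q d) :
    koszulSign F (g.deg * j) • ((counitGen g : F) • T) = (counitGen g : F) • T := by
  cases g <;> simp [UqGen.deg, counitGen]

variable [CharZero F]

theorem isEvenMap_ubar {V : Type*} [AddCommGroup V] [Module F V] {B : SuperHopfData F V}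
    (hB : B.IsSuperAlg) {f : Ubar F q d →ₗ[F] V} (h1 : f 1 = B.one)
    (hm : ∀ x y, f (x * y) = B.m (f x) (f y))
    (h : ∀ i : UqGen, B.part i.deg (f (ubarGen F q d i)) = f (ubarGen F q d i)) :
    IsSuperAlgHom (ubarAlg F q d) B f where
  even i := by
    ext x
    rw [LinearMap.comp_apply, LinearMap.comp_apply]
    induction x using ubar_induction generalizing i with
    | add x y hx hy => rw [map_add, map_add, map_add, map_add, hx, hy]
    | smul c x hx => rw [map_smul, map_smul, map_smul, map_smul, hx]
    | one =>
      rw [ubarAlg_grading.apply_of_hom ubar_one_even, h1, hB.grading.apply_of_hom hB.one_even]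
      split_ifs
      · exact h1
      · exact map_zero f
    | mul g x hx =>
      have e : i = g.deg + (i - g.deg) := by ring
      have h2 := ubarAlg_isSuperAlg.part_hom_m (ubarGen_hom (F := F) (q := q) (d := d) g)
        (i - g.deg) x
      rw [← e, ubarAlg_m, ubarAlg_m] at h2
      have h3 := hB.part_hom_m (h g) (i - g.deg) (f x)
      rw [← e] at h3
      rw [h2, hm, hx, hm, h3]
  map_m := hm
  map_one := h1

variable (hq : IsOddRoot q d)

/-- The coproduct of `Ū_q` as a linear map. -/
def ubarComulₗ : Ubar F q d →ₗ[F] Ubar F q d ⊗[F] Ubar F q d where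
  toFun x := ubarComul hq x
  map_add' x y := map_add (ubarComul hq) x y
  map_smul' c x := map_smul (ubarComul hq) c x

/-- The antipode of `Ū_q` as a linear map. -/
def ubarAntipodeₗ : Ubar F q d →ₗ[F] Ubar F q d where
  toFun x := ubarAntipode hq.ne_zero x
  map_add' x y := map_add (ubarAntipode hq.ne_zero) x y
  map_smul' c x := map_smul (ubarAntipode hq.ne_zero) c x

/-- The Hopf superalgebra structure of `Ū_q`. -/
def ubarHopf : SuperHopfData F (Ubar F q d) :=
  { ubarAlg F q d with
    comul := ubarComulₗ hq
    counit := (ubarCounit hq.pos).toLinearMap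
    antipode := ubarAntipodeₗ hq
    antipodeInv := ubarAntipodeₗ hq ∘ₗ
      LinearMap.mulLeftRight F (ubarGen F q d K2 ^ 2, ubarGen F q d k2 ^ 2) }

theorem ubarComulₗ_gen (g : UqGen) : ubarComulₗ hq (ubarGen F q d g) = comulGen g :=
  ubarComul_gen hq g

/-- The coproducts of the generators of `Ū_q`. -/
def comulGenTmul : UqGen → Ubar F q d ⊗[F] Ubar F q d
  | k1 => ubarGen F q d k1 ⊗ₜ[F] ubarGen F q d k1
  | k2 => ubarGen F q d k2 ⊗ₜ[F] ubarGen F q d k2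
  | K1 => ubarGen F q d K1 ⊗ₜ[F] ubarGen F q d K1
  | K2 => ubarGen F q d K2 ⊗ₜ[F] ubarGen F q d K2
  | e1 => ubarGen F q d e1 ⊗ₜ[F] 1 + ubarGen F q d k1 ⊗ₜ[F] ubarGen F q d e1
  | e2 => ubarGen F q d e2 ⊗ₜ[F] 1 + ubarGen F q d k2 ⊗ₜ[F] ubarGen F q d e2
  | f1 => ubarGen F q d f1 ⊗ₜ[F] ubarGen F q d K1 + 1 ⊗ₜ[F] ubarGen F q d f1
  | f2 => ubarGen F q d f2 ⊗ₜ[F] ubarGen F q d K2 + 1 ⊗ₜ[F] ubarGen F q d f2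

theorem ubarComulₗ_gen_tmul (g : UqGen) :
    ubarComulₗ hq (ubarGen F q d g) = comulGenTmul g := by
  refine (ubarComulₗ_gen hq g).trans ?_
  cases g <;> rfl

theorem ubarAntipodeₗ_gen (g : UqGen) : ubarAntipodeₗ hq (ubarGen F q d g) = antipodeGen g :=
  ubarAntipode_gen hq.ne_zero g

theorem sq_hom {i j k : ZMod 2} (hk : i + j = k) {a b : Ubar F q d}
    (ha : (ubarAlg F q d).part i a = a) (hb : (ubarAlg F q d).part j b = b) :
    ((ubarAlg F q d).tensor (ubarAlg F q d)).part k (sqTmul a b) = sqTmul a b := by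
  subst hk
  exact tensor_hom ubarAlg_grading ubarAlg_grading ha hb

theorem comulGen_hom (g : UqGen) : ((ubarAlg F q d).tensor (ubarAlg F q d)).part g.deg
    (comulGenTmul g) = comulGen g := by
  have h := ubarGen_hom (F := F) (q := q) (d := d)
  have h1 := ubar_one_even (F := F) (q := q) (d := d)
  have add {i : ZMod 2} {x y : Ubar F q d ⊗[F] Ubar F q d}
      (hx : ((ubarAlg F q d).tensor (ubarAlg F q d)).part i x = x)
      (hy : ((ubarAlg F q d).tensor (ubarAlg F q d)).part i y = y) :
      ((ubarAlg F q d).tensor (ubarAlg F q d)).part i (x + y) = x + y :=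
    (map_add _ _ _).trans (congrArg₂ _ hx hy)
  cases g
  · exact sq_hom (by simp [UqGen.deg]) (h k1) (h k1)
  · exact sq_hom (by simp [UqGen.deg]) (h k2) (h k2)
  · exact sq_hom (by simp [UqGen.deg]) (h K1) (h K1)
  · exact sq_hom (by simp [UqGen.deg]) (h K2) (h K2)
  · exact add (sq_hom (by simp [UqGen.deg]) (h e1) h1)
      (sq_hom (by simp [UqGen.deg]) (h k1) (h e1))
  · exact add (sq_hom (by simp [UqGen.deg]) (h e2) h1)
      (sq_hom (by simp [UqGen.deg]) (h k2) (h e2))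
  · exact add (sq_hom (by simp [UqGen.deg]) (h f1) (h K1))
      (sq_hom (by simp [UqGen.deg]) h1 (h f1))
  · exact add (sq_hom (by simp [UqGen.deg]) (h f2) (h K2))
      (sq_hom (by simp [UqGen.deg]) h1 (h f2))

theorem ubarComul_hom : IsSuperAlgHom (ubarAlg F q d) ((ubarAlg F q d).tensor (ubarAlg F q d))
    (ubarComulₗ hq) :=
  isEvenMap_ubar (ubarAlg_isSuperAlg.tensor ubarAlg_isSuperAlg) (map_one (ubarComul hq))
    (map_mul (ubarComul hq)) fun i => by rw [ubarComulₗ_gen_tmul]; exact comulGen_hom i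

theorem ubarCounit_hom : IsSuperAlgHom (ubarAlg F q d) (scalars F)
    (ubarCounit hq.pos).toLinearMap :=
  isEvenMap_ubar scalars_isSuperAlg (map_one (ubarCounit hq.pos))
    (map_mul (ubarCounit hq.pos)) fun i => by
      rw [AlgHom.toLinearMap_apply, ubarCounit_gen]
      cases i <;> simp [counitGen, scalars, UqGen.deg]

theorem ubarAntipode_hom : IsSuperAlgHom (ubarAlg F q d) (ubarAlg F q d).superOp
    (ubarAntipodeₗ hq) :=
  isEvenMap_ubar ubarAlg_isSuperAlg.superOp (map_one (ubarAntipode hq.ne_zero))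
    (map_mul (ubarAntipode hq.ne_zero)) fun i => by rw [ubarAntipodeₗ_gen]; exact antipodeGen_hom i

theorem ubarAntipode_hom_apply {i : ZMod 2} {x : Ubar F q d} (hx : (ubarAlg F q d).part i x = x) :
    (ubarAlg F q d).part i (ubarAntipodeₗ hq x) = ubarAntipodeₗ hq x :=
  (ubarAntipode_hom hq).even.hom hx

theorem ubarAntipode_mul {i j : ZMod 2} {x y : Ubar F q d} (hx : (ubarAlg F q d).part i x = x)
    (hy : (ubarAlg F q d).part j y = y) :
    ubarAntipodeₗ hq (x * y) = koszulSign F (i * j) • (ubarAntipodeₗ hq y * ubarAntipodeₗ hq x) := by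
  rw [← ubarAlg_m, (ubarAntipode_hom hq).map_m, superOp_m ubarAlg_grading
    (ubarAntipode_hom_apply hq hx) (ubarAntipode_hom_apply hq hy), ubarAlg_m]

theorem ubarAntipode_one : ubarAntipodeₗ hq (1 : Ubar F q d) = 1 := (ubarAntipode_hom hq).map_one

theorem ubarAntipode_mul_left {x : Ubar F q d} (hx : (ubarAlg F q d).part 0 x = x)
    (y : Ubar F q d) : ubarAntipodeₗ hq (x * y) = ubarAntipodeₗ hq y * ubarAntipodeₗ hq x := by
  refine ubarAlg_grading.induction (P := fun y => ubarAntipodeₗ hq (x * y) =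
    ubarAntipodeₗ hq y * ubarAntipodeₗ hq x) (fun a b ha hb => ?_) (fun j y hy => ?_) y
  · rw [mul_add, map_add, map_add, add_mul, ha, hb]
  · rw [ubarAntipode_mul hq hx hy, zero_mul, koszulSign_zero, one_smul]

theorem ubarAntipode_mul_right (x : Ubar F q d) {y : Ubar F q d}
    (hy : (ubarAlg F q d).part 0 y = y) :
    ubarAntipodeₗ hq (x * y) = ubarAntipodeₗ hq y * ubarAntipodeₗ hq x := by
  refine ubarAlg_grading.induction (P := fun x => ubarAntipodeₗ hq (x * y) =
    ubarAntipodeₗ hq y * ubarAntipodeₗ hq x) (fun a b ha hb => ?_) (fun j x hx => ?_) x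
  · rw [add_mul, map_add, map_add, mul_add, ha, hb]
  · rw [ubarAntipode_mul hq hx hy, mul_zero, koszulSign_zero, one_smul]

theorem ubar_k2_sq (g : UqGen) : ubarGen F q d k2 ^ 2 * ubarGen F q d g * ubarGen F q d K2 ^ 2 =
    ubarAntipodeₗ hq (antipodeGen g) := by
  have h := ubarSat (F := F) (q := q) (d := d)
  have q0 := hq.ne_zero
  have hs : q ^ (-2 : ℤ) ≠ 0 := zpow_ne_zero _ q0
  obtain ⟨c11, c12, c21, c22⟩ := h.k_f_comm
  have key {x : Ubar F q d} {c : F} (hx : ubarGen F q d k2 * x = c • (x * ubarGen F q d k2)) :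
      ubarGen F q d k2 ^ 2 * x * ubarGen F q d K2 ^ 2 = c ^ 2 • x := by
    rw [qcomm_pow_left hx, smul_mul_assoc, mul_assoc, ← (show Commute (ubarGen F q d k2)
      (ubarGen F q d K2) from h.k2K2.trans h.K2k2.symm).mul_pow, h.k2K2, one_pow, mul_one]
  have hk1 := ubarGen_hom (F := F) (q := q) (d := d) k1
  have hk2 := ubarGen_hom (F := F) (q := q) (d := d) k2
  have hK1 := ubarGen_hom (F := F) (q := q) (d := d) K1
  have hK2 := ubarGen_hom (F := F) (q := q) (d := d) K2
  simp only [UqGen.deg] at hk1 hk2 hK1 hK2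
  have t1 : ubarGen F q d k2 * ubarGen F q d k1 =
      (1 : F) • (ubarGen F q d k1 * ubarGen F q d k2) := by rw [one_smul, h.pos.k2k1]
  have q2 : q⁻¹ ^ 2 = q ^ (-2 : ℤ) := by rw [zpow_neg, inv_pow, zpow_ofNat]
  cases g <;> simp only [antipodeGen, ubarAntipodeₗ_gen, map_neg]
  · simpa using key t1
  · simpa using key (c := 1) (by rw [one_smul])
  · simpa using key (BorelRel.qcomm_of_inv one_ne_zero h.k1K1 h.K1k1 t1)
  · simpa using key (c := 1) (x := ubarGen F q d K2) (by rw [one_smul, h.k2K2, h.K2k2])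
  · rw [key (qcomm_symm q0 h.pos.e1k2), ubarAntipode_mul_left hq hK1, ubarAntipodeₗ_gen,
      ubarAntipodeₗ_gen, antipodeGen, antipodeGen, neg_mul, neg_neg, mul_assoc, h.pos.e1k1,
      mul_smul_comm, ← mul_assoc, h.K1k1, one_mul, q2]
  · rw [key (c := 1) (by rw [one_smul, h.pos.e2k2]), ubarAntipode_mul_left hq hK2,
      ubarAntipodeₗ_gen, ubarAntipodeₗ_gen, antipodeGen, antipodeGen, neg_mul, neg_neg, mul_assoc,
      h.pos.e2k2, ← mul_assoc, h.K2k2, one_mul, one_pow, one_smul]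
  · rw [key c21, ubarAntipode_mul_right hq _ hk1, ubarAntipodeₗ_gen, ubarAntipodeₗ_gen, antipodeGen,
      antipodeGen, mul_neg, neg_neg, qcomm_symm hs c11, mul_smul_comm, ← mul_assoc, h.K1k1,
      one_mul, zpow_neg, inv_inv, zpow_ofNat]
  · rw [key (c := 1) (by rw [one_smul, c22]), ubarAntipode_mul_right hq _ hk2,
      ubarAntipodeₗ_gen, ubarAntipodeₗ_gen, antipodeGen, antipodeGen, mul_neg, neg_neg,
      ← c22, ← mul_assoc, h.K2k2, one_mul, one_pow, one_smul]

theorem ubarAntipode_sq (x : Ubar F q d) : ubarAntipodeₗ hq (ubarAntipodeₗ hq x) =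
    ubarGen F q d k2 ^ 2 * x * ubarGen F q d K2 ^ 2 := by
  have h := ubarSat (F := F) (q := q) (d := d)
  have hc : ubarGen F q d K2 ^ 2 * ubarGen F q d k2 ^ 2 = 1 := by
    rw [← (show Commute (ubarGen F q d K2) (ubarGen F q d k2) from h.K2k2.trans h.k2K2.symm).mul_pow,
      h.K2k2, one_pow]
  have key : ∀ x y, ubarAntipodeₗ hq (ubarAntipodeₗ hq (x * y)) =
      ubarAntipodeₗ hq (ubarAntipodeₗ hq x) * ubarAntipodeₗ hq (ubarAntipodeₗ hq y) :=
    IsSuperAlgHom.map_m_of_hom (A := ubarAlg F q d) (B := ubarAlg F q d)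
      (f := ubarAntipodeₗ hq ∘ₗ ubarAntipodeₗ hq) ubarAlg_grading fun i j x y hx hy => by
        simp only [LinearMap.comp_apply, ubarAlg_m]
        rw [ubarAntipode_mul hq hx hy, map_smul, ubarAntipode_mul hq
          (ubarAntipode_hom_apply hq hy) (ubarAntipode_hom_apply hq hx), smul_smul, mul_comm j i,
          koszulSign_mul_self, one_smul]
  induction x using ubar_induction with
  | add x y hx hy => rw [map_add, map_add, hx, hy]; noncomm_ring
  | smul c x hx => rw [map_smul, map_smul, hx]; simp
  | one =>
    rw [ubarAntipode_one, ubarAntipode_one, mul_one,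
      ← (show Commute (ubarGen F q d k2) (ubarGen F q d K2) from h.k2K2.trans h.K2k2.symm).mul_pow,
      h.k2K2, one_pow]
  | mul g x hx =>
    rw [key, hx, ubarAntipodeₗ_gen, ← ubar_k2_sq hq]
    calc _ = ubarGen F q d k2 ^ 2 * ubarGen F q d g * (ubarGen F q d K2 ^ 2 *
          ubarGen F q d k2 ^ 2) * x * ubarGen F q d K2 ^ 2 := by simp only [mul_assoc]
      _ = _ := by rw [hc, mul_one]; simp only [mul_assoc]

/-- `m ∘ (S ⊗ id)`. -/
def ubarConvLeft : Ubar F q d ⊗[F] Ubar F q d →ₗ[F] Ubar F q d :=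
  LinearMap.mul' F (Ubar F q d) ∘ₗ TensorProduct.map (ubarAntipodeₗ hq) LinearMap.id

/-- `m ∘ (id ⊗ S)`. -/
def ubarConvRight : Ubar F q d ⊗[F] Ubar F q d →ₗ[F] Ubar F q d :=
  LinearMap.mul' F (Ubar F q d) ∘ₗ TensorProduct.map LinearMap.id (ubarAntipodeₗ hq)

theorem ubarConvLeft_tmul (a b : Ubar F q d) :
    ubarConvLeft hq (a ⊗ₜ b) = ubarAntipodeₗ hq a * b := rfl

theorem ubarConvRight_tmul (a b : Ubar F q d) :
    ubarConvRight hq (a ⊗ₜ b) = a * ubarAntipodeₗ hq b := rfl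

theorem ubarConvLeft_m {i j : ZMod 2} {a : Ubar F q d} (b : Ubar F q d)
    (ha : (ubarAlg F q d).part i a = a) {G : Ubar F q d ⊗[F] Ubar F q d}
    (hG : ((ubarAlg F q d).tensor (ubarAlg F q d)).part j G = G) :
    ubarConvLeft hq (((ubarAlg F q d).tensor (ubarAlg F q d)).m G (a ⊗ₜ b)) =
      koszulSign F (j * i) • (ubarAntipodeₗ hq a * ubarConvLeft hq G * b) := by
  rw [← hG]
  clear hG
  refine ubarAlg_grading.tensor_induction ubarAlg_grading (P := fun G =>
    ubarConvLeft hq (((ubarAlg F q d).tensor (ubarAlg F q d)).m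
      (((ubarAlg F q d).tensor (ubarAlg F q d)).part j G) (a ⊗ₜ b)) =
      koszulSign F (j * i) • (ubarAntipodeₗ hq a *
        ubarConvLeft hq (((ubarAlg F q d).tensor (ubarAlg F q d)).part j G) * b))
    (fun x y hx hy => by simp only [map_add, add_m, mul_add, add_mul, smul_add, hx, hy])
    (fun l l' g g' hg hg' => ?_) G
  rw [show ((ubarAlg F q d).tensor (ubarAlg F q d)).part j (g ⊗ₜ g') = _ from
    tensorPart_tmul ubarAlg_grading ubarAlg_grading hg hg' j]
  split_ifs with hj
  · rw [IsSuperAlg.tensor_m ubarAlg_grading ubarAlg_grading g b hg' ha, map_smul,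
      ubarConvLeft_tmul, ubarConvLeft_tmul, ubarAlg_m, ubarAlg_m, ubarAntipode_mul hq hg ha,
      smul_mul_assoc, smul_smul, ← koszulSign_add, hj, add_mul, add_comm]
    simp only [mul_assoc]
  · simp

theorem ubarConvRight_m {i j : ZMod 2} (a : Ubar F q d) {b : Ubar F q d}
    (hb : (ubarAlg F q d).part i b = b) {G : Ubar F q d ⊗[F] Ubar F q d}
    (hG : ((ubarAlg F q d).tensor (ubarAlg F q d)).part j G = G) :
    ubarConvRight hq (((ubarAlg F q d).tensor (ubarAlg F q d)).m (a ⊗ₜ b) G) =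
      koszulSign F (j * i) • (a * ubarConvRight hq G * ubarAntipodeₗ hq b) := by
  rw [← hG]
  clear hG
  refine ubarAlg_grading.tensor_induction ubarAlg_grading (P := fun G =>
    ubarConvRight hq (((ubarAlg F q d).tensor (ubarAlg F q d)).m (a ⊗ₜ b)
      (((ubarAlg F q d).tensor (ubarAlg F q d)).part j G)) =
      koszulSign F (j * i) • (a *
        ubarConvRight hq (((ubarAlg F q d).tensor (ubarAlg F q d)).part j G) *
        ubarAntipodeₗ hq b))
    (fun x y hx hy => by simp only [map_add, m_add, mul_add, add_mul, smul_add, hx, hy])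
    (fun l l' g g' hg hg' => ?_) G
  rw [show ((ubarAlg F q d).tensor (ubarAlg F q d)).part j (g ⊗ₜ g') = _ from
    tensorPart_tmul ubarAlg_grading ubarAlg_grading hg hg' j]
  split_ifs with hj
  · rw [IsSuperAlg.tensor_m ubarAlg_grading ubarAlg_grading a g' hb hg, map_smul,
      ubarConvRight_tmul, ubarConvRight_tmul, ubarAlg_m, ubarAlg_m, ubarAntipode_mul hq hb hg',
      mul_smul_comm, smul_smul, ← koszulSign_add, hj, add_mul, mul_comm i l, mul_comm i l']
    simp only [mul_assoc]
  · simp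

theorem ubarConvLeft_gen (g : UqGen) :
    ubarConvLeft hq (comulGenTmul (F := F) (q := q) (d := d) g) =
      (counitGen g : F) • (1 : Ubar F q d) := by
  have h := ubarSat (F := F) (q := q) (d := d)
  have hp (a b : Ubar F q d) : ubarConvLeft hq (a ⊗ₜ b) = ubarAntipodeₗ hq a * b := rfl
  have ha (x y : Ubar F q d ⊗[F] Ubar F q d) : ubarConvLeft hq (x + y) = ubarConvLeft hq x + ubarConvLeft hq y :=
    map_add (ubarConvLeft hq) x y
  cases g <;> simp only [comulGenTmul, counitGen, ha, hp, ubarAntipodeₗ_gen, antipodeGen,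
    ubarAntipode_one, one_smul, zero_smul]
  · exact h.K1k1
  · exact h.K2k2
  · exact h.k1K1
  · exact h.k2K2
  · simp
  · simp
  · simp [mul_assoc, h.k1K1]
  · simp [mul_assoc, h.k2K2]

theorem ubarConvRight_gen (g : UqGen) :
    ubarConvRight hq (comulGenTmul (F := F) (q := q) (d := d) g) =
      (counitGen g : F) • (1 : Ubar F q d) := by
  have h := ubarSat (F := F) (q := q) (d := d)
  have hp (a b : Ubar F q d) : ubarConvRight hq (a ⊗ₜ b) = a * ubarAntipodeₗ hq b := rfl
  have ha (x y : Ubar F q d ⊗[F] Ubar F q d) :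
      ubarConvRight hq (x + y) = ubarConvRight hq x + ubarConvRight hq y :=
    map_add (ubarConvRight hq) x y
  cases g <;> simp only [comulGenTmul, counitGen, ha, hp, ubarAntipodeₗ_gen, antipodeGen,
    ubarAntipode_one, one_smul, zero_smul]
  · exact h.k1K1
  · exact h.k2K2
  · exact h.K1k1
  · exact h.K2k2
  · simp [← mul_assoc, h.k1K1]
  · simp [← mul_assoc, h.k2K2]
  · simp
  · simp

theorem ubarHopf_isHopf : (ubarHopf (F := F) hq).IsHopf where
  grading := ubarAlg_grading
  mul_even := ubarAlg_isSuperAlg.mul_even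
  one_even := ubarAlg_isSuperAlg.one_even
  mul_assoc := ubarAlg_isSuperAlg.mul_assoc
  one_mul := ubarAlg_isSuperAlg.one_mul
  mul_one := ubarAlg_isSuperAlg.mul_one
  comul_even := (ubarComul_hom hq).even
  counit_even := by
    have := (ubarCounit_hom (F := F) hq).even 1
    simp [scalars] at this
    exact this
  coassoc := by
    have hU := ubarAlg_isSuperAlg (F := F) (q := q) (d := d)
    have hΔ := ubarComul_hom (F := F) hq
    have hid : IsSuperAlgHom (ubarAlg F q d) (ubarAlg F q d) LinearMap.id := IsSuperAlgHom.id
    have hUU := hU.tensor hU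
    refine IsSuperAlgHom.ext_ubar ((hU.assoc_hom hU hU).comp
      ((hΔ.tensor hU.grading hU.grading hUU.grading hU.grading hid).comp hΔ))
      ((hid.tensor hU.grading hU.grading hU.grading hUU.grading hΔ).comp hΔ) fun i => ?_
    have hc : (ubarHopf (F := F) hq).comul = ubarComulₗ hq := rfl
    have he (i : UqGen) : (ubarHopf (F := F) hq).counit (ubarGen F q d i) = counitGen i :=
      ubarCounit_gen hq.pos i
    have he1 : (ubarHopf (F := F) hq).counit (1 : Ubar F q d) = 1 := map_one (ubarCounit hq.pos)
    simp only [LinearMap.comp_apply, hc, ubarComulₗ_gen_tmul]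
    have h1 : ubarComulₗ hq (1 : Ubar F q d) = 1 ⊗ₜ[F] 1 := hΔ.map_one
    cases i <;> simp only [comulGenTmul, map_add, TensorProduct.map_tmul, ubarComulₗ_gen_tmul, h1,
      LinearMap.id_apply, TensorProduct.add_tmul, TensorProduct.tmul_add, LinearEquiv.coe_coe,
      TensorProduct.assoc_tmul]
    all_goals abel
  counit_left := by
    have hU := ubarAlg_isSuperAlg (F := F) (q := q) (d := d)
    have hΔ := ubarComul_hom (F := F) hq
    have hid : IsSuperAlgHom (ubarAlg F q d) (ubarAlg F q d) LinearMap.id := IsSuperAlgHom.id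
    refine IsSuperAlgHom.ext_ubar (hU.lid_hom.comp (((ubarCounit_hom hq).tensor hU.grading
      hU.grading scalars_grading hU.grading hid).comp hΔ)) hid fun i => ?_
    have hc : (ubarHopf (F := F) hq).comul = ubarComulₗ hq := rfl
    have he (i : UqGen) : (ubarHopf (F := F) hq).counit (ubarGen F q d i) = counitGen i :=
      ubarCounit_gen hq.pos i
    have he1 : (ubarHopf (F := F) hq).counit (1 : Ubar F q d) = 1 := map_one (ubarCounit hq.pos)
    simp only [LinearMap.comp_apply, hc, ubarComulₗ_gen_tmul]
    cases i <;> simp [comulGenTmul, he, he1, counitGen]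
  counit_right := by
    have hU := ubarAlg_isSuperAlg (F := F) (q := q) (d := d)
    have hΔ := ubarComul_hom (F := F) hq
    have hid : IsSuperAlgHom (ubarAlg F q d) (ubarAlg F q d) LinearMap.id := IsSuperAlgHom.id
    refine IsSuperAlgHom.ext_ubar (hU.rid_hom.comp ((hid.tensor hU.grading
      hU.grading hU.grading scalars_grading (ubarCounit_hom hq)).comp hΔ)) hid fun i => ?_
    have hc : (ubarHopf (F := F) hq).comul = ubarComulₗ hq := rfl
    have he (i : UqGen) : (ubarHopf (F := F) hq).counit (ubarGen F q d i) = counitGen i :=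
      ubarCounit_gen hq.pos i
    have he1 : (ubarHopf (F := F) hq).counit (1 : Ubar F q d) = 1 := map_one (ubarCounit hq.pos)
    simp only [LinearMap.comp_apply, hc, ubarComulₗ_gen_tmul]
    cases i <;> simp [comulGenTmul, he, he1, counitGen]
  comul_one := (ubarComul_hom hq).map_one
  comul_mul := (ubarComul_hom hq).map_m
  counit_one := map_one (ubarCounit hq.pos)
  counit_mul := map_mul (ubarCounit hq.pos)
  antipode_even := (ubarAntipode_hom hq).even
  antipode_left x := by
    change ubarConvLeft hq (ubarComulₗ hq x) = ubarCounit hq.pos x • (1 : Ubar F q d)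
    induction x using ubar_induction with
    | add x y hx hy => rw [map_add, map_add, map_add, add_smul, hx, hy]
    | smul c x hx => rw [map_smul, map_smul, map_smul, hx, smul_assoc]
    | one =>
      rw [map_one (ubarCounit hq.pos), one_smul, show ubarComulₗ hq (1 : Ubar F q d) = 1 ⊗ₜ[F] 1 from
        (ubarComul_hom hq).map_one, ubarConvLeft_tmul, ubarAntipode_one, mul_one]
    | mul g x hx =>
      have hm := (ubarComul_hom hq).map_m (ubarGen F q d g) x
      rw [ubarAlg_m, ubarComulₗ_gen_tmul] at hm
      rw [hm, map_mul, ubarCounit_gen, mul_smul, ← hx]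
      refine ubarAlg_grading.tensor_induction ubarAlg_grading (P := fun T => ubarConvLeft hq
        (((ubarAlg F q d).tensor (ubarAlg F q d)).m (comulGenTmul g) T) =
          (counitGen g : F) • ubarConvLeft hq T)
        (fun a b ha hb => by rw [m_add, map_add, map_add, ha, hb, smul_add])
        (fun i j a b ha hb => ?_) _
      rw [ubarConvLeft_m hq b ha (comulGen_hom g), ubarConvLeft_gen, mul_smul_comm, mul_one,
        smul_mul_assoc, counitGen_of_odd, ubarConvLeft_tmul]
  antipode_right x := by
    change ubarConvRight hq (ubarComulₗ hq x) = ubarCounit hq.pos x • (1 : Ubar F q d)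
    induction x using ubar_induction_right with
    | add x y hx hy => rw [map_add, map_add, map_add, add_smul, hx, hy]
    | smul c x hx => rw [map_smul, map_smul, map_smul, hx, smul_assoc]
    | one =>
      rw [map_one (ubarCounit hq.pos), one_smul, show ubarComulₗ hq (1 : Ubar F q d) = 1 ⊗ₜ[F] 1 from
        (ubarComul_hom hq).map_one, ubarConvRight_tmul, ubarAntipode_one, mul_one]
    | mul g x hx =>
      have hm := (ubarComul_hom hq).map_m x (ubarGen F q d g)
      rw [ubarAlg_m, ubarComulₗ_gen_tmul] at hm
      rw [hm, map_mul, ubarCounit_gen, mul_comm, mul_smul, ← hx]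
      refine ubarAlg_grading.tensor_induction ubarAlg_grading (P := fun T => ubarConvRight hq
        (((ubarAlg F q d).tensor (ubarAlg F q d)).m T (comulGenTmul g)) =
          (counitGen g : F) • ubarConvRight hq T)
        (fun a b ha hb => by rw [add_m, map_add, map_add, ha, hb, smul_add])
        (fun i j a b ha hb => ?_) _
      rw [ubarConvRight_m hq a hb (comulGen_hom g), ubarConvRight_gen, mul_smul_comm, mul_one,
        smul_mul_assoc, counitGen_of_odd, ubarConvRight_tmul]
  antipode_antipodeInv x := by
    have h := ubarSat (F := F) (q := q) (d := d)
    have hc : ubarGen F q d k2 ^ 2 * ubarGen F q d K2 ^ 2 = 1 := by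
      rw [← (show Commute (ubarGen F q d k2) (ubarGen F q d K2) from
        h.k2K2.trans h.K2k2.symm).mul_pow, h.k2K2, one_pow]
    change ubarAntipodeₗ hq (ubarAntipodeₗ hq (LinearMap.mulLeftRight F _ x)) = x
    rw [ubarAntipode_sq, LinearMap.mulLeftRight_apply]
    calc _ = (ubarGen F q d k2 ^ 2 * ubarGen F q d K2 ^ 2) * x *
        (ubarGen F q d k2 ^ 2 * ubarGen F q d K2 ^ 2) := by simp only [mul_assoc]
      _ = x := by rw [hc, one_mul, mul_one]
  antipodeInv_antipode x := by
    have h := ubarSat (F := F) (q := q) (d := d)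
    have hc : ubarGen F q d k2 ^ 2 * ubarGen F q d K2 ^ 2 = 1 := by
      rw [← (show Commute (ubarGen F q d k2) (ubarGen F q d K2) from
        h.k2K2.trans h.K2k2.symm).mul_pow, h.k2K2, one_pow]
    have hk2 := ubarGen_hom (F := F) (q := q) (d := d) k2
    have hK2 := ubarGen_hom (F := F) (q := q) (d := d) K2
    simp only [UqGen.deg] at hk2 hK2
    change ubarAntipodeₗ hq (LinearMap.mulLeftRight F _ (ubarAntipodeₗ hq x)) = x
    have e : LinearMap.mulLeftRight F (ubarGen F q d K2 ^ 2, ubarGen F q d k2 ^ 2)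
        (ubarAntipodeₗ hq x) =
        ubarAntipodeₗ hq (ubarGen F q d K2 ^ 2 * x * ubarGen F q d k2 ^ 2) := by
      rw [LinearMap.mulLeftRight_apply, ubarAntipode_mul_right hq _ (ubar_even_pow hk2 2),
        ubarAntipode_mul_left hq (ubar_even_pow hK2 2), pow_two, pow_two,
        ubarAntipode_mul_left hq hk2, ubarAntipode_mul_left hq hK2, ubarAntipodeₗ_gen,
        ubarAntipodeₗ_gen, antipodeGen, antipodeGen]
      simp only [mul_assoc]
    rw [e, ubarAntipode_sq]
    calc _ = (ubarGen F q d k2 ^ 2 * ubarGen F q d K2 ^ 2) * x *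
        (ubarGen F q d k2 ^ 2 * ubarGen F q d K2 ^ 2) := by simp only [mul_assoc]
      _ = x := by rw [hc, one_mul, mul_one]

theorem ubarHopf_isUbarStructure : IsUbarStructure F q d (ubarHopf hq) where
  mul_eq := rfl
  one_eq := rfl
  isHopf := ubarHopf_isHopf hq
  deg := ubarGen_hom
  comul_k1 := ubarComulₗ_gen_tmul hq k1
  comul_k2 := ubarComulₗ_gen_tmul hq k2
  comul_K1 := ubarComulₗ_gen_tmul hq K1
  comul_K2 := ubarComulₗ_gen_tmul hq K2
  comul_e1 := ubarComulₗ_gen_tmul hq e1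
  comul_e2 := ubarComulₗ_gen_tmul hq e2
  comul_f1 := ubarComulₗ_gen_tmul hq f1
  comul_f2 := ubarComulₗ_gen_tmul hq f2
  counit_k1 := ubarCounit_gen hq.pos k1
  counit_k2 := ubarCounit_gen hq.pos k2
  counit_K1 := ubarCounit_gen hq.pos K1
  counit_K2 := ubarCounit_gen hq.pos K2
  counit_e1 := ubarCounit_gen hq.pos e1
  counit_e2 := ubarCounit_gen hq.pos e2
  counit_f1 := ubarCounit_gen hq.pos f1
  counit_f2 := ubarCounit_gen hq.pos f2
  antipode_k1 := ubarAntipodeₗ_gen hq k1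
  antipode_k2 := ubarAntipodeₗ_gen hq k2
  antipode_K1 := ubarAntipodeₗ_gen hq K1
  antipode_K2 := ubarAntipodeₗ_gen hq K2
  antipode_e1 := ubarAntipodeₗ_gen hq e1
  antipode_e2 := ubarAntipodeₗ_gen hq e2
  antipode_f1 := ubarAntipodeₗ_gen hq f1
  antipode_f2 := ubarAntipodeₗ_gen hq f2

end UbarHopf

namespace SuperHopfData

variable {F : Type*} [Field F] {V : Type*} [AddCommGroup V] [Module F V]

/-- The convolution product of two endomorphisms. -/
def conv (H : SuperHopfData F V) (f g : V →ₗ[F] V) : V →ₗ[F] V :=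
  H.mul ∘ₗ TensorProduct.map f g ∘ₗ H.comul

theorem IsHopf.conv_assoc {H : SuperHopfData F V} (hH : H.IsHopf) (f g h : V →ₗ[F] V) :
    H.conv (H.conv f g) h = H.conv f (H.conv g h) := by
  have e1 : H.mul ∘ₗ TensorProduct.map (H.mul ∘ₗ TensorProduct.map f g) h =
      H.mul ∘ₗ TensorProduct.map f (H.mul ∘ₗ TensorProduct.map g h) ∘ₗ
        (TensorProduct.assoc F V V V).toLinearMap := by
    ext x y z
    exact hH.mul_assoc (f x) (g y) (h z)
  have e2 : H.conv (H.conv f g) h = (H.mul ∘ₗ TensorProduct.map (H.mul ∘ₗ TensorProduct.map f g) h)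
      ∘ₗ TensorProduct.map H.comul LinearMap.id ∘ₗ H.comul := by
    rw [LinearMap.comp_assoc, ← LinearMap.comp_assoc _ (TensorProduct.map H.comul _)
      (TensorProduct.map _ h), ← TensorProduct.map_comp]
    simp only [conv, LinearMap.comp_assoc, LinearMap.comp_id]
  rw [e2, e1, LinearMap.comp_assoc, LinearMap.comp_assoc, hH.coassoc]
  simp only [conv]
  rw [← LinearMap.comp_assoc _ _ (TensorProduct.map f _), ← TensorProduct.map_comp]
  simp only [LinearMap.comp_assoc, LinearMap.comp_id]

/-- The unit of the convolution product. -/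
def convOne (H : SuperHopfData F V) : V →ₗ[F] V := H.counit.smulRight H.one

theorem IsHopf.convOne_conv {H : SuperHopfData F V} (hH : H.IsHopf) (f : V →ₗ[F] V) :
    H.conv H.convOne f = f := by
  have e : H.mul ∘ₗ TensorProduct.map H.convOne f = f ∘ₗ (TensorProduct.lid F V).toLinearMap ∘ₗ
      TensorProduct.map H.counit LinearMap.id := by
    ext x y
    change H.m (H.counit x • H.one) (f y) = f (H.counit x • y)
    rw [smul_m, hH.one_mul, map_smul]
  rw [conv, ← LinearMap.comp_assoc, e]
  exact (congrArg (f ∘ₗ ·) hH.counit_left).trans (LinearMap.comp_id f)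

theorem IsHopf.conv_convOne {H : SuperHopfData F V} (hH : H.IsHopf) (f : V →ₗ[F] V) :
    H.conv f H.convOne = f := by
  have e : H.mul ∘ₗ TensorProduct.map f H.convOne = f ∘ₗ (TensorProduct.rid F V).toLinearMap ∘ₗ
      TensorProduct.map LinearMap.id H.counit := by
    ext x y
    change H.m (f x) (H.counit y • H.one) = f (H.counit y • x)
    rw [m_smul, hH.mul_one, map_smul]
  rw [conv, ← LinearMap.comp_assoc, e]
  exact (congrArg (f ∘ₗ ·) hH.counit_right).trans (LinearMap.comp_id f)

theorem IsHopf.antipode_conv {H : SuperHopfData F V} (hH : H.IsHopf) :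
    H.conv H.antipode LinearMap.id = H.convOne :=
  LinearMap.ext hH.antipode_left

theorem IsHopf.conv_antipode {H : SuperHopfData F V} (hH : H.IsHopf) :
    H.conv LinearMap.id H.antipode = H.convOne :=
  LinearMap.ext hH.antipode_right

theorem IsHopf.eq_antipode {H : SuperHopfData F V} (hH : H.IsHopf) {S : V →ₗ[F] V}
    (hS : H.conv S LinearMap.id = H.convOne) : S = H.antipode := by
  rw [← hH.conv_convOne S, ← hH.conv_antipode, ← hH.conv_assoc, hS, hH.convOne_conv]

theorem IsHopf.ext_of_comul {H H' : SuperHopfData F V} (hH : H.IsHopf) (hH' : H'.IsHopf)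
    (hp : H'.part = H.part) (hm : H'.mul = H.mul) (h1 : H'.one = H.one)
    (hc : H'.comul = H.comul) (he : H'.counit = H.counit) : H' = H := by
  have hS : H'.antipode = H.antipode := hH.eq_antipode <| by
    have := hH'.antipode_conv
    rw [conv, convOne, hm, hc, he, h1] at this
    exact this
  refine SuperHopfData.ext hp hm h1 hc he hS (LinearMap.ext fun x => ?_)
  rw [← hH.antipode_antipodeInv x, ← hS, hH'.antipodeInv_antipode, hS, hH.antipodeInv_antipode]

end SuperHopfData

section Uniqueness

open UqGen SuperHopfData

variable {F : Type*} [Field F] [CharZero F] {q : F} {d : ℕ} (hq : IsOddRoot q d)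

theorem IsUbarStructure.eq_ubarHopf {H : SuperHopfData F (Ubar F q d)}
    (hH : IsUbarStructure F q d H) : H = ubarHopf hq := by
  have h0 := ubarHopf_isUbarStructure (F := F) hq
  have hid := isEvenMap_ubar hH.isHopf.isSuperAlg (f := LinearMap.id) hH.one_eq.symm
    (fun x y => by simp [m, hH.mul_eq]) hH.deg
  have hp : H.part = (ubarHopf hq).part := funext fun i => (hid.even i).symm
  have hm : H.mul = (ubarHopf hq).mul := hH.mul_eq
  have h1 : H.one = (ubarHopf hq).one := hH.one_eq
  refine IsHopf.ext_of_comul h0.isHopf hH.isHopf hp hm h1 ?_ ?_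
  · refine IsSuperAlgHom.ext_ubar (B := (ubarAlg F q d).tensor (ubarAlg F q d))
      ⟨?_, ?_, ?_⟩ (ubarComul_hom hq) fun i => ?_
    · have := hH.isHopf.comul_even
      rw [hp] at this
      exact this
    · have := hH.isHopf.comul_mul
      simp only [tensor, m, hp, hm] at this
      exact this
    · have := hH.isHopf.comul_one
      rw [h1] at this
      exact this
    · refine Eq.trans ?_ (ubarComulₗ_gen_tmul hq i).symm
      cases i
      exacts [hH.comul_k1, hH.comul_k2, hH.comul_K1, hH.comul_K2, hH.comul_e1, hH.comul_e2,
        hH.comul_f1, hH.comul_f2]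
  · refine IsSuperAlgHom.ext_ubar (B := scalars F) (f := H.counit)
      ⟨fun i => ?_, ?_, ?_⟩ (ubarCounit_hom hq) fun i => ?_
    · have h := hH.isHopf.counit_even
      have ht := congrArg (H.counit ∘ₗ ·) hH.isHopf.grading.total
      simp only [LinearMap.comp_add, h, add_zero, LinearMap.comp_id] at ht
      rw [hp] at h ht
      rcases zmod_two_cases i with rfl | rfl
      · refine ht.trans ?_
        ext x
        simp [scalars]
      · refine h.trans ?_
        ext x
        simp [scalars]
    · have := hH.isHopf.counit_mul
      simp only [m, hm] at this
      exact this
    · have := hH.isHopf.counit_one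
      rw [h1] at this
      exact this
    · refine Eq.trans ?_ (ubarCounit_gen hq.pos i).symm
      cases i
      exacts [hH.counit_k1, hH.counit_k2, hH.counit_K1, hH.counit_K2, hH.counit_e1, hH.counit_e2,
        hH.counit_f1, hH.counit_f2]

end Uniqueness

section SkewDerivations

variable {F : Type*} [Field F] {R : Type*} [Ring R] [Algebra F R] {q : F} {d : ℕ}

theorem serreElt_qcomm (q : F) {a b k : R} {c c' : F} (h1 : a * k = c • (k * a))
    (h2 : b * k = c' • (k * b)) :
    serreElt q a b * k = (c ^ 2 * c') • (k * serreElt q a b) := by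
  have h3 := qcomm_mul_left (qcomm_pow_left h1 2) h2
  have h4 := qcomm_mul_left (qcomm_mul_left h1 h2) h1
  have h5 := qcomm_mul_left h2 (qcomm_pow_left h1 2)
  simp only [serreElt, add_mul, sub_mul, mul_add, mul_sub, smul_mul_assoc, mul_smul_comm, h3, h4,
    h5]
  match_scalars <;> ring

theorem serre_torus_left (hq : q ≠ 0) {k e1 e2 : R} (h1 : e1 * k = q ^ (-2 : ℤ) • (k * e1))
    (h2 : e2 * k = q • (k * e2)) :
    (e1 * k + k * e1) * e2 - (q + q⁻¹) • (e1 * e2 * k + k * e2 * e1) + e2 * (e1 * k + k * e1) =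
      0 := by
  simp only [add_mul, mul_add, mul_assoc, h1, h2, qcomm_assoc h1, qcomm_assoc h2, mul_smul_comm,
    smul_mul_assoc]
  match_scalars <;> field_simp <;> ring

theorem serre_torus_right (hq : q ≠ 0) {k e1 : R} (h1 : e1 * k = q • (k * e1)) :
    e1 * e1 * k - (q + q⁻¹) • (e1 * k * e1) + k * e1 * e1 = 0 := by
  simp only [mul_assoc, h1, qcomm_assoc h1, mul_smul_comm, smul_mul_assoc]
  match_scalars
  field_simp
  ring

theorem sum_pow_torus {z : F} (hz : IsPrimitiveRoot z d) (hd : 1 < d) {k e : R}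
    (h : e * k = z • (k * e)) : ∑ i ∈ Finset.range d, e ^ i * k * e ^ (d - 1 - i) = 0 := by
  have : ∀ i ∈ Finset.range d, e ^ i * k * e ^ (d - 1 - i) = z ^ i • (k * e ^ (d - 1)) := by
    intro i hi
    rw [qcomm_pow_left h, smul_mul_assoc, mul_assoc, ← pow_add]
    congr 3
    have := Finset.mem_range.mp hi
    omega
  rw [Finset.sum_congr rfl this, ← Finset.sum_smul, hz.geom_sum_eq_zero hd, zero_smul]

/-- The matrix of a pair of an endomorphism and a skew derivation. -/
def skewPair (s D x : R) : Matrix (Fin 2) (Fin 2) R := !![s, D; 0, x]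

theorem skewPair_mul (s D x s' D' x' : R) :
    skewPair s D x * skewPair s' D' x' = skewPair (s * s') (s * D' + D * x') (x * x') := by
  simp [skewPair]

theorem skewPair_add (s D x s' D' x' : R) :
    skewPair s D x + skewPair s' D' x' = skewPair (s + s') (D + D') (x + x') := by
  ext i j; fin_cases i <;> fin_cases j <;> simp [skewPair]

theorem skewPair_sub (s D x s' D' x' : R) :
    skewPair s D x - skewPair s' D' x' = skewPair (s - s') (D - D') (x - x') := by
  ext i j; fin_cases i <;> fin_cases j <;> simp [skewPair]

theorem skewPair_smul (c : F) (s D x : R) :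
    c • skewPair s D x = skewPair (c • s) (c • D) (c • x) := by
  ext i j; fin_cases i <;> fin_cases j <;> simp [skewPair]

theorem skewPair_one : skewPair (1 : R) 0 1 = 1 := by
  ext i j; fin_cases i <;> fin_cases j <;> simp [skewPair]

theorem skewPair_zero : skewPair (0 : R) 0 0 = 0 := by
  ext i j; fin_cases i <;> fin_cases j <;> simp [skewPair]

theorem skewPair_pow (s D x : R) (n : ℕ) : skewPair s D x ^ n =
    skewPair (s ^ n) (∑ i ∈ Finset.range n, s ^ i * D * x ^ (n - 1 - i)) (x ^ n) := by
  induction n with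
  | zero => simp [skewPair_one]
  | succ n ih =>
    rw [pow_succ, ih, skewPair_mul, ← pow_succ, ← pow_succ, Finset.sum_range_succ, Finset.sum_mul]
    congr 1
    rw [Nat.add_sub_cancel, Nat.sub_self, pow_zero, mul_one, add_comm]
    congr 1
    refine Finset.sum_congr rfl fun i hi => ?_
    have := Finset.mem_range.mp hi
    rw [mul_assoc, ← pow_succ]
    congr 2
    omega

theorem BorelRel.skewPair {k1 k2 e1 e2 s1 s2 t1 t2 D1 D2 : R} (hs : BorelRel q d s1 s2 t1 t2)
    (hx : BorelRel q d k1 k2 e1 e2) (h11 : D1 * k1 = q ^ (-2 : ℤ) • (s1 * D1))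
    (h21 : D2 * k1 = q • (s1 * D2)) (h12 : D1 * k2 = q • (s2 * D1)) (h22 : D2 * k2 = s2 * D2)
    (hD2 : t2 * D2 + D2 * e2 = 0)
    (serre : t1 * t1 * D2 + (t1 * D1 + D1 * e1) * e2 -
      (q + q⁻¹) • (t1 * t2 * D1 + (t1 * D2 + D1 * e2) * e1) +
      (t2 * (t1 * D1 + D1 * e1) + D2 * (e1 * e1)) = 0)
    (pow : ∑ i ∈ Finset.range d, t1 ^ i * D1 * e1 ^ (d - 1 - i) = 0) :
    BorelRel q d (skewPair s1 0 k1) (skewPair s2 0 k2) (skewPair t1 D1 e1) (skewPair t2 D2 e2) where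
  k1_pow := by rw [skewPair_pow, hs.k1_pow, hx.k1_pow, ← skewPair_one]; simp
  k2_pow := by rw [skewPair_pow, hs.k2_pow, hx.k2_pow, ← skewPair_one]; simp
  k2k1 := by rw [skewPair_mul, skewPair_mul, hs.k2k1, hx.k2k1]; simp
  e1k1 := by
    rw [skewPair_mul, skewPair_mul, skewPair_smul, hs.e1k1, hx.e1k1, mul_zero, zero_add, zero_mul,
      add_zero, h11]
  e2k1 := by
    rw [skewPair_mul, skewPair_mul, skewPair_smul, hs.e2k1, hx.e2k1, mul_zero, zero_add, zero_mul,
      add_zero, h21]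
  e1k2 := by
    rw [skewPair_mul, skewPair_mul, skewPair_smul, hs.e1k2, hx.e1k2, mul_zero, zero_add, zero_mul,
      add_zero, h12]
  e2k2 := by
    rw [skewPair_mul, skewPair_mul, hs.e2k2, hx.e2k2, mul_zero, zero_add, zero_mul, add_zero, h22]
  e2e2 := by rw [skewPair_mul, hs.e2e2, hx.e2e2, hD2, skewPair_zero]
  serre := by
    have h1 := hs.serre
    have h2 := hx.serre
    simp only [serreElt, pow_two] at h1 h2
    simp only [serreElt, pow_two, skewPair_mul, skewPair_smul, skewPair_add, skewPair_sub, h1, h2,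
      serre, skewPair_zero]
  e1_pow := by rw [skewPair_pow, hs.e1_pow, hx.e1_pow, pow, skewPair_zero]

end SkewDerivations

section Verma

open BorelAlg

variable {F : Type*} [Field F] {q : F} {d : ℕ} (hq : IsOddRoot q d)

theorem BorelAlg.induction_left {P : BorelAlg F q d → Prop}
    (add : ∀ x y, P x → P y → P (x + y)) (smul : ∀ (c : F) x, P x → P (c • x)) (one : P 1)
    (mul : ∀ g x, P x → P (gen F q d g * x)) (x : BorelAlg F q d) : P x :=
  induction_of_adjoin_left (adjoin_gen F q d) add smul one (by
    rintro g (rfl | rfl | rfl | rfl) <;> exact mul _) x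

include hq

theorem BorelRel.pow_sub_one {R : Type*} [Ring R] [Algebra F R] {k1 k2 e1 e2 : R}
    (h : BorelRel q d k1 k2 e1 e2) : k1 * k1 ^ (d - 1) = 1 ∧ k1 ^ (d - 1) * k1 = 1 ∧
      k2 * k2 ^ (d - 1) = 1 ∧ k2 ^ (d - 1) * k2 = 1 := by
  rw [← pow_succ', ← pow_succ, ← pow_succ', ← pow_succ, Nat.sub_add_cancel hq.pos]
  exact ⟨h.k1_pow, h.k1_pow, h.k2_pow, h.k2_pow⟩

theorem BorelRel.serre_delta {R : Type*} [Ring R] [Algebra F R] {k1 k2 e1 e2 K1 K2 : R}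
    (h : BorelRel q d k1 k2 e1 e2) (h' : BorelRel q⁻¹ d K1 K2 e1 e2) (c : F) :
    (e1 * (c • (k1 - K1)) + c • (k1 - K1) * e1) * e2 - (q + q⁻¹) •
      (e1 * e2 * (c • (k1 - K1)) + c • (k1 - K1) * e2 * e1) +
      e2 * (e1 * (c • (k1 - K1)) + c • (k1 - K1) * e1) = 0 ∧
    e1 * e1 * (c • (k2 - K2)) - (q + q⁻¹) • (e1 * (c • (k2 - K2)) * e1) +
      c • (k2 - K2) * e1 * e1 = 0 ∧
    ∑ i ∈ Finset.range d, e1 ^ i * (c • (k1 - K1)) * e1 ^ (d - 1 - i) = 0 := by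
  have a1 := serre_torus_left hq.ne_zero h.e1k1 h.e2k1
  have a2 := serre_torus_left (inv_ne_zero hq.ne_zero) h'.e1k1 h'.e2k1
  have b1 := serre_torus_right hq.ne_zero h.e1k2
  have b2 := serre_torus_right (inv_ne_zero hq.ne_zero) h'.e1k2
  have c1 := sum_pow_torus (hq.root.zpow_neg_two hq.odd) hq.one_lt h.e1k1
  have c2 := sum_pow_torus (hq.root.inv.zpow_neg_two hq.odd) hq.one_lt h'.e1k1
  rw [inv_inv, add_comm q⁻¹] at a2 b2
  refine ⟨?_, ?_, ?_⟩
  · have := congrArg (c • ·) (congrArg₂ (· - ·) a1 a2)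
    simp only [sub_zero, smul_zero] at this
    rw [← this]
    simp only [mul_smul_comm, smul_mul_assoc, mul_sub, sub_mul, mul_add, add_mul]
    module
  · have := congrArg (c • ·) (congrArg₂ (· - ·) b1 b2)
    simp only [sub_zero, smul_zero] at this
    rw [← this]
    simp only [mul_smul_comm, smul_mul_assoc, mul_sub, sub_mul]
    module
  · have := congrArg (c • ·) (congrArg₂ (· - ·) c1 c2)
    simp only [sub_zero, smul_zero, ← Finset.sum_sub_distrib, Finset.smul_sum] at this
    rw [← this]
    simp only [mul_smul_comm, smul_mul_assoc, mul_sub, sub_mul]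

/-- `k₁^{d-1}` and `k₂^{d-1}` are the inverses of `k₁` and `k₂`. -/
theorem BorelRel.inv_pow {R : Type*} [Ring R] [Algebra F R] {k1 k2 e1 e2 : R}
    (h : BorelRel q d k1 k2 e1 e2) : BorelRel q⁻¹ d (k1 ^ (d - 1)) (k2 ^ (d - 1)) e1 e2 := by
  obtain ⟨h1, h2, h3, h4⟩ := h.pow_sub_one hq
  exact h.inv hq.ne_zero h1 h2 h3 h4

/-- The lowering operator `f₁` of the Verma module comes from a skew derivation. -/
theorem BorelRel.skewPair_f1 {R : Type*} [Ring R] [Algebra F R] {k1 k2 e1 e2 : R}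
    (h : BorelRel q d k1 k2 e1 e2) : BorelRel q d (_root_.skewPair (q ^ 2 • k1) 0 k1)
      (_root_.skewPair (q⁻¹ • k2) 0 k2)
      (_root_.skewPair e1 (-((q - q⁻¹)⁻¹ • (k1 - k1 ^ (d - 1)))) e1)
      (_root_.skewPair e2 0 e2) := by
  have q0 := hq.ne_zero
  obtain ⟨a, -, c⟩ := h.serre_delta hq (h.inv_pow hq) (q - q⁻¹)⁻¹
  refine BorelRel.skewPair ?_ h ?_ ?_ ?_ ?_ ?_ ?_ ?_
  · refine { h with
      k1_pow := ?_, k2_pow := ?_, k2k1 := ?_, e1k1 := ?_, e2k1 := ?_, e1k2 := ?_, e2k2 := ?_ }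
    · rw [smul_pow, h.k1_pow, ← pow_mul, mul_comm, pow_mul, hq.root.pow_eq_one, one_pow, one_smul]
    · rw [smul_pow, h.k2_pow, _root_.inv_pow, hq.root.pow_eq_one, inv_one, one_smul]
    · simp only [smul_mul_assoc, mul_smul_comm, h.k2k1, smul_smul, mul_comm]
    · simp only [smul_mul_assoc, mul_smul_comm, h.e1k1, smul_smul, mul_comm]
    · simp only [smul_mul_assoc, mul_smul_comm, h.e2k1, smul_smul, mul_comm]
    · simp only [smul_mul_assoc, mul_smul_comm, h.e1k2, smul_smul, mul_comm]
    · simp only [smul_mul_assoc, mul_smul_comm, h.e2k2]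
  · rw [smul_mul_assoc, smul_smul, show q ^ (-2 : ℤ) * q ^ 2 = 1 by
      rw [zpow_neg, zpow_ofNat, inv_mul_cancel₀ (pow_ne_zero 2 q0)], one_smul, neg_mul, mul_neg,
      smul_mul_assoc, mul_smul_comm, sub_mul, mul_sub, ← pow_succ, ← pow_succ']
  · simp
  · have : Commute k2 k1 := h.k2k1
    rw [smul_mul_assoc, smul_smul, mul_inv_cancel₀ q0, one_smul, neg_mul, mul_neg,
      smul_mul_assoc, mul_smul_comm, sub_mul, mul_sub, this.eq, (this.pow_right _).eq]
  · simp
  · simp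
  · refine Eq.trans ?_ (neg_eq_zero.mpr a)
    simp only [mul_neg, neg_mul, mul_zero, zero_mul, zero_add, add_zero, mul_assoc, mul_add,
      add_mul]
    module
  · refine Eq.trans ?_ (neg_eq_zero.mpr c)
    rw [← Finset.sum_neg_distrib]
    exact Finset.sum_congr rfl fun i _ => by rw [mul_neg, neg_mul]

/-- The lowering operator `f₂` of the Verma module comes from a skew derivation. -/
theorem BorelRel.skewPair_f2 {R : Type*} [Ring R] [Algebra F R] {k1 k2 e1 e2 : R}
    (h : BorelRel q d k1 k2 e1 e2) : BorelRel q d (_root_.skewPair (q⁻¹ • k1) 0 k1)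
      (_root_.skewPair k2 0 k2) (_root_.skewPair e1 0 e1)
      (_root_.skewPair (-e2) ((q - q⁻¹)⁻¹ • (k2 - k2 ^ (d - 1))) e2) := by
  have q0 := hq.ne_zero
  obtain ⟨-, b, -⟩ := h.serre_delta hq (h.inv_pow hq) (q - q⁻¹)⁻¹
  have hc : Commute k2 k1 := h.k2k1
  have he : Commute e2 k2 := h.e2k2
  refine BorelRel.skewPair ?_ h ?_ ?_ ?_ ?_ ?_ ?_ ?_
  · refine { h with
      k1_pow := ?_, k2k1 := ?_, e1k1 := ?_, e2k1 := ?_, e2k2 := ?_, e2e2 := ?_, serre := ?_ }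
    · rw [smul_pow, h.k1_pow, _root_.inv_pow, hq.root.pow_eq_one, inv_one, one_smul]
    · simp only [smul_mul_assoc, mul_smul_comm, h.k2k1]
    · simp only [smul_mul_assoc, mul_smul_comm, h.e1k1, smul_smul, mul_comm]
    · simp only [smul_mul_assoc, mul_smul_comm, h.e2k1, smul_smul, mul_comm, neg_mul, mul_neg,
        smul_neg]
    · rw [neg_mul, mul_neg, h.e2k2]
    · rw [neg_mul_neg, h.e2e2]
    · have := serreElt_smul q 1 (-1) e1 e2
      rwa [h.serre, smul_zero, one_smul, neg_smul, one_smul] at this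
  · simp
  · rw [smul_mul_assoc (q⁻¹), smul_smul, mul_inv_cancel₀ q0, one_smul, smul_mul_assoc,
      mul_smul_comm, sub_mul, mul_sub, hc.eq, (hc.pow_left _).eq]
  · simp
  · rw [smul_mul_assoc, mul_smul_comm, sub_mul, mul_sub, ← pow_succ, ← pow_succ']
  · rw [neg_mul, smul_mul_assoc, mul_smul_comm, sub_mul, mul_sub, he.eq, (he.pow_right _).eq]
    simp
  · refine Eq.trans ?_ b
    simp [mul_assoc]
  · simp

variable (F) in
/-- The skew derivation giving the first lowering operator of the Verma module. -/
def BorelAlg.skew1 : BorelAlg F q d →ₐ[F] Matrix (Fin 2) (Fin 2) (BorelAlg F q d) :=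
  BorelAlg.lift ((borelRel F q d).skewPair_f1 hq)

variable (F) in
/-- The skew derivation giving the second lowering operator. -/
def BorelAlg.skew2 : BorelAlg F q d →ₐ[F] Matrix (Fin 2) (Fin 2) (BorelAlg F q d) :=
  BorelAlg.lift ((borelRel F q d).skewPair_f2 hq)

omit hq in
theorem BorelAlg.skew_mul
    {Φ : BorelAlg F q d →ₐ[F] Matrix (Fin 2) (Fin 2) (BorelAlg F q d)}
    (h : ∀ g, ∃ s D, Φ (gen F q d g) = _root_.skewPair s D (gen F q d g)) (g : BorelGen)
    {s D : BorelAlg F q d} (hg : Φ (gen F q d g) = _root_.skewPair s D (gen F q d g))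
    (y : BorelAlg F q d) : Φ (gen F q d g * y) 0 1 = s * Φ y 0 1 + D * y := by
  have h11 : Φ y 1 1 = y := by
    induction y using BorelAlg.induction_left with
    | add x y hx hy => rw [map_add, Matrix.add_apply, hx, hy]
    | smul c x hx => rw [map_smul, Matrix.smul_apply, hx]
    | one => rw [map_one]; simp
    | mul g x hx =>
      obtain ⟨s, D, h⟩ := h g
      rw [map_mul, h, Matrix.mul_apply, Fin.sum_univ_two, hx]
      simp [_root_.skewPair]
  rw [map_mul, hg, Matrix.mul_apply, Fin.sum_univ_two, h11]
  simp [_root_.skewPair]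

/-- The `(0, 1)` entry of an algebra morphism to matrices. -/
def skewOp {A R : Type*} [Ring A] [Algebra F A] [Ring R] [Algebra F R]
    (Φ : A →ₐ[F] Matrix (Fin 2) (Fin 2) R) : A →ₗ[F] R where
  toFun x := Φ x 0 1
  map_add' x y := by rw [map_add, Matrix.add_apply]
  map_smul' c x := by rw [map_smul, Matrix.smul_apply, RingHom.id_apply]

omit hq in
theorem BorelAlg.end_eq_zero {u : Module.End F (BorelAlg F q d)} (h1 : u 1 = 0)
    (h : ∀ g, ∃ c : F, u * Algebra.lmul F _ (gen F q d g) =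
      c • (Algebra.lmul F _ (gen F q d g) * u)) : u = 0 := by
  ext x
  induction x using BorelAlg.induction_left with
  | add x y hx hy => rw [map_add, hx, hy, map_add]
  | smul c x hx => rw [map_smul, hx, map_smul]
  | one => exact h1
  | mul g x hx =>
    obtain ⟨c, hc⟩ := h g
    refine (LinearMap.congr_fun hc x).trans ?_
    rw [LinearMap.smul_apply, Module.End.mul_apply, hx]
    simp

end Verma

section VermaModule

open BorelAlg

variable {F : Type*} [Field F] {q : F} {d : ℕ}

theorem pow_mul_of_comm_sub {R : Type*} [Ring R] {f e δ : R} (h : f * e = e * f - δ) (n : ℕ) :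
    f ^ n * e = e * f ^ n - ∑ i ∈ Finset.range n, f ^ i * δ * f ^ (n - 1 - i) := by
  induction n with
  | zero => simp
  | succ n ih =>
    have e1 : ∑ i ∈ Finset.range (n + 1), f ^ i * δ * f ^ (n + 1 - 1 - i) =
        (∑ i ∈ Finset.range n, f ^ i * δ * f ^ (n - 1 - i)) * f + f ^ n * δ := by
      rw [Finset.sum_range_succ, Finset.sum_mul, Nat.add_sub_cancel, Nat.sub_self, pow_zero, mul_one]
      congr 1
      refine Finset.sum_congr rfl fun i hi => ?_
      have := Finset.mem_range.mp hi
      rw [mul_assoc (f ^ i * δ), ← pow_succ]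
      congr 2
      omega
    rw [e1, pow_succ, mul_assoc, h, mul_sub, ← mul_assoc, ih, sub_mul, mul_assoc, sub_add_eq_sub_sub]

theorem BorelRel.of_lowering (hq : IsOddRoot q d) {E : Type*} [Ring E] [Algebra F E]
    {k1 k2 e1 e2 f1 f2 : E} (h : BorelRel q d k1 k2 e1 e2) (f1k1 : f1 * k1 = q ^ 2 • (k1 * f1))
    (f1k2 : f1 * k2 = q⁻¹ • (k2 * f1)) (f2k1 : f2 * k1 = q⁻¹ • (k1 * f2)) (f2k2 : f2 * k2 = k2 * f2)
    (f1e1 : f1 * e1 = e1 * f1 - (q - q⁻¹)⁻¹ • (k1 - k1 ^ (d - 1))) (f1e2 : f1 * e2 = e2 * f1)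
    (f2e1 : f2 * e1 = e1 * f2)
    (f2e2 : f2 * e2 = -(e2 * f2) + (q - q⁻¹)⁻¹ • (k2 - k2 ^ (d - 1)))
    (zero : ∀ u ∈ ({f1 ^ d, f2 * f2, serreElt q f1 f2} : Set E),
      (∀ g ∈ ({k1, k2, e1, e2} : Set E), ∃ c : F, u * g = c • (g * u)) → u = 0) :
    BorelRel q d (k1 ^ (d - 1)) (k2 ^ (d - 1)) f1 f2 := by
  have q0 := hq.ne_zero
  have f2k2' : f2 * k2 = (1 : F) • (k2 * f2) := by rw [one_smul, f2k2]
  have f1e2' : f1 * e2 = (1 : F) • (e2 * f1) := by rw [one_smul, f1e2]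
  have f2e1' : f2 * e1 = (1 : F) • (e1 * f2) := by rw [one_smul, f2e1]
  obtain ⟨hk1, hk1', hk2, hk2'⟩ := h.pow_sub_one hq
  have z2 : (q ^ 2)⁻¹ = q ^ (-2 : ℤ) := by rw [zpow_neg, zpow_ofNat]
  have z2' : (q⁻¹ : F) ^ (-2 : ℤ) = q ^ 2 := by rw [inv_zpow, zpow_neg, inv_inv, zpow_ofNat]
  have f1K1 := BorelRel.qcomm_of_inv (pow_ne_zero 2 q0) hk1 hk1' f1k1
  have f2K1 := BorelRel.qcomm_of_inv (inv_ne_zero q0) hk1 hk1' f2k1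
  have f1K2 := BorelRel.qcomm_of_inv (inv_ne_zero q0) hk2 hk2' f1k2
  have f2K2 := BorelRel.qcomm_of_inv one_ne_zero hk2 hk2' f2k2'
  rw [z2] at f1K1
  rw [inv_inv] at f2K1 f1K2
  rw [inv_one, one_smul] at f2K2
  have hf2 : f2 * f2 = 0 := by
    refine zero _ (by simp) ?_
    rintro g (rfl | rfl | rfl | rfl)
    · exact ⟨_, qcomm_mul_left f2k1 f2k1⟩
    · exact ⟨_, qcomm_mul_left f2k2' f2k2'⟩
    · exact ⟨_, qcomm_mul_left f2e1' f2e1'⟩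
    · refine ⟨1, ?_⟩
      have hc : f2 * ((q - q⁻¹)⁻¹ • (k2 - k2 ^ (d - 1))) =
          (q - q⁻¹)⁻¹ • (k2 - k2 ^ (d - 1)) * f2 := by
        rw [mul_smul_comm, smul_mul_assoc, mul_sub, sub_mul, f2k2, f2K2]
      rw [one_smul, mul_assoc, f2e2, mul_add, hc, mul_neg, ← mul_assoc, f2e2, add_mul, neg_mul,
        mul_assoc]
      abel
  -- the Serre-type identities for the lowering operators
  have s1 : ∀ {k1 k2 : E} {p : F}, p ≠ 0 → f1 * k1 = p ^ (-2 : ℤ) • (k1 * f1) →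
      f2 * k1 = p • (k1 * f2) → f1 * k2 = p • (k2 * f1) →
      ((f1 * k1 + k1 * f1) * f2 - (p + p⁻¹) • (f1 * f2 * k1 + k1 * f2 * f1) +
        f2 * (f1 * k1 + k1 * f1) = 0) ∧
      (f1 * f1 * k2 - (p + p⁻¹) • (f1 * k2 * f1) + k2 * f1 * f1 = 0) :=
    fun hp h1 h2 h3 => ⟨serre_torus_left hp h1 h2, serre_torus_right hp h3⟩
  obtain ⟨a1, b1⟩ := s1 q0 f1K1 f2K1 f1K2
  obtain ⟨a2, b2⟩ := s1 (inv_ne_zero q0) (by rw [z2', f1k1]) f2k1 f1k2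
  rw [inv_inv, add_comm q⁻¹] at a2 b2
  have c1 := sum_pow_torus (hq.root.zpow_neg_two hq.odd) hq.one_lt f1K1
  have c2 := sum_pow_torus (hq.root.inv.zpow_neg_two hq.odd) hq.one_lt (k := k1) (e := f1)
    (by rw [z2', f1k1])
  refine ⟨?_, ?_, ?_, f1K1, f2K1, f1K2, f2K2, hf2, ?_, ?_⟩
  · rw [← pow_mul, mul_comm, pow_mul, h.k1_pow, one_pow]
  · rw [← pow_mul, mul_comm, pow_mul, h.k2_pow, one_pow]
  · exact ((show Commute k2 k1 from h.k2k1).pow_pow _ _).eq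
  · refine zero _ (by simp) ?_
    rintro g (rfl | rfl | rfl | rfl)
    · exact ⟨_, serreElt_qcomm q f1k1 f2k1⟩
    · exact ⟨_, serreElt_qcomm q f1k2 f2k2'⟩
    · refine ⟨1, ?_⟩
      have assoc1 (x : E) : f1 * (g * x) =
          g * (f1 * x) - (q - q⁻¹)⁻¹ • (k1 * x - k1 ^ (d - 1) * x) := by
        rw [← mul_assoc, f1e1, sub_mul, smul_mul_assoc, sub_mul, mul_assoc]
      have assoc2 (x : E) : f2 * (g * x) = g * (f2 * x) := by rw [← mul_assoc, f2e1, mul_assoc]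
      have := congrArg ((q - q⁻¹)⁻¹ • ·) (congrArg₂ (· - ·) a1 a2)
      simp only [sub_zero, smul_zero] at this
      rw [← sub_eq_zero, ← this]
      simp only [serreElt, pow_two, mul_assoc, sub_mul, add_mul, smul_mul_assoc, mul_sub, mul_add,
        mul_smul_comm, f1e1, assoc1, assoc2, f2e1, smul_add, smul_sub]
      module
    · refine ⟨-1, ?_⟩
      have assoc1 (x : E) : f1 * (g * x) = g * (f1 * x) := by rw [← mul_assoc, f1e2, mul_assoc]
      have assoc2 (x : E) : f2 * (g * x) =
          -(g * (f2 * x)) + (q - q⁻¹)⁻¹ • (k2 * x - k2 ^ (d - 1) * x) := by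
        rw [← mul_assoc, f2e2, add_mul, smul_mul_assoc, sub_mul, neg_mul, mul_assoc]
      have := congrArg ((q - q⁻¹)⁻¹ • ·) (congrArg₂ (· - ·) b2 b1)
      simp only [sub_zero, smul_zero] at this
      rw [← sub_eq_zero, ← this]
      simp only [serreElt, pow_two, mul_assoc, sub_mul, add_mul, smul_mul_assoc, mul_sub, mul_add,
        mul_smul_comm, f2e2, assoc1, assoc2, f1e2, smul_add, smul_sub, mul_neg]
      module
  · refine zero _ (by simp) ?_
    rintro g (rfl | rfl | rfl | rfl)
    · exact ⟨_, qcomm_pow_left f1k1 d⟩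
    · exact ⟨_, qcomm_pow_left f1k2 d⟩
    · refine ⟨1, ?_⟩
      rw [pow_mul_of_comm_sub f1e1, one_smul, sub_eq_self]
      have := congrArg ((q - q⁻¹)⁻¹ • ·) (congrArg₂ (· - ·) c2 c1)
      simp only [sub_zero, smul_zero, ← Finset.sum_sub_distrib, Finset.smul_sum] at this
      rw [← this]
      simp only [mul_smul_comm, smul_mul_assoc, mul_sub, sub_mul]
    · exact ⟨_, qcomm_pow_left f1e2' d⟩

variable (hq : IsOddRoot q d)

theorem BorelAlg.skew1_gen (g : BorelGen) : ∃ s D, skew1 F hq (gen F q d g) =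
    _root_.skewPair s D (gen F q d g) := by
  cases g <;> exact ⟨_, _, by simp [skew1]; rfl⟩

theorem BorelAlg.skew2_gen (g : BorelGen) : ∃ s D, skew2 F hq (gen F q d g) =
    _root_.skewPair s D (gen F q d g) := by
  cases g <;> exact ⟨_, _, by simp [skew2]; rfl⟩

theorem BorelAlg.skewOp1_lmul {g : BorelGen} {s D : BorelAlg F q d}
    (h : skew1 F hq (gen F q d g) = _root_.skewPair s D (gen F q d g)) :
    (skewOp (skew1 F hq) * Algebra.lmul F _ (gen F q d g) : Module.End F (BorelAlg F q d)) =
      Algebra.lmul F _ s * skewOp (skew1 F hq) + Algebra.lmul F _ D :=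
  LinearMap.ext fun y => skew_mul (skew1_gen hq) g h y

theorem BorelAlg.skewOp2_lmul {g : BorelGen} {s D : BorelAlg F q d}
    (h : skew2 F hq (gen F q d g) = _root_.skewPair s D (gen F q d g)) :
    (skewOp (skew2 F hq) * Algebra.lmul F _ (gen F q d g) : Module.End F (BorelAlg F q d)) =
      Algebra.lmul F _ s * skewOp (skew2 F hq) + Algebra.lmul F _ D :=
  LinearMap.ext fun y => skew_mul (skew2_gen hq) g h y

/-- The operators of the Verma module. -/
def vermaOp : UqGen → Module.End F (BorelAlg F q d)
  | .k1 => Algebra.lmul F _ (gen F q d .k1)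
  | .k2 => Algebra.lmul F _ (gen F q d .k2)
  | .K1 => Algebra.lmul F _ (gen F q d .k1) ^ (d - 1)
  | .K2 => Algebra.lmul F _ (gen F q d .k2) ^ (d - 1)
  | .e1 => Algebra.lmul F _ (gen F q d .e1)
  | .e2 => Algebra.lmul F _ (gen F q d .e2)
  | .f1 => skewOp (skew1 F hq)
  | .f2 => skewOp (skew2 F hq)

theorem ubarSat_vermaOp : UbarSat q d (vermaOp (F := F) hq) := by
  have hp := (borelRel F q d).map (Algebra.lmul F (BorelAlg F q d))
  obtain ⟨hk1, hk1', hk2, hk2'⟩ := hp.pow_sub_one hq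
  have f1k1 := skewOp1_lmul (F := F) hq (lift_k1 _)
  have f1k2 := skewOp1_lmul (F := F) hq (lift_k2 _)
  have f1e1 := skewOp1_lmul (F := F) hq (lift_e1 _)
  have f1e2 := skewOp1_lmul (F := F) hq (lift_e2 _)
  have f2k1 := skewOp2_lmul (F := F) hq (lift_k1 _)
  have f2k2 := skewOp2_lmul (F := F) hq (lift_k2 _)
  have f2e1 := skewOp2_lmul (F := F) hq (lift_e1 _)
  have f2e2 := skewOp2_lmul (F := F) hq (lift_e2 _)
  simp only [map_zero, add_zero, map_smul, smul_mul_assoc, map_neg, map_sub, map_pow, neg_mul,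
    ← sub_eq_add_neg] at f1k1 f1k2 f1e1 f1e2 f2k1 f2k2 f2e1 f2e2
  refine ⟨hk1, hk1', hk2, hk2', hp, ?_, ?_, ?_, ?_, ?_⟩
  · refine hp.of_lowering hq f1k1 f1k2 f2k1 f2k2 f1e1 f1e2 f2e1 f2e2 fun u hu hc => ?_
    refine end_eq_zero ?_ fun g => hc _ (by cases g <;> simp)
    have o1 : vermaOp hq .f1 (1 : BorelAlg F q d) = 0 := by
      change skew1 F hq 1 0 1 = 0
      rw [map_one]; simp
    have o2 : vermaOp hq .f2 (1 : BorelAlg F q d) = 0 := by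
      change skew2 F hq 1 0 1 = 0
      rw [map_one]; simp
    obtain rfl | rfl | rfl := hu
    · obtain ⟨n, rfl⟩ := Nat.exists_eq_succ_of_ne_zero hq.pos.ne'
      rw [pow_succ, Module.End.mul_apply, o1, map_zero]
    · rw [Module.End.mul_apply, o2, map_zero]
    · simp [serreElt, pow_two, o1, o2]
  · rw [vermaOp, vermaOp, vermaOp, vermaOp, f1e1]; abel
  · have f2e2' := f2e2.trans (congrArg (· + _)
      (neg_mul (Algebra.lmul F _ (gen F q d .e2)) (skewOp (skew2 F hq))))
    rw [vermaOp, vermaOp, vermaOp, vermaOp, f2e2']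
    abel
  · exact f2e1.symm
  · exact f1e2.symm

/-- The positive Borel part of `Ū_q`. -/
def borelIncl : BorelAlg F q d →ₐ[F] Ubar F q d := BorelAlg.lift ubarSat.pos

include hq

theorem borelIncl_injective : Function.Injective (borelIncl (F := F) (q := q) (d := d)) := by
  have key : ∀ x : BorelAlg F q d, ubarLift (ubarSat_vermaOp (F := F) hq) (borelIncl x) =
      Algebra.lmul F _ x := fun x => by
    induction x using BorelAlg.induction_left with
    | add x y hx hy => rw [map_add, map_add, hx, hy, map_add]
    | smul c x hx => rw [map_smul, map_smul, hx, map_smul]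
    | one => rw [map_one, map_one, map_one]
    | mul g x hx =>
      rw [map_mul, map_mul, hx, map_mul]
      congr 1
      cases g <;> simp [borelIncl, vermaOp]
  intro x y hxy
  have := key x
  rw [hxy, key y] at this
  simpa using (LinearMap.congr_fun this 1).symm

theorem borelIncl_mem (x : BorelAlg F q d) : borelIncl x ∈ Bplus F q d := by
  have hs := ((borelRel F q d).straightening hq).span_torus_first hq.pos (adjoin_gen F q d)
  have hx : x ∈ (⊤ : Submodule F (BorelAlg F q d)) := trivial
  rw [← hs] at hx
  induction hx using Submodule.span_induction with
  | mem x hx =>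
    obtain ⟨y, rfl⟩ := hx
    refine Submodule.subset_span ⟨y, ?_⟩
    simp [borelIncl, bMonomial, ubarE3]
  | zero => rw [map_zero]; exact zero_mem _
  | add x y _ _ hx hy => rw [map_add]; exact add_mem hx hy
  | smul c x _ hx => rw [map_smul]; exact Submodule.smul_mem _ c hx

omit hq in
theorem bMonomial_eq (x : BIdx d) : bMonomial F q d x = borelIncl
    (gen F q d .k1 ^ (x.i : ℕ) * gen F q d .k2 ^ (x.j : ℕ) * gen F q d .e1 ^ (x.r : ℕ) *
      (gen F q d .e1 * gen F q d .e2 - q⁻¹ • (gen F q d .e2 * gen F q d .e1)) ^ (x.h : ℕ) *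
      gen F q d .e2 ^ (x.t : ℕ)) := by
  simp [borelIncl, bMonomial, ubarE3]

theorem mem_Bplus_iff {x : Ubar F q d} : x ∈ Bplus F q d ↔ ∃ y, borelIncl y = x := by
  refine ⟨fun hx => ?_, by rintro ⟨y, rfl⟩; exact borelIncl_mem hq y⟩
  induction hx using Submodule.span_induction with
  | mem x hx => obtain ⟨y, rfl⟩ := hx; exact ⟨_, (bMonomial_eq y).symm⟩
  | zero => exact ⟨0, map_zero _⟩
  | add x y _ _ hx hy =>
    obtain ⟨a, rfl⟩ := hx; obtain ⟨b, rfl⟩ := hy; exact ⟨a + b, map_add _ _ _⟩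
  | smul c x _ hx => obtain ⟨a, rfl⟩ := hx; exact ⟨c • a, map_smul _ _ _⟩

end VermaModule

namespace SuperHopfData

variable {F : Type*} [Field F] {V W : Type*} [AddCommGroup V] [Module F V] [AddCommGroup W]
  [Module F W]

theorem _root_.TensorProduct.map_injective_of_field {V' W' : Type*} [AddCommGroup V'] [Module F V']
    [AddCommGroup W'] [Module F W'] {f : V →ₗ[F] V'} {g : W →ₗ[F] W'}
    (hf : Function.Injective f) (hg : Function.Injective g) :
    Function.Injective (TensorProduct.map f g) := by
  obtain ⟨f', hf'⟩ := f.exists_leftInverse_of_injective (LinearMap.ker_eq_bot.mpr hf)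
  obtain ⟨g', hg'⟩ := g.exists_leftInverse_of_injective (LinearMap.ker_eq_bot.mpr hg)
  refine Function.LeftInverse.injective (g := TensorProduct.map f' g') fun t => ?_
  rw [← LinearMap.comp_apply, ← TensorProduct.map_comp, hf', hg', TensorProduct.map_id,
    LinearMap.id_apply]

theorem IsSuperAlg.of_injective {A : SuperHopfData F V} {B : SuperHopfData F W} (hA : A.IsSuperAlg)
    {f : W →ₗ[F] V} (hf : Function.Injective f) (h : B.IsSuperAlgHom A f) : B.IsSuperAlg := by
  have hg : IsGrading B.part :=
    { proj := fun i j => by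
        ext x
        apply hf
        rw [LinearMap.comp_apply, h.even.apply, h.even.apply, hA.grading.apply_apply]
        split_ifs with hij
        · exact (h.even.apply i x).symm
        · exact (map_zero f).symm
      total := by
        ext x
        apply hf
        rw [LinearMap.add_apply, map_add, h.even.apply, h.even.apply, hA.grading.add_apply]
        rfl }
  refine ⟨hg, IsEvenMap.of_tmul hg hg hg fun i j v w hv hw => ?_, ?_, fun x y z => ?_, fun x => ?_,
    fun x => ?_⟩
  · apply hf
    rw [h.even.apply]
    change A.part _ (f (B.m v w)) = f (B.m v w)
    rw [h.map_m, hA.hom_m (h.even.hom hv) (h.even.hom hw)]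
  · apply hf
    rw [h.even.apply, h.map_one, hA.one_even]
  · apply hf
    simp only [h.map_m, hA.mul_assoc]
  · apply hf
    rw [h.map_m, h.map_one, hA.one_mul]
  · apply hf
    rw [h.map_m, h.map_one, hA.mul_one]

theorem IsHopf.of_injective {A : SuperHopfData F V} {B : SuperHopfData F W} (hA : A.IsHopf)
    {f : W →ₗ[F] V} (hf : Function.Injective f) (h : B.IsHopfHom A f)
    (hS : ∀ x, A.antipodeInv (f x) = f (B.antipodeInv x)) : B.IsHopf := by
  have ha : B.IsSuperAlgHom A f := ⟨h.even, h.map_mul, h.map_one⟩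
  have hB := hA.isSuperAlg.of_injective hf ha
  have hff := TensorProduct.map_injective_of_field hf hf
  have hfff := TensorProduct.map_injective_of_field hf hff
  have hff' := ha.tensor hB.grading hB.grading hA.grading hA.grading ha
  have hmul (t : W ⊗[F] W) : f (B.mul t) = A.mul (TensorProduct.map f f t) := by
    induction t with
    | zero => simp
    | add x y hx hy => simp only [map_add, hx, hy]
    | tmul x y => exact h.map_mul x y
  refine { hB with
    comul_even := IsEvenMap.of_hom hB.grading (hB.grading.tensor hB.grading) fun i x hx => ?_
    counit_even := ?_
    coassoc := ?_
    counit_left := ?_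
    counit_right := ?_
    comul_one := ?_
    comul_mul := fun x y => ?_
    counit_one := ?_
    counit_mul := fun x y => ?_
    antipode_even := fun i => ?_
    antipode_left := fun x => ?_
    antipode_right := fun x => ?_
    antipode_antipodeInv := fun x => ?_
    antipodeInv_antipode := fun x => ?_ }
  · apply hff
    have := hff'.even.apply i (B.comul x)
    rw [← h.map_comul] at this
    refine this.trans ?_
    rw [← h.map_comul]
    exact hA.comul_even.hom (ha.even.hom hx)
  · ext x
    rw [LinearMap.comp_apply, ← h.map_counit, h.even.apply]
    exact LinearMap.congr_fun hA.counit_even (f x)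
  · ext x
    apply hfff
    have := LinearMap.congr_fun hA.coassoc (f x)
    simp only [LinearMap.comp_apply, h.map_comul] at this ⊢
    have e1 (t : W ⊗[F] W) : TensorProduct.map f (TensorProduct.map f f)
        (TensorProduct.map LinearMap.id B.comul t) =
        TensorProduct.map LinearMap.id A.comul (TensorProduct.map f f t) := by
      induction t with
      | zero => simp
      | add x y hx hy => simp only [map_add, hx, hy]
      | tmul x y => simp [h.map_comul]
    have e2 (t : (W ⊗[F] W) ⊗[F] W) : TensorProduct.map f (TensorProduct.map f f)
        ((TensorProduct.assoc F W W W).toLinearMap t) =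
        (TensorProduct.assoc F V V V).toLinearMap
          (TensorProduct.map (TensorProduct.map f f) f t) := by
      induction t with
      | zero => simp
      | add x y hx hy => simp only [map_add, hx, hy]
      | tmul t y =>
        induction t with
        | zero => simp
        | add x y hx hy => simp only [TensorProduct.add_tmul, map_add, hx, hy]
        | tmul x y => simp
    have e3 (t : W ⊗[F] W) : TensorProduct.map (TensorProduct.map f f) f
        (TensorProduct.map B.comul LinearMap.id t) =
        TensorProduct.map A.comul LinearMap.id (TensorProduct.map f f t) := by
      induction t with
      | zero => simp
      | add x y hx hy => simp only [map_add, hx, hy]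
      | tmul x y => simp [h.map_comul]
    rw [e1, ← this, e2, e3]
  · ext x
    apply hf
    have := LinearMap.congr_fun hA.counit_left (f x)
    simp only [LinearMap.comp_apply, h.map_comul, LinearMap.id_apply] at this ⊢
    refine Eq.trans ?_ this
    generalize B.comul x = t
    induction t with
    | zero => simp
    | add x y hx hy => simp only [map_add, hx, hy]
    | tmul x y => simp [h.map_counit]
  · ext x
    apply hf
    have := LinearMap.congr_fun hA.counit_right (f x)
    simp only [LinearMap.comp_apply, h.map_comul, LinearMap.id_apply] at this ⊢
    refine Eq.trans ?_ this
    generalize B.comul x = t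
    induction t with
    | zero => simp
    | add x y hx hy => simp only [map_add, hx, hy]
    | tmul x y => simp [h.map_counit]
  · apply hff
    rw [← h.map_comul, h.map_one, hA.comul_one, TensorProduct.map_tmul, h.map_one]
  · apply hff
    rw [← h.map_comul, h.map_mul, hA.comul_mul, hff'.map_m, h.map_comul, h.map_comul]
  · rw [← h.map_counit, h.map_one, hA.counit_one]
  · rw [← h.map_counit, h.map_mul, hA.counit_mul, h.map_counit, h.map_counit]
  · ext x
    apply hf
    rw [LinearMap.comp_apply, LinearMap.comp_apply, ← h.map_antipode, h.even.apply, h.even.apply,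
      ← h.map_antipode]
    exact hA.antipode_even.apply i (f x)
  · apply hf
    rw [hmul, map_smul, h.map_one, ← h.map_counit, ← hA.antipode_left, h.map_comul]
    congr 1
    generalize B.comul x = t
    induction t with
    | zero => simp
    | add x y hx hy => simp only [map_add, hx, hy]
    | tmul x y => simp [h.map_antipode]
  · apply hf
    rw [hmul, map_smul, h.map_one, ← h.map_counit, ← hA.antipode_right, h.map_comul]
    congr 1
    generalize B.comul x = t
    induction t with
    | zero => simp
    | add x y hx hy => simp only [map_add, hx, hy]
    | tmul x y => simp [h.map_antipode]
  · apply hf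
    rw [← h.map_antipode, ← hS, hA.antipode_antipodeInv]
  · apply hf
    rw [← hS, ← h.map_antipode, hA.antipodeInv_antipode]

/-- A submodule stable under the structure maps carries a Hopf superalgebra structure. -/
theorem IsHopf.exists_restrict {A : SuperHopfData F V} (hA : A.IsHopf) (U : Submodule F V)
    (part : ∀ i, ∀ x ∈ U, A.part i x ∈ U) (mul : ∀ x ∈ U, ∀ y ∈ U, A.m x y ∈ U) (one : A.one ∈ U)
    (comul : ∀ x ∈ U, A.comul x ∈ LinearMap.range (TensorProduct.map U.subtype U.subtype))
    (antipode : ∀ x ∈ U, A.antipode x ∈ U) (antipodeInv : ∀ x ∈ U, A.antipodeInv x ∈ U) :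
    ∃ B : SuperHopfData F U, B.IsHopf ∧ B.IsHopfHom A U.subtype := by
  obtain ⟨π, hπ⟩ := U.subtype.exists_leftInverse_of_injective U.ker_subtype
  have hmem {x : V} (hx : x ∈ U) : (π x : V) = x :=
    congrArg Subtype.val (LinearMap.congr_fun hπ ⟨x, hx⟩)
  refine ⟨_, hA.of_injective U.injective_subtype (B :=
    { part := fun i => π ∘ₗ A.part i ∘ₗ U.subtype
      mul := π ∘ₗ A.mul ∘ₗ TensorProduct.map U.subtype U.subtype
      one := π A.one
      comul := TensorProduct.map π π ∘ₗ A.comul ∘ₗ U.subtype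
      counit := A.counit ∘ₗ U.subtype
      antipode := π ∘ₗ A.antipode ∘ₗ U.subtype
      antipodeInv := π ∘ₗ A.antipodeInv ∘ₗ U.subtype }) ?h fun x =>
        (hmem (antipodeInv x x.2)).symm, ?h⟩
  exact
    { even := fun i => LinearMap.ext fun x => hmem (part i x x.2)
      map_mul := fun x y => hmem (mul x x.2 y y.2)
      map_one := hmem one
      map_comul := fun x => by
        obtain ⟨t, ht⟩ := comul x x.2
        change A.comul x = TensorProduct.map U.subtype U.subtype (TensorProduct.map π π (A.comul x))
        rw [← ht, ← LinearMap.comp_apply (TensorProduct.map π π), ← TensorProduct.map_comp, hπ,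
          TensorProduct.map_id, LinearMap.id_apply]
      map_counit := fun x => rfl
      map_antipode := fun x => (hmem (antipode x x.2)).symm }

end SuperHopfData

section BorelHopf

open SuperHopfData BorelAlg

variable {F : Type*} [Field F] [CharZero F] {q : F} {d : ℕ} (hq : IsOddRoot q d)

include hq

theorem one_mem_Bplus : (1 : Ubar F q d) ∈ Bplus F q d := by
  simpa using borelIncl_mem hq 1

theorem mul_mem_Bplus {x y : Ubar F q d} (hx : x ∈ Bplus F q d) (hy : y ∈ Bplus F q d) :
    x * y ∈ Bplus F q d := by
  obtain ⟨a, rfl⟩ := (mem_Bplus_iff hq).mp hx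
  obtain ⟨b, rfl⟩ := (mem_Bplus_iff hq).mp hy
  rw [← map_mul]
  exact borelIncl_mem hq _

theorem Bplus_induction {P : Ubar F q d → Prop} (add : ∀ x y, P x → P y → P (x + y))
    (smul : ∀ (c : F) x, P x → P (c • x)) (one : P 1)
    (mul : ∀ g ∈ [UqGen.k1, .k2, .e1, .e2], ∀ x ∈ Bplus F q d, P x → P (ubarGen F q d g * x))
    {x : Ubar F q d} (hx : x ∈ Bplus F q d) : P x := by
  obtain ⟨y, rfl⟩ := (mem_Bplus_iff hq).mp hx
  clear hx
  induction y using BorelAlg.induction_left with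
  | add x y hx hy => rw [map_add]; exact add _ _ hx hy
  | smul c x hx => rw [map_smul]; exact smul c _ hx
  | one => rwa [map_one]
  | mul g x hx =>
    rw [map_mul]
    have := borelIncl_mem hq x
    cases g
    · simpa [borelIncl] using mul .k1 (by simp) _ this hx
    · simpa [borelIncl] using mul .k2 (by simp) _ this hx
    · simpa [borelIncl] using mul .e1 (by simp) _ this hx
    · simpa [borelIncl] using mul .e2 (by simp) _ this hx

theorem gen_mem_Bplus {g : UqGen} (hg : g ∈ [UqGen.k1, .k2, .e1, .e2]) :
    ubarGen F q d g ∈ Bplus F q d := by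
  simp only [List.mem_cons, List.not_mem_nil, or_false] at hg
  rcases hg with rfl | rfl | rfl | rfl
  · simpa [borelIncl] using borelIncl_mem hq (gen F q d .k1)
  · simpa [borelIncl] using borelIncl_mem hq (gen F q d .k2)
  · simpa [borelIncl] using borelIncl_mem hq (gen F q d .e1)
  · simpa [borelIncl] using borelIncl_mem hq (gen F q d .e2)

theorem pow_mem_Bplus {x : Ubar F q d} (hx : x ∈ Bplus F q d) (n : ℕ) : x ^ n ∈ Bplus F q d := by
  induction n with
  | zero => rw [pow_zero]; exact one_mem_Bplus hq
  | succ n ih => rw [pow_succ]; exact mul_mem_Bplus hq ih hx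

theorem inv_mem_Bplus : ubarGen F q d .K1 ∈ Bplus F q d ∧ ubarGen F q d .K2 ∈ Bplus F q d := by
  have h := ubarSat (F := F) (q := q) (d := d)
  obtain ⟨h1, -, h2, -⟩ := h.pos.pow_sub_one hq
  have e1 : ubarGen F q d .K1 = ubarGen F q d .k1 ^ (d - 1) := left_inv_eq_right_inv h.K1k1 h1
  have e2 : ubarGen F q d .K2 = ubarGen F q d .k2 ^ (d - 1) := left_inv_eq_right_inv h.K2k2 h2
  rw [e1, e2]
  exact ⟨pow_mem_Bplus hq (gen_mem_Bplus hq (by simp)) _,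
    pow_mem_Bplus hq (gen_mem_Bplus hq (by simp)) _⟩

theorem antipode_mem_Bplus {x : Ubar F q d} (hx : x ∈ Bplus F q d) :
    ubarAntipodeₗ hq x ∈ Bplus F q d := by
  obtain ⟨i1, i2⟩ := inv_mem_Bplus (F := F) hq
  have hm : ∀ g ∈ [UqGen.k1, .k2, .e1, .e2], ubarAntipodeₗ hq (ubarGen F q d g) ∈ Bplus F q d := by
    intro g hg
    rw [ubarAntipodeₗ_gen]
    simp only [List.mem_cons, List.not_mem_nil, or_false] at hg
    rcases hg with rfl | rfl | rfl | rfl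
    · exact i1
    · exact i2
    · exact neg_mem (mul_mem_Bplus hq i1 (gen_mem_Bplus hq (by simp)))
    · exact neg_mem (mul_mem_Bplus hq i2 (gen_mem_Bplus hq (by simp)))
  suffices h : ∀ x ∈ Bplus F q d, ∀ i, ubarAntipodeₗ hq ((ubarAlg F q d).part i x) ∈ Bplus F q d by
    rw [← ubarAlg_grading.add_apply x, map_add]
    exact add_mem (h x hx 0) (h x hx 1)
  intro x hx
  refine Bplus_induction hq (P := fun x => ∀ i, ubarAntipodeₗ hq ((ubarAlg F q d).part i x) ∈
    Bplus F q d) (fun x y hx hy i => ?_) (fun c x hx i => ?_) (fun i => ?_)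
    (fun g hg x hx ih i => ?_) hx
  · rw [map_add, map_add]; exact add_mem (hx i) (hy i)
  · rw [map_smul, map_smul]; exact Submodule.smul_mem _ c (hx i)
  · rw [ubarAlg_grading.apply_of_hom ubar_one_even]
    split_ifs
    · rw [ubarAntipode_one]; exact one_mem_Bplus hq
    · rw [map_zero]; exact zero_mem _
  · have h2 := ubarAlg_isSuperAlg.part_hom_m (ubarGen_hom (F := F) (q := q) (d := d) g)
      (i - g.deg) x
    rw [show g.deg + (i - g.deg) = i by ring, ubarAlg_m, ubarAlg_m] at h2
    rw [h2, ubarAntipode_mul hq (ubarGen_hom g) (ubarAlg_grading.apply_self (i - g.deg) x)]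
    exact Submodule.smul_mem _ _ (mul_mem_Bplus hq (ih _) (hm g hg))

theorem part_mem_Bplus (i : ZMod 2) {x : Ubar F q d} (hx : x ∈ Bplus F q d) :
    (ubarAlg F q d).part i x ∈ Bplus F q d := by
  revert i
  refine Bplus_induction hq (P := fun x => ∀ i, (ubarAlg F q d).part i x ∈ Bplus F q d)
    (fun x y hx hy i => ?_) (fun c x hx i => ?_) (fun i => ?_) (fun g hg x hx ih i => ?_) hx
  · rw [map_add]; exact add_mem (hx i) (hy i)
  · rw [map_smul]; exact Submodule.smul_mem _ c (hx i)
  · rw [ubarAlg_grading.apply_of_hom ubar_one_even]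
    split_ifs
    · exact one_mem_Bplus hq
    · exact zero_mem _
  · have h2 := ubarAlg_isSuperAlg.part_hom_m (ubarGen_hom (F := F) (q := q) (d := d) g)
      (i - g.deg) x
    rw [show g.deg + (i - g.deg) = i by ring, ubarAlg_m, ubarAlg_m] at h2
    rw [h2]
    exact mul_mem_Bplus hq (gen_mem_Bplus hq hg) (ih _)

theorem comul_mem_Bplus {x : Ubar F q d} (hx : x ∈ Bplus F q d) : ubarComulₗ hq x ∈
    LinearMap.range (TensorProduct.map (Bplus F q d).subtype (Bplus F q d).subtype) := by
  set U := Bplus F q d with hU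
  set T := LinearMap.range (TensorProduct.map U.subtype U.subtype) with hT
  have tm {a b : Ubar F q d} (ha : a ∈ U) (hb : b ∈ U) : a ⊗ₜ[F] b ∈ T :=
    ⟨(⟨a, ha⟩ : U) ⊗ₜ (⟨b, hb⟩ : U), rfl⟩
  have mulT {s t : Ubar F q d ⊗[F] Ubar F q d} (hs : s ∈ T) (ht : t ∈ T) :
      ((ubarAlg F q d).tensor (ubarAlg F q d)).m s t ∈ T := by
    obtain ⟨s, rfl⟩ := hs
    obtain ⟨t, rfl⟩ := ht
    induction s with
    | zero => rw [map_zero, zero_m]; exact zero_mem _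
    | add x y hx hy => rw [map_add, add_m]; exact add_mem hx hy
    | tmul a b =>
      induction t with
      | zero => rw [map_zero, m_zero]; exact zero_mem _
      | add x y hx hy => rw [map_add, m_add]; exact add_mem hx hy
      | tmul a' b' =>
        simp only [TensorProduct.map_tmul, Submodule.subtype_apply]
        rw [← ubarAlg_grading.add_apply (b : Ubar F q d), ← ubarAlg_grading.add_apply (a' : Ubar F q d),
          TensorProduct.tmul_add, TensorProduct.add_tmul, add_m, m_add, m_add]
        have e (i j : ZMod 2) : ((ubarAlg F q d).tensor (ubarAlg F q d)).m
            ((a : Ubar F q d) ⊗ₜ (ubarAlg F q d).part i b)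
            ((ubarAlg F q d).part j a' ⊗ₜ (b' : Ubar F q d)) ∈ T := by
          rw [IsSuperAlg.tensor_m ubarAlg_grading ubarAlg_grading _ _
            (ubarAlg_grading.apply_self i _) (ubarAlg_grading.apply_self j _)]
          exact Submodule.smul_mem _ _ (tm (mul_mem_Bplus hq a.2 (part_mem_Bplus hq j a'.2))
            (mul_mem_Bplus hq (part_mem_Bplus hq i b.2) b'.2))
        exact add_mem (add_mem (e 0 0) (e 0 1)) (add_mem (e 1 0) (e 1 1))
  refine Bplus_induction hq (P := fun x => ubarComulₗ hq x ∈ T) (fun x y hx hy => ?_)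
    (fun c x hx => ?_) ?_ (fun g hg x hx ih => ?_) hx
  · rw [map_add]; exact add_mem hx hy
  · rw [map_smul]; exact Submodule.smul_mem _ c hx
  · rw [show ubarComulₗ hq (1 : Ubar F q d) = 1 ⊗ₜ 1 from (ubarComul_hom hq).map_one]
    exact tm (one_mem_Bplus hq) (one_mem_Bplus hq)
  · rw [← ubarAlg_m, (ubarComul_hom hq).map_m, ubarComulₗ_gen_tmul]
    refine mulT ?_ ih
    have m {g} := gen_mem_Bplus (F := F) hq (g := g)
    have o := one_mem_Bplus (F := F) hq
    simp only [List.mem_cons, List.not_mem_nil, or_false] at hg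
    rcases hg with rfl | rfl | rfl | rfl
    · exact tm (m (by simp)) (m (by simp))
    · exact tm (m (by simp)) (m (by simp))
    · exact add_mem (tm (m (by simp)) o) (tm (m (by simp)) (m (by simp)))
    · exact add_mem (tm (m (by simp)) o) (tm (m (by simp)) (m (by simp)))

theorem exists_borelHopf : ∃ B : SuperHopfData F (Bplus F q d),
    B.IsHopf ∧ B.IsHopfHom (ubarHopf hq) (Bplus F q d).subtype := by
  refine (ubarHopf_isHopf hq).exists_restrict _ (fun i x hx => part_mem_Bplus hq i hx)
    (fun x hx y hy => mul_mem_Bplus hq hx hy) (one_mem_Bplus hq) (fun x hx => comul_mem_Bplus hq hx)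
    (fun x hx => antipode_mem_Bplus hq hx) fun x hx => antipode_mem_Bplus hq ?_
  rw [LinearMap.mulLeftRight_apply]
  exact mul_mem_Bplus hq (mul_mem_Bplus hq (pow_mem_Bplus hq (inv_mem_Bplus hq).2 2) hx)
    (pow_mem_Bplus hq (gen_mem_Bplus hq (by simp)) 2)

end BorelHopf

namespace SuperHopfData

variable {F : Type*} [Field F] {V : Type*} [AddCommGroup V] [Module F V] [FiniteDimensional F V]
  {H : SuperHopfData F V}

theorem dualOp_m_apply (f g : Module.Dual F V) (x : V) : H.dualOp.m f g x =
    TensorProduct.dualDistrib F V V (f ⊗ₜ g) (superSign H.part H.part (H.comul x)) := rfl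

theorem dualDistrib_dualOp_comul (hp : IsGrading H.part) (f : Module.Dual F V) (a b : V) :
    TensorProduct.dualDistrib F V V (H.dualOp.comul f) (a ⊗ₜ b) = f (H.m b a) := by
  have e : TensorProduct.dualDistrib F V V (H.dualOp.comul f) =
      (f ∘ₗ H.mul ∘ₗ superFlip H.part H.part) ∘ₗ superSign H.part H.part :=
    (TensorProduct.dualDistribEquiv F V V).apply_symm_apply _
  have e' : TensorProduct.dualDistrib F V V (H.dualOp.comul f) =
      f ∘ₗ H.mul ∘ₗ (TensorProduct.comm F V V).toLinearMap := by
    rw [e]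
    refine hp.tensor_ext hp fun i j v w hv hw => ?_
    simp only [LinearMap.comp_apply]
    rw [superSign_tmul hp hp hv hw, map_smul, superFlip_tmul hp hp hv hw, smul_smul,
      koszulSign_mul_self, one_smul]
    rfl
  rw [e']
  rfl

theorem dualDistrib_injective :
    Function.Injective (TensorProduct.dualDistrib F V V) :=
  (TensorProduct.dualDistribEquiv F V V).injective

theorem dualOp_hom_iff {i : ZMod 2} {f : Module.Dual F V} :
    H.dualOp.part i f = f ↔ ∀ x, f (H.part i x) = f x :=
  ⟨fun h x => LinearMap.congr_fun h x, fun h => LinearMap.ext h⟩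

omit [FiniteDimensional F V] in
theorem dual_eq_zero_of_hom (hp : IsGrading H.part) {i j : ZMod 2} {f : Module.Dual F V}
    (hf : ∀ x, f (H.part i x) = f x) {x : V} (hx : H.part j x = x) (hij : j ≠ i) : f x = 0 := by
  rw [← hf, hp.apply_of_hom hx, if_neg hij.symm, map_zero]

omit [FiniteDimensional F V] in
theorem dual_smul_of_hom (hp : IsGrading H.part) {i j : ZMod 2} {f : Module.Dual F V}
    (hf : ∀ x, f (H.part i x) = f x) {x : V} (hx : H.part j x = x) (φ : ZMod 2 → F) :
    φ j * f x = φ i * f x := by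
  by_cases h : j = i
  · rw [h]
  · rw [dual_eq_zero_of_hom hp hf hx h, mul_zero, mul_zero]

theorem dualOp_grading (hp : IsGrading H.part) : IsGrading H.dualOp.part where
  proj i j := by
    ext f x
    change f (H.part j (H.part i x)) = _
    rw [hp.apply_apply]
    by_cases h : i = j
    · subst h; simp [dualOp]
    · simp [h, Ne.symm h]
  total := by
    ext f x
    change f (H.part 0 x) + f (H.part 1 x) = f x
    rw [← map_add, hp.add_apply]

omit [FiniteDimensional F V] in
theorem dualDistrib_superSign_of_even_right (hp : IsGrading H.part) (f : Module.Dual F V)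
    {g : Module.Dual F V} (hg : ∀ x, g (H.part 0 x) = g x) (t : V ⊗[F] V) :
    TensorProduct.dualDistrib F V V (f ⊗ₜ g) (superSign H.part H.part t) =
      TensorProduct.dualDistrib F V V (f ⊗ₜ g) t := by
  refine LinearMap.congr_fun (f := TensorProduct.dualDistrib F V V (f ⊗ₜ g) ∘ₗ
    superSign H.part H.part) (hp.tensor_ext hp fun i j v w hv hw => ?_) t
  rw [LinearMap.comp_apply, superSign_tmul hp hp hv hw, map_smul, TensorProduct.dualDistrib_apply,
    smul_eq_mul, mul_left_comm, dual_smul_of_hom hp hg hw (fun j => koszulSign F (i * j)), mul_zero,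
    koszulSign_zero, one_mul]

omit [FiniteDimensional F V] in
theorem dualDistrib_superSign_of_even_left (hp : IsGrading H.part) {f : Module.Dual F V}
    (hf : ∀ x, f (H.part 0 x) = f x) (g : Module.Dual F V) (t : V ⊗[F] V) :
    TensorProduct.dualDistrib F V V (f ⊗ₜ g) (superSign H.part H.part t) =
      TensorProduct.dualDistrib F V V (f ⊗ₜ g) t := by
  refine LinearMap.congr_fun (f := TensorProduct.dualDistrib F V V (f ⊗ₜ g) ∘ₗ
    superSign H.part H.part) (hp.tensor_ext hp fun i j v w hv hw => ?_) t
  rw [LinearMap.comp_apply, superSign_tmul hp hp hv hw, map_smul, TensorProduct.dualDistrib_apply,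
    smul_eq_mul, ← mul_assoc, dual_smul_of_hom hp hf hv (fun i => koszulSign F (i * j)), zero_mul,
    koszulSign_zero, one_mul]

omit [FiniteDimensional F V] in
theorem IsHopf.counit_part_zero (hH : H.IsHopf) (x : V) : H.counit (H.part 0 x) = H.counit x := by
  have h := LinearMap.congr_fun hH.counit_even x
  rw [LinearMap.comp_apply, LinearMap.zero_apply] at h
  conv_rhs => rw [← hH.grading.add_apply x, map_add, h, add_zero]

theorem IsHopf.dualOp_mul_assoc (hH : H.IsHopf) (f g h : Module.Dual F V) :
    H.dualOp.m (H.dualOp.m f g) h = H.dualOp.m f (H.dualOp.m g h) := by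
  have hp := hH.grading
  have hpp := hp.tensor hp
  set φ : V ⊗[F] V →ₗ[F] F := TensorProduct.dualDistrib F V V (f ⊗ₜ g) ∘ₗ superSign H.part H.part
  set γ : V ⊗[F] V →ₗ[F] F := TensorProduct.dualDistrib F V V (g ⊗ₜ h) ∘ₗ superSign H.part H.part
  set L := TensorProduct.dualDistrib F (V ⊗[F] V) V (φ ⊗ₜ h) ∘ₗ
    superSign (tensorPart H.part H.part) H.part
  set L' := TensorProduct.dualDistrib F V (V ⊗[F] V) (f ⊗ₜ γ) ∘ₗ
    superSign H.part (tensorPart H.part H.part)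
  have e1 : TensorProduct.dualDistrib F V V (H.dualOp.m f g ⊗ₜ h) ∘ₗ superSign H.part H.part =
      L ∘ₗ TensorProduct.map H.comul LinearMap.id := by
    refine hp.tensor_ext hp fun i j v w hv hw => ?_
    simp only [LinearMap.comp_apply, L, TensorProduct.map_tmul, LinearMap.id_apply]
    rw [superSign_tmul hp hp hv hw, superSign_tmul hpp hp (hH.comul_even.hom hv) hw, map_smul,
      map_smul]
    rfl
  have e2 : TensorProduct.dualDistrib F V V (f ⊗ₜ H.dualOp.m g h) ∘ₗ superSign H.part H.part =
      L' ∘ₗ TensorProduct.map LinearMap.id H.comul := by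
    refine hp.tensor_ext hp fun i j v w hv hw => ?_
    simp only [LinearMap.comp_apply, L', TensorProduct.map_tmul, LinearMap.id_apply]
    rw [superSign_tmul hp hp hv hw, superSign_tmul hp hpp hv (hH.comul_even.hom hw), map_smul,
      map_smul]
    rfl
  have e3 : L = L' ∘ₗ (TensorProduct.assoc F V V V).toLinearMap := by
    refine TensorProduct.ext' fun s z => ?_
    refine hp.induction (P := fun z => L (s ⊗ₜ z) =
      (L' ∘ₗ (TensorProduct.assoc F V V V).toLinearMap) (s ⊗ₜ z)) (fun a b ha hb => ?_) (fun k z hz => ?_) z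
    · rw [TensorProduct.tmul_add, map_add, map_add, ha, hb]
    refine hp.tensor_induction hp (P := fun s => L (s ⊗ₜ z) =
      (L' ∘ₗ (TensorProduct.assoc F V V V).toLinearMap) (s ⊗ₜ z)) (fun a b ha hb => ?_)
      (fun i j x y hx hy => ?_) s
    · rw [TensorProduct.add_tmul, map_add, map_add, ha, hb]
    simp only [LinearMap.comp_apply, L, L', LinearEquiv.coe_coe, TensorProduct.assoc_tmul]
    rw [superSign_tmul hpp hp (tensor_hom hp hp hx hy) hz,
      superSign_tmul hp hpp hx (tensor_hom hp hp hy hz), map_smul, map_smul,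
      TensorProduct.dualDistrib_apply, TensorProduct.dualDistrib_apply]
    simp only [φ, γ, LinearMap.comp_apply]
    rw [superSign_tmul hp hp hx hy, superSign_tmul hp hp hy hz, map_smul, map_smul,
      TensorProduct.dualDistrib_apply, TensorProduct.dualDistrib_apply, mul_add, add_mul,
      koszulSign_add, koszulSign_add]
    simp only [smul_eq_mul]
    ring
  ext x
  rw [dualOp_m_apply, dualOp_m_apply]
  refine (LinearMap.congr_fun e1 _).trans ((?_ : _ = _).trans (LinearMap.congr_fun e2 _).symm)
  rw [e3]
  exact congrArg L' (LinearMap.congr_fun hH.coassoc x)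

theorem IsHopf.dualOp_isSuperAlg (hH : H.IsHopf) : H.dualOp.IsSuperAlg where
  grading := dualOp_grading hH.grading
  mul_even := by
    have hp := hH.grading
    refine IsEvenMap.of_tmul (dualOp_grading hp) (dualOp_grading hp) (dualOp_grading hp)
      fun i j f g hf hg => dualOp_hom_iff.mpr fun x => ?_
    rw [dualOp_hom_iff] at hf hg
    change H.dualOp.m f g _ = H.dualOp.m f g _
    rw [dualOp_m_apply, dualOp_m_apply, hH.comul_even.apply]
    refine LinearMap.congr_fun (f := TensorProduct.dualDistrib F V V (f ⊗ₜ g) ∘ₗ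
      superSign H.part H.part ∘ₗ tensorPart H.part H.part (i + j))
      (g := TensorProduct.dualDistrib F V V (f ⊗ₜ g) ∘ₗ superSign H.part H.part)
      (hp.tensor_ext hp fun k l v w hv hw => ?_) (H.comul x)
    simp only [LinearMap.comp_apply]
    rw [tensorPart_tmul hp hp hv hw]
    split_ifs with h
    · rfl
    · rw [map_zero, map_zero, superSign_tmul hp hp hv hw, map_smul, TensorProduct.dualDistrib_apply]
      by_cases hk : k = i
      · have hl : l ≠ j := fun hl => h (by rw [hk, hl])
        rw [dual_eq_zero_of_hom hp hg hw hl, mul_zero, smul_zero]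
      · rw [dual_eq_zero_of_hom hp hf hv hk, zero_mul, smul_zero]
  one_even := dualOp_hom_iff.mpr hH.counit_part_zero
  mul_assoc := hH.dualOp_mul_assoc
  one_mul f := by
    ext x
    rw [dualOp_m_apply]
    refine (dualDistrib_superSign_of_even_left hH.grading hH.counit_part_zero f _).trans ?_
    have := congrArg f (LinearMap.congr_fun hH.counit_left x)
    refine Eq.trans ?_ this
    simp only [LinearMap.comp_apply]
    generalize H.comul x = t
    induction t with
    | zero => simp
    | add x y hx hy => simp only [map_add, hx, hy]
    | tmul x y => simp [dualOp]
  mul_one f := by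
    ext x
    rw [dualOp_m_apply]
    refine (dualDistrib_superSign_of_even_right hH.grading f hH.counit_part_zero _).trans ?_
    have := congrArg f (LinearMap.congr_fun hH.counit_right x)
    refine Eq.trans ?_ this
    simp only [LinearMap.comp_apply]
    generalize H.comul x = t
    induction t with
    | zero => simp
    | add x y hx hy => simp only [map_add, hx, hy]
    | tmul x y => simp [dualOp, mul_comm]

/-- `(a₁ ⊗ a₂) ⊗ (b₁ ⊗ b₂) ↦ ± (a₁ ⊗ b₁) ⊗ (a₂ ⊗ b₂)`, the sign being that of the product of
`(Hᵒᵖ)* ⊗ (Hᵒᵖ)*`. -/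
def dualShuffle (H : SuperHopfData F V) :
    (V ⊗[F] V) ⊗[F] (V ⊗[F] V) →ₗ[F] (V ⊗[F] V) ⊗[F] (V ⊗[F] V) :=
  superInterchange H.part H.part ∘ₗ
    TensorProduct.map (superSign H.part H.part) (superSign H.part H.part)

omit [FiniteDimensional F V] in
theorem dualShuffle_tmul (hp : IsGrading H.part) {i j k l : ZMod 2} {a b c e : V}
    (ha : H.part i a = a) (hb : H.part j b = b) (hc : H.part k c = c) (he : H.part l e = e) :
    H.dualShuffle ((a ⊗ₜ b) ⊗ₜ (c ⊗ₜ e)) =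
      koszulSign F (i * j + k * l + j * k) • ((a ⊗ₜ c) ⊗ₜ (b ⊗ₜ e)) := by
  simp only [dualShuffle, LinearMap.comp_apply, TensorProduct.map_tmul]
  rw [superSign_tmul hp hp ha hb, superSign_tmul hp hp hc he, TensorProduct.tmul_smul,
    ← TensorProduct.smul_tmul', map_smul, map_smul, superInterchange_tmul hp hp a e hb hc, smul_smul,
    smul_smul, koszulSign_add, koszulSign_add, mul_comm (koszulSign F (k * l))]

theorem dualOp_tensor_m_apply (hp : IsGrading H.part) (f g : Module.Dual F V ⊗[F] Module.Dual F V)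
    (a b : V) : TensorProduct.dualDistrib F V V ((H.dualOp.tensor H.dualOp).m f g) (a ⊗ₜ b) =
      TensorProduct.dualDistrib F _ _ (TensorProduct.dualDistrib F V V f ⊗ₜ
        TensorProduct.dualDistrib F V V g) (H.dualShuffle (H.comul a ⊗ₜ H.comul b)) := by
  have hX := dualOp_grading hp
  refine hX.tensor_induction hX (P := fun f => TensorProduct.dualDistrib F V V
    ((H.dualOp.tensor H.dualOp).m f g) (a ⊗ₜ b) = TensorProduct.dualDistrib F _ _
      (TensorProduct.dualDistrib F V V f ⊗ₜ TensorProduct.dualDistrib F V V g)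
      (H.dualShuffle (H.comul a ⊗ₜ H.comul b))) (fun x y hx hy => ?_) (fun i j f f' hf hf' => ?_) f
  · simp only [add_m, map_add, LinearMap.add_apply, hx, hy, TensorProduct.add_tmul]
  refine hX.tensor_induction hX (P := fun g => TensorProduct.dualDistrib F V V
    ((H.dualOp.tensor H.dualOp).m (f ⊗ₜ f') g) (a ⊗ₜ b) = TensorProduct.dualDistrib F _ _
      (TensorProduct.dualDistrib F V V (f ⊗ₜ f') ⊗ₜ TensorProduct.dualDistrib F V V g)
      (H.dualShuffle (H.comul a ⊗ₜ H.comul b))) (fun x y hx hy => ?_) (fun k l g g' hg hg' => ?_) g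
  · simp only [m_add, map_add, LinearMap.add_apply, hx, hy, TensorProduct.tmul_add]
  rw [IsSuperAlg.tensor_m hX hX f g' hf' hg, map_smul, LinearMap.smul_apply,
    TensorProduct.dualDistrib_apply, dualOp_m_apply, dualOp_m_apply]
  rw [dualOp_hom_iff] at hf hf' hg hg'
  generalize H.comul a = s
  generalize H.comul b = t
  refine hp.tensor_induction hp (P := fun s => _ • (TensorProduct.dualDistrib F V V (f ⊗ₜ g)
    (superSign H.part H.part s) * _) = TensorProduct.dualDistrib F _ _ _
      (H.dualShuffle (s ⊗ₜ t))) (fun x y hx hy => ?_) (fun i' j' x x' hx hx' => ?_) s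
  · simp only [TensorProduct.add_tmul, map_add, add_mul, smul_add, hx, hy]
  refine hp.tensor_induction hp (P := fun t => _ • (_ * TensorProduct.dualDistrib F V V (f' ⊗ₜ g')
    (superSign H.part H.part t)) = TensorProduct.dualDistrib F _ _ _
      (H.dualShuffle (_ ⊗ₜ t))) (fun x y hx hy => ?_) (fun k' l' y y' hy hy' => ?_) t
  · simp only [TensorProduct.tmul_add, map_add, mul_add, smul_add, hx, hy]
  rw [dualShuffle_tmul hp hx hx' hy hy', superSign_tmul hp hp hx hx', superSign_tmul hp hp hy hy']
  simp only [map_smul, TensorProduct.dualDistrib_apply, smul_eq_mul, koszulSign_add]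
  have e1 := dual_smul_of_hom hp hf' hy (fun j => koszulSign F (j * k))
  have e2 := dual_smul_of_hom hp hg hx' (fun k => koszulSign F (k' * k))
  rw [mul_comm k' j'] at e2
  linear_combination (-koszulSign F (i' * j') * f x * g x' * koszulSign F (k' * l') * g' y') * e1 +
    (-koszulSign F (i' * j') * f x * f' y * koszulSign F (k' * l') * g' y') * e2

theorem IsHopf.dualOp_comul_mul (hH : H.IsHopf) (f g : Module.Dual F V) :
    H.dualOp.comul (H.dualOp.m f g) =
      (H.dualOp.tensor H.dualOp).m (H.dualOp.comul f) (H.dualOp.comul g) := by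
  have hp := hH.grading
  apply dualDistrib_injective
  refine TensorProduct.ext' fun a b => ?_
  rw [dualDistrib_dualOp_comul hp, dualOp_tensor_m_apply hp, dualOp_m_apply, hH.comul_mul]
  generalize H.comul a = s
  generalize H.comul b = t
  refine hp.tensor_induction hp (P := fun s => TensorProduct.dualDistrib F V V (f ⊗ₜ g)
    (superSign H.part H.part ((H.tensor H).m t s)) = TensorProduct.dualDistrib F _ _ _
      (H.dualShuffle (s ⊗ₜ t))) (fun x y hx hy => ?_) (fun i j x x' hx hx' => ?_) s
  · simp only [TensorProduct.add_tmul, map_add, m_add, hx, hy]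
  refine hp.tensor_induction hp (P := fun t => TensorProduct.dualDistrib F V V (f ⊗ₜ g)
    (superSign H.part H.part ((H.tensor H).m t _)) = TensorProduct.dualDistrib F _ _ _
      (H.dualShuffle (_ ⊗ₜ t))) (fun x y hx hy => ?_) (fun k l y y' hy hy' => ?_) t
  · simp only [TensorProduct.tmul_add, map_add, add_m, hx, hy]
  rw [dualShuffle_tmul hp hx hx' hy hy', IsSuperAlg.tensor_m hp hp y x' hy' hx, map_smul,
    superSign_tmul hp hp (hH.isSuperAlg.hom_m hy hx) (hH.isSuperAlg.hom_m hy' hx'), smul_smul,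
    map_smul, map_smul, TensorProduct.dualDistrib_apply, TensorProduct.dualDistrib_apply,
    dualDistrib_dualOp_comul hp, dualDistrib_dualOp_comul hp, ← koszulSign_add]
  congr 2
  clear hx hx' hy hy'
  revert i j k l
  decide

end SuperHopfData

namespace SuperHopfData

variable {F : Type*} [Field F] {V : Type*} [AddCommGroup V] [Module F V] (H : SuperHopfData F V)

/-- Left multiplication. -/
def lmul (x : V) : V →ₗ[F] V := TensorProduct.curry H.mul x

/-- Right multiplication. -/
def rmul (x : V) : V →ₗ[F] V := (TensorProduct.curry H.mul).flip x

theorem lmul_apply (x y : V) : H.lmul x y = H.m x y := rfl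

theorem rmul_apply (x y : V) : H.rmul x y = H.m y x := rfl

/-- The operator `x ↦ (-1)^{ε|x|} x`. -/
def sgn (ε : ZMod 2) : V →ₗ[F] V := ∑ i : ZMod 2, koszulSign F (ε * i) • H.part i

variable {H}

theorem sgn_of_hom (hp : IsGrading H.part) (ε : ZMod 2) {i : ZMod 2} {x : V}
    (hx : H.part i x = x) : H.sgn ε x = koszulSign F (ε * i) • x := by
  rw [sgn, LinearMap.sum_apply, Finset.sum_eq_single i]
  · rw [LinearMap.smul_apply, hx]
  · intro j _ hj
    rw [LinearMap.smul_apply, hp.apply_of_hom hx, if_neg hj, smul_zero]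
  · simp

theorem sgn_zero (hp : IsGrading H.part) : H.sgn 0 = LinearMap.id := by
  ext x
  refine hp.induction (P := fun x => H.sgn 0 x = x) (fun a b ha hb => by rw [map_add, ha, hb])
    (fun i x hx => ?_) x
  rw [sgn_of_hom hp 0 hx, zero_mul, koszulSign_zero, one_smul]

theorem sgn_sgn (hp : IsGrading H.part) (ε : ZMod 2) (x : V) : H.sgn ε (H.sgn ε x) = x := by
  refine hp.induction (P := fun x => H.sgn ε (H.sgn ε x) = x)
    (fun a b ha hb => by rw [map_add, map_add, ha, hb]) (fun i x hx => ?_) x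
  rw [sgn_of_hom hp ε hx, map_smul, sgn_of_hom hp ε hx, smul_smul, koszulSign_mul_self, one_smul]

theorem IsSuperAlg.sgn_m (hH : H.IsSuperAlg) (ε : ZMod 2) (x y : V) :
    H.sgn ε (H.m x y) = H.m (H.sgn ε x) (H.sgn ε y) := by
  refine IsSuperAlgHom.map_m_of_hom (A := H) (B := H) hH.grading (fun i j x y hx hy => ?_) x y
  rw [sgn_of_hom hH.grading ε hx, sgn_of_hom hH.grading ε hy,
    sgn_of_hom hH.grading ε (hH.hom_m hx hy), smul_m, m_smul, smul_smul, ← koszulSign_add, mul_add]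

/-- `(f ⊗ g) ∘ superSign`, the pairing defining the product of `(Hᵒᵖ)*`. -/
def signPair (H : SuperHopfData F V) (f g : Module.Dual F V) : V ⊗[F] V →ₗ[F] F :=
  TensorProduct.dualDistrib F V V (f ⊗ₜ g) ∘ₗ superSign H.part H.part

theorem signPair_tmul (hp : IsGrading H.part) (f g : Module.Dual F V) {i j : ZMod 2} {x y : V}
    (hx : H.part i x = x) (hy : H.part j y = y) :
    H.signPair f g (x ⊗ₜ y) = koszulSign F (i * j) * (f x * g y) := by
  rw [signPair, LinearMap.comp_apply, superSign_tmul hp hp hx hy, map_smul,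
    TensorProduct.dualDistrib_apply, smul_eq_mul]

theorem IsSuperAlg.signPair_m_left (hH : H.IsSuperAlg) (f g : Module.Dual F V) {i j : ZMod 2}
    {x y : V} (hx : H.part i x = x) (hy : H.part j y = y) (t : V ⊗[F] V) :
    H.signPair f g ((H.tensor H).m (x ⊗ₜ y) t) = koszulSign F (i * j) *
      H.signPair (f ∘ₗ H.lmul x) (g ∘ₗ H.lmul y ∘ₗ H.sgn i) t := by
  have hp := hH.grading
  refine hp.tensor_induction hp (P := fun t => H.signPair f g ((H.tensor H).m (x ⊗ₜ y) t) =
    koszulSign F (i * j) * H.signPair (f ∘ₗ H.lmul x) (g ∘ₗ H.lmul y ∘ₗ H.sgn i) t)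
    (fun a b ha hb => by rw [m_add, map_add, map_add, ha, hb, mul_add])
    (fun k l a b ha hb => ?_) t
  rw [tensor_m hp hp x b hy ha, map_smul, signPair_tmul hp _ _ (hH.hom_m hx ha) (hH.hom_m hy hb),
    signPair_tmul hp _ _ ha hb]
  simp only [LinearMap.comp_apply, lmul_apply, sgn_of_hom hp i hb, m_smul, map_smul, smul_eq_mul]
  have : koszulSign F (j * k) * koszulSign F ((i + k) * (j + l)) =
      koszulSign F (i * j) * (koszulSign F (k * l) * koszulSign F (i * l)) := by
    simp only [← koszulSign_add]
    congr 1
    clear hx hy ha hb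
    revert i j k l
    decide
  linear_combination (f (H.m x a) * g (H.m y b)) * this

theorem IsSuperAlg.signPair_m_right (hH : H.IsSuperAlg) (f g : Module.Dual F V) {i j : ZMod 2}
    {x y : V} (hx : H.part i x = x) (hy : H.part j y = y) (t : V ⊗[F] V) :
    H.signPair f g ((H.tensor H).m t (x ⊗ₜ y)) = koszulSign F (i * j) *
      H.signPair (f ∘ₗ H.rmul x ∘ₗ H.sgn j) (g ∘ₗ H.rmul y) t := by
  have hp := hH.grading
  refine hp.tensor_induction hp (P := fun t => H.signPair f g ((H.tensor H).m t (x ⊗ₜ y)) =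
    koszulSign F (i * j) * H.signPair (f ∘ₗ H.rmul x ∘ₗ H.sgn j) (g ∘ₗ H.rmul y) t)
    (fun a b ha hb => by rw [add_m, map_add, map_add, ha, hb, mul_add])
    (fun k l a b ha hb => ?_) t
  rw [tensor_m hp hp a y hb hx, map_smul, signPair_tmul hp _ _ (hH.hom_m ha hx) (hH.hom_m hb hy),
    signPair_tmul hp _ _ ha hb]
  simp only [LinearMap.comp_apply, rmul_apply, sgn_of_hom hp j ha, smul_m, map_smul, smul_eq_mul]
  have : koszulSign F (l * i) * koszulSign F ((k + i) * (l + j)) =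
      koszulSign F (i * j) * (koszulSign F (k * l) * koszulSign F (j * k)) := by
    simp only [← koszulSign_add]
    congr 1
    clear hx hy ha hb
    revert i j k l
    decide
  linear_combination (f (H.m a x) * g (H.m b y)) * this

variable [FiniteDimensional F V]

theorem dualOp_m_eq (f g : Module.Dual F V) : H.dualOp.m f g = H.signPair f g ∘ₗ H.comul := rfl

/-- `k` is an even grouplike element. -/
structure IsGrouplike (H : SuperHopfData F V) (k : V) : Prop where
  even : H.part 0 k = k
  comul : H.comul k = k ⊗ₜ k

/-- `e` is homogeneous of degree `ε` with `Δ e = e ⊗ 1 + k ⊗ e`, where `k` is grouplike. -/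
structure IsSkewPrimitive (H : SuperHopfData F V) (ε : ZMod 2) (k e : V) : Prop where
  grouplike : H.IsGrouplike k
  hom : H.part ε e = e
  comul : H.comul e = e ⊗ₜ H.one + k ⊗ₜ e

section Rules

variable (hH : H.IsHopf) {k e : V} {ε : ZMod 2} (f g : Module.Dual F V)

include hH

theorem IsGrouplike.dual_m_lmul (hk : H.IsGrouplike k) : H.dualOp.m f g ∘ₗ H.lmul k =
    H.dualOp.m (f ∘ₗ H.lmul k) (g ∘ₗ H.lmul k) := by
  ext x
  simp only [dualOp_m_eq, LinearMap.comp_apply, lmul_apply]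
  rw [hH.comul_mul, hk.comul, hH.isSuperAlg.signPair_m_left f g hk.even hk.even,
    sgn_zero hH.grading, zero_mul, koszulSign_zero, one_mul, LinearMap.comp_id]

theorem IsGrouplike.dual_m_rmul (hk : H.IsGrouplike k) : H.dualOp.m f g ∘ₗ H.rmul k =
    H.dualOp.m (f ∘ₗ H.rmul k) (g ∘ₗ H.rmul k) := by
  ext x
  simp only [dualOp_m_eq, LinearMap.comp_apply, rmul_apply]
  rw [hH.comul_mul, hk.comul, hH.isSuperAlg.signPair_m_right f g hk.even hk.even,
    sgn_zero hH.grading, zero_mul, koszulSign_zero, one_mul, LinearMap.comp_id]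

omit [FiniteDimensional F V] in
theorem IsHopf.lmul_one : H.lmul H.one = LinearMap.id := LinearMap.ext hH.one_mul

omit [FiniteDimensional F V] in
theorem IsHopf.rmul_one : H.rmul H.one = LinearMap.id := LinearMap.ext hH.mul_one

theorem IsSkewPrimitive.dual_m_lmul (he : H.IsSkewPrimitive ε k e) :
    H.dualOp.m f g ∘ₗ H.lmul e = H.dualOp.m (f ∘ₗ H.lmul e) (g ∘ₗ H.sgn ε) +
      H.dualOp.m (f ∘ₗ H.lmul k) (g ∘ₗ H.lmul e) := by
  ext x
  simp only [dualOp_m_eq, LinearMap.comp_apply, LinearMap.add_apply, lmul_apply]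
  rw [hH.comul_mul, he.comul, add_m, map_add,
    hH.isSuperAlg.signPair_m_left f g he.hom hH.one_even,
    hH.isSuperAlg.signPair_m_left f g he.grouplike.even he.hom, hH.lmul_one, sgn_zero hH.grading,
    zero_mul, mul_zero, koszulSign_zero, one_mul, one_mul, LinearMap.comp_id, LinearMap.id_comp]

theorem IsSkewPrimitive.dual_m_rmul (he : H.IsSkewPrimitive ε k e) :
    H.dualOp.m f g ∘ₗ H.rmul e = H.dualOp.m (f ∘ₗ H.rmul e) g +
      H.dualOp.m (f ∘ₗ H.rmul k ∘ₗ H.sgn ε) (g ∘ₗ H.rmul e) := by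
  ext x
  simp only [dualOp_m_eq, LinearMap.comp_apply, LinearMap.add_apply, rmul_apply]
  rw [hH.comul_mul, he.comul, m_add, map_add,
    hH.isSuperAlg.signPair_m_right f g he.hom hH.one_even,
    hH.isSuperAlg.signPair_m_right f g he.grouplike.even he.hom, hH.rmul_one, sgn_zero hH.grading,
    zero_mul, mul_zero, koszulSign_zero, one_mul, one_mul, LinearMap.comp_id, LinearMap.comp_id]

end Rules

end SuperHopfData

/-- Skew derivations `L₁, L₂` with respect to automorphisms `T₁, T₂`, which recognize zero, force
the relations of the Borel part. -/
theorem BorelRel.of_skewDerivation {F : Type*} [Field F] {q : F} {d : ℕ} (hq : IsOddRoot q d)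
    {Y : Type*} [Ring Y] [Algebra F Y] {κ1 κ2 A C : Y} {a c : F} (T1 T2 σ : Y →ₐ[F] Y)
    (L1 L2 : Y →ₗ[F] Y) (ε : Y →ₐ[F] F)
    (hL1 : ∀ x y, L1 (x * y) = L1 x * y + T1 x * L1 y)
    (hL2 : ∀ x y, L2 (x * y) = L2 x * σ y + T2 x * L2 y)
    (zero : ∀ u, ε u = 0 → (∃ c : F, T1 u = c • u) → (∃ c : F, T2 u = c • u) → L1 u = 0 → L2 u = 0 →
      u = 0)
    (T1κ1 : T1 κ1 = q ^ 2 • κ1) (T1κ2 : T1 κ2 = q⁻¹ • κ2) (T1A : T1 A = q ^ 2 • A)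
    (T1C : T1 C = q⁻¹ • C) (T2κ1 : T2 κ1 = q⁻¹ • κ1) (T2κ2 : T2 κ2 = κ2) (T2A : T2 A = q⁻¹ • A)
    (T2C : T2 C = C) (σκ1 : σ κ1 = κ1) (σκ2 : σ κ2 = κ2) (σA : σ A = A) (σC : σ C = -C)
    (εκ1 : ε κ1 = 1) (εκ2 : ε κ2 = 1) (εA : ε A = 0) (εC : ε C = 0)
    (L1κ1 : L1 κ1 = 0) (L1κ2 : L1 κ2 = 0) (L1A : L1 A = algebraMap F Y a) (L1C : L1 C = 0)
    (L2κ1 : L2 κ1 = 0) (L2κ2 : L2 κ2 = 0) (L2A : L2 A = 0) (L2C : L2 C = algebraMap F Y c) :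
    BorelRel q d κ1 κ2 A C := by
  have q0 := hq.ne_zero
  rw [Algebra.algebraMap_eq_smul_one] at L1A L2C
  have L11 : L1 1 = 0 := by simpa using hL1 1 1
  have L21 : L2 1 = 0 := by simpa using hL2 1 1
  have z2 : (q : F) ^ (-2 : ℤ) = (q ^ 2)⁻¹ := by rw [zpow_neg, zpow_ofNat]
  have Lpow {κ : Y} (h1 : L1 κ = 0) (h2 : L2 κ = 0) (n : ℕ) : L1 (κ ^ n) = 0 ∧ L2 (κ ^ n) = 0 := by
    induction n with
    | zero => rw [pow_zero]; exact ⟨L11, L21⟩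
    | succ n ih => rw [pow_succ, hL1, hL2, ih.1, ih.2, h1, h2]; simp
  have qd : (q⁻¹) ^ d = 1 := by rw [_root_.inv_pow, hq.root.pow_eq_one, inv_one]
  have q2d : (q ^ 2) ^ d = 1 := by
    rw [← pow_mul, mul_comm, pow_mul, hq.root.pow_eq_one, one_pow]
  refine ⟨?_, ?_, ?_, ?_, ?_, ?_, ?_, ?_, ?_, ?_⟩
  · rw [← sub_eq_zero]
    refine zero _ ?_ ⟨1, ?_⟩ ⟨1, ?_⟩ ?_ ?_
    · simp [εκ1]
    · rw [map_sub, map_pow, T1κ1, smul_pow, q2d, map_one]; simp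
    · rw [map_sub, map_pow, T2κ1, smul_pow, qd, map_one]; simp
    · rw [map_sub, (Lpow L1κ1 L2κ1 d).1, L11, sub_zero]
    · rw [map_sub, (Lpow L1κ1 L2κ1 d).2, L21, sub_zero]
  · rw [← sub_eq_zero]
    refine zero _ ?_ ⟨1, ?_⟩ ⟨1, ?_⟩ ?_ ?_
    · simp [εκ2]
    · rw [map_sub, map_pow, T1κ2, smul_pow, qd, map_one]; simp
    · rw [map_sub, map_pow, T2κ2, map_one]; simp
    · rw [map_sub, (Lpow L1κ2 L2κ2 d).1, L11, sub_zero]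
    · rw [map_sub, (Lpow L1κ2 L2κ2 d).2, L21, sub_zero]
  · rw [← sub_eq_zero]
    refine zero _ ?_ ⟨q ^ 2 * q⁻¹, ?_⟩ ⟨q⁻¹, ?_⟩ ?_ ?_
    · simp [εκ1, εκ2]
    · simp only [map_sub, map_mul, T1κ1, T1κ2, smul_mul_assoc, mul_smul_comm]; module
    · simp only [map_sub, map_mul, T2κ1, T2κ2, smul_mul_assoc, mul_smul_comm]; module
    · simp only [map_sub, hL1, L1κ1, L1κ2]; simp
    · simp only [map_sub, hL2, L2κ1, L2κ2]; simp
  · rw [← sub_eq_zero]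
    refine zero _ ?_ ⟨q ^ 2 * q ^ 2, ?_⟩ ⟨q⁻¹ * q⁻¹, ?_⟩ ?_ ?_
    · simp [εA]
    · simp only [map_sub, map_mul, map_smul, T1κ1, T1A, smul_mul_assoc, mul_smul_comm]; module
    · simp only [map_sub, map_mul, map_smul, T2κ1, T2A, smul_mul_assoc, mul_smul_comm]; module
    · simp only [map_sub, map_smul, hL1, L1κ1, L1A, T1κ1, z2]
      simp only [zero_mul, mul_zero, zero_add, add_zero, mul_smul_comm, mul_one, one_mul, smul_mul_assoc,
        smul_smul]
      rw [show (q ^ 2)⁻¹ * (a * q ^ 2) = a by field_simp, sub_self]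
    · simp only [map_sub, map_smul, hL2, L2κ1, L2A]; simp
  · rw [← sub_eq_zero]
    refine zero _ ?_ ⟨q ^ 2 * q⁻¹, ?_⟩ ⟨q⁻¹, ?_⟩ ?_ ?_
    · simp [εC]
    · simp only [map_sub, map_mul, map_smul, T1κ1, T1C, smul_mul_assoc, mul_smul_comm]; module
    · simp only [map_sub, map_mul, map_smul, T2κ1, T2C, smul_mul_assoc, mul_smul_comm]; module
    · simp only [map_sub, map_smul, hL1, L1κ1, L1C]; simp
    · simp only [map_sub, map_smul, hL2, L2κ1, L2C, T2κ1, σκ1]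
      simp [smul_smul, q0, mul_comm c, mul_assoc]
  · rw [← sub_eq_zero]
    refine zero _ ?_ ⟨q ^ 2 * q⁻¹, ?_⟩ ⟨q⁻¹, ?_⟩ ?_ ?_
    · simp [εA]
    · simp only [map_sub, map_mul, map_smul, T1κ2, T1A, smul_mul_assoc, mul_smul_comm]; module
    · simp only [map_sub, map_mul, map_smul, T2κ2, T2A, smul_mul_assoc, mul_smul_comm]; module
    · simp only [map_sub, map_smul, hL1, L1κ2, L1A, T1κ2]
      simp [smul_smul, q0, mul_comm a, mul_assoc]
    · simp only [map_sub, map_smul, hL2, L2κ2, L2A]; simp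
  · rw [← sub_eq_zero]
    refine zero _ ?_ ⟨q⁻¹ * q⁻¹, ?_⟩ ⟨1, ?_⟩ ?_ ?_
    · simp [εC]
    · simp only [map_sub, map_mul, T1κ2, T1C, smul_mul_assoc, mul_smul_comm]; module
    · simp only [map_sub, map_mul, T2κ2, T2C]; simp
    · simp only [map_sub, hL1, L1κ2, L1C]; simp
    · simp only [map_sub, hL2, L2κ2, L2C, T2κ2, σκ2]; simp
  · refine zero _ ?_ ⟨q⁻¹ * q⁻¹, ?_⟩ ⟨1, ?_⟩ ?_ ?_
    · simp [εC]
    · simp only [map_mul, T1C, smul_mul_assoc, mul_smul_comm]; module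
    · simp only [map_mul, T2C]; simp
    · simp only [hL1, L1C]; simp
    · simp only [hL2, L2C, T2C, σC]; simp
  · refine zero _ ?_ ⟨(q ^ 2) ^ 2 * q⁻¹, ?_⟩ ⟨(q⁻¹) ^ 2, ?_⟩ ?_ ?_
    · simp [serreElt, εA]
    · rw [serreElt_map, T1A, T1C, serreElt_smul]
    · have := serreElt_smul q q⁻¹ 1 A C
      rw [one_smul, mul_one] at this
      rw [serreElt_map, T2A, T2C, this]
    · simp only [serreElt, pow_two, map_sub, map_add, map_smul, hL1, L1A, L1C, T1A, T1C, map_mul,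
        smul_mul_assoc, mul_smul_comm, mul_zero, zero_mul, add_zero, zero_add, one_mul, mul_one,
        mul_add, smul_zero, smul_smul, mul_assoc, add_mul, smul_add]
      match_scalars <;> field_simp <;> ring
    · simp only [serreElt, pow_two, map_sub, map_add, map_smul, hL2, L2A, L2C, T2A, T2C, map_mul,
        smul_mul_assoc, mul_smul_comm, mul_zero, zero_mul, add_zero, zero_add, one_mul, mul_one, σA]
      match_scalars
      field_simp
      ring
  · have hA : ∀ n, L1 (A ^ (n + 1)) = (a * ∑ i ∈ Finset.range (n + 1), (q ^ 2) ^ i) • A ^ n := by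
      intro n
      induction n with
      | zero => simp [L1A]
      | succ n ih =>
        rw [pow_succ, hL1, ih, map_pow, T1A, L1A, smul_pow, smul_mul_assoc, ← pow_succ,
          smul_mul_assoc, mul_smul_comm, mul_one, smul_smul, ← add_smul,
          Finset.sum_range_succ _ (n + 1)]
        congr 1
        ring
    have hA2 : ∀ n, L2 (A ^ n) = 0 := by
      intro n
      induction n with
      | zero => rw [pow_zero, L21]
      | succ n ih => rw [pow_succ, hL2, ih, L2A]; simp
    obtain ⟨n, hn⟩ := Nat.exists_eq_succ_of_ne_zero hq.pos.ne'
    refine zero _ ?_ ⟨1, ?_⟩ ⟨1, ?_⟩ ?_ (hA2 d)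
    · rw [map_pow, εA, zero_pow hq.pos.ne']
    · rw [map_pow, T1A, smul_pow, q2d]
    · rw [map_pow, T2A, smul_pow, qd]
    · have h2 : IsPrimitiveRoot (q ^ 2) d :=
        hq.root.pow_of_coprime 2 ((Nat.coprime_two_left).mpr hq.odd)
      have := hA n
      rw [← Nat.succ_eq_add_one, ← hn, h2.geom_sum_eq_zero hq.one_lt] at this
      rw [this, mul_zero, zero_smul]

namespace SuperHopfData

variable {F : Type*} [Field F] {q : F} {d : ℕ} {W : Type*} [AddCommGroup W] [Module F W]

/-- `B` is a Hopf superalgebra structure on the positive Borel algebra, transported by `θ`. -/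
structure IsBorelHopf (B : SuperHopfData F W) (θ : BorelAlg F q d ≃ₗ[F] W) : Prop where
  isHopf : B.IsHopf
  map_mul : ∀ x y, θ (x * y) = B.m (θ x) (θ y)
  map_one : θ 1 = B.one
  k1 : B.IsGrouplike (θ (BorelAlg.gen F q d .k1))
  k2 : B.IsGrouplike (θ (BorelAlg.gen F q d .k2))
  e1 : B.IsSkewPrimitive 0 (θ (BorelAlg.gen F q d .k1)) (θ (BorelAlg.gen F q d .e1))
  e2 : B.IsSkewPrimitive 1 (θ (BorelAlg.gen F q d .k2)) (θ (BorelAlg.gen F q d .e2))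
  counit_k1 : B.counit (θ (BorelAlg.gen F q d .k1)) = 1
  counit_k2 : B.counit (θ (BorelAlg.gen F q d .k2)) = 1
  counit_e1 : B.counit (θ (BorelAlg.gen F q d .e1)) = 0
  counit_e2 : B.counit (θ (BorelAlg.gen F q d .e2)) = 0

/-- A character with given values on the generators `k₁, k₂` and vanishing on `e₁, e₂`. -/
structure IsTorusChar (B : SuperHopfData F W) (θ : BorelAlg F q d ≃ₗ[F] W) (s1 s2 : F)
    (f : Module.Dual F W) : Prop where
  map_m : ∀ x y, f (B.m x y) = f x * f y
  map_one : f B.one = 1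
  k1 : f (θ (BorelAlg.gen F q d .k1)) = s1
  k2 : f (θ (BorelAlg.gen F q d .k2)) = s2
  e1 : f (θ (BorelAlg.gen F q d .e1)) = 0
  e2 : f (θ (BorelAlg.gen F q d .e2)) = 0

/-- A functional `f` with `f(xy) = f(x) ε(y) + κ(x) f(y)` vanishing on the torus, with given values
on `e₁, e₂`. -/
structure IsSkewChar (B : SuperHopfData F W) (θ : BorelAlg F q d ≃ₗ[F] W) (κ : Module.Dual F W)
    (c1 c2 : F) (f : Module.Dual F W) : Prop where
  map_m : ∀ x y, f (B.m x y) = f x * B.counit y + κ x * f y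
  map_one : f B.one = 0
  k1 : f (θ (BorelAlg.gen F q d .k1)) = 0
  k2 : f (θ (BorelAlg.gen F q d .k2)) = 0
  e1 : f (θ (BorelAlg.gen F q d .e1)) = c1
  e2 : f (θ (BorelAlg.gen F q d .e2)) = c2

variable {B : SuperHopfData F W} {θ : BorelAlg F q d ≃ₗ[F] W}

namespace IsBorelHopf

variable (hB : IsBorelHopf B θ)

include hB

theorem induction {P : W → Prop} (add : ∀ x y, P x → P y → P (x + y))
    (smul : ∀ (c : F) x, P x → P (c • x)) (one : P B.one)
    (mul : ∀ g x, P x → P (B.m (θ (BorelAlg.gen F q d g)) x)) (x : W) : P x := by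
  obtain ⟨y, rfl⟩ := θ.surjective x
  induction y using BorelAlg.induction_left with
  | add x y hx hy => rw [_root_.map_add]; exact add _ _ hx hy
  | smul c x hx => rw [_root_.map_smul]; exact smul _ _ hx
  | one => rwa [hB.map_one]
  | mul g x hx => rw [hB.map_mul]; exact mul _ _ hx

/-- The test for vanishing of a functional. -/
theorem dual_eq_zero {u : Module.Dual F W} (h : u B.one = 0)
    (mul : ∀ g, ∃ c : F, u ∘ₗ B.lmul (θ (BorelAlg.gen F q d g)) = c • u) : u = 0 := by
  ext x
  refine hB.induction (P := fun x => u x = 0) (fun x y hx hy => by rw [_root_.map_add, hx, hy, add_zero])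
    (fun c x hx => by rw [_root_.map_smul, hx, smul_zero]) h (fun g x hx => ?_) x
  obtain ⟨c, hc⟩ := mul g
  have := LinearMap.congr_fun hc x
  rw [LinearMap.comp_apply, lmul_apply] at this
  rw [this, LinearMap.smul_apply, hx, smul_zero]

theorem isTorusChar_counit : IsTorusChar B θ 1 1 B.counit :=
  ⟨hB.isHopf.counit_mul, hB.isHopf.counit_one, hB.counit_k1, hB.counit_k2, hB.counit_e1,
    hB.counit_e2⟩

theorem exists_torusChar {s1 s2 : F} (hd : 0 < d) (h1 : s1 ^ d = 1) (h2 : s2 ^ d = 1) :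
    ∃ f, IsTorusChar B θ s1 s2 f := by
  have h : BorelRel q d s1 s2 (0 : F) 0 := by
    constructor <;> simp [h1, h2, mul_comm, serreElt, hd.ne']
  have hm (x y : W) : θ.symm (B.m x y) = θ.symm x * θ.symm y := by
    apply θ.injective
    rw [hB.map_mul, θ.apply_symm_apply, θ.apply_symm_apply, θ.apply_symm_apply]
  refine ⟨(BorelAlg.lift h).toLinearMap ∘ₗ θ.symm.toLinearMap, ?_, ?_, ?_, ?_, ?_, ?_⟩
  · intro x y
    simp [hm]
  · simp [← hB.map_one]
  all_goals simp

theorem exists_skewChar (hq : IsOddRoot q d) {s1 s2 c1 c2 : F} {κ : Module.Dual F W}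
    (hκ : IsTorusChar B θ s1 s2 κ) (h11 : c1 = q ^ (-2 : ℤ) * (s1 * c1)) (h21 : c2 = q * (s1 * c2))
    (h12 : c1 = q * (s2 * c1)) (h22 : c2 = s2 * c2) : ∃ f, IsSkewChar B θ κ c1 c2 f := by
  have hm (x y : W) : θ.symm (B.m x y) = θ.symm x * θ.symm y := by
    apply θ.injective
    rw [hB.map_mul, θ.apply_symm_apply, θ.apply_symm_apply, θ.apply_symm_apply]
  let k : BorelAlg F q d →ₐ[F] F := AlgHom.ofLinearMap (κ ∘ₗ θ.toLinearMap)
    (by simp [hB.map_one, hκ.map_one]) (fun x y => by simp [hB.map_mul, hκ.map_m])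
  let ε : BorelAlg F q d →ₐ[F] F := AlgHom.ofLinearMap (B.counit ∘ₗ θ.toLinearMap)
    (by simp [hB.map_one, hB.isHopf.counit_one])
    (fun x y => by simp [hB.map_mul, hB.isHopf.counit_mul])
  have hk : ∀ x, k x = κ (θ x) := fun _ => rfl
  have hε : ∀ x, ε x = B.counit (θ x) := fun _ => rfl
  have r1 := (BorelAlg.borelRel F q d).map k
  have r2 := (BorelAlg.borelRel F q d).map ε
  simp only [hk, hε, hκ.k1, hκ.k2, hκ.e1, hκ.e2, hB.counit_k1, hB.counit_k2, hB.counit_e1,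
    hB.counit_e2] at r1 r2
  have h := BorelRel.skewPair (D1 := c1) (D2 := c2) r1 r2 (by simpa using h11) (by simpa using h21)
    (by simpa using h12) (by simpa using h22) (by simp) (by simp) (by
      refine Finset.sum_eq_zero fun i hi => ?_
      have := Finset.mem_range.mp hi
      have := hq.one_lt
      rcases Nat.eq_zero_or_pos i with rfl | hi
      · rw [show (0 : F) ^ (d - 1 - 0) = 0 from zero_pow (by omega), mul_zero]
      · rw [zero_pow (by omega), zero_mul, zero_mul])
  set Φ := BorelAlg.lift h
  have key : ∀ x, Φ x 0 0 = k x ∧ Φ x 1 0 = 0 ∧ Φ x 1 1 = ε x := fun x => by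
    induction x using BorelAlg.induction_left with
    | add x y hx hy => simp [hx, hy]
    | smul c x hx => simp [hx]
    | one => simp
    | mul g x hx =>
      simp only [_root_.map_mul, Matrix.mul_apply, Fin.sum_univ_two, hx]
      cases g <;> simp [Φ, _root_.skewPair, hk, hε, hκ.k1, hκ.k2, hκ.e1, hκ.e2, hB.counit_k1,
        hB.counit_k2, hB.counit_e1, hB.counit_e2]
  refine ⟨skewOp Φ ∘ₗ θ.symm.toLinearMap, ?_, ?_, ?_, ?_, ?_, ?_⟩
  · intro x y
    change Φ _ 0 1 = Φ _ 0 1 * _ + _ * Φ _ 0 1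
    simp only [LinearEquiv.coe_coe]
    rw [hm, _root_.map_mul, Matrix.mul_apply, Fin.sum_univ_two, (key _).1, (key _).2.2, hk, hε,
      θ.apply_symm_apply, θ.apply_symm_apply, add_comm]
  · change Φ _ 0 1 = 0
    simp [← hB.map_one]
  all_goals
    change Φ _ 0 1 = _
    simp [Φ, _root_.skewPair]

end IsBorelHopf

namespace IsTorusChar

variable {s1 s2 : F} {f : Module.Dual F W} (hf : IsTorusChar B θ s1 s2 f)

include hf

theorem comp_lmul (x : W) : f ∘ₗ B.lmul x = f x • f := LinearMap.ext fun y => hf.map_m x y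

theorem comp_rmul (x : W) : f ∘ₗ B.rmul x = f x • f :=
  LinearMap.ext fun y => (hf.map_m y x).trans (mul_comm _ _)

theorem comp_sgn (hB : IsBorelHopf B θ) (ε : ZMod 2) : f ∘ₗ B.sgn ε = f := by
  rw [← sub_eq_zero]
  have hs := hB.isHopf.isSuperAlg
  refine hB.dual_eq_zero ?_ fun g => ?_
  · rw [LinearMap.sub_apply, LinearMap.comp_apply, sgn_of_hom hs.grading ε hs.one_even]
    simp
  have key {i : ZMod 2} {x : W} (hx : B.part i x = x) :
      (f ∘ₗ B.sgn ε - f) ∘ₗ B.lmul x = koszulSign F (ε * i) • (f x • f ∘ₗ B.sgn ε) - f x • f := by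
    ext y
    simp only [LinearMap.comp_apply, lmul_apply, LinearMap.sub_apply, LinearMap.smul_apply]
    rw [hs.sgn_m, sgn_of_hom hs.grading ε hx, smul_m, _root_.map_smul, hf.map_m, hf.map_m]
    simp
  cases g
  · exact ⟨f (θ (BorelAlg.gen F q d .k1)), by rw [key hB.k1.even]; simp [smul_sub]⟩
  · exact ⟨f (θ (BorelAlg.gen F q d .k2)), by rw [key hB.k2.even]; simp [smul_sub]⟩
  · exact ⟨0, by rw [key hB.e1.hom, hf.e1]; simp⟩
  · exact ⟨0, by rw [key hB.e2.hom, hf.e2]; simp⟩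

end IsTorusChar

namespace IsSkewChar

variable {c1 c2 : F} {f κ : Module.Dual F W} (hf : IsSkewChar B θ κ c1 c2 f)

include hf

theorem comp_lmul (x : W) : f ∘ₗ B.lmul x = f x • B.counit + κ x • f :=
  LinearMap.ext fun y => hf.map_m x y

theorem comp_rmul (x : W) : f ∘ₗ B.rmul x = B.counit x • f + f x • κ :=
  LinearMap.ext fun y => (hf.map_m y x).trans (by simp [mul_comm])

theorem comp_sgn {s1 s2 : F} (hB : IsBorelHopf B θ) (hκ : IsTorusChar B θ s1 s2 κ) {i : ZMod 2}
    (hc1 : i = 1 → c1 = 0) (hc2 : i = 0 → c2 = 0) (ε : ZMod 2) :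
    f ∘ₗ B.sgn ε = koszulSign F (ε * i) • f := by
  rw [← sub_eq_zero]
  have hs := hB.isHopf.isSuperAlg
  have he := hB.isTorusChar_counit.comp_sgn hB ε
  have hκ' := hκ.comp_sgn hB ε
  refine hB.dual_eq_zero ?_ fun g => ?_
  · rw [LinearMap.sub_apply, LinearMap.comp_apply, sgn_of_hom hs.grading ε hs.one_even]
    simp [hf.map_one]
  have key {j : ZMod 2} {x : W} (hx : B.part j x = x) :
      (f ∘ₗ B.sgn ε - koszulSign F (ε * i) • f) ∘ₗ B.lmul x =
        koszulSign F (ε * j) • (f x • B.counit + κ x • f ∘ₗ B.sgn ε) -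
          koszulSign F (ε * i) • (f x • B.counit + κ x • f) := by
    ext y
    simp only [LinearMap.comp_apply, lmul_apply, LinearMap.sub_apply, LinearMap.smul_apply,
      LinearMap.add_apply]
    rw [hs.sgn_m, sgn_of_hom hs.grading ε hx, smul_m, _root_.map_smul, hf.map_m, hf.map_m]
    have := LinearMap.congr_fun he y
    rw [LinearMap.comp_apply] at this
    rw [this]
    simp
  cases g
  · refine ⟨κ (θ (BorelAlg.gen F q d .k1)), ?_⟩
    rw [key hB.k1.even, hf.k1]
    simp [smul_sub, smul_smul, mul_comm]
  · refine ⟨κ (θ (BorelAlg.gen F q d .k2)), ?_⟩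
    rw [key hB.k2.even, hf.k2]
    simp [smul_sub, smul_smul, mul_comm]
  · refine ⟨0, ?_⟩
    rw [key hB.e1.hom, hf.e1, hκ.e1]
    rcases zmod_two_cases i with rfl | rfl
    · simp
    · simp [hc1 rfl]
  · refine ⟨0, ?_⟩
    rw [key hB.e2.hom, hf.e2, hκ.e2]
    rcases zmod_two_cases i with rfl | rfl
    · simp [hc2 rfl]
    · simp

end IsSkewChar

end SuperHopfData

namespace SuperHopfData

variable {F : Type*} [Field F] {q : F} {d : ℕ} {W : Type*} [AddCommGroup W] [Module F W]
  [FiniteDimensional F W] {B : SuperHopfData F W} {θ : BorelAlg F q d ≃ₗ[F] W}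

/-- The superalgebra `(Bᵒᵖ)*` as an algebra. -/
abbrev IsHopf.DualAlg {B : SuperHopfData F W} (h : B.IsHopf) : Type _ :=
  SAlg B.dualOp h.dualOp_isSuperAlg

theorem IsHopf.dualOp_m_one_apply (hB : B.IsHopf) (f g : Module.Dual F W) :
    B.dualOp.m f g B.one = f B.one * g B.one := by
  rw [dualOp_m_apply, hB.comul_one, superSign_tmul hB.grading hB.grading hB.one_even hB.one_even]
  simp

/-- Evaluation at `1` as a character of `(Bᵒᵖ)*`. -/
def IsHopf.dualEval (hB : B.IsHopf) : hB.DualAlg →ₐ[F] F :=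
  AlgHom.ofLinearMap (A := hB.DualAlg) (Module.Dual.eval F W B.one) hB.counit_one
    fun f g => hB.dualOp_m_one_apply f g

/-- Transposed left multiplication by a grouplike element. -/
def IsGrouplike.dualHom (hB : B.IsHopf) {k : W} (hk : B.IsGrouplike k) (h1 : B.counit k = 1) :
    hB.DualAlg →ₐ[F] hB.DualAlg :=
  AlgHom.ofLinearMap (A := hB.DualAlg) (B := hB.DualAlg) (B.lmul k).dualMap
    (LinearMap.ext fun x => (hB.counit_mul k x).trans (by rw [h1, _root_.one_mul]; rfl))
    fun f g => hk.dual_m_lmul hB f g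

theorem IsHopf.dualOp_m_sgn (hB : B.IsHopf) (ε : ZMod 2) (f g : Module.Dual F W) :
    B.dualOp.m f g ∘ₗ B.sgn ε = B.dualOp.m (f ∘ₗ B.sgn ε) (g ∘ₗ B.sgn ε) := by
  have e (f : Module.Dual F W) : B.dualOp.sgn ε f = f ∘ₗ B.sgn ε := by
    ext x
    simp [sgn, dualOp]
  rw [← e, ← e, ← e, hB.dualOp_isSuperAlg.sgn_m]

/-- The parity automorphism of `(Bᵒᵖ)*`. -/
def IsHopf.dualSgn (hB : B.IsHopf) : hB.DualAlg →ₐ[F] hB.DualAlg :=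
  AlgHom.ofLinearMap (A := hB.DualAlg) (B := hB.DualAlg) (B.sgn 1).dualMap
    (LinearMap.ext fun x => (by
      change B.counit (B.sgn 1 x) = B.counit x
      refine hB.grading.induction (P := fun x => B.counit (B.sgn 1 x) = B.counit x)
        (fun a b ha hb => by rw [map_add, map_add, map_add, ha, hb]) (fun i x hx => ?_) x
      rw [sgn_of_hom hB.grading 1 hx, map_smul, smul_eq_mul, dual_smul_of_hom hB.grading
        hB.counit_part_zero hx (fun i => koszulSign F (1 * i)), mul_zero, koszulSign_zero, _root_.one_mul]))
    fun f g => hB.dualOp_m_sgn 1 f g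

theorem IsBorelHopf.borelRel_dual (hq : IsOddRoot q d) (hB : IsBorelHopf B θ)
    {l1 l2 f1 f2 : Module.Dual F W} {c1 c2 : F} (h1 : IsTorusChar B θ (q ^ 2) q⁻¹ l1)
    (h2 : IsTorusChar B θ q⁻¹ 1 l2) (hf1 : IsSkewChar B θ l1 c1 0 f1)
    (hf2 : IsSkewChar B θ l2 0 c2 f2) :
    BorelRel (R := hB.isHopf.DualAlg) q d l1 l2 f1 f2 := by
  have hb := hB.isHopf
  set k1 := θ (BorelAlg.gen F q d .k1)
  set k2 := θ (BorelAlg.gen F q d .k2)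
  set e1 := θ (BorelAlg.gen F q d .e1)
  set e2 := θ (BorelAlg.gen F q d .e2)
  refine BorelRel.of_skewDerivation (Y := hb.DualAlg) hq (a := c1) (c := c2)
    (hB.k1.dualHom hb hB.counit_k1) (hB.k2.dualHom hb hB.counit_k2) hb.dualSgn
    (B.lmul e1).dualMap (B.lmul e2).dualMap hb.dualEval ?_ ?_ ?_ ?_ ?_ ?_ ?_ ?_ ?_ ?_ ?_ ?_ ?_ ?_ ?_
    h1.map_one h2.map_one hf1.map_one hf2.map_one ?_ ?_ ?_ ?_ ?_ ?_ ?_ ?_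
  · intro f g
    have := hB.e1.dual_m_lmul hb f g
    rwa [sgn_zero hb.grading] at this
  · intro f g
    exact hB.e2.dual_m_lmul hb f g
  · intro u hu ⟨c, hc⟩ ⟨c', hc'⟩ he1 he2
    refine hB.dual_eq_zero (u := u) hu fun g => ?_
    cases g
    · exact ⟨c, hc⟩
    · exact ⟨c', hc'⟩
    · exact ⟨0, Eq.trans he1 (zero_smul F u).symm⟩
    · exact ⟨0, Eq.trans he2 (zero_smul F u).symm⟩
  · exact (h1.comp_lmul k1).trans (by rw [h1.k1]; rfl)
  · exact (h2.comp_lmul k1).trans (by rw [h2.k1]; rfl)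
  · exact (hf1.comp_lmul k1).trans (by rw [hf1.k1, h1.k1, zero_smul, zero_add]; rfl)
  · exact (hf2.comp_lmul k1).trans (by rw [hf2.k1, h2.k1, zero_smul, zero_add]; rfl)
  · exact (h1.comp_lmul k2).trans (by rw [h1.k2]; rfl)
  · exact (h2.comp_lmul k2).trans (by rw [h2.k2, one_smul])
  · exact (hf1.comp_lmul k2).trans (by rw [hf1.k2, h1.k2, zero_smul, zero_add]; rfl)
  · exact (hf2.comp_lmul k2).trans (by rw [hf2.k2, h2.k2, zero_smul, zero_add, one_smul])
  · exact h1.comp_sgn hB 1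
  · exact h2.comp_sgn hB 1
  · exact (hf1.comp_sgn hB h1 (i := 0) (by simp) (by simp) 1).trans (by simp)
  · refine (hf2.comp_sgn hB h2 (i := 1) (by simp) (by simp) 1).trans ?_
    rw [_root_.one_mul, koszulSign_one]
    exact neg_one_smul F f2
  · exact (h1.comp_lmul e1).trans (by rw [h1.e1, zero_smul]; rfl)
  · exact (h2.comp_lmul e1).trans (by rw [h2.e1, zero_smul]; rfl)
  · exact (hf1.comp_lmul e1).trans (by
      rw [hf1.e1, h1.e1, zero_smul, add_zero, Algebra.algebraMap_eq_smul_one]; rfl)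
  · exact (hf2.comp_lmul e1).trans (by rw [hf2.e1, h2.e1, zero_smul, zero_smul, add_zero]; rfl)
  · exact (h1.comp_lmul e2).trans (by rw [h1.e2, zero_smul]; rfl)
  · exact (h2.comp_lmul e2).trans (by rw [h2.e2, zero_smul]; rfl)
  · exact (hf1.comp_lmul e2).trans (by rw [hf1.e2, h1.e2, zero_smul, zero_smul, add_zero]; rfl)
  · exact (hf2.comp_lmul e2).trans (by
      rw [hf2.e2, h2.e2, zero_smul, add_zero, Algebra.algebraMap_eq_smul_one]; rfl)

/-- The transpose of right multiplication by `g` in `(Bᵒᵖ)*`. -/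
def dualRight (B : SuperHopfData F W) (g : Module.Dual F W) : W →ₗ[F] W :=
  (TensorProduct.rid F W).toLinearMap ∘ₗ TensorProduct.map LinearMap.id g ∘ₗ
    superSign B.part B.part ∘ₗ B.comul

theorem apply_dualRight (f g : Module.Dual F W) (x : W) :
    f (B.dualRight g x) = B.dualOp.m f g x := by
  rw [dualOp_m_apply]
  simp only [dualRight, LinearMap.comp_apply]
  generalize superSign B.part B.part (B.comul x) = t
  induction t with
  | zero => simp
  | add x y hx hy => simp only [map_add, hx, hy]
  | tmul x y => simp [mul_comm]

theorem apply_dualRight_m (f g : Module.Dual F W) (a x : W) :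
    f (B.dualRight g (B.m a x)) = (B.dualOp.m f g ∘ₗ B.lmul a) x := apply_dualRight f g _

omit [FiniteDimensional F W] in
theorem dual_ext {x y : W} (h : ∀ f : Module.Dual F W, f x = f y) : x = y :=
  sub_eq_zero.mp ((Module.forall_dual_apply_eq_zero_iff F _).mp fun f => by
    rw [map_sub, h, sub_self])

section DualRight

variable (hB : IsBorelHopf B θ)

include hB

theorem IsTorusChar.dualRight_one {s1 s2 : F} {g : Module.Dual F W} (hg : IsTorusChar B θ s1 s2 g) :
    B.dualRight g B.one = B.one :=
  dual_ext fun f => by rw [apply_dualRight, hB.isHopf.dualOp_m_one_apply, hg.map_one, mul_one]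

theorem IsTorusChar.dualRight_k {s1 s2 : F} {g : Module.Dual F W} (hg : IsTorusChar B θ s1 s2 g)
    {k : W} (hk : B.IsGrouplike k) (x : W) :
    B.dualRight g (B.m k x) = g k • B.m k (B.dualRight g x) :=
  dual_ext fun f => by
    rw [apply_dualRight_m, hk.dual_m_lmul hB.isHopf,
      hg.comp_lmul, m_smul, LinearMap.smul_apply, ← apply_dualRight, map_smul]
    rfl

theorem IsTorusChar.dualRight_e {s1 s2 : F} {g : Module.Dual F W} (hg : IsTorusChar B θ s1 s2 g)
    {ε : ZMod 2} {k e : W} (he : B.IsSkewPrimitive ε k e) (h0 : g e = 0) (x : W) :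
    B.dualRight g (B.m e x) = B.m e (B.dualRight g x) :=
  dual_ext fun f => by
    rw [apply_dualRight_m, he.dual_m_lmul hB.isHopf,
      hg.comp_lmul, hg.comp_sgn hB, h0, zero_smul, m_zero, add_zero, ← apply_dualRight]
    rfl

variable {κ g : Module.Dual F W} {c1 c2 : F} (hg : IsSkewChar B θ κ c1 c2 g)

include hg

theorem IsSkewChar.dualRight_one : B.dualRight g B.one = 0 :=
  dual_ext fun f => by
    rw [apply_dualRight, hB.isHopf.dualOp_m_one_apply, hg.map_one, mul_zero, map_zero]

theorem IsSkewChar.dualRight_k {k : W} (hk : B.IsGrouplike k) (h0 : g k = 0) (x : W) :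
    B.dualRight g (B.m k x) = κ k • B.m k (B.dualRight g x) :=
  dual_ext fun f => by
    rw [apply_dualRight_m, hk.dual_m_lmul hB.isHopf,
      hg.comp_lmul, h0, zero_smul, zero_add, m_smul, LinearMap.smul_apply, ← apply_dualRight,
      map_smul]
    rfl

theorem IsSkewChar.dualRight_e {s1 s2 : F} (hκ : IsTorusChar B θ s1 s2 κ) {i ε : ZMod 2}
    (hc1 : i = 1 → c1 = 0) (hc2 : i = 0 → c2 = 0) {k e : W} (he : B.IsSkewPrimitive ε k e)
    (h0 : κ e = 0) (x : W) :
    B.dualRight g (B.m e x) = koszulSign F (ε * i) • B.m e (B.dualRight g x) + g e • B.m k x :=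
  dual_ext fun f => by
    rw [apply_dualRight_m, he.dual_m_lmul hB.isHopf,
      hg.comp_lmul, h0, zero_smul, add_zero, hg.comp_sgn hB hκ hc1 hc2, m_smul, m_smul,
      LinearMap.add_apply, LinearMap.smul_apply, LinearMap.smul_apply, ← apply_dualRight,
      ← apply_dualRight, map_add, map_smul, map_smul]
    congr 2
    rw [apply_dualRight]
    exact congrArg (· x) (hB.isHopf.dualOp_isSuperAlg.mul_one _)

end DualRight

end SuperHopfData

theorem Submodule.mem_of_sum_mem_of_eigen {F : Type*} [Field F] {V : Type*} [AddCommGroup V]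
    [Module F V] {I : Submodule F V} {τ : V →ₗ[F] V} (hτ : ∀ x ∈ I, τ x ∈ I) {ι : Type*}
    (s : Finset ι) {μ : ι → F} (hμ : Set.InjOn μ s) (v : ι → V)
    (hv : ∀ i ∈ s, τ (v i) = μ i • v i) (hs : ∑ i ∈ s, v i ∈ I) : ∀ i ∈ s, v i ∈ I := by
  classical
  induction s using Finset.induction_on generalizing v with
  | empty => simp
  | insert a s ha ih =>
    have hμ' : Set.InjOn μ s := hμ.mono (by simp)
    have h1 : ∑ i ∈ s, (μ i - μ a) • v i ∈ I := by
      have h2 := I.sub_mem (hτ _ hs) (I.smul_mem (μ a) hs)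
      rw [map_sum, Finset.smul_sum, ← Finset.sum_sub_distrib, Finset.sum_insert ha,
        hv a (Finset.mem_insert_self _ _), sub_self, zero_add] at h2
      convert h2 using 1
      refine Finset.sum_congr rfl fun i hi => ?_
      rw [hv i (Finset.mem_insert_of_mem hi), sub_smul]
    have h2 := ih hμ' (fun i => (μ i - μ a) • v i) (fun i hi => by
      rw [map_smul, hv i (Finset.mem_insert_of_mem hi), smul_comm]) h1
    have h3 : ∀ i ∈ s, v i ∈ I := fun i hi => by
      refine (I.smul_mem_iff (sub_ne_zero.mpr fun h => ha ?_)).mp (h2 i hi)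
      rwa [← hμ (Finset.mem_coe.mpr (Finset.mem_insert_of_mem hi))
        (Finset.mem_coe.mpr (Finset.mem_insert_self a s)) h]
    intro i hi
    rcases Finset.mem_insert.mp hi with rfl | hi
    · rw [Finset.sum_insert ha] at hs
      exact (I.add_mem_iff_left (I.sum_mem h3)).mp hs
    · exact h3 i hi

section Separation

variable {F : Type*} [Field F] {q : F} {d : ℕ} {R : Type*} [Ring R] [Algebra F R]
  {k1 k2 e1 e2 : R}

/-- The monomials in the generators of the Borel part. -/
def borelMonomial (q : F) (k1 k2 e1 e2 : R) (i j r h t : ℕ) : R :=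
  k1 ^ i * k2 ^ j * e1 ^ r * (e1 * e2 - q⁻¹ • (e2 * e1)) ^ h * e2 ^ t

variable {τ1 τ2 δ1 δ2 : R →ₗ[F] R} {ε : R →ₗ[F] F} {a c : F}

/-- Torus automorphisms `τᵢ` and skew derivations `δᵢ` of the Borel part with a counit `ε`. -/
structure IsBorelDerivation (q : F) (k1 k2 e1 e2 : R) (τ1 τ2 δ1 δ2 : R →ₗ[F] R) (ε : R →ₗ[F] F)
    (a c : F) : Prop where
  τ1_one : τ1 1 = 1
  τ1_k1 : ∀ x, τ1 (k1 * x) = q ^ 2 • (k1 * τ1 x)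
  τ1_k2 : ∀ x, τ1 (k2 * x) = q⁻¹ • (k2 * τ1 x)
  τ1_e1 : ∀ x, τ1 (e1 * x) = e1 * τ1 x
  τ1_e2 : ∀ x, τ1 (e2 * x) = e2 * τ1 x
  τ2_one : τ2 1 = 1
  τ2_k1 : ∀ x, τ2 (k1 * x) = q⁻¹ • (k1 * τ2 x)
  τ2_k2 : ∀ x, τ2 (k2 * x) = k2 * τ2 x
  τ2_e1 : ∀ x, τ2 (e1 * x) = e1 * τ2 x
  τ2_e2 : ∀ x, τ2 (e2 * x) = e2 * τ2 x
  δ1_one : δ1 1 = 0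
  δ1_k1 : ∀ x, δ1 (k1 * x) = q ^ 2 • (k1 * δ1 x)
  δ1_k2 : ∀ x, δ1 (k2 * x) = q⁻¹ • (k2 * δ1 x)
  δ1_e1 : ∀ x, δ1 (e1 * x) = e1 * δ1 x + a • (k1 * x)
  δ1_e2 : ∀ x, δ1 (e2 * x) = e2 * δ1 x
  δ2_one : δ2 1 = 0
  δ2_k1 : ∀ x, δ2 (k1 * x) = q⁻¹ • (k1 * δ2 x)
  δ2_k2 : ∀ x, δ2 (k2 * x) = k2 * δ2 x
  δ2_e1 : ∀ x, δ2 (e1 * x) = e1 * δ2 x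
  δ2_e2 : ∀ x, δ2 (e2 * x) = -(e2 * δ2 x) + c • (k2 * x)
  ε_one : ε 1 = 1
  ε_k1 : ∀ x, ε (k1 * x) = ε x
  ε_k2 : ∀ x, ε (k2 * x) = ε x
  ε_e1 : ∀ x, ε (e1 * x) = 0
  ε_e2 : ∀ x, ε (e2 * x) = 0

theorem map_pow_mul_of_qcomm {δ : R →ₗ[F] R} {k : R} {c : F} (h : ∀ x, δ (k * x) = c • (k * δ x))
    (n : ℕ) (x : R) : δ (k ^ n * x) = c ^ n • (k ^ n * δ x) := by
  induction n with
  | zero => simp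
  | succ n ih => rw [pow_succ', mul_assoc, h, ih, mul_smul_comm, smul_smul, ← pow_succ', mul_assoc]

namespace IsBorelDerivation

variable (D : IsBorelDerivation q k1 k2 e1 e2 τ1 τ2 δ1 δ2 ε a c)

include D

theorem τ_monomial (i j r h t : ℕ) :
    τ1 (borelMonomial q k1 k2 e1 e2 i j r h t) =
      (q ^ (2 * i) * q⁻¹ ^ j) • borelMonomial q k1 k2 e1 e2 i j r h t ∧
    τ2 (borelMonomial q k1 k2 e1 e2 i j r h t) =
      q⁻¹ ^ i • borelMonomial q k1 k2 e1 e2 i j r h t := by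
  have p {τ : R →ₗ[F] R} {e : R} (h : ∀ x, τ (e * x) = e * τ x) (n : ℕ) (x : R) :
      τ (e ^ n * x) = e ^ n * τ x := by
    simpa using map_pow_mul_of_qcomm (c := (1 : F)) (by simpa using h) n x
  have e3 {τ : R →ₗ[F] R} (h1 : ∀ x, τ (e1 * x) = e1 * τ x) (h2 : ∀ x, τ (e2 * x) = e2 * τ x)
      (x : R) : τ ((e1 * e2 - q⁻¹ • (e2 * e1)) * x) = (e1 * e2 - q⁻¹ • (e2 * e1)) * τ x := by
    simp only [sub_mul, smul_mul_assoc, map_sub, map_smul, mul_assoc, h1, h2]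
  have l1 := p D.τ1_e2 t 1
  have l2 := p D.τ2_e2 t 1
  rw [mul_one, D.τ1_one, mul_one] at l1
  rw [mul_one, D.τ2_one, mul_one] at l2
  constructor
  · rw [borelMonomial, mul_assoc, mul_assoc, mul_assoc, map_pow_mul_of_qcomm D.τ1_k1,
      map_pow_mul_of_qcomm D.τ1_k2, p D.τ1_e1, p (e3 D.τ1_e1 D.τ1_e2), l1, mul_smul_comm, smul_smul,
      pow_mul]
  · rw [borelMonomial, mul_assoc, mul_assoc, mul_assoc, map_pow_mul_of_qcomm D.τ2_k1,
      p D.τ2_k2, p D.τ2_e1, p (e3 D.τ2_e1 D.τ2_e2), l2]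

theorem ε_monomial (i j r h t : ℕ) : ε (borelMonomial q k1 k2 e1 e2 i j r h t) =
    if r = 0 ∧ h = 0 ∧ t = 0 then 1 else 0 := by
  have p {k : R} (h : ∀ x, ε (k * x) = ε x) (n : ℕ) (x : R) : ε (k ^ n * x) = ε x := by
    induction n with
    | zero => simp
    | succ n ih => rw [pow_succ', mul_assoc, h, ih]
  have e3 (x : R) : ε ((e1 * e2 - q⁻¹ • (e2 * e1)) * x) = 0 := by
    simp only [sub_mul, smul_mul_assoc, map_sub, map_smul, mul_assoc, D.ε_e1, D.ε_e2]
    simp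
  rw [borelMonomial, mul_assoc, mul_assoc, mul_assoc, p D.ε_k1, p D.ε_k2]
  rcases r with _ | r
  · rcases h with _ | h
    · rcases t with _ | t
      · simp [D.ε_one]
      · rw [pow_succ' e2]; simp [D.ε_e2]
    · rw [pow_succ' (_ - _)]; simp [mul_assoc, e3]
  · rw [pow_succ' e1]; simp [mul_assoc, D.ε_e1]

variable (h : BorelRel q d k1 k2 e1 e2) (hq : IsOddRoot q d)

include h hq

theorem δ1_nilp (s t : ℕ) : δ1 ((e1 * e2 - q⁻¹ • (e2 * e1)) ^ s * e2 ^ t) = 0 := by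
  have e3 (x : R) : δ1 ((e1 * e2 - q⁻¹ • (e2 * e1)) * x) = (e1 * e2 - q⁻¹ • (e2 * e1)) * δ1 x := by
    simp only [sub_mul, smul_mul_assoc, map_sub, map_smul, mul_assoc, D.δ1_e1, D.δ1_e2, mul_add,
      mul_smul_comm, qcomm_assoc h.e2k1, smul_add, smul_smul]
    match_scalars <;> field_simp [hq.ne_zero] <;> ring
  have p2 (t : ℕ) : δ1 (e2 ^ t) = 0 := by
    induction t with
    | zero => rw [pow_zero, D.δ1_one]
    | succ t ih => rw [pow_succ', D.δ1_e2, ih, mul_zero]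
  induction s with
  | zero => rw [pow_zero, one_mul, p2]
  | succ s ih => rw [pow_succ' (_ - _), mul_assoc, e3, ih, mul_zero]

theorem δ1_monomial_zero (i j s t : ℕ) : δ1 (borelMonomial q k1 k2 e1 e2 i j 0 s t) = 0 := by
  rw [borelMonomial, mul_assoc, mul_assoc, mul_assoc, map_pow_mul_of_qcomm D.δ1_k1,
    map_pow_mul_of_qcomm D.δ1_k2, pow_zero, one_mul, D.δ1_nilp h hq]
  simp

theorem δ1_monomial (ha : a ≠ 0) (i j r : ℕ) (hr : r + 1 < d) : ∃ γ : F, γ ≠ 0 ∧ ∀ s t,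
    δ1 (borelMonomial q k1 k2 e1 e2 i j (r + 1) s t) =
      γ • borelMonomial q k1 k2 e1 e2 (i + 1) j r s t := by
  have q0 := hq.ne_zero
  have hz := hq.root.zpow_neg_two hq.odd
  have key (z : R) (h0 : δ1 z = 0) (n : ℕ) : δ1 (e1 ^ (n + 1) * z) =
      (a * ∑ l ∈ Finset.range (n + 1), (q ^ (-2 : ℤ)) ^ l) • (k1 * (e1 ^ n * z)) := by
    induction n with
    | zero => rw [pow_one, D.δ1_e1, h0]; simp
    | succ n ih =>
      rw [pow_succ', mul_assoc, D.δ1_e1, ih, mul_smul_comm, ← mul_assoc e1 k1, h.e1k1,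
        Finset.sum_range_succ' _ (n + 1), smul_mul_assoc, mul_assoc k1 e1, ← mul_assoc e1 (e1 ^ n),
        ← pow_succ', smul_smul, ← add_smul, pow_zero]
      congr 1
      simp only [pow_succ _ _, ← Finset.sum_mul]
      ring
  refine ⟨(q ^ 2) ^ i * (q⁻¹ ^ j * (a * ∑ l ∈ Finset.range (r + 1), (q ^ (-2 : ℤ)) ^ l)), ?_, ?_⟩
  · refine mul_ne_zero (by simp [q0]) (mul_ne_zero (by simp [q0]) (mul_ne_zero ha fun h0 => ?_))
    have h1 := mul_geom_sum (q ^ (-2 : ℤ)) (r + 1)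
    rw [h0, mul_zero, eq_comm, sub_eq_zero] at h1
    exact absurd (Nat.le_of_dvd (Nat.succ_pos r) (hz.dvd_of_pow_eq_one _ h1)) (not_le.mpr hr)
  · intro s t
    rw [borelMonomial, mul_assoc, mul_assoc, mul_assoc, map_pow_mul_of_qcomm D.δ1_k1,
      map_pow_mul_of_qcomm D.δ1_k2, key _ (D.δ1_nilp h hq s t), borelMonomial]
    simp only [mul_smul_comm, smul_smul]
    congr 1
    have hc : k2 ^ j * k1 = k1 * k2 ^ j := ((show Commute k2 k1 from h.k2k1).pow_left j).eq
    rw [← mul_assoc (k2 ^ j), hc, pow_succ]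
    simp only [mul_assoc]

theorem δ1_pow_monomial (ha : a ≠ 0) (n i j r : ℕ) (hr : r < d) :
    (r < n → ∀ s t, (δ1 ^ n) (borelMonomial q k1 k2 e1 e2 i j r s t) = 0) ∧
    (r = n → ∃ γ : F, γ ≠ 0 ∧ ∀ s t, (δ1 ^ n) (borelMonomial q k1 k2 e1 e2 i j r s t) =
      γ • borelMonomial q k1 k2 e1 e2 (i + n) j 0 s t) := by
  induction n generalizing i r with
  | zero => exact ⟨by simp, fun hr => ⟨1, one_ne_zero, by simp [hr]⟩⟩
  | succ n ih =>
    rcases r with _ | r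
    · refine ⟨fun _ s t => ?_, fun hr => absurd hr (by omega)⟩
      rw [pow_succ, Module.End.mul_apply, D.δ1_monomial_zero h hq, map_zero]
    · obtain ⟨γ, hγ, H⟩ := D.δ1_monomial h hq ha i j r hr
      obtain ⟨ih1, ih2⟩ := ih (i + 1) r (by omega)
      refine ⟨fun hr s t => ?_, fun hr => ?_⟩
      · rw [pow_succ, Module.End.mul_apply, H, map_smul, ih1 (by omega), smul_zero]
      · obtain ⟨γ', hγ', H'⟩ := ih2 (by omega)
        refine ⟨γ * γ', mul_ne_zero hγ hγ', fun s t => ?_⟩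
        rw [pow_succ, Module.End.mul_apply, H, map_smul, H', smul_smul, add_assoc, add_comm 1 n]

theorem δ2_monomial (i j : ℕ) : δ2 (borelMonomial q k1 k2 e1 e2 i j 0 0 0) = 0 ∧
    δ2 (borelMonomial q k1 k2 e1 e2 i j 0 0 1) =
      (q⁻¹ ^ i * c) • borelMonomial q k1 k2 e1 e2 i (j + 1) 0 0 0 ∧
    δ2 (borelMonomial q k1 k2 e1 e2 i j 0 1 0) =
      (q⁻¹ ^ i * c * (q - q⁻¹)) • borelMonomial q k1 k2 e1 e2 i (j + 1) 1 0 0 ∧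
    δ2 (borelMonomial q k1 k2 e1 e2 i j 0 1 1) = (q⁻¹ ^ i * c) •
      ((q - q⁻¹) • borelMonomial q k1 k2 e1 e2 i (j + 1) 1 0 1 -
        q • borelMonomial q k1 k2 e1 e2 i (j + 1) 0 1 0) := by
  have p2 (x : R) : δ2 (k2 ^ j * x) = k2 ^ j * δ2 x := by
    simpa using map_pow_mul_of_qcomm (c := (1 : F)) (by simpa using D.δ2_k2) j x
  have b0 : δ2 e1 = 0 := by have := D.δ2_e1 1; rwa [D.δ2_one, mul_zero, mul_one] at this
  have b1 : δ2 e2 = c • k2 := by simpa [D.δ2_one] using D.δ2_e2 1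
  simp only [borelMonomial, mul_assoc, map_pow_mul_of_qcomm D.δ2_k1, p2, pow_zero, pow_one, one_mul,
    mul_one, D.δ2_one, pow_succ k2]
  have p2' : δ2 (k2 ^ j) = 0 := by simpa [D.δ2_one] using p2 1
  refine ⟨by rw [p2', mul_zero, smul_zero], ?_, ?_, ?_⟩
  · rw [b1, mul_smul_comm, mul_smul_comm, smul_smul]
  · rw [map_sub, map_smul, D.δ2_e1, D.δ2_e2, b0, b1]
    simp only [mul_smul_comm, h.e1k2, mul_zero, neg_zero, zero_add, ← sub_smul, smul_smul]
    module
  · rw [sub_mul, map_sub, smul_mul_assoc, map_smul, mul_assoc, mul_assoc, D.δ2_e1, D.δ2_e2, D.δ2_e2,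
      D.δ2_e1, b1]
    have e21 : e2 * (e1 * k2) = q • (k2 * (e2 * e1)) := by
      rw [h.e1k2, mul_smul_comm, ← mul_assoc, h.e2k2, mul_assoc]
    have e21' : e2 * k2 = k2 * e2 := h.e2k2
    simp only [mul_smul_comm, e21, e21', mul_sub, neg_add_cancel, mul_zero, zero_sub, mul_add, mul_neg]
    match_scalars <;> field_simp [hq.ne_zero] <;> ring

theorem eq_zero_of_sum_nilp_mem (ha : a ≠ 0) (hc : c ≠ 0) {I : Submodule F R}
    (hI : ∀ x ∈ I, ε x = 0) (h1 : ∀ x ∈ I, δ1 x ∈ I) (h2 : ∀ x ∈ I, δ2 x ∈ I) (i j : ℕ)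
    (b : Fin 2 → Fin 2 → F)
    (hb : ∑ s, ∑ t, b s t • borelMonomial q k1 k2 e1 e2 i j 0 s t ∈ I) : ∀ s t, b s t = 0 := by
  have q0 := hq.ne_zero
  have hd := hq.one_lt
  have hqq := hq.sub_inv_ne
  obtain ⟨m0, m1, m2, m3⟩ := D.δ2_monomial h hq i j
  obtain ⟨γ, hγ, hγ'⟩ := D.δ1_monomial h hq ha i (j + 1) 0 (by omega)
  obtain ⟨n0, n1, -, -⟩ := D.δ2_monomial h hq (i + 1) (j + 1)
  have z := D.δ1_monomial_zero h hq
  simp only [Fin.sum_univ_two, Fin.val_zero, Fin.val_one] at hb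
  have e0 := hI _ hb
  have hb2 := h2 _ hb
  simp only [map_add, map_smul, m0, m1, m2, m3] at hb2
  have e1 := hI _ hb2
  have hb3 := h1 _ hb2
  simp only [map_add, map_sub, map_smul, hγ', z, zero_add] at hb3
  have e2 := hI _ hb3
  have hb4 := h2 _ hb3
  simp only [map_add, map_sub, map_smul, n0, n1, z] at hb4
  have e3 := hI _ hb4
  simp [D.ε_monomial, q0, hc, hγ, hqq] at e0 e1 e2 e3
  exact Fin.forall_fin_two.mpr ⟨Fin.forall_fin_two.mpr ⟨e0, e1⟩, Fin.forall_fin_two.mpr ⟨e2, e3⟩⟩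

theorem eq_zero_of_sum_fixed_mem (ha : a ≠ 0) (hc : c ≠ 0) {I : Submodule F R}
    (hI : ∀ x ∈ I, ε x = 0) (h1 : ∀ x ∈ I, δ1 x ∈ I) (h2 : ∀ x ∈ I, δ2 x ∈ I) (i j : ℕ)
    (b : Fin d → Fin 2 → Fin 2 → F)
    (hb : ∑ r, ∑ s, ∑ t, b r s t • borelMonomial q k1 k2 e1 e2 i j r s t ∈ I) (r : Fin d)
    (s t : Fin 2) : b r s t = 0 := by
  suffices H : ∀ n ≤ d, ∀ r : Fin d, d - n ≤ r → ∀ s t, b r s t = 0 from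
    H d le_rfl r (by omega) s t
  intro n
  induction n with
  | zero => intro _ r hr; exact absurd r.isLt (by omega)
  | succ n ih =>
    intro hn r hr
    rcases Nat.lt_or_ge (r : ℕ) (d - n) with hr' | hr'
    swap
    · exact ih (by omega) r hr'
    have hpow : ∀ m, ∀ x ∈ I, (δ1 ^ m) x ∈ I := by
      intro m
      induction m with
      | zero => exact fun x hx => hx
      | succ m ihm => exact fun x hx => by rw [pow_succ, Module.End.mul_apply]; exact ihm _ (h1 x hx)
    obtain ⟨γ, hγ, H⟩ := (D.δ1_pow_monomial h hq ha r i j r r.isLt).2 rfl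
    have hb' := hpow r _ hb
    rw [map_sum, Finset.sum_eq_single r] at hb'
    · simp only [map_sum, map_smul, H, smul_comm _ γ, ← Finset.smul_sum] at hb'
      exact D.eq_zero_of_sum_nilp_mem h hq ha hc hI h1 h2 (i + r) j (b r)
        ((I.smul_mem_iff hγ).mp hb')
    · intro r' _ hr''
      rw [map_sum]
      refine Finset.sum_eq_zero fun s _ => ?_
      rw [map_sum]
      refine Finset.sum_eq_zero fun t _ => ?_
      rw [map_smul]
      rcases lt_or_gt_of_ne (Fin.val_ne_of_ne hr'') with hlt | hgt
      · rw [(D.δ1_pow_monomial h hq ha r i j r' r'.isLt).1 hlt, smul_zero]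
      · rw [ih (by omega) r' (by omega), zero_smul]
    · simp

/-- A subspace of the kernel of the counit that is stable under the torus automorphisms and the skew
derivations contains no nontrivial combination of the monomials. -/
theorem eq_zero_of_sum_mem (ha : a ≠ 0) (hc : c ≠ 0) {I : Submodule F R}
    (hI : ∀ x ∈ I, ε x = 0) (h1 : ∀ x ∈ I, δ1 x ∈ I) (h2 : ∀ x ∈ I, δ2 x ∈ I)
    (h1' : ∀ x ∈ I, τ1 x ∈ I) (h2' : ∀ x ∈ I, τ2 x ∈ I) (b : BIdx d → F)
    (hb : ∑ y, b y • borelMonomial q k1 k2 e1 e2 y.i y.j y.r y.h y.t ∈ I) (y : BIdx d) :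
    b y = 0 := by
  have q0 := hq.ne_zero
  rw [← (bIdxEquiv d).symm.sum_comp] at hb
  simp only [Fintype.sum_prod_type] at hb
  have inj : Set.InjOn (fun i : Fin d => (q⁻¹ : F) ^ (i : ℕ)) (Finset.univ : Finset (Fin d)) :=
    fun i _ i' _ hii => Fin.ext (hq.root.inv.pow_inj i.isLt i'.isLt hii)
  have s2 := Submodule.mem_of_sum_mem_of_eigen h2' Finset.univ inj _ (fun i _ => by
    simp only [map_sum, map_smul, (D.τ_monomial _ _ _ _ _).2, Finset.smul_sum, bIdxEquiv,
      Equiv.coe_fn_symm_mk]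
    simp only [smul_comm ((q⁻¹ : F) ^ _)]) hb y.i (Finset.mem_univ _)
  have inj' : Set.InjOn (fun j : Fin d => q ^ (2 * (y.i : ℕ)) * q⁻¹ ^ (j : ℕ))
      (Finset.univ : Finset (Fin d)) :=
    fun j hj j' hj' hjj => inj hj hj' (mul_left_cancel₀ (pow_ne_zero _ q0) hjj)
  have s1 := Submodule.mem_of_sum_mem_of_eigen h1' Finset.univ inj' _ (fun j _ => by
    simp only [map_sum, map_smul, (D.τ_monomial _ _ _ _ _).1, Finset.smul_sum, bIdxEquiv,
      Equiv.coe_fn_symm_mk]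
    simp only [smul_comm (q ^ _ * q⁻¹ ^ _)]) s2 y.j (Finset.mem_univ _)
  exact D.eq_zero_of_sum_fixed_mem h hq ha hc hI h1 h2 y.i y.j
    (fun r s t => b ⟨y.i, y.j, r, s, t⟩) s1 y.r y.h y.t

end IsBorelDerivation

end Separation

open BorelAlg

section Straightening

variable {F : Type*} [Field F] {q : F} {d : ℕ} {R : Type*} [Ring R] [Algebra F R]
  {k1 k2 e1 e2 : R}

theorem BorelRel.straightening_inv (hq : IsOddRoot q d) (h : BorelRel q d k1 k2 e1 e2) :
    Straightening F d (k1 ^ (d - 1)) (k2 ^ (d - 1)) e1 (e2 * e1 - q • (e1 * e2)) e2 := by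
  have q0 := hq.ne_zero
  have hs := h.straightening hq
  have hi := h.inv_pow hq
  obtain ⟨h1, h2, h3, h4⟩ := h.pow_sub_one hq
  have e3 : e2 * e1 - q • (e1 * e2) = (-q) • (e1 * e2 - q⁻¹ • (e2 * e1)) := by
    match_scalars <;> field_simp
  rw [e3]
  refine { hs with
    k1_pow := hi.k1_pow, k2_pow := hi.k2_pow, k2k1 := hi.k2k1
    e1k1 := ⟨_, zpow_ne_zero _ (inv_ne_zero q0), hi.e1k1⟩
    e2k1 := ⟨_, inv_ne_zero q0, hi.e2k1⟩
    e1k2 := ⟨_, inv_ne_zero q0, hi.e1k2⟩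
    e2k2 := ⟨1, one_ne_zero, by rw [hi.e2k2, one_smul]⟩
    e3k1 := ?_, e3k2 := ?_, e3e3 := ?_, e2e1 := ?_, e3e1 := ?_, e2e3 := ?_ }
  · obtain ⟨c, hc, H⟩ := hs.e3k1
    exact ⟨_, inv_ne_zero hc, by
      rw [smul_mul_assoc, qcomm_of_inv hc h1 h2 H, mul_smul_comm, smul_comm]⟩
  · obtain ⟨c, hc, H⟩ := hs.e3k2
    exact ⟨_, inv_ne_zero hc, by
      rw [smul_mul_assoc, qcomm_of_inv hc h3 h4 H, mul_smul_comm, smul_comm]⟩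
  · rw [smul_mul_assoc, mul_smul_comm, hs.e3e3, smul_zero, smul_zero]
  · obtain ⟨a, b, H⟩ := hs.e2e1
    generalize e1 * e2 - q⁻¹ • (e2 * e1) = z at H ⊢
    exact ⟨a, b * (-q)⁻¹, by rw [H, smul_smul, mul_assoc, inv_mul_cancel₀ (neg_ne_zero.mpr q0),
      mul_one]⟩
  · obtain ⟨c, H⟩ := hs.e3e1
    exact ⟨c, by rw [smul_mul_assoc, H, mul_smul_comm, smul_comm]⟩
  · obtain ⟨c, H⟩ := hs.e2e3
    exact ⟨c, by rw [smul_mul_assoc, mul_smul_comm, H, smul_comm]⟩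

theorem BorelRel.adjoin_inv (hq : IsOddRoot q d) (h : BorelRel q d k1 k2 e1 e2)
    (hgen : Algebra.adjoin F {k1, k2, e1, e2} = ⊤) :
    Algebra.adjoin F {k1 ^ (d - 1), k2 ^ (d - 1), e1, e2} = ⊤ := by
  rw [eq_top_iff, ← hgen]
  refine Algebra.adjoin_le ?_
  have hp (k : R) (hk : k ^ d = 1) : (k ^ (d - 1)) ^ (d - 1) = k := by
    obtain ⟨n, rfl⟩ : ∃ n, d = n + 2 := ⟨d - 2, by have := hq.one_lt; omega⟩
    rw [← pow_mul, show (n + 2 - 1) * (n + 2 - 1) = (n + 2) * n + 1 by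
      simp only [Nat.add_sub_cancel, show n + 2 - 1 = n + 1 by omega]; ring, pow_add, pow_mul, hk]
    simp
  have hm (x) (hx : x ∈ ({k1 ^ (d - 1), k2 ^ (d - 1), e1, e2} : Set R)) :
      x ∈ Algebra.adjoin F ({k1 ^ (d - 1), k2 ^ (d - 1), e1, e2} : Set R) :=
    Algebra.subset_adjoin hx
  rintro g (rfl | rfl | rfl | rfl)
  · rw [SetLike.mem_coe]
    have := pow_mem (hm (g ^ (d - 1)) (by simp)) (d - 1)
    rwa [hp _ h.k1_pow] at this
  · rw [SetLike.mem_coe]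
    have := pow_mem (hm (g ^ (d - 1)) (by simp)) (d - 1)
    rwa [hp _ h.k2_pow] at this
  · exact hm _ (by simp)
  · exact hm _ (by simp)

end Straightening

namespace SuperHopfData

variable {F : Type*} [Field F] {q : F} {d : ℕ} {W : Type*} [AddCommGroup W] [Module F W]
  {B : SuperHopfData F W} {θ : BorelAlg F q d ≃ₗ[F] W}

/-- The functionals `κ₁⁻¹, κ₂⁻¹, α_{e₁}, α_{e₂}`, which generate `(Bᵒᵖ)*`. -/
structure IsBorelDual (B : SuperHopfData F W) (θ : BorelAlg F q d ≃ₗ[F] W)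
    (κ1 κ2 φ1 φ2 : Module.Dual F W) : Prop where
  l1 : IsTorusChar B θ (q ^ 2) q⁻¹ κ1
  l2 : IsTorusChar B θ q⁻¹ 1 κ2
  f1 : IsSkewChar B θ κ1 (-(q - q⁻¹)⁻¹) 0 φ1
  f2 : IsSkewChar B θ κ2 0 (q - q⁻¹)⁻¹ φ2

theorem IsBorelHopf.exists_isBorelDual (hB : IsBorelHopf B θ) (hq : IsOddRoot q d) :
    ∃ l1 l2 f1 f2, IsBorelDual B θ l1 l2 f1 f2 := by
  have q0 := hq.ne_zero
  have q1 := hq.root.pow_eq_one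
  have q1' : (q⁻¹) ^ d = 1 := by rw [inv_pow, q1, inv_one]
  have q2 : (q ^ 2) ^ d = 1 := by rw [← pow_mul, mul_comm, pow_mul, q1, one_pow]
  have z2 : (q : F) ^ (-2 : ℤ) = (q ^ 2)⁻¹ := by rw [zpow_neg, zpow_ofNat]
  obtain ⟨l1, h1⟩ := hB.exists_torusChar hq.pos q2 q1'
  obtain ⟨l2, h2⟩ := hB.exists_torusChar hq.pos q1' (one_pow d)
  obtain ⟨f1, h3⟩ := hB.exists_skewChar hq (c1 := -(q - q⁻¹)⁻¹) (c2 := 0) h1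
    (by rw [z2, inv_mul_cancel_left₀ (pow_ne_zero 2 q0)]) (by simp)
    (by rw [mul_inv_cancel_left₀ q0]) (by simp)
  obtain ⟨f2, h4⟩ := hB.exists_skewChar hq (c1 := 0) (c2 := (q - q⁻¹)⁻¹) h2 (by simp)
    (by rw [mul_inv_cancel_left₀ q0]) (by simp) (by simp)
  exact ⟨l1, l2, f1, f2, h1, h2, h3, h4⟩

variable [FiniteDimensional F W] {l1 l2 f1 f2 : Module.Dual F W}

namespace IsBorelDual

variable (hD : IsBorelDual B θ l1 l2 f1 f2) (hB : IsBorelHopf B θ) (hq : IsOddRoot q d)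

include hD hB

theorem isBorelDerivation : IsBorelDerivation q (gen F q d .k1) (gen F q d .k2) (gen F q d .e1)
    (gen F q d .e2)
    (θ.symm.toLinearMap ∘ₗ B.dualRight l1 ∘ₗ θ.toLinearMap)
    (θ.symm.toLinearMap ∘ₗ B.dualRight l2 ∘ₗ θ.toLinearMap)
    (θ.symm.toLinearMap ∘ₗ B.dualRight f1 ∘ₗ θ.toLinearMap)
    (θ.symm.toLinearMap ∘ₗ B.dualRight f2 ∘ₗ θ.toLinearMap)
    (B.counit ∘ₗ θ.toLinearMap) (-(q - q⁻¹)⁻¹) (q - q⁻¹)⁻¹ := by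
  have hm (x y : W) : θ.symm (B.m x y) = θ.symm x * θ.symm y := by
    apply θ.injective
    rw [hB.map_mul, θ.apply_symm_apply, θ.apply_symm_apply, θ.apply_symm_apply]
  have h1 : θ.symm B.one = 1 := by rw [← hB.map_one, θ.symm_apply_apply]
  constructor <;> simp only [LinearMap.comp_apply, LinearEquiv.coe_coe, hB.map_mul, hB.map_one]
  · rw [hD.l1.dualRight_one hB, h1]
  · intro x; rw [hD.l1.dualRight_k hB hB.k1, hD.l1.k1]; simp [hm]
  · intro x; rw [hD.l1.dualRight_k hB hB.k2, hD.l1.k2]; simp [hm]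
  · intro x; rw [hD.l1.dualRight_e hB hB.e1 hD.l1.e1]; simp [hm]
  · intro x; rw [hD.l1.dualRight_e hB hB.e2 hD.l1.e2]; simp [hm]
  · rw [hD.l2.dualRight_one hB, h1]
  · intro x; rw [hD.l2.dualRight_k hB hB.k1, hD.l2.k1]; simp [hm]
  · intro x; rw [hD.l2.dualRight_k hB hB.k2, hD.l2.k2]; simp [hm]
  · intro x; rw [hD.l2.dualRight_e hB hB.e1 hD.l2.e1]; simp [hm]
  · intro x; rw [hD.l2.dualRight_e hB hB.e2 hD.l2.e2]; simp [hm]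
  · rw [hD.f1.dualRight_one hB, map_zero]
  · intro x; rw [hD.f1.dualRight_k hB hB.k1 hD.f1.k1, hD.l1.k1]; simp [hm]
  · intro x; rw [hD.f1.dualRight_k hB hB.k2 hD.f1.k2, hD.l1.k2]; simp [hm]
  · intro x
    rw [hD.f1.dualRight_e hB hD.l1 (i := 0) (by simp) (by simp) hB.e1 hD.l1.e1, hD.f1.e1]
    simp [hm]
  · intro x
    rw [hD.f1.dualRight_e hB hD.l1 (i := 0) (by simp) (by simp) hB.e2 hD.l1.e2, hD.f1.e2]
    simp [hm]
  · rw [hD.f2.dualRight_one hB, map_zero]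
  · intro x; rw [hD.f2.dualRight_k hB hB.k1 hD.f2.k1, hD.l2.k1]; simp [hm]
  · intro x; rw [hD.f2.dualRight_k hB hB.k2 hD.f2.k2, hD.l2.k2]; simp [hm]
  · intro x
    rw [hD.f2.dualRight_e hB hD.l2 (i := 1) (by simp) (by simp) hB.e1 hD.l2.e1, hD.f2.e1]
    simp [hm]
  · intro x
    rw [hD.f2.dualRight_e hB hD.l2 (i := 1) (by simp) (by simp) hB.e2 hD.l2.e2, hD.f2.e2]
    simp [hm]
  · exact hB.isHopf.counit_one
  · intro x; rw [hB.isHopf.counit_mul, hB.counit_k1, one_mul]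
  · intro x; rw [hB.isHopf.counit_mul, hB.counit_k2, one_mul]
  · intro x; rw [hB.isHopf.counit_mul, hB.counit_e1, zero_mul]
  · intro x; rw [hB.isHopf.counit_mul, hB.counit_e2, zero_mul]

/-- The isomorphism of the Borel algebra with `(Bᵒᵖ)*`. -/
def lift (hD : IsBorelDual B θ l1 l2 f1 f2) (hB : IsBorelHopf B θ) (hq : IsOddRoot q d) :
    BorelAlg F q d →ₐ[F] hB.isHopf.DualAlg :=
  BorelAlg.lift (hB.borelRel_dual hq hD.l1 hD.l2 hD.f1 hD.f2)

/-- The underlying linear map of `lift`. -/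
def liftₗ (hD : IsBorelDual B θ l1 l2 f1 f2) (hB : IsBorelHopf B θ) (hq : IsOddRoot q d) :
    BorelAlg F q d →ₗ[F] Module.Dual F W := (hD.lift hB hq).toLinearMap

theorem liftₗ_mul (x y : BorelAlg F q d) : hD.liftₗ hB hq (x * y) =
    B.dualOp.m (hD.liftₗ hB hq x) (hD.liftₗ hB hq y) := map_mul (hD.lift hB hq) x y

theorem liftₗ_one : hD.liftₗ hB hq 1 = B.counit := map_one (hD.lift hB hq)

theorem liftₗ_k1 : hD.liftₗ hB hq (gen F q d .k1) = l1 :=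
  BorelAlg.lift_k1 (hB.borelRel_dual hq hD.l1 hD.l2 hD.f1 hD.f2)

theorem liftₗ_k2 : hD.liftₗ hB hq (gen F q d .k2) = l2 :=
  BorelAlg.lift_k2 (hB.borelRel_dual hq hD.l1 hD.l2 hD.f1 hD.f2)

theorem liftₗ_e1 : hD.liftₗ hB hq (gen F q d .e1) = f1 :=
  BorelAlg.lift_e1 (hB.borelRel_dual hq hD.l1 hD.l2 hD.f1 hD.f2)

theorem liftₗ_e2 : hD.liftₗ hB hq (gen F q d .e2) = f2 :=
  BorelAlg.lift_e2 (hB.borelRel_dual hq hD.l1 hD.l2 hD.f1 hD.f2)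

include hq

theorem linearIndependent_monomial : LinearIndependent F fun y : BIdx d =>
    borelMonomial q (gen F q d .k1) (gen F q d .k2) (gen F q d .e1) (gen F q d .e2)
      y.i y.j y.r y.h y.t := by
  have hc := inv_ne_zero hq.sub_inv_ne
  rw [Fintype.linearIndependent_iff]
  intro c hc0
  exact (hD.isBorelDerivation hB).eq_zero_of_sum_mem (borelRel F q d) hq (neg_ne_zero.mpr hc) hc
    (I := ⊥) (by simp) (by simp) (by simp) (by simp) (by simp) c (by rw [hc0]; exact zero_mem _)

omit hD hB in
theorem span_monomial : Submodule.span F (Set.range fun y : BIdx d =>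
    borelMonomial q (gen F q d .k1) (gen F q d .k2) (gen F q d .e1) (gen F q d .e2)
      y.i y.j y.r y.h y.t) = ⊤ :=
  ((borelRel F q d).straightening hq).span_torus_first hq.pos (adjoin_gen F q d)

/-- The basis of monomials. -/
def basis (hD : IsBorelDual B θ l1 l2 f1 f2) (hB : IsBorelHopf B θ) (hq : IsOddRoot q d) :
    Module.Basis (BIdx d) F W :=
  (Module.Basis.mk (hD.linearIndependent_monomial hB hq) (span_monomial hq).ge).map θ

theorem basis_apply (y : BIdx d) : hD.basis hB hq y = θ (borelMonomial q (gen F q d .k1)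
    (gen F q d .k2) (gen F q d .e1) (gen F q d .e2) y.i y.j y.r y.h y.t) := by
  simp [basis]

theorem liftₗ_surjective : Function.Surjective (hD.liftₗ hB hq) := by
  have hc := inv_ne_zero hq.sub_inv_ne
  set Y : Submodule F (Module.Dual F W) := LinearMap.range (hD.liftₗ hB hq) with hY
  suffices h : Y = ⊤ from LinearMap.range_eq_top.mp h
  set I : Submodule F (BorelAlg F q d) := Y.dualCoannihilator.comap θ.toLinearMap with hI
  have mem {x : BorelAlg F q d} : x ∈ I ↔ ∀ y, hD.liftₗ hB hq y (θ x) = 0 := by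
    simp only [hI, Submodule.mem_comap, Submodule.mem_dualCoannihilator]
    exact ⟨fun h y => h _ ⟨y, rfl⟩, by rintro h _ ⟨y, rfl⟩; exact h y⟩
  have stable (g : BorelGen) : ∀ x ∈ I, (θ.symm.toLinearMap ∘ₗ
      B.dualRight (hD.liftₗ hB hq (gen F q d g)) ∘ₗ θ.toLinearMap) x ∈ I := by
    intro x hx
    rw [mem] at hx ⊢
    intro y
    have := hx (y * gen F q d g)
    rw [liftₗ_mul] at this
    simp only [LinearMap.comp_apply, LinearEquiv.coe_coe, LinearEquiv.apply_symm_apply]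
    rw [apply_dualRight]
    exact this
  have I0 : I = ⊥ := by
    rw [eq_bot_iff]
    intro x hx
    obtain ⟨c, rfl⟩ := (Submodule.mem_span_range_iff_exists_fun F).mp
      ((span_monomial (F := F) hq).symm ▸ Submodule.mem_top : x ∈ Submodule.span F _)
    have := (hD.isBorelDerivation hB).eq_zero_of_sum_mem (borelRel F q d) hq (neg_ne_zero.mpr hc) hc
      (I := I) (fun x hx => ?_) ?_ ?_ ?_ ?_ c hx
    · simp [this]
    · have := (mem.mp hx) 1
      rwa [liftₗ_one] at this
    · simpa only [liftₗ_e1] using stable .e1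
    · simpa only [liftₗ_e2] using stable .e2
    · simpa only [liftₗ_k1] using stable .k1
    · simpa only [liftₗ_k2] using stable .k2
  have Y0 : Y.dualCoannihilator = ⊥ := by
    rw [eq_bot_iff]
    intro x hx
    have : θ.symm x ∈ I := by
      rw [hI, Submodule.mem_comap]
      simpa using hx
    rw [I0, Submodule.mem_bot] at this
    simpa using this
  rw [← Subspace.dualCoannihilator_dualAnnihilator_eq (W := Y), Y0, Submodule.dualAnnihilator_bot]

theorem liftₗ_bijective : Function.Bijective (hD.liftₗ hB hq) := by
  have hs := hD.liftₗ_surjective hB hq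
  haveI : FiniteDimensional F (BorelAlg F q d) := θ.symm.finiteDimensional
  refine ⟨?_, hs⟩
  refine (LinearMap.injective_iff_surjective_of_finrank_eq_finrank
    (f := hD.liftₗ hB hq) ?_).mpr hs
  rw [Subspace.dual_finrank_eq, θ.finrank_eq]

end IsBorelDual

end SuperHopfData

open BorelAlg

section Monomials

variable {F : Type*} [Field F] {q : F} {R : Type*} [Ring R] [Algebra F R] {k1 k2 e1 e2 : R}

theorem map_borelMonomial {g : R →ₗ[F] F} {s1 s2 : F} (h1 : ∀ x, g (k1 * x) = s1 * g x)
    (h2 : ∀ x, g (k2 * x) = s2 * g x) (i j r h t : ℕ) :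
    g (borelMonomial q k1 k2 e1 e2 i j r h t) =
      s1 ^ i * s2 ^ j * g (borelMonomial q k1 k2 e1 e2 0 0 r h t) := by
  have p {k : R} {s : F} (h : ∀ x, g (k * x) = s * g x) (n : ℕ) (x : R) :
      g (k ^ n * x) = s ^ n * g x := by
    induction n with
    | zero => simp
    | succ n ih => rw [pow_succ', mul_assoc, h, ih, pow_succ', mul_assoc]
  rw [borelMonomial, mul_assoc, mul_assoc, mul_assoc, p h1, p h2, borelMonomial, pow_zero, pow_zero,
    one_mul, one_mul, ← mul_assoc, mul_assoc (e1 ^ r)]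

theorem borelMonomial_zero : borelMonomial q k1 k2 e1 e2 0 0 0 0 0 = 1 := by simp [borelMonomial]

theorem borelMonomial_succ_e1 (r h t : ℕ) : borelMonomial q k1 k2 e1 e2 0 0 (r + 1) h t =
    e1 * borelMonomial q k1 k2 e1 e2 0 0 r h t := by
  simp [borelMonomial, pow_succ' e1, mul_assoc]

theorem borelMonomial_succ_e3 (h t : ℕ) : borelMonomial q k1 k2 e1 e2 0 0 0 (h + 1) t =
    e1 * (e2 * borelMonomial q k1 k2 e1 e2 0 0 0 h t) -
      q⁻¹ • (e2 * (e1 * borelMonomial q k1 k2 e1 e2 0 0 0 h t)) := by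
  simp [borelMonomial, pow_succ' (_ - _), mul_assoc, sub_mul]

theorem borelMonomial_succ_e2 (t : ℕ) : borelMonomial q k1 k2 e1 e2 0 0 0 0 (t + 1) =
    e2 * borelMonomial q k1 k2 e1 e2 0 0 0 0 t := by
  simp [borelMonomial, pow_succ' e2]

end Monomials

namespace SuperHopfData

variable {F : Type*} [Field F] {q : F} {d : ℕ} {W : Type*} [AddCommGroup W] [Module F W]
  {B : SuperHopfData F W} {θ : BorelAlg F q d ≃ₗ[F] W}

theorem IsTorusChar.apply_monomial {s1 s2 : F} {f : Module.Dual F W} (hf : IsTorusChar B θ s1 s2 f)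
    (hB : IsBorelHopf B θ) (i j r h t : ℕ) :
    f (θ (borelMonomial q (gen F q d .k1) (gen F q d .k2) (gen F q d .e1) (gen F q d .e2)
      i j r h t)) = if r = 0 ∧ h = 0 ∧ t = 0 then s1 ^ i * s2 ^ j else 0 := by
  have m (x y : BorelAlg F q d) : f (θ (x * y)) = f (θ x) * f (θ y) := by rw [hB.map_mul, hf.map_m]
  refine (map_borelMonomial (g := f ∘ₗ θ.toLinearMap) (s1 := s1) (s2 := s2)
    (fun x => by simp [m, hf.k1]) (fun x => by simp [m, hf.k2]) i j r h t).trans ?_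
  rcases r with _ | r
  · rcases h with _ | h
    · rcases t with _ | t
      · simp [borelMonomial_zero, hB.map_one, hf.map_one]
      · simp [borelMonomial_succ_e2, m, hf.e2]
    · simp [borelMonomial_succ_e3, m, hf.e2]
  · simp [borelMonomial_succ_e1, m, hf.e1]

theorem IsSkewChar.apply_monomial {s1 s2 c1 c2 : F} {f κ : Module.Dual F W}
    (hf : IsSkewChar B θ κ c1 c2 f) (hκ : IsTorusChar B θ s1 s2 κ)
    (hB : IsBorelHopf B θ) (i j r h t : ℕ) :
    f (θ (borelMonomial q (gen F q d .k1) (gen F q d .k2) (gen F q d .e1) (gen F q d .e2)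
      i j r h t)) = s1 ^ i * s2 ^ j * (if r = 1 ∧ h = 0 ∧ t = 0 then c1 else
        if r = 0 ∧ h = 0 ∧ t = 1 then c2 else 0) := by
  have m (x y : BorelAlg F q d) : f (θ (x * y)) = f (θ x) * B.counit (θ y) + κ (θ x) * f (θ y) := by
    rw [hB.map_mul, hf.map_m]
  have hε := hB.isTorusChar_counit.apply_monomial hB 0 0
  have mε (x y : BorelAlg F q d) : B.counit (θ (x * y)) = B.counit (θ x) * B.counit (θ y) := by
    rw [hB.map_mul, hB.isHopf.counit_mul]
  refine (map_borelMonomial (g := f ∘ₗ θ.toLinearMap) (s1 := s1) (s2 := s2)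
    (fun x => by simp [m, hf.k1, hκ.k1]) (fun x => by simp [m, hf.k2, hκ.k2]) i j r h t).trans ?_
  congr 1
  rcases r with _ | r
  · rcases h with _ | h
    · rcases t with _ | t
      · simp [borelMonomial_zero, hB.map_one, hf.map_one]
      · simp [borelMonomial_succ_e2, m, hf.e2, hκ.e2, hε]
    · simp [borelMonomial_succ_e3, m, mε, hκ.e1, hκ.e2, hB.counit_e1, hB.counit_e2]
  · simp [borelMonomial_succ_e1, m, hf.e1, hκ.e1, hε]

variable [FiniteDimensional F W] {l1 l2 f1 f2 : Module.Dual F W}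

theorem IsTorusChar.m_eq (hB : IsBorelHopf B θ) {s1 s2 t1 t2 : F} {f g h : Module.Dual F W}
    (hf : IsTorusChar B θ s1 s2 f) (hg : IsTorusChar B θ t1 t2 g)
    (hh : IsTorusChar B θ (s1 * t1) (s2 * t2) h) : B.dualOp.m f g = h := by
  rw [← sub_eq_zero]
  refine hB.dual_eq_zero ?_ fun b => ?_
  · rw [LinearMap.sub_apply, hB.isHopf.dualOp_m_one_apply, hf.map_one, hg.map_one, hh.map_one,
      one_mul, sub_self]
  cases b
  · refine ⟨s1 * t1, ?_⟩
    rw [LinearMap.sub_comp, hB.k1.dual_m_lmul hB.isHopf, hf.comp_lmul, hg.comp_lmul, hh.comp_lmul,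
      hf.k1, hg.k1, hh.k1, smul_m, m_smul, smul_smul, smul_sub]
  · refine ⟨s2 * t2, ?_⟩
    rw [LinearMap.sub_comp, hB.k2.dual_m_lmul hB.isHopf, hf.comp_lmul, hg.comp_lmul, hh.comp_lmul,
      hf.k2, hg.k2, hh.k2, smul_m, m_smul, smul_smul, smul_sub]
  · refine ⟨0, ?_⟩
    rw [LinearMap.sub_comp, hB.e1.dual_m_lmul hB.isHopf, hf.comp_lmul, hg.comp_lmul, hh.comp_lmul,
      hf.e1, hg.e1, hh.e1]
    simp
  · refine ⟨0, ?_⟩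
    rw [LinearMap.sub_comp, hB.e2.dual_m_lmul hB.isHopf, hf.comp_lmul, hg.comp_lmul, hh.comp_lmul,
      hf.e2, hg.e2, hh.e2]
    simp

namespace IsBorelDual

variable (hD : IsBorelDual B θ l1 l2 f1 f2) (hB : IsBorelHopf B θ) (hq : IsOddRoot q d)

theorem sum_coord_apply {V ι : Type*} [AddCommGroup V] [Module F V] [Fintype ι] [DecidableEq ι]
    (b : Module.Basis ι F V) (φ : ι → F) (y : ι) : (∑ x, φ x • b.coord x) (b y) = φ y := by
  simp [Finsupp.single_apply]

theorem alphaE1_eq : alphaE1 q (hD.basis hB hq) = f1 := by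
  classical
  refine (hD.basis hB hq).ext fun y => ?_
  rw [alphaE1, LinearMap.smul_apply, sum_coord_apply, basis_apply, hD.f1.apply_monomial hD.l1 hB]
  have h := hq.ne_zero
  by_cases hy : (y.r : ℕ) = 1 ∧ y.h = 0 ∧ y.t = 0
  · simp only [hy, and_self, Fin.val_zero, if_true, smul_eq_mul]
    rw [zpow_sub₀ h, zpow_mul, zpow_natCast, zpow_natCast, inv_pow]
    simp [div_eq_mul_inv, mul_comm]
  · have : ¬((y.r : ℕ) = 1 ∧ (y.h : ℕ) = 0 ∧ (y.t : ℕ) = 0) := by simpa using hy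
    simp [hy, this]

theorem alphaE2_eq : alphaE2 q (hD.basis hB hq) = f2 := by
  classical
  refine (hD.basis hB hq).ext fun y => ?_
  rw [alphaE2, LinearMap.smul_apply, sum_coord_apply, basis_apply, hD.f2.apply_monomial hD.l2 hB]
  have e (n : Fin 2) : ((n : ℕ) = 1 ↔ n = 1) ∧ ((n : ℕ) = 0 ↔ n = 0) := by
    revert n; decide
  simp only [e]
  by_cases hy : (y.r : ℕ) = 0 ∧ y.h = 0 ∧ y.t = 1
  · simp [hy, mul_comm]
  · simp [hy]

theorem isTorusChar_alphaK1 : IsTorusChar B θ (q ^ 2)⁻¹ q (alphaK1 q (hD.basis hB hq)) := by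
  classical
  obtain ⟨f, hf⟩ := hB.exists_torusChar (s1 := (q ^ 2)⁻¹) (s2 := q) hq.pos
    (by rw [inv_pow, ← pow_mul, mul_comm, pow_mul, hq.root.pow_eq_one, one_pow, inv_one])
    hq.root.pow_eq_one
  convert hf
  refine (hD.basis hB hq).ext fun y => ?_
  rw [alphaK1, sum_coord_apply, basis_apply, hf.apply_monomial hB]
  have : ((y.r : ℕ) = 0 ∧ y.h = 0 ∧ y.t = 0) ↔
    ((y.r : ℕ) = 0 ∧ (y.h : ℕ) = 0 ∧ (y.t : ℕ) = 0) := by simp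
  simp only [this]
  congr 1
  rw [zpow_add₀ hq.ne_zero, neg_mul, zpow_neg, zpow_mul, inv_pow]
  simp

theorem isTorusChar_alphaK2 : IsTorusChar B θ q 1 (alphaK2 q (hD.basis hB hq)) := by
  classical
  obtain ⟨f, hf⟩ := hB.exists_torusChar (s1 := q) (s2 := 1) hq.pos hq.root.pow_eq_one (one_pow d)
  convert hf
  refine (hD.basis hB hq).ext fun y => ?_
  rw [alphaK2, sum_coord_apply, basis_apply, hf.apply_monomial hB]
  have : ((y.r : ℕ) = 0 ∧ y.h = 0 ∧ y.t = 0) ↔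
    ((y.r : ℕ) = 0 ∧ (y.h : ℕ) = 0 ∧ (y.t : ℕ) = 0) := by simp
  simp only [this, one_pow, mul_one]

theorem alphaE3_eq : alphaE3 q (hD.basis hB hq) =
    B.dualOp.m f2 f1 - q • B.dualOp.m f1 f2 := by
  classical
  set D := B.dualOp.m f2 f1 - q • B.dualOp.m f1 f2 with hDdef
  have q0 := hq.ne_zero
  have hb := hB.isHopf
  have D1 : D B.one = 0 := by
    rw [hDdef, LinearMap.sub_apply, LinearMap.smul_apply, hb.dualOp_m_one_apply,
      hb.dualOp_m_one_apply, hD.f1.map_one, hD.f2.map_one]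
    simp
  have Dk1 : D ∘ₗ B.lmul (θ (gen F q d .k1)) = q • D := by
    rw [hDdef, LinearMap.sub_comp, LinearMap.smul_comp, hB.k1.dual_m_lmul hb, hB.k1.dual_m_lmul hb,
      hD.f1.comp_lmul, hD.f2.comp_lmul, hD.f1.k1, hD.f2.k1, hD.l1.k1, hD.l2.k1]
    simp only [zero_smul, zero_add, m_smul, smul_m, smul_smul, smul_sub]
    match_scalars <;> field_simp
  have Dk2 : D ∘ₗ B.lmul (θ (gen F q d .k2)) = q⁻¹ • D := by
    rw [hDdef, LinearMap.sub_comp, LinearMap.smul_comp, hB.k2.dual_m_lmul hb, hB.k2.dual_m_lmul hb,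
      hD.f1.comp_lmul, hD.f2.comp_lmul, hD.f1.k2, hD.f2.k2, hD.l1.k2, hD.l2.k2]
    simp only [zero_smul, zero_add, m_smul, smul_m, smul_smul, smul_sub]
    match_scalars <;> field_simp
  have m1 (f : Module.Dual F W) : B.dualOp.m B.counit f = f := hb.dualOp_isSuperAlg.one_mul f
  have m2 (f : Module.Dual F W) : B.dualOp.m f B.counit = f := hb.dualOp_isSuperAlg.mul_one f
  have De1 : D ∘ₗ B.lmul (θ (gen F q d .e1)) = f2 := by
    rw [hDdef, LinearMap.sub_comp, LinearMap.smul_comp, hB.e1.dual_m_lmul hb, hB.e1.dual_m_lmul hb,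
      sgn_zero hb.grading, LinearMap.comp_id, LinearMap.comp_id,
      hD.f1.comp_lmul, hD.f2.comp_lmul, hD.f1.comp_lmul, hD.f2.comp_lmul, hD.f1.e1, hD.f2.e1,
      hD.l1.e1, hD.l2.e1, hD.f1.k1, hD.f2.k1, hD.l1.k1, hD.l2.k1]
    simp only [zero_smul, zero_add, add_zero, m_smul, smul_m, smul_smul, zero_m, m_zero, m1, m2]
    have := hq.sub_inv_ne
    rw [← sub_smul, show -(q - q⁻¹)⁻¹ * q⁻¹ - q * -(q - q⁻¹)⁻¹ = (q - q⁻¹) * (q - q⁻¹)⁻¹ by ring,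
      mul_inv_cancel₀ this, one_smul]
  have De2 : D ∘ₗ B.lmul (θ (gen F q d .e2)) = 0 := by
    rw [hDdef, LinearMap.sub_comp, LinearMap.smul_comp, hB.e2.dual_m_lmul hb, hB.e2.dual_m_lmul hb,
      hD.f1.comp_sgn hB hD.l1 (i := 0) (by simp) (by simp), mul_zero, koszulSign_zero, one_smul,
      hD.f1.comp_lmul, hD.f2.comp_lmul, hD.f1.comp_lmul, hD.f2.comp_lmul, hD.f1.e2, hD.f2.e2,
      hD.l1.e2, hD.l2.e2, hD.f1.k2, hD.f2.k2, hD.l1.k2, hD.l2.k2]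
    simp only [zero_smul, zero_add, add_zero, m_smul, smul_m, smul_smul, zero_m, m_zero, m1, m2]
    rw [mul_comm (q - q⁻¹)⁻¹ q⁻¹, mul_inv_cancel_left₀ q0, sub_self]
  have r {g : BorelGen} {u : Module.Dual F W} (h : D ∘ₗ B.lmul (θ (gen F q d g)) = u)
      (x : BorelAlg F q d) : D (θ (gen F q d g * x)) = u (θ x) := by
    rw [hB.map_mul, ← h]; rfl
  refine (hD.basis hB hq).ext fun y => ?_
  have key (r' h t : ℕ) : D (θ (borelMonomial q (gen F q d .k1) (gen F q d .k2) (gen F q d .e1)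
      (gen F q d .e2) 0 0 r' h t)) = if (r' = 1 ∧ h = 0 ∧ t = 1) ∨ (r' = 0 ∧ h = 1 ∧ t = 0)
        then (q - q⁻¹)⁻¹ else 0 := by
    have hf2 := hD.f2.apply_monomial hD.l2 hB 0 0
    have mf2 (x y : BorelAlg F q d) :
        f2 (θ (x * y)) = f2 (θ x) * B.counit (θ y) + l2 (θ x) * f2 (θ y) := by
      rw [hB.map_mul, hD.f2.map_m]
    have hε := hB.isTorusChar_counit.apply_monomial hB 0 0
    rcases r' with _ | r'
    · rcases h with _ | h
      · rcases t with _ | t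
        · simp [borelMonomial_zero, hB.map_one, D1]
        · simp [borelMonomial_succ_e2, r De2]
      · simp [borelMonomial_succ_e3, r De2, r De1, mf2, hD.f2.e2, hD.l2.e2, hε]
    · simp [borelMonomial_succ_e1, r De1, hf2]
      intros
      omega
  rw [alphaE3, LinearMap.smul_apply, sum_coord_apply, basis_apply]
  refine Eq.trans ?_ (map_borelMonomial (g := D ∘ₗ θ.toLinearMap) (s1 := q) (s2 := q⁻¹)
    (fun x => by simp [r Dk1]) (fun x => by simp [r Dk2]) y.i y.j y.r y.h y.t).symm
  rw [LinearMap.comp_apply, LinearEquiv.coe_coe, key]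
  have e : (((y.r : ℕ) = 1 ∧ y.h = 0 ∧ y.t = 1) ∨ ((y.r : ℕ) = 0 ∧ y.h = 1 ∧ y.t = 0)) ↔
      (((y.r : ℕ) = 1 ∧ (y.h : ℕ) = 0 ∧ (y.t : ℕ) = 1) ∨
        ((y.r : ℕ) = 0 ∧ (y.h : ℕ) = 1 ∧ (y.t : ℕ) = 0)) := by
    have (n : Fin 2) : ((n : ℕ) = 1 ↔ n = 1) ∧ ((n : ℕ) = 0 ↔ n = 0) := by
      revert n; decide
    simp only [this]
  simp only [e, zpow_sub₀ q0, zpow_natCast]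
  split_ifs
  · rw [smul_eq_mul, inv_pow, div_eq_mul_inv, mul_comm]
  · simp

end IsBorelDual

end SuperHopfData

section EvenTensors

variable {F : Type*} [Field F] {V W : Type*} [AddCommGroup V] [Module F V] [AddCommGroup W]
  [Module F W] {p : ZMod 2 → V →ₗ[F] V} {r : ZMod 2 → W →ₗ[F] W}

theorem IsGrading.even_induction (hp : IsGrading p) (hr : IsGrading r) {P : V ⊗[F] W → Prop}
    (add : ∀ s t, P s → P t → P (s + t))
    (tmul : ∀ i v w, p i v = v → r i w = w → P (v ⊗ₜ w)) {s : V ⊗[F] W}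
    (hs : tensorPart p r 0 s = s) : P s := by
  rw [← hs]
  refine hp.tensor_induction hr (P := fun s => P (tensorPart p r 0 s)) (fun a b ha hb => ?_)
    (fun i j v w hv hw => ?_) s
  · rw [map_add]; exact add _ _ ha hb
  · rw [tensorPart_tmul hp hr hv hw]
    split_ifs with h
    · have hij : i = j := by
        clear hv hw; revert i j; decide
      subst hij
      exact tmul i v w hv hw
    · simpa using tmul 0 0 0 (map_zero _) (map_zero _)

/-- Evaluation of the first tensor factor. -/
def slice (f : Module.Dual F W) : W ⊗[F] V →ₗ[F] V :=
  (TensorProduct.lid F V).toLinearMap ∘ₗ TensorProduct.map f LinearMap.id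

@[simp] theorem slice_tmul (f : Module.Dual F W) (w : W) (v : V) :
    slice f (w ⊗ₜ[F] v) = f w • v := by simp [slice]

theorem slice_ext {ι : Type*} [Fintype ι] (b : Module.Basis ι F W) {s t : W ⊗[F] V}
    (h : ∀ f : Module.Dual F W, slice f s = slice f t) : s = t := by
  have e (s : W ⊗[F] V) : s = ∑ i, b i ⊗ₜ slice (b.coord i) s := by
    induction s with
    | zero => simp
    | add x y hx hy => simp only [map_add, TensorProduct.tmul_add, Finset.sum_add_distrib, ← hx, ← hy]
    | tmul w v =>
      simp only [slice_tmul, TensorProduct.tmul_smul, TensorProduct.smul_tmul']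
      rw [← TensorProduct.sum_tmul]
      congr 1
      exact (b.sum_repr w).symm
  rw [e s, e t]
  simp only [h]

end EvenTensors

namespace SuperHopfData

variable {F : Type*} [Field F] {V W : Type*} [AddCommGroup V] [Module F V] [AddCommGroup W]
  [Module F W] {H : SuperHopfData F V} {B : SuperHopfData F W}

theorem slice_m_left (hB : B.IsSuperAlg) (hH : H.IsSuperAlg) (f : Module.Dual F W) (x : W) {v : V}
    {i : ZMod 2} (hv : H.part i v = v) (t : W ⊗[F] V) :
    slice f ((B.tensor H).m (x ⊗ₜ v) t) = H.m v (slice (f ∘ₗ B.lmul x ∘ₗ B.sgn i) t) := by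
  refine hB.grading.tensor_induction hH.grading (P := fun t => slice f ((B.tensor H).m (x ⊗ₜ v) t) =
    H.m v (slice (f ∘ₗ B.lmul x ∘ₗ B.sgn i) t)) (fun a b ha hb => ?_) (fun k l w u hw hu => ?_) t
  · rw [m_add, map_add, map_add, m_add, ha, hb]
  · rw [IsSuperAlg.tensor_m hB.grading hH.grading x u hv hw, map_smul, slice_tmul, slice_tmul]
    simp only [LinearMap.comp_apply, sgn_of_hom hB.grading i hw, map_smul, lmul_apply, m_smul,
      smul_smul, smul_eq_mul]

theorem slice_m_right (hB : B.IsSuperAlg) (hH : H.IsSuperAlg) (f : Module.Dual F W) {x : W} (v : V)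
    {i : ZMod 2} (hx : B.part i x = x) {t : W ⊗[F] V} (ht : (B.tensor H).part 0 t = t) :
    slice f ((B.tensor H).m t (x ⊗ₜ v)) = H.m (slice (f ∘ₗ B.rmul x ∘ₗ B.sgn i) t) v := by
  refine hB.grading.even_induction hH.grading (P := fun t => slice f ((B.tensor H).m t (x ⊗ₜ v)) =
    H.m (slice (f ∘ₗ B.rmul x ∘ₗ B.sgn i) t) v) (fun a b ha hb => ?_) (fun k w u hw hu => ?_) ht
  · rw [add_m, map_add, map_add, add_m, ha, hb]
  · rw [IsSuperAlg.tensor_m hB.grading hH.grading w v hu hx, map_smul, slice_tmul, slice_tmul]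
    simp only [LinearMap.comp_apply, sgn_of_hom hB.grading i hw, map_smul, rmul_apply, smul_m,
      smul_smul, smul_eq_mul, mul_comm i]

variable [FiniteDimensional F W] {ι : Type*} [Fintype ι] (b : Module.Basis ι F W)
  (χ₀ : Module.Dual F W →ₗ[F] V)

/-- The canonical element `∑ bᵢ ⊗ χ₀(bⁱ)`. -/
def canonicalElt {ι : Type*} [Fintype ι] (b : Module.Basis ι F W) (χ₀ : Module.Dual F W →ₗ[F] V) :
    W ⊗[F] V := ∑ i, b i ⊗ₜ χ₀ (b.coord i)

omit [FiniteDimensional F W] in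
theorem slice_canonicalElt (f : Module.Dual F W) : slice f (canonicalElt b χ₀) = χ₀ f := by
  simp only [canonicalElt, map_sum, slice_tmul]
  simp only [← map_smul, ← map_sum]
  congr 1
  exact b.sum_dual_apply_smul_coord f

variable {χ₀}

theorem canonicalElt_even (hB : IsGrading B.part) (hχ : IsEvenMap B.dualOp.part H.part χ₀) :
    (B.tensor H).part 0 (canonicalElt b χ₀) = canonicalElt b χ₀ := by
  refine slice_ext b fun f => ?_
  have e (t : W ⊗[F] V) : slice f ((B.tensor H).part 0 t) =
      H.part 0 (slice (f ∘ₗ B.part 0) t) + H.part 1 (slice (f ∘ₗ B.part 1) t) := by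
    induction t with
    | zero => simp
    | add x y hx hy => simp only [map_add, hx, hy]; abel
    | tmul w v => simp [tensor, tensorPart, sum_zmod_two]
  rw [e, slice_canonicalElt, slice_canonicalElt, slice_canonicalElt, ← hχ.apply, ← hχ.apply,
    ← map_add]
  congr 1
  ext x
  change f (B.part 0 (B.part 0 x)) + f (B.part 1 (B.part 1 x)) = f x
  rw [hB.apply_self, hB.apply_self, ← map_add, hB.add_apply]

/-- The coproduct of `B`, with the second factor mapped by `j`. -/
def comulR (B : SuperHopfData F W) (j : W →ₗ[F] V) : W →ₗ[F] W ⊗[F] V :=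
  TensorProduct.map LinearMap.id j ∘ₗ B.comul

/-- The opposite coproduct of `B`, with the second factor mapped by `j`. -/
def comulRop (B : SuperHopfData F W) (j : W →ₗ[F] V) : W →ₗ[F] W ⊗[F] V :=
  TensorProduct.map LinearMap.id j ∘ₗ superFlip B.part B.part ∘ₗ B.comul

omit [FiniteDimensional F W] in
theorem IsHopf.comul_hom (hB : B.IsHopf) : IsSuperAlgHom B (B.tensor B) B.comul :=
  ⟨hB.comul_even, hB.comul_mul, hB.comul_one⟩

omit [FiniteDimensional F W] in
theorem IsHopfHom.isSuperAlgHom {j : W →ₗ[F] V} (hj : B.IsHopfHom H j) : IsSuperAlgHom B H j :=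
  ⟨hj.even, hj.map_mul, hj.map_one⟩

section Intertwine

variable (hB : B.IsHopf) (hH : H.IsSuperAlg) {j : W →ₗ[F] V} (hj : IsSuperAlgHom B H j)

include hB hH hj

omit [FiniteDimensional F W] in
theorem comulR_hom : IsSuperAlgHom B (B.tensor H) (B.comulR j) :=
  (IsSuperAlgHom.id.tensor hB.grading hB.grading hB.grading hH.grading hj).comp hB.comul_hom

omit [FiniteDimensional F W] in
theorem comulRop_hom : IsSuperAlgHom B (B.tensor H) (B.comulRop j) :=
  (IsSuperAlgHom.id.tensor hB.grading hB.grading hB.grading hH.grading hj).comp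
    ((hB.isSuperAlg.flip_hom hB.isSuperAlg).comp hB.comul_hom)

omit [FiniteDimensional F W] in
/-- The relation `Δᵒᵖ(x) R = R Δ(x)` is multiplicative in `x`. -/
theorem intertwine_m {t : W ⊗[F] V} {x y : W}
    (hx : (B.tensor H).m (B.comulRop j x) t = (B.tensor H).m t (B.comulR j x))
    (hy : (B.tensor H).m (B.comulRop j y) t = (B.tensor H).m t (B.comulR j y)) :
    (B.tensor H).m (B.comulRop j (B.m x y)) t = (B.tensor H).m t (B.comulR j (B.m x y)) := by
  have hA := hB.isSuperAlg.tensor hH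
  rw [(comulR_hom hB hH hj).map_m, (comulRop_hom hB hH hj).map_m, hA.mul_assoc, hy, ← hA.mul_assoc,
    hx, hA.mul_assoc]

variable (hχ : IsSuperAlgHom B.dualOp H χ₀)

include hχ

theorem IsGrouplike.intertwine {k : W} (hk : B.IsGrouplike k)
    (h : ∀ f, H.m (j k) (χ₀ (f ∘ₗ B.lmul k)) = H.m (χ₀ (f ∘ₗ B.rmul k)) (j k)) :
    (B.tensor H).m (B.comulRop j k) (canonicalElt b χ₀) =
      (B.tensor H).m (canonicalElt b χ₀) (B.comulR j k) := by
  have e1 : B.comulR j k = k ⊗ₜ j k := by simp [comulR, hk.comul]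
  have e2 : B.comulRop j k = k ⊗ₜ j k := by
    simp [comulRop, hk.comul, superFlip_tmul hB.grading hB.grading hk.even hk.even]
  refine slice_ext b fun f => ?_
  rw [e1, e2, slice_m_left hB.isSuperAlg hH f k (hj.even.hom hk.even),
    slice_m_right hB.isSuperAlg hH f (j k) hk.even (canonicalElt_even b hB.grading hχ.even),
    sgn_zero hB.grading, LinearMap.comp_id, LinearMap.comp_id, slice_canonicalElt,
    slice_canonicalElt, h]

theorem IsSkewPrimitive.intertwine {k e : W} {ε : ZMod 2} (he : B.IsSkewPrimitive ε k e)
    (h : ∀ f, H.m (j e) (χ₀ (f ∘ₗ B.sgn ε)) + H.m (j k) (χ₀ (f ∘ₗ B.lmul e)) =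
      χ₀ (f ∘ₗ B.rmul e ∘ₗ B.sgn ε) + H.m (χ₀ (f ∘ₗ B.rmul k)) (j e)) :
    (B.tensor H).m (B.comulRop j e) (canonicalElt b χ₀) =
      (B.tensor H).m (canonicalElt b χ₀) (B.comulR j e) := by
  have hk := he.grouplike.even
  have e1 : B.comulR j e = e ⊗ₜ H.one + k ⊗ₜ j e := by simp [comulR, he.comul, hj.map_one]
  have e2 : B.comulRop j e = B.one ⊗ₜ j e + e ⊗ₜ j k := by
    simp only [comulRop, LinearMap.comp_apply, he.comul, map_add,
      superFlip_tmul hB.grading hB.grading he.hom hB.one_even,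
      superFlip_tmul hB.grading hB.grading hk he.hom]
    simp
  refine slice_ext b fun f => ?_
  have hR := canonicalElt_even b hB.grading hχ.even
  rw [e1, e2, add_m, m_add, map_add, map_add,
    slice_m_left hB.isSuperAlg hH f B.one (hj.even.hom he.hom),
    slice_m_left hB.isSuperAlg hH f e (hj.even.hom hk),
    slice_m_right hB.isSuperAlg hH f H.one he.hom hR, slice_m_right hB.isSuperAlg hH f (j e) hk hR,
    hB.lmul_one, sgn_zero hB.grading, LinearMap.comp_id, LinearMap.comp_id, LinearMap.id_comp,
    slice_canonicalElt, slice_canonicalElt, slice_canonicalElt, slice_canonicalElt, hH.mul_one, h]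

end Intertwine

section Closure

variable (hB : B.IsHopf) (hH : H.IsSuperAlg) (hχ : IsSuperAlgHom B.dualOp H χ₀) {f g : Module.Dual F W}

include hB hH hχ

theorem IsSkewPrimitive.slice_rel_m {k e : W} {ε : ZMod 2} (he : B.IsSkewPrimitive ε k e)
    {k' e' : V} (hg' : H.m k' (χ₀ (f ∘ₗ B.lmul k)) = H.m (χ₀ (f ∘ₗ B.rmul k)) k')
    (hf : H.m e' (χ₀ (f ∘ₗ B.sgn ε)) + H.m k' (χ₀ (f ∘ₗ B.lmul e)) =
      χ₀ (f ∘ₗ B.rmul e ∘ₗ B.sgn ε) + H.m (χ₀ (f ∘ₗ B.rmul k)) e')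
    (hg : H.m e' (χ₀ (g ∘ₗ B.sgn ε)) + H.m k' (χ₀ (g ∘ₗ B.lmul e)) =
      χ₀ (g ∘ₗ B.rmul e ∘ₗ B.sgn ε) + H.m (χ₀ (g ∘ₗ B.rmul k)) e') :
    H.m e' (χ₀ (B.dualOp.m f g ∘ₗ B.sgn ε)) + H.m k' (χ₀ (B.dualOp.m f g ∘ₗ B.lmul e)) =
      χ₀ (B.dualOp.m f g ∘ₗ B.rmul e ∘ₗ B.sgn ε) + H.m (χ₀ (B.dualOp.m f g ∘ₗ B.rmul k)) e' := by
  have e1 : f ∘ₗ B.rmul k ∘ₗ B.sgn ε ∘ₗ B.sgn ε = f ∘ₗ B.rmul k := by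
    ext x; simp [sgn_sgn hB.grading]
  rw [he.dual_m_lmul hB, hB.dualOp_m_sgn, he.grouplike.dual_m_rmul hB,
    ← LinearMap.comp_assoc _ _ (B.dualOp.m f g), he.dual_m_rmul hB, LinearMap.add_comp,
    hB.dualOp_m_sgn, hB.dualOp_m_sgn]
  simp only [LinearMap.comp_assoc]
  rw [e1, map_add, map_add]
  simp only [hχ.map_m, m_add]
  rw [← hH.mul_assoc, ← add_assoc, ← hH.mul_assoc, ← add_m, hf, ← hH.mul_assoc, hg', hH.mul_assoc,
    add_m, hH.mul_assoc, add_assoc, ← m_add, hg, m_add, hH.mul_assoc, add_assoc]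

end Closure

end SuperHopfData

open BorelAlg

namespace SuperHopfData

variable {F : Type*} [Field F] [CharZero F] {q : F} {d : ℕ} {W : Type*} [AddCommGroup W] [Module F W]
  [FiniteDimensional F W] {B : SuperHopfData F W} {θ : BorelAlg F q d ≃ₗ[F] W}
  {l1 l2 f1 f2 : Module.Dual F W} {H : SuperHopfData F (Ubar F q d)}

omit [FiniteDimensional F W] [CharZero F] in
theorem _root_.IsUbarStructure.m_eq (hH : IsUbarStructure F q d H) (x y : Ubar F q d) :
    H.m x y = x * y := by rw [m, hH.mul_eq]; rfl

theorem dualOp_hom_of_sgn (hB : IsGrading B.part) {i : ZMod 2} {f : Module.Dual F W}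
    (h : f ∘ₗ B.sgn 1 = koszulSign F i • f) : B.dualOp.part i f = f := by
  refine dualOp_hom_iff.mpr fun x => ?_
  refine hB.induction (P := fun x => f (B.part i x) = f x)
    (fun a b ha hb => by rw [map_add, map_add, map_add, ha, hb]) (fun j x hx => ?_) x
  rw [hB.apply_of_hom hx]
  split_ifs with hij
  · rfl
  have e := LinearMap.congr_fun h x
  rw [LinearMap.comp_apply, sgn_of_hom hB 1 hx, map_smul, LinearMap.smul_apply, one_mul] at e
  have e2 : (2 : F) * f x = 0 := by
    rcases zmod_two_cases i with rfl | rfl <;> rcases zmod_two_cases j with rfl | rfl <;>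
      simp at hij e <;> first | linear_combination e | linear_combination -e
  rw [map_zero]
  exact ((mul_eq_zero.mp e2).resolve_left two_ne_zero).symm

/-- The inclusion of the Borel algebra as the negative part of `Ū_q`. -/
def negIncl : BorelAlg F q d →ₐ[F] Ubar F q d := BorelAlg.lift ubarSat.neg

namespace IsBorelDual

variable (hD : IsBorelDual B θ l1 l2 f1 f2) (hB : IsBorelHopf B θ) (hq : IsOddRoot q d)

/-- The map `(Bᵒᵖ)* → Ū_q` onto the negative part. -/
def toUbar (hD : IsBorelDual B θ l1 l2 f1 f2) (hB : IsBorelHopf B θ) (hq : IsOddRoot q d) :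
    Module.Dual F W →ₗ[F] Ubar F q d :=
  negIncl.toLinearMap ∘ₗ (LinearEquiv.ofBijective _ (hD.liftₗ_bijective hB hq)).symm.toLinearMap

omit [CharZero F] in
theorem toUbar_liftₗ (x : BorelAlg F q d) : hD.toUbar hB hq (hD.liftₗ hB hq x) = negIncl x := by
  have := (LinearEquiv.ofBijective _ (hD.liftₗ_bijective hB hq)).symm_apply_apply x
  rw [LinearEquiv.ofBijective_apply] at this
  rw [toUbar, LinearMap.comp_apply, LinearEquiv.coe_coe, this]
  rfl

omit [CharZero F] in
include hD hB hq in
/-- Induction on `(Bᵒᵖ)*` with its generators. -/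
theorem induction {P : Module.Dual F W → Prop} (add : ∀ f g, P f → P g → P (f + g))
    (smul : ∀ (c : F) f, P f → P (c • f)) (one : P B.counit)
    (m1 : ∀ f, P f → P (B.dualOp.m l1 f)) (m2 : ∀ f, P f → P (B.dualOp.m l2 f))
    (m3 : ∀ f, P f → P (B.dualOp.m f1 f)) (m4 : ∀ f, P f → P (B.dualOp.m f2 f))
    (f : Module.Dual F W) : P f := by
  obtain ⟨x, rfl⟩ := hD.liftₗ_surjective hB hq f
  induction x using BorelAlg.induction_left with
  | add x y hx hy => rw [map_add]; exact add _ _ hx hy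
  | smul c x hx => rw [map_smul]; exact smul _ _ hx
  | one => rwa [liftₗ_one]
  | mul g x hx =>
    rw [liftₗ_mul]
    cases g
    · rw [liftₗ_k1]; exact m1 _ hx
    · rw [liftₗ_k2]; exact m2 _ hx
    · rw [liftₗ_e1]; exact m3 _ hx
    · rw [liftₗ_e2]; exact m4 _ hx

omit [CharZero F] in
theorem toUbar_mul (f g : Module.Dual F W) : hD.toUbar hB hq (B.dualOp.m f g) =
    hD.toUbar hB hq f * hD.toUbar hB hq g := by
  obtain ⟨x, rfl⟩ := hD.liftₗ_surjective hB hq f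
  obtain ⟨y, rfl⟩ := hD.liftₗ_surjective hB hq g
  rw [← liftₗ_mul, toUbar_liftₗ, toUbar_liftₗ, toUbar_liftₗ, map_mul]

omit [CharZero F] in
theorem toUbar_counit : hD.toUbar hB hq B.counit = 1 := by
  rw [← hD.liftₗ_one hB hq, toUbar_liftₗ, map_one]

omit [CharZero F] in
theorem toUbar_l1 : hD.toUbar hB hq l1 = ubarGen F q d .K1 :=
  (congrArg _ (hD.liftₗ_k1 hB hq).symm).trans ((hD.toUbar_liftₗ hB hq _).trans (lift_k1 _))

omit [CharZero F] in
theorem toUbar_l2 : hD.toUbar hB hq l2 = ubarGen F q d .K2 :=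
  (congrArg _ (hD.liftₗ_k2 hB hq).symm).trans ((hD.toUbar_liftₗ hB hq _).trans (lift_k2 _))

omit [CharZero F] in
theorem toUbar_f1 : hD.toUbar hB hq f1 = ubarGen F q d .f1 :=
  (congrArg _ (hD.liftₗ_e1 hB hq).symm).trans ((hD.toUbar_liftₗ hB hq _).trans (lift_e1 _))

omit [CharZero F] in
theorem toUbar_f2 : hD.toUbar hB hq f2 = ubarGen F q d .f2 :=
  (congrArg _ (hD.liftₗ_e2 hB hq).symm).trans ((hD.toUbar_liftₗ hB hq _).trans (lift_e2 _))

include hD hB in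
theorem dual_hom : B.dualOp.part 0 l1 = l1 ∧ B.dualOp.part 0 l2 = l2 ∧ B.dualOp.part 0 f1 = f1 ∧
    B.dualOp.part 1 f2 = f2 := by
  have hg := hB.isHopf.grading
  refine ⟨dualOp_hom_of_sgn hg ?_, dualOp_hom_of_sgn hg ?_, dualOp_hom_of_sgn hg ?_,
    dualOp_hom_of_sgn hg ?_⟩
  · rw [hD.l1.comp_sgn hB, koszulSign_zero, one_smul]
  · rw [hD.l2.comp_sgn hB, koszulSign_zero, one_smul]
  · rw [hD.f1.comp_sgn hB hD.l1 (i := 0) (by simp) (by simp), one_mul]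
  · rw [hD.f2.comp_sgn hB hD.l2 (i := 1) (by simp) (by simp), one_mul]

variable (hH : IsUbarStructure F q d H)

include hH

theorem toUbar_hom : IsSuperAlgHom B.dualOp H (hD.toUbar hB hq) where
  map_m f g := by rw [toUbar_mul, hH.m_eq]
  map_one := by rw [hH.one_eq]; exact toUbar_counit hD hB hq
  even := by
    have hX := hB.isHopf.dualOp_isSuperAlg
    have hU := hH.isHopf.isSuperAlg
    obtain ⟨h1, h2, h3, h4⟩ := hD.dual_hom hB
    have step {i : ZMod 2} {g f : Module.Dual F W} (hg : B.dualOp.part i g = g)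
        (hg' : H.part i (hD.toUbar hB hq g) = hD.toUbar hB hq g)
        (hf : ∀ k, hD.toUbar hB hq (B.dualOp.part k f) = H.part k (hD.toUbar hB hq f)) (k : ZMod 2) :
        hD.toUbar hB hq (B.dualOp.part k (B.dualOp.m g f)) =
          H.part k (hD.toUbar hB hq (B.dualOp.m g f)) := by
      obtain ⟨j, rfl⟩ : ∃ j, k = i + j := ⟨k - i, by abel⟩
      rw [hX.part_hom_m hg, toUbar_mul, toUbar_mul, ← hH.m_eq, ← hH.m_eq, hU.part_hom_m hg', hf]
    intro k
    refine LinearMap.ext fun f => ?_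
    revert k
    refine hD.induction hB hq (P := fun f => ∀ k, hD.toUbar hB hq (B.dualOp.part k f) =
        H.part k (hD.toUbar hB hq f)) (fun f g hf hg k => ?_) (fun c f hf k => ?_) (fun k => ?_)
      (fun f hf => step h1 ?_ hf) (fun f hf => step h2 ?_ hf) (fun f hf => step h3 ?_ hf)
      (fun f hf => step h4 ?_ hf) f
    · rw [map_add, map_add, map_add, map_add, hf, hg]
    · rw [map_smul, map_smul, map_smul, map_smul, hf]
    · have e1 := (dualOp_grading hB.isHopf.grading).apply_of_hom hX.one_even k
      have e2 := hH.isHopf.grading.apply_of_hom hU.one_even k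
      change B.dualOp.part k B.counit = if k = 0 then B.counit else 0 at e1
      rw [hH.one_eq] at e2
      rw [e1, toUbar_counit, e2]
      split_ifs
      · exact toUbar_counit hD hB hq
      · exact map_zero _
    · rw [toUbar_l1]; exact hH.deg .K1
    · rw [toUbar_l2]; exact hH.deg .K2
    · rw [toUbar_f1]; exact hH.deg .f1
    · rw [toUbar_f2]; exact hH.deg .f2

omit hH [CharZero F] in
theorem _root_.SuperHopfData.IsTorusChar.dualOp_comul (hB : IsBorelHopf B θ) {s1 s2 : F} {f : Module.Dual F W}
    (hf : IsTorusChar B θ s1 s2 f) : B.dualOp.comul f = f ⊗ₜ f := by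
  apply dualDistrib_injective
  refine TensorProduct.ext' fun a b => ?_
  rw [dualDistrib_dualOp_comul hB.isHopf.grading, hf.map_m, TensorProduct.dualDistrib_apply,
    mul_comm]

omit hH [CharZero F] in
theorem _root_.SuperHopfData.IsSkewChar.dualOp_comul (hB : IsBorelHopf B θ) {c1 c2 : F} {f κ : Module.Dual F W}
    (hf : IsSkewChar B θ κ c1 c2 f) : B.dualOp.comul f = f ⊗ₜ κ + B.counit ⊗ₜ f := by
  apply dualDistrib_injective
  refine TensorProduct.ext' fun a b => ?_
  rw [dualDistrib_dualOp_comul hB.isHopf.grading, hf.map_m, map_add, LinearMap.add_apply,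
    TensorProduct.dualDistrib_apply, TensorProduct.dualDistrib_apply]
  ring

theorem toUbar_comul (f : Module.Dual F W) : H.comul (hD.toUbar hB hq f) =
    TensorProduct.map (hD.toUbar hB hq) (hD.toUbar hB hq) (B.dualOp.comul f) := by
  have hX := hB.isHopf.dualOp_isSuperAlg
  have hφ := hD.toUbar_hom hB hq hH
  have hφφ := hφ.tensor hX.grading hX.grading hH.isHopf.grading hH.isHopf.grading hφ
  have step {g f : Module.Dual F W}
      (hg : H.comul (hD.toUbar hB hq g) =
        TensorProduct.map (hD.toUbar hB hq) (hD.toUbar hB hq) (B.dualOp.comul g))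
      (hf : H.comul (hD.toUbar hB hq f) =
        TensorProduct.map (hD.toUbar hB hq) (hD.toUbar hB hq) (B.dualOp.comul f)) :
      H.comul (hD.toUbar hB hq (B.dualOp.m g f)) =
        TensorProduct.map (hD.toUbar hB hq) (hD.toUbar hB hq) (B.dualOp.comul (B.dualOp.m g f)) := by
    rw [hφ.map_m, hH.isHopf.comul_mul, hB.isHopf.dualOp_comul_mul, hφφ.map_m, hg, hf]
  refine hD.induction hB hq (P := fun f => H.comul (hD.toUbar hB hq f) =
    TensorProduct.map (hD.toUbar hB hq) (hD.toUbar hB hq) (B.dualOp.comul f))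
    (fun f g hf hg => ?_) (fun c f hf => ?_) ?_ (fun f => step ?_) (fun f => step ?_)
    (fun f => step ?_) (fun f => step ?_) f
  · simp only [map_add, hf, hg]
  · simp only [map_smul, hf]
  · rw [toUbar_counit, ← hH.one_eq, hH.isHopf.comul_one, hB.isTorusChar_counit.dualOp_comul hB,
      TensorProduct.map_tmul, toUbar_counit, hH.one_eq]
  · rw [hD.l1.dualOp_comul hB, TensorProduct.map_tmul, toUbar_l1, hH.comul_K1]
  · rw [hD.l2.dualOp_comul hB, TensorProduct.map_tmul, toUbar_l2, hH.comul_K2]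
  · rw [hD.f1.dualOp_comul hB, map_add, TensorProduct.map_tmul, TensorProduct.map_tmul, toUbar_l1,
      toUbar_f1, toUbar_counit, hH.comul_f1]
  · rw [hD.f2.dualOp_comul hB, map_add, TensorProduct.map_tmul, TensorProduct.map_tmul, toUbar_l2,
      toUbar_f2, toUbar_counit, hH.comul_f2]

theorem toUbar_counit_comp (f : Module.Dual F W) :
    H.counit (hD.toUbar hB hq f) = f B.one := by
  have step {g f : Module.Dual F W} (hg : H.counit (hD.toUbar hB hq g) = g B.one)
      (hf : H.counit (hD.toUbar hB hq f) = f B.one) :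
      H.counit (hD.toUbar hB hq (B.dualOp.m g f)) = B.dualOp.m g f B.one := by
    rw [toUbar_mul, ← hH.m_eq, hH.isHopf.counit_mul, hB.isHopf.dualOp_m_one_apply, hg, hf]
  refine hD.induction hB hq (P := fun f => H.counit (hD.toUbar hB hq f) = f B.one)
    (fun f g hf hg => ?_) (fun c f hf => ?_) ?_ (fun f => step ?_) (fun f => step ?_)
    (fun f => step ?_) (fun f => step ?_) f
  · rw [map_add, map_add, hf, hg, LinearMap.add_apply]
  · rw [map_smul, map_smul, hf, LinearMap.smul_apply]
  · rw [toUbar_counit, ← hH.one_eq, hH.isHopf.counit_one, hB.isHopf.counit_one]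
  · rw [toUbar_l1, hD.l1.map_one, hH.counit_K1]
  · rw [toUbar_l2, hD.l2.map_one, hH.counit_K2]
  · rw [toUbar_f1, hD.f1.map_one, hH.counit_f1]
  · rw [toUbar_f2, hD.f2.map_one, hH.counit_f2]

section Slice

variable {j : W →ₗ[F] Ubar F q d} (hj : IsSuperAlgHom B H j) (hjθ : ∀ x, j (θ x) = borelIncl x)

omit hH [CharZero F] in
/-- The relation obtained by slicing `Δᵒᵖ(k) R = R Δ(k)`. -/
theorem slice_grouplike (g : BorelGen) (hg : g = .k1 ∨ g = .k2) (f : Module.Dual F W) :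
    borelIncl (gen F q d g) * hD.toUbar hB hq (f ∘ₗ B.lmul (θ (gen F q d g))) =
      hD.toUbar hB hq (f ∘ₗ B.rmul (θ (gen F q d g))) * borelIncl (gen F q d g) := by
  have hs := ubarSat (F := F) (q := q) (d := d)
  have q0 := hq.ne_zero
  obtain ⟨c11, c12, c21, c22⟩ := hs.k_f_comm
  have hk : B.IsGrouplike (θ (gen F q d g)) := by
    rcases hg with rfl | rfl
    exacts [hB.k1, hB.k2]
  have step {a f : Module.Dual F W}
      (ha : borelIncl (gen F q d g) * hD.toUbar hB hq (a ∘ₗ B.lmul (θ (gen F q d g))) =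
        hD.toUbar hB hq (a ∘ₗ B.rmul (θ (gen F q d g))) * borelIncl (gen F q d g))
      (hf : borelIncl (gen F q d g) * hD.toUbar hB hq (f ∘ₗ B.lmul (θ (gen F q d g))) =
        hD.toUbar hB hq (f ∘ₗ B.rmul (θ (gen F q d g))) * borelIncl (gen F q d g)) :
      borelIncl (gen F q d g) * hD.toUbar hB hq (B.dualOp.m a f ∘ₗ B.lmul (θ (gen F q d g))) =
        hD.toUbar hB hq (B.dualOp.m a f ∘ₗ B.rmul (θ (gen F q d g))) * borelIncl (gen F q d g) := by
    rw [hk.dual_m_lmul hB.isHopf, hk.dual_m_rmul hB.isHopf, toUbar_mul, toUbar_mul, ← mul_assoc,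
      ha, mul_assoc, hf, mul_assoc]
  have kK : ubarGen F q d .k1 * ubarGen F q d .K2 = ubarGen F q d .K2 * ubarGen F q d .k1 ∧
      ubarGen F q d .k2 * ubarGen F q d .K1 = ubarGen F q d .K1 * ubarGen F q d .k2 := by
    have inv {a b c : Ubar F q d} (h1 : b * c = 1) (h2 : c * b = 1) (h : b * a = a * b) :
        a * c = c * a := by
      rw [← mul_one (c * a), ← h1, mul_assoc, ← mul_assoc a, ← h, mul_assoc, ← mul_assoc, h2,
        one_mul]
    exact ⟨inv hs.k2K2 hs.K2k2 hs.pos.k2k1, inv hs.k1K1 hs.K1k1 hs.pos.k2k1.symm⟩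
  refine hD.induction hB hq (P := fun f =>
    borelIncl (gen F q d g) * hD.toUbar hB hq (f ∘ₗ B.lmul (θ (gen F q d g))) =
      hD.toUbar hB hq (f ∘ₗ B.rmul (θ (gen F q d g))) * borelIncl (gen F q d g))
    (fun f g hf hg => ?_) (fun c f hf => ?_) ?_ (fun f => step ?_) (fun f => step ?_)
    (fun f => step ?_) (fun f => step ?_) f
  · simp only [LinearMap.add_comp, map_add, mul_add, add_mul, hf, hg]
  · simp only [LinearMap.smul_comp, map_smul, mul_smul_comm, smul_mul_assoc, hf]
  · rw [hB.isTorusChar_counit.comp_lmul, hB.isTorusChar_counit.comp_rmul, map_smul, toUbar_counit]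
    simp
  · rw [hD.l1.comp_lmul, hD.l1.comp_rmul, map_smul, toUbar_l1, mul_smul_comm, smul_mul_assoc]
    congr 1
    rcases hg with rfl | rfl
    · simp only [borelIncl, lift_k1, hs.k1K1, hs.K1k1]
    · simp only [borelIncl, lift_k2, kK.2]
  · rw [hD.l2.comp_lmul, hD.l2.comp_rmul, map_smul, toUbar_l2, mul_smul_comm, smul_mul_assoc]
    congr 1
    rcases hg with rfl | rfl
    · simp only [borelIncl, lift_k1, kK.1]
    · simp only [borelIncl, lift_k2, hs.k2K2, hs.K2k2]
  · rw [hD.f1.comp_lmul, hD.f1.comp_rmul]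
    rcases hg with rfl | rfl
    · rw [hD.f1.k1, hD.l1.k1, hB.counit_k1]
      simp only [zero_smul, zero_add, add_zero, one_smul, map_smul, toUbar_f1, borelIncl, lift_k1,
        mul_smul_comm, c11, smul_smul]
      rw [zpow_neg, zpow_ofNat, mul_inv_cancel₀ (pow_ne_zero 2 q0), one_smul]
    · rw [hD.f1.k2, hD.l1.k2, hB.counit_k2]
      simp only [zero_smul, zero_add, add_zero, one_smul, map_smul, toUbar_f1, borelIncl, lift_k2,
        mul_smul_comm, c21, smul_smul]
      rw [inv_mul_cancel₀ q0, one_smul]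
  · rw [hD.f2.comp_lmul, hD.f2.comp_rmul]
    rcases hg with rfl | rfl
    · rw [hD.f2.k1, hD.l2.k1, hB.counit_k1]
      simp only [zero_smul, zero_add, add_zero, one_smul, map_smul, toUbar_f2, borelIncl, lift_k1,
        mul_smul_comm, c12, smul_smul]
      rw [inv_mul_cancel₀ q0, one_smul]
    · rw [hD.f2.k2, hD.l2.k2, hB.counit_k2]
      simp only [zero_smul, zero_add, add_zero, one_smul, map_smul, toUbar_f2, borelIncl, lift_k2,
        mul_smul_comm, c22, smul_smul]

include hj hjθ

/-- `Δᵒᵖ(x) R = R Δ(x)` for `x ∈ B` and `R = ∑ bᵢ ⊗ bⁱ`. -/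
theorem intertwine {ι : Type*} [Fintype ι] (b : Module.Basis ι F W) (x : W) :
    (B.tensor H).m (B.comulRop j x) (canonicalElt b (hD.toUbar hB hq)) =
      (B.tensor H).m (canonicalElt b (hD.toUbar hB hq)) (B.comulR j x) := by
  have hU := hH.isHopf.isSuperAlg
  have hφ := hD.toUbar_hom hB hq hH
  have hs := ubarSat (F := F) (q := q) (d := d)
  have q0 := hq.ne_zero
  have hc := hB.isTorusChar_counit
  have hT := hB.isHopf.isSuperAlg.tensor hU
  have skew (g k : BorelGen) (ε : ZMod 2) (hk : k = .k1 ∨ k = .k2)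
      (he : B.IsSkewPrimitive ε (θ (gen F q d k)) (θ (gen F q d g)))
      (h1 : ∀ f : Module.Dual F W, (f = B.counit ∨ f = l1 ∨ f = l2 ∨ f = f1 ∨ f = f2) →
        borelIncl (gen F q d g) * hD.toUbar hB hq (f ∘ₗ B.sgn ε) +
          borelIncl (gen F q d k) * hD.toUbar hB hq (f ∘ₗ B.lmul (θ (gen F q d g))) =
        hD.toUbar hB hq (f ∘ₗ B.rmul (θ (gen F q d g)) ∘ₗ B.sgn ε) +
          hD.toUbar hB hq (f ∘ₗ B.rmul (θ (gen F q d k))) * borelIncl (gen F q d g)) :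
      (B.tensor H).m (B.comulRop j (θ (gen F q d g))) (canonicalElt b (hD.toUbar hB hq)) =
      (B.tensor H).m (canonicalElt b (hD.toUbar hB hq)) (B.comulR j (θ (gen F q d g))) := by
    refine he.intertwine b hB.isHopf hU hj hφ fun f => ?_
    have step {a : Module.Dual F W} (ha : a = B.counit ∨ a = l1 ∨ a = l2 ∨ a = f1 ∨ a = f2)
        {f : Module.Dual F W}
        (hf : H.m (j (θ (gen F q d g))) (hD.toUbar hB hq (f ∘ₗ B.sgn ε)) +
          H.m (j (θ (gen F q d k))) (hD.toUbar hB hq (f ∘ₗ B.lmul (θ (gen F q d g)))) =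
        hD.toUbar hB hq (f ∘ₗ B.rmul (θ (gen F q d g)) ∘ₗ B.sgn ε) +
          H.m (hD.toUbar hB hq (f ∘ₗ B.rmul (θ (gen F q d k)))) (j (θ (gen F q d g)))) :=
      he.slice_rel_m hB.isHopf hU hφ (f := a) (k' := j (θ (gen F q d k)))
        (by rw [hH.m_eq, hH.m_eq, hjθ]; exact hD.slice_grouplike hB hq k hk a)
        (by simp only [hH.m_eq, hjθ]; exact h1 a ha) hf
    refine hD.induction hB hq (P := fun f =>
      H.m (j (θ (gen F q d g))) (hD.toUbar hB hq (f ∘ₗ B.sgn ε)) +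
          H.m (j (θ (gen F q d k))) (hD.toUbar hB hq (f ∘ₗ B.lmul (θ (gen F q d g)))) =
        hD.toUbar hB hq (f ∘ₗ B.rmul (θ (gen F q d g)) ∘ₗ B.sgn ε) +
          H.m (hD.toUbar hB hq (f ∘ₗ B.rmul (θ (gen F q d k)))) (j (θ (gen F q d g))))
      (fun f g hf hg => ?_) (fun c f hf => ?_) ?_ (fun f => step ?_) (fun f => step ?_)
      (fun f => step ?_) (fun f => step ?_) f
    · simp only [LinearMap.add_comp, map_add, m_add, add_m]
      rw [add_add_add_comm, hf, hg, add_add_add_comm]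
    · simp only [LinearMap.smul_comp, map_smul, m_smul, smul_m, ← smul_add, hf]
    · simp only [hH.m_eq, hjθ]; exact h1 _ (by simp)
    all_goals simp
  have torus {s1 s2 : F} {f : Module.Dual F W} {K : Ubar F q d} (hf : IsTorusChar B θ s1 s2 f)
      (hK : hD.toUbar hB hq f = K) (g k : BorelGen) (ε : ZMod 2) (h0 : f (θ (gen F q d g)) = 0)
      (h : borelIncl (gen F q d g) * K = f (θ (gen F q d k)) • (K * borelIncl (gen F q d g))) :
      borelIncl (gen F q d g) * hD.toUbar hB hq (f ∘ₗ B.sgn ε) +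
          borelIncl (gen F q d k) * hD.toUbar hB hq (f ∘ₗ B.lmul (θ (gen F q d g))) =
        hD.toUbar hB hq (f ∘ₗ B.rmul (θ (gen F q d g)) ∘ₗ B.sgn ε) +
          hD.toUbar hB hq (f ∘ₗ B.rmul (θ (gen F q d k))) * borelIncl (gen F q d g) := by
    rw [hf.comp_sgn hB, hf.comp_lmul, ← LinearMap.comp_assoc _ _ f, hf.comp_rmul, hf.comp_rmul, h0,
      map_smul, hK, h]
    simp [hK]
  have hi := hs.pos_inv q0
  have z2 : (q⁻¹ : F) ^ (-2 : ℤ) = q ^ 2 := by rw [zpow_neg, inv_zpow, inv_inv, zpow_ofNat]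
  have gens (g : BorelGen) :
      (B.tensor H).m (B.comulRop j (θ (gen F q d g))) (canonicalElt b (hD.toUbar hB hq)) =
      (B.tensor H).m (canonicalElt b (hD.toUbar hB hq)) (B.comulR j (θ (gen F q d g))) := by
    cases g
    · exact hB.k1.intertwine b hB.isHopf hU hj hφ fun f => by
        rw [hH.m_eq, hH.m_eq, hjθ]; exact hD.slice_grouplike hB hq _ (by simp) f
    · exact hB.k2.intertwine b hB.isHopf hU hj hφ fun f => by
        rw [hH.m_eq, hH.m_eq, hjθ]; exact hD.slice_grouplike hB hq _ (by simp) f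
    · refine skew .e1 .k1 0 (by simp) hB.e1 fun f hf => ?_
      rcases hf with rfl | rfl | rfl | rfl | rfl
      · exact torus hc (hD.toUbar_counit hB hq) _ _ _ hc.e1 (by simp [hc.k1])
      · exact torus hD.l1 (hD.toUbar_l1 hB hq) _ _ _ hD.l1.e1
          (by simp only [borelIncl, lift_e1, hD.l1.k1, hi.e1k1, z2])
      · exact torus hD.l2 (hD.toUbar_l2 hB hq) _ _ _ hD.l2.e1
          (by simp only [borelIncl, lift_e1, hD.l2.k1, hi.e1k2])
      · rw [sgn_zero hB.isHopf.grading, LinearMap.comp_id, LinearMap.comp_id, hD.f1.comp_lmul,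
          hD.f1.comp_rmul, hD.f1.comp_rmul, hD.f1.e1, hD.f1.k1, hD.l1.e1, hB.counit_k1,
          hB.counit_e1]
        simp only [zero_smul, zero_add, add_zero, one_smul, map_smul, hD.toUbar_f1,
          hD.toUbar_l1, hD.toUbar_counit, borelIncl, lift_e1, lift_k1, hs.e1f1, smul_sub, neg_smul,
          mul_neg, mul_smul_comm, mul_one]
        abel
      · rw [sgn_zero hB.isHopf.grading, LinearMap.comp_id, LinearMap.comp_id, hD.f2.comp_lmul,
          hD.f2.comp_rmul, hD.f2.comp_rmul, hD.f2.e1, hD.f2.k1, hD.l2.e1, hB.counit_k1,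
          hB.counit_e1]
        simp only [zero_smul, zero_add, add_zero, one_smul, map_zero, hD.toUbar_f2, borelIncl,
          lift_e1, lift_k1, hs.e1f2, mul_zero]
    · refine skew .e2 .k2 1 (by simp) hB.e2 fun f hf => ?_
      rcases hf with rfl | rfl | rfl | rfl | rfl
      · exact torus hc (hD.toUbar_counit hB hq) _ _ _ hc.e2 (by simp [hc.k2])
      · exact torus hD.l1 (hD.toUbar_l1 hB hq) _ _ _ hD.l1.e2
          (by simp only [borelIncl, lift_e2, hD.l1.k2, hi.e2k1])
      · exact torus hD.l2 (hD.toUbar_l2 hB hq) _ _ _ hD.l2.e2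
          (by simp only [borelIncl, lift_e2, hD.l2.k2, hi.e2k2, one_smul])
      · rw [hD.f1.comp_sgn hB hD.l1 (i := 0) (by simp) (by simp), hD.f1.comp_lmul,
          ← LinearMap.comp_assoc _ _ f, hD.f1.comp_rmul, hD.f1.comp_rmul, hD.f1.e2, hD.f1.k2,
          hD.l1.e2, hB.counit_k2, hB.counit_e2]
        simp only [zero_smul, zero_add, add_zero, one_smul, map_zero, hD.toUbar_f1, borelIncl,
          lift_e2, lift_k2, hs.e2f1, mul_zero, koszulSign_zero, LinearMap.zero_comp]
      · rw [hD.f2.comp_sgn hB hD.l2 (i := 1) (by simp) (by simp), hD.f2.comp_lmul,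
          ← LinearMap.comp_assoc _ _ f, hD.f2.comp_rmul, hD.f2.comp_rmul, hD.f2.e2, hD.f2.k2,
          hD.l2.e2, hB.counit_k2, hB.counit_e2]
        simp only [zero_smul, zero_add, add_zero, one_smul, map_smul, hD.toUbar_f2,
          hD.toUbar_l2, hD.toUbar_counit, borelIncl, lift_e2, lift_k2, hs.e2f2, smul_sub, mul_one,
          mul_smul_comm, koszulSign_one, LinearMap.smul_comp, hD.l2.comp_sgn hB]
        rw [neg_one_smul]
        abel
  refine hB.induction (P := fun x =>
    (B.tensor H).m (B.comulRop j x) (canonicalElt b (hD.toUbar hB hq)) =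
      (B.tensor H).m (canonicalElt b (hD.toUbar hB hq)) (B.comulR j x))
    (fun x y hx hy => ?_) (fun c x hx => ?_) ?_ (fun g x hx => ?_) x
  · rw [map_add, map_add, add_m, m_add, hx, hy]
  · rw [map_smul, map_smul, smul_m, m_smul, hx]
  · rw [(comulR_hom hB.isHopf hU hj).map_one, (comulRop_hom hB.isHopf hU hj).map_one, hT.one_mul,
      hT.mul_one]
  · exact intertwine_m hB.isHopf hU hj (gens g) hx

end Slice

end IsBorelDual

end SuperHopfData

namespace SuperHopfData

section Flip

variable {F : Type*} [Field F] {V V' W : Type*} [AddCommGroup V] [Module F V] [AddCommGroup V']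
  [Module F V'] [AddCommGroup W] [Module F W]

theorem IsGrading.tensor3_ext {Z Y : Type*} [AddCommGroup Z] [Module F Z] [AddCommGroup Y]
    [Module F Y] {p : ZMod 2 → V →ₗ[F] V} {r : ZMod 2 → V' →ₗ[F] V'} {s : ZMod 2 → Z →ₗ[F] Z}
    (hp : IsGrading p) (hr : IsGrading r) (hs : IsGrading s) {f g : (V ⊗[F] V') ⊗[F] Z →ₗ[F] Y}
    (h : ∀ i j k x y z, p i x = x → r j y = y → s k z = z →
      f ((x ⊗ₜ y) ⊗ₜ z) = g ((x ⊗ₜ y) ⊗ₜ z)) : f = g := by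
  refine TensorProduct.ext (hp.tensor_ext hr fun i j x y hx hy => LinearMap.ext fun z => ?_)
  exact hs.induction (P := fun z => f ((x ⊗ₜ y) ⊗ₜ z) = g ((x ⊗ₜ y) ⊗ₜ z))
    (fun a b ha hb => by rw [TensorProduct.tmul_add, map_add, map_add, ha, hb])
    (fun k z hz => h i j k x y z hx hy hz) z

theorem superFlip_map {W' : Type*} [AddCommGroup W'] [Module F W'] {p : ZMod 2 → V →ₗ[F] V}
    {p' : ZMod 2 → V' →ₗ[F] V'} {r : ZMod 2 → W →ₗ[F] W} {r' : ZMod 2 → W' →ₗ[F] W'}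
    (hp : IsGrading p) (hp' : IsGrading p') (hr : IsGrading r) (hr' : IsGrading r') {f : V →ₗ[F] V'}
    {g : W →ₗ[F] W'} (hf : IsEvenMap p p' f) (hg : IsEvenMap r r' g) (t : V ⊗[F] W) :
    superFlip p' r' (TensorProduct.map f g t) = TensorProduct.map g f (superFlip p r t) := by
  refine LinearMap.congr_fun (f := superFlip p' r' ∘ₗ TensorProduct.map f g)
    (g := TensorProduct.map g f ∘ₗ superFlip p r) (hp.tensor_ext hr fun i k v w hv hw => ?_) t
  simp only [LinearMap.comp_apply, TensorProduct.map_tmul,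
    superFlip_tmul hp hr hv hw, superFlip_tmul hp' hr' (hf.hom hv) (hg.hom hw), map_smul]

theorem superFlip_map_left {p : ZMod 2 → V →ₗ[F] V} {p' : ZMod 2 → V' →ₗ[F] V'}
    {r : ZMod 2 → W →ₗ[F] W} (hp : IsGrading p) (hp' : IsGrading p') (hr : IsGrading r)
    {f : V →ₗ[F] V'} (hf : IsEvenMap p p' f) (t : V ⊗[F] W) :
    superFlip p' r (TensorProduct.map f LinearMap.id t) =
      TensorProduct.map LinearMap.id f (superFlip p r t) :=
  superFlip_map hp hp' hr hr hf (fun _ => rfl) t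

variable {H : SuperHopfData F V} {B : SuperHopfData F W}

theorem superFlip_one_left (hH : H.IsSuperAlg) (hB : B.IsSuperAlg) (x : W) :
    superFlip H.part B.part (H.one ⊗ₜ x) = x ⊗ₜ H.one := by
  refine hB.grading.induction (P := fun x => superFlip H.part B.part (H.one ⊗ₜ x) = x ⊗ₜ H.one)
    (fun a b ha hb => by rw [TensorProduct.tmul_add, map_add, ha, hb, TensorProduct.add_tmul])
    (fun i x hx => ?_) x
  rw [superFlip_tmul hH.grading hB.grading hH.one_even hx, zero_mul, koszulSign_zero, one_smul]

theorem superFlip_one_right (hH : H.IsSuperAlg) (hB : B.IsSuperAlg) (x : V) :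
    superFlip H.part B.part (x ⊗ₜ B.one) = B.one ⊗ₜ x := by
  refine hH.grading.induction (P := fun x => superFlip H.part B.part (x ⊗ₜ B.one) = B.one ⊗ₜ x)
    (fun a b ha hb => by rw [TensorProduct.add_tmul, map_add, ha, hb, TensorProduct.tmul_add])
    (fun i x hx => ?_) x
  rw [superFlip_tmul hH.grading hB.grading hx hB.one_even, mul_zero, koszulSign_zero, one_smul]

/-- `S(xy) = (-1)^{|x||y|} S(y) S(x)`. -/
def AntipodeMul (H : SuperHopfData F V) : Prop := ∀ i k x y, H.part i x = x → H.part k y = y →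
  H.antipode (H.m x y) = koszulSign F (i * k) • H.m (H.antipode y) (H.antipode x)

theorem IsHopf.antipodeInv_hom (hH : H.IsHopf) {i : ZMod 2} {x : V} (hx : H.part i x = x) :
    H.part i (H.antipodeInv x) = H.antipodeInv x := by
  rw [← hH.antipodeInv_antipode (H.part i _), hH.antipode_even.apply, hH.antipode_antipodeInv, hx]

theorem IsHopf.antipode_one (hH : H.IsHopf) : H.antipode H.one = H.one := by
  have := hH.antipode_left H.one
  rw [hH.comul_one, TensorProduct.map_tmul, hH.counit_one, one_smul] at this
  exact (hH.mul_one _).symm.trans this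

/-- `∑ (-1)^{|x'||x''|} S⁻¹(x'') x' = ε(x)`. -/
theorem IsHopf.antipodeInv_comul (hH : H.IsHopf) (hS : H.AntipodeMul) (x : V) :
    H.mul (TensorProduct.map H.antipodeInv LinearMap.id (superFlip H.part H.part (H.comul x))) =
      H.counit x • H.one := by
  have hp := hH.grading
  have inj : Function.Injective H.antipode := Function.LeftInverse.injective hH.antipodeInv_antipode
  apply inj
  rw [map_smul, hH.antipode_one, ← hH.antipode_left]
  refine LinearMap.congr_fun (f := H.antipode ∘ₗ H.mul ∘ₗ
    TensorProduct.map H.antipodeInv LinearMap.id ∘ₗ superFlip H.part H.part)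
    (g := H.mul ∘ₗ TensorProduct.map H.antipode LinearMap.id)
    (hp.tensor_ext hp fun i k v w hv hw => ?_) (H.comul x)
  simp only [LinearMap.comp_apply, TensorProduct.map_tmul, LinearMap.id_apply,
    superFlip_tmul hp hp hv hw, map_smul]
  change _ • H.antipode (H.m _ _) = H.m _ _
  rw [hS k i _ _ (hH.antipodeInv_hom hw) hv, hH.antipode_antipodeInv, smul_smul, mul_comm k,
    koszulSign_mul_self, one_smul]

end Flip

variable {F : Type*} [Field F] {V W : Type*} [AddCommGroup V] [Module F V] [AddCommGroup W]
  [Module F W] [FiniteDimensional F W] {H : SuperHopfData F V} {B : SuperHopfData F W}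

/-- The canonical element, formed with some basis of `B`. -/
abbrev canonicalR (χ₀ : Module.Dual F W →ₗ[F] V) : W ⊗[F] V :=
  canonicalElt (Module.finBasis F W) χ₀

/-- Morphisms `j : B → H` and `χ₀ : (Bᵒᵖ)* → H` which together define a morphism `D(B) → H`. -/
structure IsDoublePair (H : SuperHopfData F V) (B : SuperHopfData F W) (j : W →ₗ[F] V)
    (χ₀ : Module.Dual F W →ₗ[F] V) : Prop where
  isHopf : H.IsHopf
  sub_isHopf : B.IsHopf
  antipodeMul : H.AntipodeMul
  isHopfHom : B.IsHopfHom H j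
  injective : Function.Injective j
  dual_hom : IsSuperAlgHom B.dualOp H χ₀
  dual_comul : ∀ f, H.comul (χ₀ f) = TensorProduct.map χ₀ χ₀ (B.dualOp.comul f)
  dual_counit : ∀ f, H.counit (χ₀ f) = f B.one
  intertwine : ∀ x, (B.tensor H).m (B.comulRop j x) (canonicalR χ₀) =
    (B.tensor H).m (canonicalR χ₀) (B.comulR j x)

/-- The cross relation of the double as a function of an iterated coproduct. -/
def crossMap (B : SuperHopfData F W) (g : Module.Dual F W) :
    (W ⊗[F] W) ⊗[F] W →ₗ[F] Module.Dual F W ⊗[F] W :=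
  ∑ i₁ : ZMod 2, ∑ i₂ : ZMod 2, ∑ i₃ : ZMod 2, ∑ m : ZMod 2, ∑ l : ZMod 2,
    koszulSign F (m * (i₁ + i₂ + i₃) + i₃ * (i₁ + i₂) + l * i₁) •
      (TensorProduct.map
          (TensorProduct.lift (Module.Dual.transpose ∘ₗ B.sandwich l)) LinearMap.id ∘ₗ
        (TensorProduct.rightComm F (W ⊗[F] W) W (Module.Dual F W)).toLinearMap ∘ₗ
        (TensorProduct.mk F ((W ⊗[F] W) ⊗[F] W) (Module.Dual F W)).flip ((B.part m).dualMap g) ∘ₗ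
        (TensorProduct.rightComm F W W W).toLinearMap ∘ₗ
        TensorProduct.map (TensorProduct.map (B.part i₁) (B.part i₂)) (B.part i₃))

omit [FiniteDimensional F W] in
theorem doubleCross_tmul (a : W) (g : Module.Dual F W) : B.doubleCross (a ⊗ₜ g) =
    B.crossMap g (TensorProduct.map B.comul LinearMap.id (B.comul a)) := by
  simp only [crossMap, doubleCross, LinearMap.comp_apply, LinearMap.sum_apply,
    LinearMap.smul_apply, TensorProduct.map_tmul]
  rfl

theorem crossMap_tmul (hp : IsGrading B.part) {g : Module.Dual F W} {k a b c : ZMod 2} {x y w : W}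
    (hg : B.dualOp.part k g = g) (hx : B.part a x = x) (hy : B.part b y = y)
    (hw : B.part c w = w) : B.crossMap g ((x ⊗ₜ y) ⊗ₜ w) =
      koszulSign F (k * (a + b + c) + c * (a + b)) •
        ((g ∘ₗ B.lmul (B.antipodeInv w) ∘ₗ B.rmul x ∘ₗ B.sgn a) ⊗ₜ y) := by
  have hgm (m : ZMod 2) : (B.part m).dualMap g = if m = k then g else 0 :=
    (dualOp_grading hp).apply_of_hom hg m
  have hK (l : ZMod 2) (x y w : W) (g : Module.Dual F W) : TensorProduct.map
      (TensorProduct.lift (Module.Dual.transpose ∘ₗ B.sandwich l)) LinearMap.id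
        ((TensorProduct.rightComm F (W ⊗[F] W) W (Module.Dual F W)).toLinearMap
        ((TensorProduct.mk F ((W ⊗[F] W) ⊗[F] W) (Module.Dual F W)).flip g
        ((TensorProduct.rightComm F W W W).toLinearMap ((x ⊗ₜ y) ⊗ₜ w)))) =
      (g ∘ₗ B.lmul (B.antipodeInv w) ∘ₗ B.rmul x ∘ₗ B.part l) ⊗ₜ y := rfl
  have l0 : B.lmul 0 = 0 := map_zero (TensorProduct.curry B.mul)
  have r0 : B.rmul 0 = 0 := map_zero (TensorProduct.curry B.mul).flip
  simp only [crossMap, LinearMap.comp_apply, LinearMap.sum_apply, LinearMap.smul_apply,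
    TensorProduct.map_tmul, hp.apply_of_hom hx, hp.apply_of_hom hy, hp.apply_of_hom hw, hgm, hK]
  rw [Finset.sum_eq_single a (fun i _ hi => ?_) (by simp),
    Finset.sum_eq_single b (fun i _ hi => ?_) (by simp),
    Finset.sum_eq_single c (fun i _ hi => ?_) (by simp),
    Finset.sum_eq_single k (fun i _ hi => ?_) (by simp)]
  · simp only [if_true, koszulSign_add, sgn, sum_zmod_two, LinearMap.comp_add, LinearMap.comp_smul,
      TensorProduct.add_tmul, smul_add, ← TensorProduct.smul_tmul', smul_smul, mul_comm a]
  · refine Finset.sum_eq_zero fun _ _ => ?_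
    rw [if_neg hi, LinearMap.zero_comp, TensorProduct.zero_tmul, smul_zero]
  · simp only [if_neg hi, map_zero, l0, LinearMap.zero_comp, LinearMap.comp_zero,
      TensorProduct.zero_tmul, smul_zero, Finset.sum_const_zero]
  · simp only [if_neg hi, TensorProduct.tmul_zero, smul_zero, Finset.sum_const_zero]
  · simp only [if_neg hi, r0, LinearMap.zero_comp, LinearMap.comp_zero,
      TensorProduct.zero_tmul, smul_zero, Finset.sum_const_zero]

/-- The linear map `f ⊗ a ↦ χ₀(f) j(a)`. -/
def doubleMap (H : SuperHopfData F V) (j : W →ₗ[F] V) (χ₀ : Module.Dual F W →ₗ[F] V) :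
    Module.Dual F W ⊗[F] W →ₗ[F] V := H.mul ∘ₗ TensorProduct.map χ₀ j

omit [FiniteDimensional F W] in
theorem doubleMap_tmul (j : W →ₗ[F] V) (χ₀ : Module.Dual F W →ₗ[F] V) (f : Module.Dual F W) (a : W) :
    H.doubleMap j χ₀ (f ⊗ₜ a) = H.m (χ₀ f) (j a) := rfl

namespace IsDoublePair

variable {j : W →ₗ[F] V} {χ₀ : Module.Dual F W →ₗ[F] V} (hP : IsDoublePair H B j χ₀)

include hP

theorem sub_antipodeMul : B.AntipodeMul := fun i k x y hx hy => by
  apply hP.injective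
  have hj := hP.isHopfHom
  rw [← hj.map_antipode, hj.map_mul, hP.antipodeMul i k _ _ (hj.even.hom hx) (hj.even.hom hy),
    map_smul, hj.map_mul, hj.map_antipode, hj.map_antipode]

/-- `∑ (-1)^{|a'''|(|a'|+|a''|)} (S⁻¹(a''') ⊗ 1) R (a' ⊗ a'') = (1 ⊗ a) R`. -/
theorem cross_canonicalR (a : W) :
    ((B.tensor H).mul ∘ₗ TensorProduct.map ((TensorProduct.mk F W V).flip H.one ∘ₗ B.antipodeInv)
      ((B.tensor H).lmul (canonicalR χ₀) ∘ₗ TensorProduct.map LinearMap.id j))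
      (superFlip (tensorPart B.part B.part) B.part
        (TensorProduct.map B.comul LinearMap.id (B.comul a))) =
      (B.tensor H).m (B.one ⊗ₜ j a) (canonicalR χ₀) := by
  have hB := hP.sub_isHopf
  have hp := hB.grading
  have hU := hP.isHopf.isSuperAlg
  have hT := hB.isSuperAlg.tensor hU
  set R := canonicalR χ₀
  set ζ : W →ₗ[F] W ⊗[F] V := (TensorProduct.mk F W V).flip H.one ∘ₗ B.antipodeInv
  have hζ (c : W) : ζ c = B.antipodeInv c ⊗ₜ H.one := rfl
  set G : W ⊗[F] (W ⊗[F] W) →ₗ[F] W ⊗[F] V := (B.tensor H).mul ∘ₗ TensorProduct.map ζ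
    (TensorProduct.map LinearMap.id j ∘ₗ superFlip B.part B.part)
  set E : W ⊗[F] W →ₗ[F] W := B.mul ∘ₗ TensorProduct.map B.antipodeInv LinearMap.id ∘ₗ
    superFlip B.part B.part
  have e1 : ((B.tensor H).mul ∘ₗ TensorProduct.map ζ
      ((B.tensor H).lmul R ∘ₗ TensorProduct.map LinearMap.id j)) ∘ₗ
      TensorProduct.map LinearMap.id B.comul =
      (B.tensor H).rmul R ∘ₗ G ∘ₗ TensorProduct.map LinearMap.id B.comul := by
    refine TensorProduct.ext' fun c x => ?_
    have h := hP.intertwine x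
    simp only [comulR, comulRop, LinearMap.comp_apply] at h
    simp only [LinearMap.comp_apply, TensorProduct.map_tmul, LinearMap.id_apply, G, lmul_apply,
      rmul_apply]
    change (B.tensor H).m (ζ c) _ = (B.tensor H).m ((B.tensor H).m (ζ c) _) R
    rw [← h, hT.mul_assoc]
  have e2 : G ∘ₗ superFlip (tensorPart B.part B.part) B.part =
      TensorProduct.map LinearMap.id j ∘ₗ superFlip B.part B.part ∘ₗ
        TensorProduct.map LinearMap.id E ∘ₗ (TensorProduct.assoc F W W W).toLinearMap := by
    refine IsGrading.tensor3_ext hp hp hp fun i k l x y w hx hy hw => ?_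
    have hw' := hB.antipodeInv_hom hw
    have hE : E (y ⊗ₜ w) = koszulSign F (k * l) • B.m (B.antipodeInv w) y := by
      simp only [E, LinearMap.comp_apply, superFlip_tmul hp hp hy hw, map_smul,
        TensorProduct.map_tmul, LinearMap.id_apply]
      rfl
    simp only [LinearMap.comp_apply, superFlip_tmul (hp.tensor hp) hp (tensor_hom hp hp hx hy) hw, map_smul, G,
      TensorProduct.map_tmul, superFlip_tmul hp hp hx hy, LinearEquiv.coe_coe,
      TensorProduct.assoc_tmul, LinearMap.id_apply, hE, TensorProduct.tmul_smul,
      superFlip_tmul hp hp hx (hB.isSuperAlg.hom_m hw' hy), hζ]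
    change _ • _ • (B.tensor H).m _ _ = _
    rw [IsSuperAlg.tensor_m_even_left hp hU.grading _ _ _ hU.one_even, hU.one_mul, smul_smul,
      smul_smul, ← koszulSign_add, ← koszulSign_add]
    congr 2
    ring
  have e3 : E ∘ₗ B.comul = B.counit.smulRight B.one :=
    LinearMap.ext fun x => hB.antipodeInv_comul hP.sub_antipodeMul x
  have c := LinearMap.congr_fun hB.coassoc a
  simp only [LinearMap.comp_apply, LinearEquiv.coe_coe] at c
  have e4 : TensorProduct.map LinearMap.id (B.counit.smulRight B.one) (B.comul a) = a ⊗ₜ B.one := by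
    have := LinearMap.congr_fun hB.counit_right a
    rw [LinearMap.comp_apply, LinearMap.comp_apply, LinearMap.id_apply] at this
    conv_rhs => rw [← this]
    generalize B.comul a = t
    induction t with
    | zero => simp
    | add x y hx hy => simp only [map_add, hx, hy, TensorProduct.add_tmul]
    | tmul x y => simp [TensorProduct.smul_tmul']
  rw [superFlip_map_left hp (hp.tensor hp) hp hB.comul_even]
  refine (LinearMap.congr_fun e1 _).trans ?_
  rw [LinearMap.comp_apply, LinearMap.comp_apply, rmul_apply,
    ← superFlip_map_left hp (hp.tensor hp) hp hB.comul_even]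
  congr 1
  refine (LinearMap.congr_fun e2 _).trans ?_
  rw [LinearMap.comp_apply, LinearMap.comp_apply, LinearMap.comp_apply, LinearEquiv.coe_coe, c,
    ← LinearMap.comp_apply (TensorProduct.map LinearMap.id E), ← TensorProduct.map_comp, e3,
    LinearMap.id_comp, e4, superFlip_one_right hB.isSuperAlg hB.isSuperAlg, TensorProduct.map_tmul,
    LinearMap.id_apply]

/-- The defining relation of the double holds in `H`. -/
theorem doubleMap_doubleCross (a : W) (g : Module.Dual F W) :
    H.doubleMap j χ₀ (B.doubleCross (a ⊗ₜ g)) = H.m (j a) (χ₀ g) := by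
  have hB := hP.sub_isHopf
  have hp := hB.grading
  have hU := hP.isHopf.isSuperAlg
  have hX := hB.dualOp_isSuperAlg
  set R := canonicalR χ₀ with hR
  have hRe : (B.tensor H).part 0 R = R := canonicalElt_even _ hp hP.dual_hom.even
  refine hX.grading.induction (P := fun g => H.doubleMap j χ₀ (B.doubleCross (a ⊗ₜ g)) =
    H.m (j a) (χ₀ g)) (fun g g' h h' => by
      rw [TensorProduct.tmul_add, map_add, map_add, h, h', map_add, m_add]) (fun k g hg => ?_) g
  refine hp.induction (P := fun a => H.doubleMap j χ₀ (B.doubleCross (a ⊗ₜ g)) =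
    H.m (j a) (χ₀ g)) (fun a a' h h' => by
      rw [TensorProduct.add_tmul, map_add, map_add, h, h', map_add, add_m]) (fun i a ha => ?_) a
  have cross := hP.cross_canonicalR a
  rw [← hR] at cross
  obtain ⟨P, hPdef⟩ : ∃ P, P = (B.tensor H).mul ∘ₗ TensorProduct.map
    ((TensorProduct.mk F W V).flip H.one ∘ₗ B.antipodeInv)
    ((B.tensor H).lmul R ∘ₗ TensorProduct.map LinearMap.id j) := ⟨_, rfl⟩
  rw [← hPdef] at cross
  have e2 : H.doubleMap j χ₀ ∘ₗ B.crossMap g = slice g ∘ₗ P ∘ₗ superFlip (tensorPart B.part B.part) B.part ∘ₗ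
      ((B.tensor B).tensor B).sgn k := by
    refine IsGrading.tensor3_ext hp hp hp fun a b c x y w hx hy hw => ?_
    have hPa : P (w ⊗ₜ (x ⊗ₜ y)) = (B.tensor H).m (B.antipodeInv w ⊗ₜ H.one)
      ((B.tensor H).m R (x ⊗ₜ j y)) := by rw [hPdef]; rfl
    have hsg : ((B.tensor B).tensor B).sgn k ((x ⊗ₜ y) ⊗ₜ w) = _ :=
      sgn_of_hom ((hp.tensor hp).tensor hp) k (tensor_hom (hp.tensor hp) hp
        (tensor_hom hp hp hx hy) hw)
    rw [LinearMap.comp_apply, LinearMap.comp_apply, LinearMap.comp_apply, LinearMap.comp_apply, hsg, map_smul, map_smul, map_smul,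
      superFlip_tmul (hp.tensor hp) hp (tensor_hom hp hp hx hy) hw, map_smul, map_smul, hPa,
      slice_m_left hB.isSuperAlg hU g _ hU.one_even, hU.one_mul, sgn_zero hp, LinearMap.comp_id,
      slice_m_right hB.isSuperAlg hU _ _ hx hRe, slice_canonicalElt]
    rw [crossMap_tmul hp hg hx hy hw, map_smul, doubleMap_tmul, smul_smul,
      ← koszulSign_add, mul_comm c]
    rfl
  have ht : ((B.tensor B).tensor B).part i (TensorProduct.map B.comul LinearMap.id (B.comul a)) =
      TensorProduct.map B.comul LinearMap.id (B.comul a) :=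
    (hB.comul_hom.tensor hp hp (hp.tensor hp) hp .id).even.hom (hB.comul_even.hom ha)
  rw [doubleCross_tmul, ← LinearMap.comp_apply (H.doubleMap j χ₀), e2, LinearMap.comp_apply, LinearMap.comp_apply, LinearMap.comp_apply,
    sgn_of_hom ((hp.tensor hp).tensor hp) k ht, map_smul, map_smul, map_smul,
    cross, slice_m_left hB.isSuperAlg hU g B.one (hP.isHopfHom.even.hom ha),
    hB.lmul_one, LinearMap.id_comp, slice_canonicalElt]
  have hs : g ∘ₗ B.sgn i = koszulSign F (i * k) • g := by
    rw [← sgn_of_hom (dualOp_grading hp) i hg]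
    ext x
    simp [sgn, dualOp]
  rw [hs, map_smul, m_smul, smul_smul, mul_comm k, koszulSign_mul_self, one_smul]

end IsDoublePair

end SuperHopfData

namespace SuperHopfData

variable {F : Type*} [Field F] {V W : Type*} [AddCommGroup V] [Module F V] [AddCommGroup W]
  [Module F W] [FiniteDimensional F W] {H : SuperHopfData F V} {B : SuperHopfData F W}

theorem dualDistrib_dualOp_comul' (hp : IsGrading B.part) (f : Module.Dual F W) (t : W ⊗[F] W) :
    TensorProduct.dualDistrib F W W (B.dualOp.comul f) t =
      f (B.mul (TensorProduct.comm F W W t)) := by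
  induction t with
  | zero => simp
  | add x y hx hy => simp only [map_add, hx, hy]
  | tmul x y => exact dualDistrib_dualOp_comul hp f x y

theorem comp_lmul_eq (hp : IsGrading B.part) (f : Module.Dual F W) (x : W) : f ∘ₗ B.lmul x =
    TensorProduct.rid F _ (TensorProduct.map LinearMap.id (Module.Dual.eval F W x)
      (B.dualOp.comul f)) := by
  ext y
  have e : (f ∘ₗ B.lmul x) y = TensorProduct.dualDistrib F W W (B.dualOp.comul f) (y ⊗ₜ x) :=
    (dualDistrib_dualOp_comul hp f y x).symm
  rw [e]
  generalize B.dualOp.comul f = s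
  induction s with
  | zero => simp
  | add s t hs ht => simp only [map_add, hs, ht, LinearMap.add_apply]
  | tmul f g => simp [mul_comm]

theorem slice_canonicalElt_m (hB : B.IsHopf) (hH : H.IsSuperAlg) {ι : Type*} [Fintype ι]
    (b : Module.Basis ι F W) (φ : Module.Dual F W →ₗ[F] V) {ψ : Module.Dual F W →ₗ[F] V}
    (hψ : IsEvenMap B.dualOp.part H.part ψ) (f : Module.Dual F W) :
    slice f ((B.tensor H).m (canonicalElt b φ) (canonicalElt b ψ)) =
      H.mul (superFlip H.part H.part (TensorProduct.map ψ φ (B.dualOp.comul f))) := by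
  have hp := hB.grading
  have hX := dualOp_grading hp
  have key (x : W) (v : V) : slice f ((B.tensor H).m (x ⊗ₜ v) (canonicalElt b ψ)) =
      H.mul (superFlip H.part H.part (TensorProduct.map ψ ((Module.Dual.eval F W x).smulRight v)
        (B.dualOp.comul f))) := by
    refine hH.grading.induction (P := fun v => slice f ((B.tensor H).m (x ⊗ₜ v)
      (canonicalElt b ψ)) = H.mul (superFlip H.part H.part (TensorProduct.map ψ
        ((Module.Dual.eval F W x).smulRight v) (B.dualOp.comul f)))) (fun v w hv hw => ?_)
      (fun i v hv => ?_) v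
    · have : (Module.Dual.eval F W x).smulRight (v + w) = (Module.Dual.eval F W x).smulRight v +
        (Module.Dual.eval F W x).smulRight w := by ext; simp
      rw [TensorProduct.tmul_add, add_m, map_add, hv, hw, this, TensorProduct.map_add_right,
        LinearMap.add_apply, map_add, map_add]
    · rw [slice_m_left hB.isSuperAlg hH f x hv, slice_canonicalElt, ← LinearMap.comp_assoc,
        comp_lmul_eq hp]
      generalize B.dualOp.comul f = s
      have hs (g : Module.Dual F W) : g ∘ₗ B.sgn i = B.dualOp.sgn i g := by
        ext x
        simp [sgn, dualOp]
      rw [hs]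
      refine hX.tensor_induction hX (P := fun s => H.m v (ψ (B.dualOp.sgn i
        (TensorProduct.rid F _ (TensorProduct.map LinearMap.id (Module.Dual.eval F W x) s)))) =
        H.mul (superFlip H.part H.part (TensorProduct.map ψ
          ((Module.Dual.eval F W x).smulRight v) s))) (fun s t hs ht => ?_)
        (fun k l g h hg hh => ?_) s
      · simp only [map_add, m_add, hs, ht]
      · simp only [TensorProduct.map_tmul, TensorProduct.rid_tmul, LinearMap.id_apply, map_smul,
          sgn_of_hom hX i hg, LinearMap.smulRight_apply, TensorProduct.tmul_smul, m_smul,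
          superFlip_tmul hH.grading hH.grading (hψ.hom hg) hv, mul_comm k]
        rfl
  have e : ∑ i, (Module.Dual.eval F W (b i)).smulRight (φ (b.coord i)) = φ := by
    refine LinearMap.ext fun h => ?_
    simp only [LinearMap.sum_apply, LinearMap.smulRight_apply, Module.Dual.eval_apply,
      ← map_smul, ← map_sum]
    exact congrArg φ (b.sum_dual_apply_smul_coord h)
  conv_lhs => rw [canonicalElt, m, TensorProduct.sum_tmul, map_sum, map_sum]
  refine (Finset.sum_congr rfl fun i _ => key (b i) (φ (b.coord i))).trans ?_
  conv_rhs => rw [← e, ← TensorProduct.mapBilinear_apply (R := F), map_sum, LinearMap.sum_apply,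
    map_sum, map_sum]
  rfl

theorem IsHopf.dualOp_antipodeInv_comul (hB : B.IsHopf) (f : Module.Dual F W) :
    B.dualOp.mul (superFlip B.dualOp.part B.dualOp.part (TensorProduct.map B.dualOp.antipodeInv
      LinearMap.id (B.dualOp.comul f))) = f B.one • B.counit := by
  have hp := hB.grading
  have hX := dualOp_grading hp
  have key (s : Module.Dual F W ⊗[F] Module.Dual F W) (t : W ⊗[F] W) :
      TensorProduct.dualDistrib F W W (superFlip B.dualOp.part B.dualOp.part
        (TensorProduct.map B.dualOp.antipodeInv LinearMap.id s)) (superSign B.part B.part t) =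
      TensorProduct.dualDistrib F W W s
        (TensorProduct.map B.antipode LinearMap.id (TensorProduct.comm F W W t)) := by
    refine hX.tensor_induction hX (P := fun s => TensorProduct.dualDistrib F W W
      (superFlip B.dualOp.part B.dualOp.part (TensorProduct.map B.dualOp.antipodeInv LinearMap.id s))
      (superSign B.part B.part t) = TensorProduct.dualDistrib F W W s
        (TensorProduct.map B.antipode LinearMap.id (TensorProduct.comm F W W t)))
      (fun s t hs ht => by simp only [map_add, LinearMap.add_apply, hs, ht])
      (fun a b g h hg hh => ?_) s
    refine LinearMap.congr_fun (f := TensorProduct.dualDistrib F W W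
      (superFlip B.dualOp.part B.dualOp.part (TensorProduct.map B.dualOp.antipodeInv LinearMap.id
        (g ⊗ₜ h))) ∘ₗ superSign B.part B.part) (g := TensorProduct.dualDistrib F W W (g ⊗ₜ h) ∘ₗ
        TensorProduct.map B.antipode LinearMap.id ∘ₗ (TensorProduct.comm F W W).toLinearMap)
      (hp.tensor_ext hp fun c e y z hy hz => ?_) t
    have hg' : B.dualOp.part a (B.dualOp.antipodeInv g) = B.dualOp.antipodeInv g :=
      dualOp_hom_iff.mpr fun x => (congrArg g (hB.antipode_even.apply a x)).trans
        (dualOp_hom_iff.mp hg _)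
    have h1 := dual_smul_of_hom hp (dualOp_hom_iff.mp hh) hy (fun c => koszulSign F (c * e))
    have h2 := dual_smul_of_hom hp (dualOp_hom_iff.mp hg') hz (fun e => koszulSign F (b * e))
    simp only [LinearMap.comp_apply, superSign_tmul hp hp hy hz, TensorProduct.map_tmul,
      LinearMap.id_apply, superFlip_tmul hX hX hg' hh, map_smul, LinearMap.smul_apply, smul_eq_mul,
      TensorProduct.dualDistrib_apply, LinearEquiv.coe_coe, TensorProduct.comm_tmul]
    change _ = B.dualOp.antipodeInv g z * h y
    have h3 := koszulSign_mul_self (F := F) (a * b)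
    rw [mul_comm b a] at h2
    linear_combination koszulSign F (a * b) * B.dualOp.antipodeInv g z * h1 +
      koszulSign F (a * b) * h y * h2 + B.dualOp.antipodeInv g z * h y * h3
  ext x
  change TensorProduct.dualDistrib F W W _ (superSign B.part B.part (B.comul x)) = f B.one * B.counit x
  rw [key, dualDistrib_dualOp_comul' hp, TensorProduct.map_comm]
  have := hB.antipode_right x
  simp only [TensorProduct.comm_comm, this, map_smul, smul_eq_mul, mul_comm]

namespace IsDoublePair

variable {j : W →ₗ[F] V} {χ₀ : Module.Dual F W →ₗ[F] V} (hP : IsDoublePair H B j χ₀)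

include hP

theorem antipodeInv_even : IsEvenMap H.part H.part H.antipodeInv :=
  IsEvenMap.of_hom hP.isHopf.grading hP.isHopf.grading fun _ _ => hP.isHopf.antipodeInv_hom

theorem canonicalR_inv :
    (B.tensor H).m (canonicalR (H.antipodeInv ∘ₗ χ₀)) (canonicalR χ₀) = (B.tensor H).one ∧
    (B.tensor H).m (canonicalR χ₀) (canonicalR (H.antipodeInv ∘ₗ χ₀)) = (B.tensor H).one ∧
    ∀ f, H.antipode (χ₀ f) = χ₀ (B.dualOp.antipode f) := by
  have hH := hP.isHopf
  have hB := hP.sub_isHopf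
  have hU := hH.isSuperAlg
  have hT := hB.isSuperAlg.tensor hU
  have hX := dualOp_grading hB.grading
  have hSe : IsEvenMap B.dualOp.part B.dualOp.part B.dualOp.antipodeInv := fun i =>
    LinearMap.ext fun g => LinearMap.ext fun x => congrArg g (hB.antipode_even.apply i x).symm
  have h1 : (B.tensor H).m (canonicalR (H.antipodeInv ∘ₗ χ₀)) (canonicalR χ₀) =
      (B.tensor H).one := by
    refine slice_ext (Module.finBasis F W) fun f => ?_
    rw [slice_canonicalElt_m hB hU _ _ hP.dual_hom.even,
      ← LinearMap.id_comp χ₀, ← LinearMap.comp_assoc, LinearMap.comp_id, TensorProduct.map_comp,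
      LinearMap.comp_apply, ← hP.dual_comul, superFlip_map hH.grading hH.grading hH.grading
        hH.grading (fun _ => rfl) hP.antipodeInv_even, hH.antipodeInv_comul hP.antipodeMul,
      hP.dual_counit]
    exact (slice_tmul f _ _).symm
  have h2 : (B.tensor H).m (canonicalR χ₀) (canonicalR (χ₀ ∘ₗ B.dualOp.antipodeInv)) =
      (B.tensor H).one := by
    refine slice_ext (Module.finBasis F W) fun f => ?_
    have e : χ₀ = χ₀ ∘ₗ LinearMap.id := rfl
    rw [slice_canonicalElt_m hB hU _ _ fun i => by
      rw [LinearMap.comp_assoc, hSe, ← LinearMap.comp_assoc, hP.dual_hom.even]; rfl]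
    conv_lhs => rw [e, LinearMap.comp_assoc, LinearMap.id_comp, TensorProduct.map_comp]
    have hm (s : Module.Dual F W ⊗[F] Module.Dual F W) :
        H.mul (TensorProduct.map χ₀ χ₀ s) = χ₀ (B.dualOp.mul s) := by
      induction s with
      | zero => simp
      | add s t hs ht => simp only [map_add, hs, ht]
      | tmul f g => exact (hP.dual_hom.map_m f g).symm
    rw [LinearMap.comp_apply, superFlip_map hX hH.grading hX hH.grading hP.dual_hom.even
      hP.dual_hom.even, hm, hB.dualOp_antipodeInv_comul, map_smul]
    refine Eq.trans ?_ (slice_tmul f _ _).symm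
    exact congrArg _ hP.dual_hom.map_one
  have h3 : canonicalR (H.antipodeInv ∘ₗ χ₀) = canonicalR (χ₀ ∘ₗ B.dualOp.antipodeInv) := by
    rw [← hT.mul_one (canonicalR (H.antipodeInv ∘ₗ χ₀)), ← h2, ← hT.mul_assoc, h1, hT.one_mul]
  refine ⟨h1, by rw [h3, h2], fun f => ?_⟩
  have := congrArg (slice (B.dualOp.antipode f)) h3
  rw [slice_canonicalElt, slice_canonicalElt] at this
  have e : B.dualOp.antipodeInv (B.dualOp.antipode f) = f :=
    LinearMap.ext fun x => congrArg f (hB.antipodeInv_antipode x)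
  rw [LinearMap.comp_apply, LinearMap.comp_apply, e] at this
  rw [← this, hH.antipode_antipodeInv]

theorem doubleMap_counit_tmul (a : W) : H.doubleMap j χ₀ (B.counit ⊗ₜ a) = j a := by
  rw [doubleMap_tmul]
  exact (congrArg (H.m · (j a)) hP.dual_hom.map_one).trans (hP.isHopf.one_mul _)

theorem doubleMap_tmul_one (f : Module.Dual F W) : H.doubleMap j χ₀ (f ⊗ₜ B.one) = χ₀ f := by
  rw [doubleMap_tmul, hP.isHopfHom.map_one, hP.isHopf.mul_one]

theorem doubleMap_m (s t : Module.Dual F W ⊗[F] W) : H.doubleMap j χ₀ (B.double.m s t) =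
    H.m (H.doubleMap j χ₀ s) (H.doubleMap j χ₀ t) := by
  have hH := hP.isHopf
  have key (f : Module.Dual F W) (c : W) (u : Module.Dual F W ⊗[F] W) :
      H.doubleMap j χ₀ (TensorProduct.map B.dualOp.mul B.mul
        ((TensorProduct.assoc F (Module.Dual F W) (Module.Dual F W) (W ⊗[F] W)).symm
          (f ⊗ₜ TensorProduct.assoc F (Module.Dual F W) W W (u ⊗ₜ c)))) =
      H.m (χ₀ f) (H.m (H.doubleMap j χ₀ u) (j c)) := by
    induction u with
    | zero => simp
    | add x y hx hy =>
      simp only [TensorProduct.add_tmul, TensorProduct.tmul_add, map_add, hx, hy, add_m, m_add]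
    | tmul g a =>
      change H.m (χ₀ (B.dualOp.m f g)) (j (B.m a c)) = _
      rw [hP.dual_hom.map_m, hP.isHopfHom.map_mul, doubleMap_tmul, hH.mul_assoc, hH.mul_assoc]
  induction s with
  | zero => simp
  | add x y hx hy => rw [add_m, map_add, map_add, add_m, hx, hy]
  | tmul f a =>
    induction t with
    | zero => simp
    | add x y hx hy => rw [m_add, map_add, map_add, m_add, hx, hy]
    | tmul g c =>
      refine (key f c (B.doubleCross (a ⊗ₜ g))).trans ?_
      rw [hP.doubleMap_doubleCross, doubleMap_tmul, doubleMap_tmul, hH.mul_assoc, hH.mul_assoc]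

theorem doubleMap_isHopfHom : B.double.IsHopfHom H (H.doubleMap j χ₀) where
  map_mul := hP.doubleMap_m
  map_one := (hP.doubleMap_counit_tmul B.one).trans hP.isHopfHom.map_one
  even := IsEvenMap.of_tmul (dualOp_grading hP.sub_isHopf.grading) hP.sub_isHopf.grading
    hP.isHopf.grading fun _ _ _ _ hf ha =>
      hP.isHopf.isSuperAlg.hom_m (hP.dual_hom.even.hom hf) (hP.isHopfHom.even.hom ha)
  map_comul u := by
    have hH := hP.isHopf
    have hp := hH.grading
    have hB := hP.sub_isHopf.grading
    have hX := dualOp_grading hB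
    have key (s : Module.Dual F W ⊗[F] Module.Dual F W) (t : W ⊗[F] W) :
        (H.tensor H).m (TensorProduct.map χ₀ χ₀ s) (TensorProduct.map j j t) =
          TensorProduct.map (H.doubleMap j χ₀) (H.doubleMap j χ₀)
            (superInterchange B.dualOp.part B.part (s ⊗ₜ t)) := by
      refine hX.tensor_induction hX (P := fun s => (H.tensor H).m (TensorProduct.map χ₀ χ₀ s)
        (TensorProduct.map j j t) = TensorProduct.map (H.doubleMap j χ₀) (H.doubleMap j χ₀)
            (superInterchange B.dualOp.part B.part (s ⊗ₜ t))) (fun x y hx hy => by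
          rw [map_add, add_m, hx, hy, TensorProduct.add_tmul, map_add, map_add])
        (fun i k f g hf hg => ?_) s
      refine hB.tensor_induction hB (P := fun t => (H.tensor H).m (TensorProduct.map χ₀ χ₀ (f ⊗ₜ g))
        (TensorProduct.map j j t) = TensorProduct.map (H.doubleMap j χ₀) (H.doubleMap j χ₀)
            (superInterchange B.dualOp.part B.part ((f ⊗ₜ g) ⊗ₜ t))) (fun x y hx hy => by
          rw [map_add, m_add, hx, hy, TensorProduct.tmul_add, map_add, map_add])
        (fun l n a c ha hc => ?_) t
      rw [TensorProduct.map_tmul, TensorProduct.map_tmul, IsSuperAlg.tensor_m hp hp _ _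
        (hP.dual_hom.even.hom hg) (hP.isHopfHom.even.hom ha), superInterchange_tmul hX hB f c hg ha,
        map_smul, TensorProduct.map_tmul, doubleMap_tmul, doubleMap_tmul]
    induction u with
    | zero => simp
    | add x y hx hy => simp only [map_add, hx, hy]
    | tmul f a =>
      rw [doubleMap_tmul, hH.comul_mul, hP.dual_comul, hP.isHopfHom.map_comul, key]
      rfl
  map_counit u := by
    induction u with
    | zero => simp
    | add x y hx hy => simp only [map_add, hx, hy]
    | tmul f a =>
      rw [doubleMap_tmul, hP.isHopf.counit_mul, hP.dual_counit, hP.isHopfHom.map_counit]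
      rfl
  map_antipode u := by
    have hp := hP.sub_isHopf.grading
    refine LinearMap.congr_fun (f := H.antipode ∘ₗ H.doubleMap j χ₀)
      (g := H.doubleMap j χ₀ ∘ₗ B.double.antipode)
      ((dualOp_grading hp).tensor_ext hp fun i k f a hf ha => ?_) u
    have e : B.double.antipode (f ⊗ₜ a) = koszulSign F (i * k) •
        B.double.m (B.counit ⊗ₜ B.antipode a) (B.dualOp.antipode f ⊗ₜ B.one) := by
      change B.doubleMul (TensorProduct.map _ _ (superFlip B.dualOp.part B.part (f ⊗ₜ a))) = _
      rw [superFlip_tmul (dualOp_grading hp) hp hf ha, map_smul, map_smul]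
      rfl
    rw [LinearMap.comp_apply, LinearMap.comp_apply, e, map_smul, hP.doubleMap_m,
      hP.doubleMap_counit_tmul, hP.doubleMap_tmul_one, doubleMap_tmul,
      hP.antipodeMul i k _ _ (hP.dual_hom.even.hom hf) (hP.isHopfHom.even.hom ha),
      hP.isHopfHom.map_antipode, hP.canonicalR_inv.2.2]

end IsDoublePair

end SuperHopfData

namespace SuperHopfData

section Legs

variable {F : Type*} [Field F] {V W Z : Type*} [AddCommGroup V] [Module F V] [AddCommGroup W]
  [Module F W] [AddCommGroup Z] [Module F Z] {H : SuperHopfData F V}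

theorem slice_map (f : Module.Dual F V) (φ : W →ₗ[F] V) (ψ : Z →ₗ[F] V) (t : W ⊗[F] Z) :
    slice f (TensorProduct.map φ ψ t) = ψ (slice (f ∘ₗ φ) t) := by
  induction t with
  | zero => simp
  | add x y hx hy => simp only [map_add, hx, hy]
  | tmul w z => simp

theorem superSign_superSign (hp : IsGrading H.part) (t : V ⊗[F] V) :
    superSign H.part H.part (superSign H.part H.part t) = t := by
  refine LinearMap.congr_fun (f := superSign H.part H.part ∘ₗ superSign H.part H.part)
    (g := LinearMap.id) (hp.tensor_ext hp fun i j x y hx hy => ?_) t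
  rw [LinearMap.comp_apply, superSign_tmul hp hp hx hy, map_smul, superSign_tmul hp hp hx hy,
    smul_smul, koszulSign_mul_self, one_smul, LinearMap.id_apply]

theorem slice_signPair_ext [FiniteDimensional F V] (hp : IsGrading H.part) {x y : (V ⊗[F] V) ⊗[F] Z}
    (h : ∀ f g, slice (H.signPair f g) x = slice (H.signPair f g) y) : x = y := by
  let b := Module.finBasis F V
  refine slice_ext (b.tensorProduct b) fun φ => ?_
  have e : φ = TensorProduct.dualDistrib F V V ((TensorProduct.dualDistribEquiv F V V).symm
      (φ ∘ₗ superSign H.part H.part)) ∘ₗ superSign H.part H.part := by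
    have := (TensorProduct.dualDistribEquiv F V V).apply_symm_apply (φ ∘ₗ superSign H.part H.part)
    change TensorProduct.dualDistrib F V V _ = _ at this
    rw [this]
    exact LinearMap.ext fun t => congrArg φ (superSign_superSign hp t).symm
  rw [e]
  generalize (TensorProduct.dualDistribEquiv F V V).symm (φ ∘ₗ superSign H.part H.part) = s
  have add (α β : Module.Dual F (V ⊗[F] V)) (z : (V ⊗[F] V) ⊗[F] Z) :
      slice (α + β) z = slice α z + slice β z := by
    simp [slice, TensorProduct.map_add_left]
  induction s with
  | zero => simp [slice]
  | add s t hs ht => rw [map_add, LinearMap.add_comp, add, add, hs, ht]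
  | tmul f g => exact h f g

variable (hH : H.IsHopf)

include hH

theorem map_superFlip_leg13 (T : V ⊗[F] V) : TensorProduct.map (superFlip H.part H.part)
    LinearMap.id (H.leg13 T) = H.leg23 T := by
  induction T with
  | zero => simp [leg13, leg23]
  | add x y hx hy => simp only [leg13, leg23, TensorProduct.tmul_add, map_add] at *; rw [hx, hy]
  | tmul s u => simp [leg13, leg23, superFlip_one_right hH.isSuperAlg hH.isSuperAlg]

theorem map_superFlip_leg23 (T : V ⊗[F] V) : TensorProduct.map (superFlip H.part H.part)
    LinearMap.id (H.leg23 T) = H.leg13 T := by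
  induction T with
  | zero => simp [leg13, leg23]
  | add x y hx hy => simp only [leg13, leg23, TensorProduct.tmul_add, map_add] at *; rw [hx, hy]
  | tmul s u => simp [leg13, leg23, superFlip_one_left hH.isSuperAlg hH.isSuperAlg]

theorem assoc_leg13 (T : V ⊗[F] V) : TensorProduct.map LinearMap.id (superFlip H.part H.part)
    (TensorProduct.assoc F V V V (H.leg13 T)) = TensorProduct.assoc F V V V (H.leg12 T) := by
  induction T with
  | zero => simp [leg13, leg12]
  | add x y hx hy => simp only [leg13, leg12, TensorProduct.add_tmul, map_add] at *; rw [hx, hy]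
  | tmul s u => simp [leg13, leg12, superFlip_one_left hH.isSuperAlg hH.isSuperAlg]

theorem assoc_leg12 (T : V ⊗[F] V) : TensorProduct.map LinearMap.id (superFlip H.part H.part)
    (TensorProduct.assoc F V V V (H.leg12 T)) = TensorProduct.assoc F V V V (H.leg13 T) := by
  induction T with
  | zero => simp [leg13, leg12]
  | add x y hx hy => simp only [leg13, leg12, TensorProduct.add_tmul, map_add] at *; rw [hx, hy]
  | tmul s u => simp [leg13, leg12, superFlip_one_right hH.isSuperAlg hH.isSuperAlg]

/-- Multiplicativity of slices, the source of `(Δ ⊗ id)(R) = R₁₃ R₂₃`. -/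
theorem slice_leg13_m_leg23 {S T : V ⊗[F] V} (hS : (H.tensor H).part 0 S = S)
    (hT : (H.tensor H).part 0 T = T) (f g : Module.Dual F V) :
    slice (H.signPair f g) (((H.tensor H).tensor H).m (H.leg13 S) (H.leg23 T)) =
      H.m (slice f S) (slice g T) := by
  have hp := hH.grading
  refine hp.even_induction hp (P := fun S => slice (H.signPair f g) (((H.tensor H).tensor H).m
    (H.leg13 S) (H.leg23 T)) = H.m (slice f S) (slice g T)) (fun x y hx hy => ?_)
    (fun i s u hs hu => ?_) hS
  · have : H.leg13 (x + y) = H.leg13 x + H.leg13 y := map_add _ _ _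
    rw [this, add_m, map_add, hx, hy, map_add, add_m]
  refine hp.even_induction hp (P := fun T => slice (H.signPair f g) (((H.tensor H).tensor H).m
    (H.leg13 (s ⊗ₜ u)) (H.leg23 T)) = H.m (slice f (s ⊗ₜ u)) (slice g T)) (fun x y hx hy => ?_)
    (fun k t v ht hv => ?_) hT
  · have : H.leg23 (x + y) = H.leg23 x + H.leg23 y := by
      simp only [leg23, TensorProduct.tmul_add, map_add]
    rw [this, m_add, map_add, hx, hy, map_add, m_add]
  · have e1 : H.leg13 (s ⊗ₜ u) = (s ⊗ₜ H.one) ⊗ₜ u := rfl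
    have e2 : H.leg23 (t ⊗ₜ v) = (H.one ⊗ₜ t) ⊗ₜ v := rfl
    rw [e1, e2, IsSuperAlg.tensor_m (A := H.tensor H) (hp.tensor hp) hp _ _ hu
      (tensor_hom hp hp hH.one_even ht), IsSuperAlg.tensor_m_even_left hp hp _ _ _ hH.one_even,
      hH.mul_one, hH.one_mul, map_smul, slice_tmul, signPair_tmul hp f g hs ht, slice_tmul,
      slice_tmul, smul_m, m_smul, smul_smul, smul_smul, ← mul_assoc, zero_add, koszulSign_mul_self,
      one_mul]

theorem leg13_tmul_m_leg12 (s u : V) {T : V ⊗[F] V} (hT : (H.tensor H).part 0 T = T) :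
    ((H.tensor H).tensor H).m (H.leg13 (s ⊗ₜ u)) (H.leg12 T) =
      (H.tensor H).m (s ⊗ₜ H.one) T ⊗ₜ u := by
  have hp := hH.grading
  have e1 : H.leg13 (s ⊗ₜ u) = (s ⊗ₜ H.one) ⊗ₜ u := rfl
  rw [e1, leg12, IsSuperAlg.tensor_m_even_right (A := H.tensor H) (hp.tensor hp) hp _ _ _ hT,
    hH.mul_one]

end Legs

namespace IsDoublePair

variable {F : Type*} [Field F] {V W : Type*} [AddCommGroup V] [Module F V] [AddCommGroup W]
  [Module F W] [FiniteDimensional F W] [FiniteDimensional F V] {H : SuperHopfData F V}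
  {B : SuperHopfData F W} {j : W →ₗ[F] V} {χ₀ : Module.Dual F W →ₗ[F] V}
  (hP : IsDoublePair H B j χ₀)

/-- The `R`-matrix `∑ j(bᵢ) ⊗ χ₀(bⁱ)`. -/
abbrev _root_.SuperHopfData.pairR (j : W →ₗ[F] V) (χ₀ : Module.Dual F W →ₗ[F] V) : V ⊗[F] V :=
  TensorProduct.map j LinearMap.id (canonicalR χ₀)

include hP

theorem map_hom : IsSuperAlgHom (B.tensor H) (H.tensor H) (TensorProduct.map j LinearMap.id) :=
  hP.isHopfHom.isSuperAlgHom.tensor hP.sub_isHopf.grading hP.isHopf.grading hP.isHopf.grading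
    hP.isHopf.grading .id

theorem pairR_even : (H.tensor H).part 0 (pairR j χ₀) = pairR j χ₀ :=
  hP.map_hom.even.hom (canonicalElt_even _ hP.sub_isHopf.grading hP.dual_hom.even)

omit hP [FiniteDimensional F V] in
theorem slice_pairR (f : Module.Dual F V) : slice f (pairR j χ₀) = χ₀ (f ∘ₗ j) := by
  rw [slice_map, slice_canonicalElt, LinearMap.id_apply]

theorem hexagon_left : TensorProduct.map H.comul LinearMap.id (pairR j χ₀) =
    ((H.tensor H).tensor H).m (H.leg13 (pairR j χ₀)) (H.leg23 (pairR j χ₀)) := by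
  have hp := hP.isHopf.grading
  have hB := hP.sub_isHopf.grading
  refine slice_signPair_ext hp fun f g => ?_
  rw [slice_leg13_m_leg23 hP.isHopf hP.pairR_even hP.pairR_even, slice_pairR, slice_pairR,
    ← hP.dual_hom.map_m]
  have e1 : slice (H.signPair f g) (TensorProduct.map H.comul LinearMap.id (pairR j χ₀)) =
      slice (H.signPair f g ∘ₗ H.comul) (pairR j χ₀) := by
    generalize pairR j χ₀ = t
    induction t with
    | zero => simp
    | add x y hx hy => simp only [map_add, hx, hy]
    | tmul v z => simp
  rw [e1, slice_pairR, dualOp_m_eq]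
  congr 1
  have e2 : H.signPair f g ∘ₗ TensorProduct.map j j = B.signPair (f ∘ₗ j) (g ∘ₗ j) :=
    hB.tensor_ext hB fun i k x y hx hy => by
      rw [LinearMap.comp_apply, TensorProduct.map_tmul, signPair_tmul hp f g
        (hP.isHopfHom.even.hom hx) (hP.isHopfHom.even.hom hy), signPair_tmul hB _ _ hx hy]
      rfl
  rw [← e2, LinearMap.comp_assoc, LinearMap.comp_assoc]
  congr 1
  exact LinearMap.ext hP.isHopfHom.map_comul

theorem hexagon_right : (TensorProduct.assoc F V V V).symm
      (TensorProduct.map LinearMap.id H.comul (pairR j χ₀)) =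
    ((H.tensor H).tensor H).m (H.leg13 (pairR j χ₀)) (H.leg12 (pairR j χ₀)) := by
  have hU := hP.isHopf.isSuperAlg
  apply (TensorProduct.assoc F V V V).injective
  rw [LinearEquiv.apply_symm_apply]
  refine slice_ext (Module.finBasis F V) fun f => ?_
  have e0 (t : V ⊗[F] V) : slice f (TensorProduct.map LinearMap.id H.comul t) =
      H.comul (slice f t) := by
    induction t with
    | zero => simp
    | add x y hx hy => simp only [map_add, hx, hy]
    | tmul v z => simp
  have e1 (t : V ⊗[F] V) (u : V) : slice f (TensorProduct.assoc F V V V (t ⊗ₜ u)) =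
      slice f t ⊗ₜ u := by
    induction t with
    | zero => simp
    | add x y hx hy => simp only [TensorProduct.add_tmul, map_add, hx, hy]
    | tmul v z => simp [TensorProduct.smul_tmul']
  have e2 (x : W) (u : V) : slice f (TensorProduct.assoc F V V V (((H.tensor H).tensor H).m
      (H.leg13 (j x ⊗ₜ u)) (H.leg12 (pairR j χ₀)))) = χ₀ ((f ∘ₗ j) ∘ₗ B.lmul x) ⊗ₜ u := by
    rw [leg13_tmul_m_leg12 hP.isHopf _ _ hP.pairR_even, e1,
      slice_m_left hU hU _ _ hU.one_even, hU.one_mul, sgn_zero hU.grading, LinearMap.comp_id,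
      slice_pairR]
    congr 2
    ext y
    exact congrArg f (hP.isHopfHom.map_mul x y).symm
  have e3 : pairR j χ₀ = ∑ i, j (Module.finBasis F W i) ⊗ₜ χ₀ ((Module.finBasis F W).coord i) := by
    simp [pairR, canonicalR, canonicalElt]
  rw [e0, slice_pairR, hP.dual_comul]
  conv_rhs => rw [e3, leg13, map_sum, m, TensorProduct.sum_tmul, map_sum, map_sum, map_sum]
  rw [← e3]
  refine Eq.trans ?_ (Finset.sum_congr rfl fun i _ => (e2 _ _).symm)
  simp only [comp_lmul_eq hP.sub_isHopf.grading]
  generalize B.dualOp.comul (f ∘ₗ j) = s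
  induction s with
  | zero => simp
  | add s t hs ht => simp only [map_add, hs, ht, TensorProduct.add_tmul, Finset.sum_add_distrib]
  | tmul g h =>
    simp only [TensorProduct.map_tmul, TensorProduct.rid_tmul, LinearMap.id_apply, map_smul,
      Module.Dual.eval_apply, TensorProduct.smul_tmul, ← TensorProduct.tmul_sum]
    simp only [← map_smul, ← map_sum]
    rw [(Module.finBasis F W).sum_dual_apply_smul_coord]

theorem intertwine_sub (a : W) :
    (H.tensor H).m (superFlip H.part H.part (H.comul (j a))) (pairR j χ₀) =
      (H.tensor H).m (pairR j χ₀) (H.comul (j a)) := by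
  have hB := hP.sub_isHopf.grading
  have hp := hP.isHopf.grading
  have h := congrArg (TensorProduct.map j LinearMap.id) (hP.intertwine a)
  rw [hP.map_hom.map_m, hP.map_hom.map_m] at h
  have e (t : W ⊗[F] W) : TensorProduct.map j LinearMap.id (TensorProduct.map LinearMap.id j t) =
      TensorProduct.map j j t := by
    rw [← LinearMap.comp_apply, ← TensorProduct.map_comp, LinearMap.comp_id, LinearMap.id_comp]
  rw [comulRop, comulR, LinearMap.comp_apply, LinearMap.comp_apply, LinearMap.comp_apply, e, e,
    ← superFlip_map hB hp hB hp hP.isHopfHom.even hP.isHopfHom.even,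
    ← hP.isHopfHom.map_comul] at h
  exact h

theorem yang_baxter :
    ((H.tensor H).tensor H).m (H.leg12 (pairR j χ₀))
      (((H.tensor H).tensor H).m (H.leg13 (pairR j χ₀)) (H.leg23 (pairR j χ₀))) =
    ((H.tensor H).tensor H).m (((H.tensor H).tensor H).m (H.leg23 (pairR j χ₀))
      (H.leg13 (pairR j χ₀))) (H.leg12 (pairR j χ₀)) := by
  have hU := hP.isHopf.isSuperAlg
  have hp := hU.grading
  have hF := (hU.flip_hom hU).tensor (hp.tensor hp) hp (hp.tensor hp) hp (.id (A := H))
  have hx : ((H.tensor H).tensor H).m (H.leg23 (pairR j χ₀)) (H.leg13 (pairR j χ₀)) =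
      TensorProduct.map (superFlip H.part H.part) LinearMap.id
        (((H.tensor H).tensor H).m (H.leg13 (pairR j χ₀)) (H.leg23 (pairR j χ₀))) := by
    rw [hF.map_m, map_superFlip_leg13 hP.isHopf, map_superFlip_leg23 hP.isHopf]
  rw [hx, ← hP.hexagon_left, leg12]
  have key (t : W ⊗[F] V) : ((H.tensor H).tensor H).m (pairR j χ₀ ⊗ₜ H.one)
      (TensorProduct.map H.comul LinearMap.id (TensorProduct.map j LinearMap.id t)) =
      ((H.tensor H).tensor H).m (TensorProduct.map (superFlip H.part H.part) LinearMap.id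
        (TensorProduct.map H.comul LinearMap.id (TensorProduct.map j LinearMap.id t)))
        (pairR j χ₀ ⊗ₜ H.one) := by
    induction t with
    | zero => simp
    | add x y hx hy => simp only [map_add, m_add, add_m, hx, hy]
    | tmul a v =>
      simp only [TensorProduct.map_tmul, LinearMap.id_apply]
      rw [IsSuperAlg.tensor_m_even_left (A := H.tensor H) (hp.tensor hp) hp _ _ _ hU.one_even,
        IsSuperAlg.tensor_m_even_right (A := H.tensor H) (hp.tensor hp) hp _ _ _ hP.pairR_even,
        hU.one_mul, hU.mul_one, hP.intertwine_sub]
  exact key _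

theorem intertwine_dual (g : Module.Dual F W) :
    (H.tensor H).m (superFlip H.part H.part (H.comul (χ₀ g))) (pairR j χ₀) =
      (H.tensor H).m (pairR j χ₀) (H.comul (χ₀ g)) := by
  have hU := hP.isHopf.isSuperAlg
  have hp := hU.grading
  have hT := hU.tensor hU
  have hA := hU.assoc_hom hU hU
  have h3 := hT.tensor hU
  set R := pairR j χ₀ with hR
  obtain ⟨f, rfl⟩ : ∃ f, f ∘ₗ j = g :=
    LinearMap.dualMap_surjective_of_injective hP.injective g
  have hF := (IsSuperAlgHom.id (A := H)).tensor hp (hp.tensor hp) hp (hp.tensor hp)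
    (hU.flip_hom hU)
  have hyb := congrArg (TensorProduct.assoc F V V V) hP.yang_baxter
  have am (x y) : TensorProduct.assoc F V V V (((H.tensor H).tensor H).m x y) =
    (H.tensor (H.tensor H)).m (TensorProduct.assoc F V V V x) (TensorProduct.assoc F V V V y) :=
    hA.map_m x y
  have e23 : TensorProduct.assoc F V V V (H.leg23 R) = H.one ⊗ₜ R := by simp [leg23]
  have hr : (H.tensor (H.tensor H)).m (TensorProduct.assoc F V V V (H.leg13 R))
      (TensorProduct.assoc F V V V (H.leg12 R)) = TensorProduct.map LinearMap.id H.comul R := by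
    rw [← am, ← hP.hexagon_right, LinearEquiv.apply_symm_apply]
  have hr' : (H.tensor (H.tensor H)).m (TensorProduct.assoc F V V V (H.leg12 R))
      (TensorProduct.assoc F V V V (H.leg13 R)) = TensorProduct.map LinearMap.id
        (superFlip H.part H.part) (TensorProduct.map LinearMap.id H.comul R) := by
    rw [← hr, hF.map_m, assoc_leg13 hP.isHopf, assoc_leg12 hP.isHopf]
  have hA3 := hU.tensor hT
  rw [am, am, am, am, ← hA3.mul_assoc, hr', hA3.mul_assoc, hr, e23] at hyb
  have hyb := congrArg (slice f) hyb
  have s1 (t : V ⊗[F] (V ⊗[F] V)) : slice f ((H.tensor (H.tensor H)).m t (H.one ⊗ₜ R)) =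
      (H.tensor H).m (slice f t) R := by
    induction t with
    | zero => simp
    | add x y hx hy => simp only [map_add, add_m, hx, hy]
    | tmul x y =>
      rw [IsSuperAlg.tensor_m_even_right (B := H.tensor H) hp (hp.tensor hp) _ _ _ hU.one_even,
        hU.mul_one, slice_tmul, slice_tmul, smul_m]
  have s2 (t : V ⊗[F] (V ⊗[F] V)) : slice f ((H.tensor (H.tensor H)).m (H.one ⊗ₜ R) t) =
      (H.tensor H).m R (slice f t) := by
    induction t with
    | zero => simp
    | add x y hx hy => simp only [map_add, m_add, hx, hy]
    | tmul x y =>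
      rw [IsSuperAlg.tensor_m_even_left (B := H.tensor H) hp (hp.tensor hp) _ _ _ hP.pairR_even,
        hU.one_mul, slice_tmul, slice_tmul, m_smul]
  have s3 {Z Y : Type _} [AddCommGroup Z] [Module F Z] [AddCommGroup Y] [Module F Y]
      (φ : Z →ₗ[F] Y) (t : V ⊗[F] Z) : slice f (TensorProduct.map LinearMap.id φ t) =
      φ (slice f t) := by
    induction t with
    | zero => simp
    | add x y hx hy => simp only [map_add, hx, hy]
    | tmul v z => simp
  rwa [s1, s2, s3, s3, slice_pairR] at hyb

/-- The image of the `R`-matrix of the double is a universal `R`-matrix. -/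
theorem isBraided (hs : Function.Surjective (H.doubleMap j χ₀)) {ι : Type*} [Fintype ι]
    (b : Module.Basis ι F W) : H.IsBraided
      (TensorProduct.map (H.doubleMap j χ₀) (H.doubleMap j χ₀) (B.doubleR b)) := by
  have hH := hP.isHopf
  have hU := hH.isSuperAlg
  have hT := hU.tensor hU
  have e : TensorProduct.map (H.doubleMap j χ₀) (H.doubleMap j χ₀) (B.doubleR b) = pairR j χ₀ := by
    have : canonicalR χ₀ = canonicalElt b χ₀ :=
      slice_ext b fun f => by rw [slice_canonicalElt, slice_canonicalElt]
    rw [pairR, this, doubleR, canonicalElt, map_sum, map_sum]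
    refine Finset.sum_congr rfl fun i _ => ?_
    rw [TensorProduct.map_tmul, TensorProduct.map_tmul, hP.doubleMap_tmul_one]
    exact congrArg (· ⊗ₜ _) (hP.doubleMap_counit_tmul _)
  rw [e]
  obtain ⟨h1, h2, -⟩ := hP.canonicalR_inv
  have h1 := congrArg (TensorProduct.map j LinearMap.id) h1
  have h2 := congrArg (TensorProduct.map j LinearMap.id) h2
  rw [hP.map_hom.map_m, hP.map_hom.map_one] at h1 h2
  have hf := (hU.flip_hom hU).comp hH.comul_hom
  have all (x : V) : (H.tensor H).m (superFlip H.part H.part (H.comul x)) (pairR j χ₀) =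
      (H.tensor H).m (pairR j χ₀) (H.comul x) := by
    obtain ⟨u, rfl⟩ := hs x
    induction u with
    | zero => simp
    | add x y hx hy => simp only [map_add, add_m, m_add, hx, hy]
    | tmul f a =>
      have h := hf.map_m (χ₀ f) (j a)
      rw [LinearMap.comp_apply, LinearMap.comp_apply, LinearMap.comp_apply] at h
      rw [doubleMap_tmul, h, hH.comul_mul, hT.mul_assoc, hP.intertwine_sub, ← hT.mul_assoc,
        hP.intertwine_dual, hT.mul_assoc]
  exact ⟨hP.pairR_even, ⟨_, h2, h1, fun x => by rw [← all, hT.mul_assoc, h2, hT.mul_one]⟩,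
    hP.hexagon_left, hP.hexagon_right⟩

end IsDoublePair

end SuperHopfData

namespace SuperHopfData

section

variable {F : Type*} [Field F] {V W : Type*} [AddCommGroup V] [Module F V] [AddCommGroup W]
  [Module F W] {A : SuperHopfData F V} {B : SuperHopfData F W} {f : V →ₗ[F] W}

theorem IsHopfHom.hom_of_injective (h : A.IsHopfHom B f) (hf : Function.Injective f) {i : ZMod 2}
    {x : V} (hx : B.part i (f x) = f x) : A.part i x = x :=
  hf ((h.even.apply i x).trans hx)

theorem IsHopfHom.isGrouplike_of_injective (h : A.IsHopfHom B f) (hf : Function.Injective f) {k : V}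
    (hk : B.IsGrouplike (f k)) : A.IsGrouplike k where
  even := h.hom_of_injective hf hk.even
  comul := TensorProduct.map_injective_of_field hf hf <| by
    rw [← h.map_comul, hk.comul, TensorProduct.map_tmul]

theorem IsHopfHom.isSkewPrimitive_of_injective (h : A.IsHopfHom B f) (hf : Function.Injective f)
    {ε : ZMod 2} {k e : V} (he : B.IsSkewPrimitive ε (f k) (f e)) : A.IsSkewPrimitive ε k e where
  grouplike := h.isGrouplike_of_injective hf he.grouplike
  hom := h.hom_of_injective hf he.hom
  comul := TensorProduct.map_injective_of_field hf hf <| by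
    rw [← h.map_comul, he.comul, map_add, TensorProduct.map_tmul, TensorProduct.map_tmul, h.map_one]

end

open BorelAlg

section

variable {F : Type*} [Field F] [CharZero F] {q : F} {d : ℕ}

/-- The Borel part as a subspace of `Ū_q`. -/
def borelEquiv (hq : IsOddRoot q d) : BorelAlg F q d ≃ₗ[F] Bplus F q d :=
  LinearEquiv.ofBijective (borelIncl.toLinearMap.codRestrict _ (borelIncl_mem hq))
    ⟨fun _ _ h => borelIncl_injective hq (congrArg Subtype.val h), fun y => by
      obtain ⟨x, hx⟩ := (mem_Bplus_iff hq).mp y.2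
      exact ⟨x, Subtype.ext hx⟩⟩

theorem borelEquiv_coe (hq : IsOddRoot q d) (x : BorelAlg F q d) :
    (Bplus F q d).subtype (borelEquiv hq x) = borelIncl x := rfl

theorem isBorelHopf (hq : IsOddRoot q d) {H : SuperHopfData F (Ubar F q d)}
    (hH : IsUbarStructure F q d H) {B : SuperHopfData F (Bplus F q d)} (hB : B.IsHopf)
    (h : B.IsHopfHom H (Bplus F q d).subtype) : IsBorelHopf B (borelEquiv hq) := by
  have hi := (Bplus F q d).injective_subtype
  have hg : borelIncl (gen F q d .k1) = ubarGen F q d .k1 ∧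
      borelIncl (gen F q d .k2) = ubarGen F q d .k2 ∧
      borelIncl (gen F q d .e1) = ubarGen F q d .e1 ∧
      borelIncl (gen F q d .e2) = ubarGen F q d .e2 := by simp [borelIncl]
  obtain ⟨g1, g2, g3, g4⟩ := hg
  have k1 : B.IsGrouplike (borelEquiv hq (gen F q d .k1)) := h.isGrouplike_of_injective hi <| by
    rw [borelEquiv_coe, g1]; exact ⟨hH.deg .k1, hH.comul_k1⟩
  have k2 : B.IsGrouplike (borelEquiv hq (gen F q d .k2)) := h.isGrouplike_of_injective hi <| by
    rw [borelEquiv_coe, g2]; exact ⟨hH.deg .k2, hH.comul_k2⟩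
  refine ⟨hB, fun x y => hi ?_, hi ?_, k1, k2, h.isSkewPrimitive_of_injective hi ?_,
    h.isSkewPrimitive_of_injective hi ?_, ?_, ?_, ?_, ?_⟩
  · rw [h.map_mul, hH.m_eq, borelEquiv_coe, borelEquiv_coe, borelEquiv_coe, _root_.map_mul]
  · rw [h.map_one, hH.one_eq, borelEquiv_coe, _root_.map_one]
  · rw [borelEquiv_coe, borelEquiv_coe, g1, g3]
    exact ⟨⟨hH.deg .k1, hH.comul_k1⟩, hH.deg .e1, by rw [hH.comul_e1, hH.one_eq]⟩
  · rw [borelEquiv_coe, borelEquiv_coe, g2, g4]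
    exact ⟨⟨hH.deg .k2, hH.comul_k2⟩, hH.deg .e2, by rw [hH.comul_e2, hH.one_eq]⟩
  · rw [← h.map_counit, borelEquiv_coe, g1, hH.counit_k1]
  · rw [← h.map_counit, borelEquiv_coe, g2, hH.counit_k2]
  · rw [← h.map_counit, borelEquiv_coe, g3, hH.counit_e1]
  · rw [← h.map_counit, borelEquiv_coe, g4, hH.counit_e2]

end

namespace IsBorelDual

variable {F : Type*} [Field F] {q : F} {d : ℕ} {W : Type*} [AddCommGroup W] [Module F W]
  [FiniteDimensional F W] {B : SuperHopfData F W} {θ : BorelAlg F q d ≃ₗ[F] W}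
  {l1 l2 f1 f2 : Module.Dual F W} (hD : IsBorelDual B θ l1 l2 f1 f2) (hB : IsBorelHopf B θ)
  (hq : IsOddRoot q d)

theorem alphaK_eq : alphaK1 q (hD.basis hB hq) = hD.liftₗ hB hq (gen F q d .k1 ^ (d - 1)) ∧
    alphaK2 q (hD.basis hB hq) = hD.liftₗ hB hq (gen F q d .k2 ^ (d - 1)) := by
  have q0 := hq.ne_zero
  obtain ⟨-, a1, -, a2⟩ := (borelRel F q d).pow_sub_one hq
  have key {g : BorelGen} {l f : Module.Dual F W} (hl : hD.liftₗ hB hq (gen F q d g) = l)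
      (h : B.dualOp.m l f = B.counit) (a : gen F q d g ^ (d - 1) * gen F q d g = 1) :
      f = hD.liftₗ hB hq (gen F q d g ^ (d - 1)) := by
    obtain ⟨y, rfl⟩ := hD.liftₗ_surjective hB hq f
    subst hl
    rw [← liftₗ_mul, ← hD.liftₗ_one hB hq] at h
    rw [left_inv_eq_right_inv a ((hD.liftₗ_bijective hB hq).1 h)]
  refine ⟨key (hD.liftₗ_k1 hB hq) (hD.l1.m_eq hB (hD.isTorusChar_alphaK1 hB hq) ?_) a1,
    key (hD.liftₗ_k2 hB hq) (hD.l2.m_eq hB (hD.isTorusChar_alphaK2 hB hq) ?_) a2⟩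
  · rw [mul_inv_cancel₀ (pow_ne_zero 2 q0), inv_mul_cancel₀ q0]; exact hB.isTorusChar_counit
  · rw [inv_mul_cancel₀ q0, _root_.mul_one]; exact hB.isTorusChar_counit

theorem liftₗ_pow (x : BorelAlg F q d) (n : ℕ) :
    hD.liftₗ hB hq (x ^ n) = B.dualOp.npow (hD.liftₗ hB hq x) n := by
  induction n with
  | zero => rw [pow_zero, liftₗ_one]; rfl
  | succ n ih => rw [pow_succ, liftₗ_mul, ih]; rfl

theorem alphaMonomial_eq (y : BIdx d) : alphaMonomial q B.dualOp (hD.basis hB hq) y =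
    hD.liftₗ hB hq (gen F q d .e1 ^ (y.r : ℕ) *
      (gen F q d .e2 * gen F q d .e1 - q • (gen F q d .e1 * gen F q d .e2)) ^ (y.h : ℕ) *
      gen F q d .e2 ^ (y.t : ℕ) * (gen F q d .k1 ^ (d - 1)) ^ (y.i : ℕ) *
      (gen F q d .k2 ^ (d - 1)) ^ (y.j : ℕ)) := by
  obtain ⟨a1, a2⟩ := hD.alphaK_eq hB hq
  have e1 := (hD.alphaE1_eq hB hq).trans (hD.liftₗ_e1 hB hq).symm
  have e2 := (hD.alphaE2_eq hB hq).trans (hD.liftₗ_e2 hB hq).symm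
  have e3 : alphaE3 q (hD.basis hB hq) = hD.liftₗ hB hq
      (gen F q d .e2 * gen F q d .e1 - q • (gen F q d .e1 * gen F q d .e2)) := by
    rw [_root_.map_sub, _root_.map_smul, liftₗ_mul, liftₗ_mul]
    refine (hD.alphaE3_eq hB hq).trans ?_
    congr 1
    · exact congrArg₂ _ (hD.liftₗ_e2 hB hq).symm (hD.liftₗ_e1 hB hq).symm
    · exact congrArg (q • ·) (congrArg₂ _ (hD.liftₗ_e1 hB hq).symm (hD.liftₗ_e2 hB hq).symm)
  rw [alphaMonomial, a1, a2, e1, e2, e3]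
  simp only [liftₗ_mul, liftₗ_pow _ _ _ _ (y.r : ℕ), liftₗ_pow _ _ _ _ (y.h : ℕ),
    liftₗ_pow _ _ _ _ (y.t : ℕ), liftₗ_pow _ _ _ _ (y.i : ℕ), liftₗ_pow _ _ _ _ (y.j : ℕ)]

theorem span_alphaMonomial :
    Submodule.span F (Set.range (alphaMonomial q B.dualOp (hD.basis hB hq))) = ⊤ := by
  have h := (borelRel F q d).straightening_inv hq
  have := congrArg (Submodule.map (hD.liftₗ hB hq))
    (h.span_torus_last hq.pos ((borelRel F q d).adjoin_inv hq (adjoin_gen F q d)))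
  rw [Submodule.map_span, ← Set.range_comp, Submodule.map_top,
    LinearMap.range_eq_top.mpr (hD.liftₗ_surjective hB hq)] at this
  rw [← this]
  congr 2
  exact funext fun y => hD.alphaMonomial_eq hB hq y

theorem toUbar_alphaMonomial (y : BIdx d) :
    hD.toUbar hB hq (alphaMonomial q B.dualOp (hD.basis hB hq) y) =
      ubarGen F q d .f1 ^ (y.r : ℕ) * ubarF3 F q d ^ (y.h : ℕ) * ubarGen F q d .f2 ^ (y.t : ℕ) *
        ubarGen F q d .k1 ^ (y.i : ℕ) * ubarGen F q d .k2 ^ (y.j : ℕ) := by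
  have hs := ubarSat (F := F) (q := q) (d := d)
  obtain ⟨a1, -, a2, -⟩ := hs.neg.pow_sub_one hq
  have g1 := lift_k1 hs.neg
  have g2 := lift_k2 hs.neg
  have g3 := lift_e1 hs.neg
  have g4 := lift_e2 hs.neg
  rw [alphaMonomial_eq, toUbar_liftₗ, left_inv_eq_right_inv hs.k1K1 a1,
    left_inv_eq_right_inv hs.k2K2 a2, ubarF3, negIncl]
  simp only [_root_.map_mul, _root_.map_pow, _root_.map_sub, _root_.map_smul, g1, g2, g3, g4]

end IsBorelDual

variable {F : Type*} [Field F] {q : F} {d : ℕ} {H : SuperHopfData F (Ubar F q d)}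
  {B : SuperHopfData F (Bplus F q d)} {b : Module.Basis (BIdx d) F (Bplus F q d)}

theorem isChi_unique (hb : Submodule.span F (Set.range (alphaMonomial q B.dualOp b)) = ⊤)
    {χ χ' : Module.Dual F (Bplus F q d) ⊗[F] Bplus F q d →ₗ[F] Ubar F q d}
    (h : IsChi q B b χ) (h' : IsChi q B b χ') : χ' = χ := by
  apply TensorProduct.ext
  refine LinearMap.ext_on hb ?_
  rintro _ ⟨y, rfl⟩
  exact b.ext fun x => (h' y x).trans (h y x).symm

theorem isChi_doubleMap (hH : IsUbarStructure F q d H)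
    {χ₀ : Module.Dual F (Bplus F q d) →ₗ[F] Ubar F q d}
    (hb : ∀ x, (b x : Ubar F q d) = bMonomial F q d x)
    (h : ∀ y : BIdx d, χ₀ (alphaMonomial q B.dualOp b y) =
      ubarGen F q d .f1 ^ (y.r : ℕ) * ubarF3 F q d ^ (y.h : ℕ) * ubarGen F q d .f2 ^ (y.t : ℕ) *
        ubarGen F q d .k1 ^ (y.i : ℕ) * ubarGen F q d .k2 ^ (y.j : ℕ)) :
    IsChi q B b (H.doubleMap (Bplus F q d).subtype χ₀) := by
  intro y x
  have hc : Commute (ubarGen F q d .k2) (ubarGen F q d .k1) := ubarSat.pos.k2k1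
  have hc := (hc.pow_pow y.j x.i).eq
  rw [doubleMap_tmul, hH.m_eq, h, Submodule.subtype_apply, hb, bMonomial, pow_add, pow_add]
  simp only [_root_.mul_assoc]
  rw [← _root_.mul_assoc (_ ^ (y.j : ℕ)) (_ ^ (x.i : ℕ)), hc]
  simp only [_root_.mul_assoc]

theorem doubleMap_surjective (hH : IsUbarStructure F q d H)
    {χ₀ : Module.Dual F (Bplus F q d) →ₗ[F] Ubar F q d}
    (hP : IsDoublePair H B (Bplus F q d).subtype χ₀)
    (hk : ∀ g ∈ [UqGen.k1, .k2, .e1, .e2], ubarGen F q d g ∈ Bplus F q d)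
    (hf : ∀ g ∈ [UqGen.K1, .K2, .f1, .f2], ∃ f, χ₀ f = ubarGen F q d g) :
    Function.Surjective (H.doubleMap (Bplus F q d).subtype χ₀) := by
  have hg (g : UqGen) : ∃ t, H.doubleMap (Bplus F q d).subtype χ₀ t = ubarGen F q d g := by
    by_cases h : g ∈ [UqGen.k1, .k2, .e1, .e2]
    · exact ⟨_, hP.doubleMap_counit_tmul ⟨_, hk g h⟩⟩
    · obtain ⟨f, hf⟩ := hf g (by cases g <;> simp_all)
      exact ⟨_, (hP.doubleMap_tmul_one f).trans hf⟩
  intro x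
  induction x using ubar_induction with
  | add x y hx hy =>
    obtain ⟨s, rfl⟩ := hx
    obtain ⟨t, rfl⟩ := hy
    exact ⟨s + t, _root_.map_add _ _ _⟩
  | smul c x hx =>
    obtain ⟨s, rfl⟩ := hx
    exact ⟨c • s, _root_.map_smul _ _ _⟩
  | one => exact ⟨_, hP.doubleMap_isHopfHom.map_one.trans hH.one_eq⟩
  | mul i x hx =>
    obtain ⟨s, rfl⟩ := hx
    obtain ⟨t, ht⟩ := hg i
    exact ⟨_, (hP.doubleMap_m t s).trans (by rw [hH.m_eq, ht])⟩

end SuperHopfData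

end

theorem mainTheorem8 {F : Type*} [Field F] [CharZero F] (d : ℕ) (hd : Odd d) (hd1 : 1 < d)
    (q : F) (hq : IsPrimitiveRoot q d) :
    FiniteDimensional F (Ubar F q d) ∧
    ∃ H : SuperHopfData F (Ubar F q d),
      IsUbarStructure F q d H ∧ (∀ H', IsUbarStructure F q d H' → H' = H) ∧
    ∃ HB : SuperHopfData F (Bplus F q d),
      HB.IsHopf ∧ HB.IsHopfHom H (Bplus F q d).subtype ∧
    ∃ b : Module.Basis (BIdx d) F (Bplus F q d),
      (∀ x, (b x : Ubar F q d) = bMonomial F q d x) ∧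
    ∃ χ : Module.Dual F (Bplus F q d) ⊗[F] Bplus F q d →ₗ[F] Ubar F q d,
      IsChi q HB b χ ∧ (∀ χ', IsChi q HB b χ' → χ' = χ) ∧
      HB.double.IsHopfHom H χ ∧ Function.Surjective χ ∧
      H.IsBraided (TensorProduct.map χ χ (HB.doubleR b)) := by
  have hr : IsOddRoot q d := ⟨hq, hd, hd1⟩
  have hH := ubarHopf_isUbarStructure (F := F) hr
  obtain ⟨B, hB, hi⟩ := exists_borelHopf (F := F) hr
  have hBH := SuperHopfData.isBorelHopf hr hH hB hi
  obtain ⟨l1, l2, f1, f2, hD⟩ := hBH.exists_isBorelDual hr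
  have hP : SuperHopfData.IsDoublePair (ubarHopf hr) B (Bplus F q d).subtype
      (hD.toUbar hBH hr) :=
    { isHopf := hH.isHopf
      sub_isHopf := hB
      antipodeMul := fun _ _ _ _ hx hy => ubarAntipode_mul hr hx hy
      isHopfHom := hi
      injective := (Bplus F q d).injective_subtype
      dual_hom := hD.toUbar_hom hBH hr hH
      dual_comul := hD.toUbar_comul hBH hr hH
      dual_counit := hD.toUbar_counit_comp hBH hr hH
      intertwine := hD.intertwine hBH hr hH ⟨hi.even, hi.map_mul, hi.map_one⟩
        (SuperHopfData.borelEquiv_coe hr) _ }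
  have hs := SuperHopfData.doubleMap_surjective hH hP (fun _ => gen_mem_Bplus hr) (by
    intro g hg
    simp only [List.mem_cons, List.not_mem_nil, or_false] at hg
    rcases hg with rfl | rfl | rfl | rfl
    exacts [⟨_, hD.toUbar_l1 hBH hr⟩, ⟨_, hD.toUbar_l2 hBH hr⟩, ⟨_, hD.toUbar_f1 hBH hr⟩,
      ⟨_, hD.toUbar_f2 hBH hr⟩])
  have hb (x : BIdx d) : (hD.basis hBH hr x : Ubar F q d) = bMonomial F q d x := by
    rw [hD.basis_apply, bMonomial_eq]
    rfl
  have hfin : FiniteDimensional F (Ubar F q d) := Module.Finite.of_surjective _ hs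
  have hχ := SuperHopfData.isChi_doubleMap hH hb (hD.toUbar_alphaMonomial hBH hr)
  exact ⟨hfin, ubarHopf hr, hH, fun _ h => h.eq_ubarHopf hr, B, hB, hi, hD.basis hBH hr, hb, _, hχ,
    fun _ h => SuperHopfData.isChi_unique (hD.span_alphaMonomial hBH hr) hχ h,
    hP.doubleMap_isHopfHom, hs, hP.isBraided hs _⟩
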